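/- Let $d\ge 2$ be fixed. Let $P$ be a set of $n$ points in $\mathbb{R}^d$, each of which has a colour from $\{1,\dots,\varphi\}$, and let $s\in\{2,\dots,n\}$ be a parameter. On a pointer machine, one can build in $O\bigl(n\log n\,(s\log_s n)^{d-1}\bigr)$ time a data structure of size $O\bigl(n(s\log_s n)^{d-1}\bigr)$ that answers dominance frequency reporting queries: given $q\in\mathbb{R}^d$, with dominance range $Q=(-\infty,q_1]\times\dots\times(-\infty,q_d]$, it reports, in some order and without repetition, exactly the pairs $(c,f)$ where $c$ is a colour that occurs among the points of $P\cap Q$ and $f>0$ is the number of points of colour $c$ in $P\cap Q$. If $k$ is the number of colours that occur in $P\cap Q$, the query takes $O\bigl(\log n\,\log_s^{d-2}n+k\log_s^{d-1}n\bigr)$ time. Any number of queries can be asked one after the other, and the time and size bounds continue to hold throughout. The preprocessing and query programs and the implied constants depend only on $d$ (not on $n$, $s$, $\varphi$, $P$, the colouring or the queries). Here a pointer machine has a constant number of registers and a memory of cells with a constant number of fields. Registers and fields hold addresses (which can be copied, compared for equality and followed), real numbers (which can be copied and compared), or natural numbers of size $O(n+\varphi)$ (which can be copied, compared, added and subtracted,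 with subtraction truncated at $0$). Every elementary operation, including allocating a cell and printing a pair, takes one step; size is the number of memory cells reachable from the registers. The input points are given as a linked list of cells, in any order. -/

import Mathlib

/-! A pointer machine: finitely many registers and memory cells with finitely many fields (a program
is a finite text and so mentions only finitely many registers and fields), addresses that can only
be copied, compared for equality and followed, real numbers that can only be copied and compared,
and natural numbers up to a word bound that can be copied, compared, added and subtracted. -/

namespace PointerMachine

/-- The content of a register or of a field of a memory cell. -/
inductive Val where
  | nil : Val
  | ptr (a : ℕ) : Val
  | num (k : ℕ) : Val
  | real (x : ℝ) : Val

/-- A state of the machine. The allocated cells are those with address `< next`; `cell a f` is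
field `f` of the cell with address `a`; `out` lists the pairs printed so far. -/
structure State where
  reg : ℕ → Val
  cell : ℕ → ℕ → Val
  next : ℕ
  out : List (ℕ × ℕ)

/-- Elementary instructions; `r`, `a`, `b`, `p` are names of registers, `f` is the name of a field
and `k` is a constant written in the program. -/
inductive Instr where
  | clear (r : ℕ) : Instr
  | const (r k : ℕ) : Instr
  | move (r a : ℕ) : Instr
  | add (r a b : ℕ) : Instr
  | sub (r a b : ℕ) : Instr
  | new (r : ℕ) : Instr
  | load (r p f : ℕ) : Instr
  | store (p f a : ℕ) : Instr
  | emit (a b : ℕ) : Instr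

/-- Assign a value to a register. -/
def State.set (σ : State) (r : ℕ) (v : Val) : State :=
  { σ with reg := Function.update σ.reg r v }

/-- The effect of an instruction on a machine whose words hold numbers up to `W`. The value `none`
is a run-time error: an operand of the wrong kind, a pointer that does not lead to an allocated
cell, or a number that does not fit in a word. -/
def Instr.exec (W : ℕ) : Instr → State → Option State
  | .clear r, σ => some (σ.set r .nil)
  | .const r k, σ => if k ≤ W then some (σ.set r (.num k)) else none
  | .move r a, σ => some (σ.set r (σ.reg a))
  | .add r a b, σ =>
    match σ.reg a, σ.reg b with
    | .num x, .num y => if x + y ≤ W then some (σ.set r (.num (x + y))) else none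
    | _, _ => none
  | .sub r a b, σ =>
    match σ.reg a, σ.reg b with
    | .num x, .num y => some (σ.set r (.num (x - y)))
    | _, _ => none
  | .new r, σ =>
    some { σ with
      reg := Function.update σ.reg r (.ptr σ.next)
      cell := Function.update σ.cell σ.next (fun _ => .nil)
      next := σ.next + 1 }
  | .load r p f, σ =>
    match σ.reg p with
    | .ptr x => if x < σ.next then some (σ.set r (σ.cell x f)) else none
    | _ => none
  | .store p f a, σ =>
    match σ.reg p with
    | .ptr x =>
      if x < σ.next then
        some { σ with
          cell := Function.update σ.cell x (Function.update (σ.cell x) f (σ.reg a)) }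
      else none
    | _ => none
  | .emit a b, σ =>
    match σ.reg a, σ.reg b with
    | .num x, .num y => some { σ with out := σ.out ++ [(x, y)] }
    | _, _ => none

/-- Tests: whether two registers hold the same pointer (or both `nil`), and whether the number in
one register is at most that in the other (two natural or two real numbers). -/
inductive Test where
  | same (a b : ℕ) : Test
  | le (a b : ℕ) : Test

/-- The result of a test; `none` is a run-time error. -/
noncomputable def Test.eval : Test → State → Option Bool
  | .same a b, σ =>
    match σ.reg a, σ.reg b with
    | .nil, .nil => some true
    | .nil, .ptr _ => some false
    | .ptr _, .nil => some false
    | .ptr x, .ptr y => some (decide (x = y))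
    | _, _ => none
  | .le a b, σ =>
    match σ.reg a, σ.reg b with
    | .num x, .num y => some (decide (x ≤ y))
    | .real x, .real y => some (decide (x ≤ y))
    | _, _ => none

/-- Programs. -/
inductive Prog where
  | skip : Prog
  | instr (i : Instr) : Prog
  | seq (p q : Prog) : Prog
  | branch (c : Test) (p q : Prog) : Prog
  | loop (c : Test) (p : Prog) : Prog

/-- `Run W p σ t σ'`: with word bound `W`, the program `p` started in state `σ` halts without error
in state `σ'` after exactly `t` steps; each instruction and each evaluation of a test is a step. -/
inductive Run (W : ℕ) : Prog → State → ℕ → State → Prop where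
  | skip (σ : State) : Run W .skip σ 1 σ
  | instr {i : Instr} {σ σ' : State} (h : i.exec W σ = some σ') : Run W (.instr i) σ 1 σ'
  | seq {p q : Prog} {σ σ' σ'' : State} {t t' : ℕ} (hp : Run W p σ t σ')
      (hq : Run W q σ' t' σ'') : Run W (.seq p q) σ (t + t') σ''
  | branch_true {c : Test} {p q : Prog} {σ σ' : State} {t : ℕ} (hc : c.eval σ = some true)
      (hp : Run W p σ t σ') : Run W (.branch c p q) σ (t + 1) σ'
  | branch_false {c : Test} {p q : Prog} {σ σ' : State} {t : ℕ} (hc : c.eval σ = some false)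
      (hq : Run W q σ t σ') : Run W (.branch c p q) σ (t + 1) σ'
  | loop_true {c : Test} {p : Prog} {σ σ' σ'' : State} {t t' : ℕ} (hc : c.eval σ = some true)
      (hp : Run W p σ t σ') (hl : Run W (.loop c p) σ' t' σ'') :
      Run W (.loop c p) σ (t + t' + 1) σ''
  | loop_false {c : Test} {p : Prog} {σ : State} (hc : c.eval σ = some false) :
      Run W (.loop c p) σ 1 σ

/-- Some field of the allocated cell `a` points to the allocated cell `b`. -/
def State.Link (σ : State) (a b : ℕ) : Prop :=
  a < σ.next ∧ b < σ.next ∧ ∃ f, σ.cell a f = .ptr b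

/-- The cells that can be reached from the registers by following pointers. -/
def State.live (σ : State) : Set ℕ :=
  {b | ∃ r a, σ.reg r = .ptr a ∧ a < σ.next ∧ Relation.ReflTransGen σ.Link a b}

theorem State.live_finite (σ : State) : σ.live.Finite := by
  refine (Set.finite_Iio σ.next).subset ?_
  rintro b ⟨r, a, -, ha, h⟩
  induction h with
  | refl => exact ha
  | tail _ h _ => exact h.2.1

/-- The size of the data structure held by the machine: the number of its (reachable) cells. -/
noncomputable def State.size (σ : State) : ℕ := σ.live.ncard

end PointerMachine

namespace ColorFrequency

open PointerMachine

/-- The memory cell that describes the `j`-th input point: its coordinates in the fields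
`0, …, d - 1`, its colour in field `d`, a pointer to the next input point in field `d + 1`. -/
def inputCell {n d : ℕ} (p : Fin n → Fin d → ℝ) (col : Fin n → ℕ) (j : Fin n) (f : ℕ) : Val :=
  if h : f < d then .real (p j ⟨f, h⟩)
  else if f = d then .num (col j)
  else if f = d + 1 ∧ (j : ℕ) + 1 < n then .ptr (j + 1)
  else .nil

/-- The state in which a preprocessing program starts: the points form a linked list of `n` cells
whose first cell is in register `0`; register `1` holds `n` and register `2` holds `s`. -/
def inputState {n d : ℕ} (p : Fin n → Fin d → ℝ) (col : Fin n → ℕ) (s : ℕ) : State where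
  reg r := if r = 0 ∧ 0 < n then .ptr 0 else if r = 1 then .num n
    else if r = 2 then .num s else .nil
  cell a := if h : a < n then inputCell p col ⟨a, h⟩ else fun _ => .nil
  next := n
  out := []

/-- Pose the query with corner `q`: its coordinates are put into the registers `0, …, d - 1` and
the output is emptied; the rest of the machine is left as it is. -/
def ask {d : ℕ} (σ : State) (q : Fin d → ℝ) : State :=
  { σ with
    reg := fun r => if h : r < d then .real (q ⟨r, h⟩) else σ.reg r
    out := [] }

/-- `Queried W d query σ σ'`: the machine gets from `σ` to `σ'` by answering some finite sequence
of queries in `ℝ^d` one after the other with the program `query`. -/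
inductive Queried (W d : ℕ) (query : Prog) (σ : State) : State → Prop where
  | start : Queried W d query σ σ
  | next {σ' σ'' : State} {t : ℕ} (q : Fin d → ℝ) (h : Queried W d query σ σ')
      (hr : Run W query (ask σ' q) t σ'') : Queried W d query σ σ''

open Classical in
/-- The number of points of colour `c` in the dominance range
`(-∞, q 0] × ⋯ × (-∞, q (d - 1)]`. -/
noncomputable def frequency {n d : ℕ} (p : Fin n → Fin d → ℝ) (col : Fin n → ℕ)
    (q : Fin d → ℝ) (c : ℕ) : ℕ :=
  (Finset.univ.filter fun j => col j = c ∧ ∀ i, p j i ≤ q i).card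

open Classical in
/-- The number of distinct colours of the points in the dominance range with corner `q`. -/
noncomputable def numColors {n d : ℕ} (p : Fin n → Fin d → ℝ) (col : Fin n → ℕ)
    (q : Fin d → ℝ) : ℕ :=
  ((Finset.univ.filter fun j => ∀ i, p j i ≤ q i).image col).card

/-- The list `l` consists, in some order and without repetition, of the pairs `(c, f)` where `c` is
a colour that occurs in the dominance range with corner `q` and `f > 0` is its frequency there. -/
def IsAnswer {n d : ℕ} (p : Fin n → Fin d → ℝ) (col : Fin n → ℕ) (q : Fin d → ℝ)
    (l : List (ℕ × ℕ)) : Prop :=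
  l.Nodup ∧ ∀ c f, (c, f) ∈ l ↔ f = frequency p col q c ∧ 0 < f

end ColorFrequency

/-! The points are swept in the order of coordinate `0` and inserted one by one into a structure for
the remaining `d - 1` coordinates. Insertion copies paths, so the root reached after each insertion
stays valid as the structure for that prefix of the order. A query finds by binary search the
version that consists of exactly the points with first coordinate at most `q 0`, and replaces each
other `q i` by a number of points. What is left is a conjunction of rank conditions `rk i j < y i`.
Ties need no care, since the points with key at most `q i` form a prefix of any order sorted by that
key.

For one coordinate the structure is a binary trie on the ranks, cut into blocks of `⌊log₂ s⌋`
levels. At each leaf of a block hangs a structure for the points that precede this leaf within its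
block. A prefix of the ranks is the disjoint union of one such set per block along a path
(`walk_spec`), so a query visits `O(log_s n)` substructures. A new point enters at most `s`
substructures per block (`prefix_ins`, `trie_ins`), hence `O(s log_s n)` in all. Nesting `d - 1`
tries raises both numbers to the power `d - 1` (`countP_spec`, `dom_ins`).

The innermost structures are lists of colours with weights, where the weights of a colour add up to
its frequency and the length is at most twice the number of colours present. Insertion puts a pair
of weight `1` in front. When the credit is used up, the list is compacted to one pair per colour,
and a potential pays for this (`weightP_spec`). Amortisation is compatible with path copying because
only the newest version is ever extended: older versions stay readable, but their potential is never
needed again. A query adds the weights of all visited lists to counters in the colour cells and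
chains the colours whose counter becomes positive (`accP_spec`); finally it prints the chain and
resets the counters (`outP_spec`). Every colour in a visited list occurs in the query range, so each
such list has at most `2k` entries.

With `L` levels and `M` blocks per trie, a query costs `O(L M^(d-2) + k M^(d-1))` and the
preprocessing `O(n L + n (sM)^(d-1))`, where `L = O(log n)` and `M = O(log_s n)`
(`trieLevels_bounds`). Since `log n ≤ s log_s n`, the number of preprocessing steps is also bounded
by the required size. A step allocates at most one cell and queries allocate none, so the size bound
holds at all times.

Correctness is carried by triples `WP` with time bounds. Preprocessing mostly extends the heap
(`Grow`), so descriptions of old cells persist; where cells are filled after their allocation, `Upd`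
records which. Fields from `8` on are reserved for the counters and are exempt from all heap
comparisons. All registers in use from the end of the preprocessing on have numbers at least `d`,
because posing a query overwrites the others. -/

set_option linter.unusedSimpArgs false

namespace PointerMachine

/-! ### Running straight-line code and loops -/

/-- The effect of a list of instructions. -/
def execL (W : ℕ) : List Instr → State → Option State
  | [], σ => some σ
  | i :: is, σ => (i.exec W σ).bind (execL W is)

/-- Straight-line code. -/
def blk : List Instr → Prog
  | [] => .skip
  | i :: is => .seq (.instr i) (blk is)

/-- `p` runs from `σ` in at most `T` steps to a state that satisfies `Q`. -/
def WP (W : ℕ) (p : Prog) (σ : State) (T : ℕ) (Q : State → Prop) : Prop :=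
  ∃ t σ', t ≤ T ∧ Run W p σ t σ' ∧ Q σ'

theorem WP.mono {W p σ T T'} {Q Q' : State → Prop} (h : WP W p σ T Q) (hT : T ≤ T')
    (hQ : ∀ σ', Q σ' → Q' σ') : WP W p σ T' Q' := by
  obtain ⟨t, σ', ht, hr, hq⟩ := h
  exact ⟨t, σ', ht.trans hT, hr, hQ _ hq⟩

theorem WP.le {W p σ T T'} {Q : State → Prop} (h : WP W p σ T Q) (hT : T ≤ T') :
    WP W p σ T' Q := h.mono hT fun _ h => h

theorem WP.conseq {W p σ T} {Q Q' : State → Prop} (h : WP W p σ T Q)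
    (hQ : ∀ σ', Q σ' → Q' σ') : WP W p σ T Q' := h.mono le_rfl hQ

/-- The triple for the second program sits in the postcondition of the first. Thus intermediate
states need no names, and the time bounds add. -/
theorem WP.seq {W p q σ T T'} {Q : State → Prop}
    (h : WP W p σ T fun σ' => WP W q σ' T' Q) : WP W (.seq p q) σ (T + T') Q := by
  obtain ⟨t, σ', ht, hr, t', σ'', ht', hr', hq⟩ := h
  exact ⟨t + t', σ'', by omega, .seq hr hr', hq⟩

theorem run_blk {W is} : ∀ {σ σ' : State}, execL W is σ = some σ' →
    Run W (blk is) σ (is.length + 1) σ' := by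
  induction is with
  | nil => intro σ σ' h; simp only [execL, Option.some.injEq] at h; subst h; exact .skip _
  | cons i is ih =>
    intro σ σ' h
    simp only [execL, Option.bind_eq_some_iff] at h
    obtain ⟨σ₁, h₁, h₂⟩ := h
    have := Run.seq (Run.instr h₁) (ih h₂)
    rwa [add_comm 1] at this

theorem WP.blk {W is σ} {Q : State → Prop} (h : ∃ σ', execL W is σ = some σ' ∧ Q σ') :
    WP W (blk is) σ (is.length + 1) Q := by
  obtain ⟨σ', h, hq⟩ := h
  exact ⟨_, σ', le_rfl, run_blk h, hq⟩

theorem WP.skip {W σ} {Q : State → Prop} (h : Q σ) : WP W .skip σ 1 Q :=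
  ⟨1, σ, le_rfl, .skip _, h⟩

theorem WP.branch {W c p q σ T} {b : Bool} {Q : State → Prop} (hc : c.eval σ = some b)
    (h1 : b = true → WP W p σ T Q) (h2 : b = false → WP W q σ T Q) :
    WP W (.branch c p q) σ (T + 1) Q := by
  cases b with
  | true =>
    obtain ⟨t, σ', ht, hr, hq⟩ := h1 rfl
    exact ⟨t + 1, σ', by omega, .branch_true hc hr, hq⟩
  | false =>
    obtain ⟨t, σ', ht, hr, hq⟩ := h2 rfl
    exact ⟨t + 1, σ', by omega, .branch_false hc hr, hq⟩

/-- The comparison of two numbers, as made by `Test.le`. -/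
noncomputable def leVal : Val → Val → Option Bool
  | .num x, .num y => some (decide (x ≤ y))
  | .real x, .real y => some (decide (x ≤ y))
  | _, _ => none

theorem eval_le (a b : ℕ) (σ : State) : (Test.le a b).eval σ = leVal (σ.reg a) (σ.reg b) := by
  simp only [Test.eval]
  cases σ.reg a <;> cases σ.reg b <;> rfl

/-- The comparison of two addresses, as made by `Test.same`. -/
def sameVal : Val → Val → Option Bool
  | .nil, .nil => some true
  | .nil, .ptr _ => some false
  | .ptr _, .nil => some false
  | .ptr x, .ptr y => some (decide (x = y))
  | _, _ => none

theorem eval_same (a b : ℕ) (σ : State) :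
    (Test.same a b).eval σ = sameVal (σ.reg a) (σ.reg b) := by
  simp only [Test.eval]
  cases σ.reg a <;> cases σ.reg b <;> rfl

/-! Register `d + 4` holds `0`, `d + 5` holds `1`, `d + 6` holds `nil`, and `d + 7` is the flag
of the loops. -/

/-- Record in the flag whether register `x` holds an address. -/
def setFlag (d x : ℕ) : Prog :=
  .branch (.same x (d + 6)) (.instr (.const (d + 7) 0)) (.instr (.const (d + 7) 1))

/-- Repeat `p` while register `x` holds an address. -/
def whileNe (d x : ℕ) (p : Prog) : Prog :=
  .seq (setFlag d x) (.loop (.le (d + 5) (d + 7)) (.seq p (setFlag d x)))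

theorem setFlag_nil {W d x σ} (hx : σ.reg x = .nil) (h6 : σ.reg (d + 6) = .nil) :
    Run W (setFlag d x) σ 2 (σ.set (d + 7) (.num 0)) :=
  .branch_true (by rw [eval_same, hx, h6]; rfl) (.instr (by simp [Instr.exec]))

theorem setFlag_ptr {W d x a σ} (hW : 1 ≤ W) (hx : σ.reg x = .ptr a)
    (h6 : σ.reg (d + 6) = .nil) :
    Run W (setFlag d x) σ 2 (σ.set (d + 7) (.num 1)) :=
  .branch_false (by rw [eval_same, hx, h6]; rfl) (.instr (by simp [Instr.exec, hW]))

/-- A loop continues while its test is true, and the only test on addresses is equality. Inequality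
with `nil` therefore has to pass through the numerical flag: two steps to set it and one for the
failing test. -/
theorem WP.while_nil {W d x p σ} {Q : State → Prop} (hx : σ.reg x = .nil)
    (h5 : σ.reg (d + 5) = .num 1) (h6 : σ.reg (d + 6) = .nil)
    (h : Q (σ.set (d + 7) (.num 0))) : WP W (whileNe d x p) σ 3 Q := by
  refine ⟨3, _, le_rfl, .seq (setFlag_nil hx h6) (.loop_false ?_), h⟩
  rw [eval_le]; simp [State.set, Function.update_of_ne, h5, leVal]

/-- One unrolling. The flag set at the end of the body is the same piece of program as the flag set
at the head of the remaining `whileNe`, so the run of the latter is split there and glued onto the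
body. This leaves an overhead of `3` per iteration. -/
theorem WP.while_ptr {W d x a p σ T T'} {Q : State → Prop} (hW : 1 ≤ W)
    (hx : σ.reg x = .ptr a) (h5 : σ.reg (d + 5) = .num 1) (h6 : σ.reg (d + 6) = .nil)
    (h : WP W p (σ.set (d + 7) (.num 1)) T fun σ' => WP W (whileNe d x p) σ' T' Q) :
    WP W (whileNe d x p) σ (T + T' + 3) Q := by
  obtain ⟨t, σ₁, ht, hr, t', σ₂, ht', hr', hq⟩ := h
  cases hr' with
  | seq h₁ h₂ =>
    refine ⟨_, σ₂, ?_, .seq (setFlag_ptr hW hx h6) (.loop_true ?_ (.seq hr h₁) h₂), hq⟩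
    · omega
    · rw [eval_le]; simp [State.set, Function.update_of_ne, h5, leVal]

/-! ### Basic properties of runs -/

/-- `Queried` speaks of arbitrary runs of the query program. Determinism identifies them with the
runs that are constructed here. -/
theorem Run.det {W p σ t σ'} (h : Run W p σ t σ') : ∀ {t₁ σ₁}, Run W p σ t₁ σ₁ → σ' = σ₁ := by
  induction h with
  | skip => intro _ _ h; cases h; rfl
  | instr h => intro _ _ h'; cases h' with | instr h' => simpa [h] using h'
  | seq _ _ ih₁ ih₂ =>
    intro _ _ h; cases h with | seq h₁ h₂ => cases ih₁ h₁; exact ih₂ h₂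
  | branch_true hc _ ih =>
    intro _ _ h; cases h with
    | branch_true _ h => exact ih h
    | branch_false hc' _ => simp [hc] at hc'
  | branch_false hc _ ih =>
    intro _ _ h; cases h with
    | branch_true hc' _ => simp [hc] at hc'
    | branch_false _ h => exact ih h
  | loop_true hc _ _ ih₁ ih₂ =>
    intro _ _ h; cases h with
    | loop_true _ h₁ h₂ => cases ih₁ h₁; exact ih₂ h₂
    | loop_false hc' => simp [hc] at hc'
  | loop_false hc =>
    intro _ _ h; cases h with
    | loop_true hc' _ _ => simp [hc] at hc'
    | loop_false _ => rfl

theorem Instr.exec_next {W i σ σ'} (h : Instr.exec W i σ = some σ') : σ'.next ≤ σ.next + 1 := by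
  cases i <;> simp only [Instr.exec] at h <;>
    (repeat' split at h) <;> simp_all [State.set] <;> subst h <;> simp

/-- Time bounds memory: an instruction allocates at most one cell. -/
theorem Run.next_le {W p σ t σ'} (h : Run W p σ t σ') : σ'.next ≤ σ.next + t := by
  induction h with
  | instr h => exact Instr.exec_next h
  | _ => omega

theorem State.size_le_next (σ : State) : σ.size ≤ σ.next := by
  have : σ.live ⊆ Set.Iio σ.next := by
    rintro b ⟨r, a, -, ha, h⟩
    induction h with
    | refl => exact ha
    | tail _ h _ => exact h.2.1
  simpa [State.size] using Set.ncard_le_ncard this (Set.finite_Iio σ.next)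

/-! ### Allocating a cell with given contents -/

/-- Store registers into fields of the cell to which register `r` points. -/
def stores (r : ℕ) (fs : List (ℕ × ℕ)) : List Instr := fs.map fun fa => .store r fa.1 fa.2

/-- The contents of a cell after fields have been assigned. -/
def row (reg : ℕ → Val) : List (ℕ × ℕ) → (ℕ → Val)
  | [] => fun _ => .nil
  | fa :: fs => Function.update (row reg fs) fa.1 (reg fa.2)

/-- Allocate a cell and fill its fields. -/
def mk (r : ℕ) (fs : List (ℕ × ℕ)) : List Instr := .new r :: stores r fs.reverse

theorem execL_append {W is js σ} :
    execL W (is ++ js) σ = (execL W is σ).bind (execL W js) := by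
  induction is generalizing σ with
  | nil => simp [execL]
  | cons i is ih => simp [execL, Option.bind_assoc, ih]

/-- The stores are made in reverse order, so induction on the list peels off the last one, which is
the outermost update in `row`. The side condition is needed because the target register is
overwritten by the new address before the stores read their sources. -/
theorem execL_mk {W r fs} {reg : ℕ → Val} {cell next out} (h : ∀ fa ∈ fs, fa.2 ≠ r) :
    execL W (mk r fs) ⟨reg, cell, next, out⟩ =
      some ⟨Function.update reg r (.ptr next), Function.update cell next (row reg fs), next + 1,
        out⟩ := by
  simp only [mk, execL, Instr.exec, Option.bind_some]
  induction fs with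
  | nil => simp [stores, execL, row]
  | cons fa fs ih =>
    rw [stores, List.reverse_cons, List.map_append, execL_append]
    rw [stores] at ih
    rw [ih fun x hx => h x (List.mem_cons_of_mem _ hx)]
    simp [execL, Instr.exec, row, h fa]

theorem execL_mk_append {W r fs is} {reg : ℕ → Val} {cell next out}
    (h : ∀ fa ∈ fs, fa.2 ≠ r) :
    execL W (mk r fs ++ is) ⟨reg, cell, next, out⟩ =
      execL W is ⟨Function.update reg r (.ptr next), Function.update cell next (row reg fs),
        next + 1, out⟩ := by
  rw [execL_append, execL_mk h]; rfl

theorem length_mk (r : ℕ) (fs : List (ℕ × ℕ)) : (mk r fs).length = fs.length + 1 := by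
  simp [mk, stores]

/-! ### Growth of the heap and predicates that survive it -/

/-- `σ'` arises from `σ` by allocating and filling new cells and by changing registers with numbers
between `lo` and `hi`. -/
structure Grow (lo hi : ℕ) (σ σ' : State) : Prop where
  next_le : σ.next ≤ σ'.next
  cell_eq : ∀ a < σ.next, σ'.cell a = σ.cell a
  out_eq : σ'.out = σ.out
  reg_eq : ∀ r, r < lo ∨ hi ≤ r → σ'.reg r = σ.reg r

theorem Grow.refl (lo hi σ) : Grow lo hi σ σ := ⟨le_rfl, fun _ _ => rfl, rfl, fun _ _ => rfl⟩

theorem Grow.trans {lo hi σ σ' σ''} (h : Grow lo hi σ σ') (h' : Grow lo hi σ' σ'') :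
    Grow lo hi σ σ'' :=
  ⟨h.next_le.trans h'.next_le,
    fun a ha => (h'.cell_eq a (ha.trans_le h.next_le)).trans (h.cell_eq a ha),
    h'.out_eq.trans h.out_eq, fun r hr => (h'.reg_eq r hr).trans (h.reg_eq r hr)⟩

theorem Grow.mono {lo hi lo' hi' σ σ'} (h : Grow lo hi σ σ') (hl : lo' ≤ lo) (hh : hi ≤ hi') :
    Grow lo' hi' σ σ' :=
  ⟨h.next_le, h.cell_eq, h.out_eq, fun r hr => h.reg_eq r (by omega)⟩

theorem Grow.set {lo hi σ σ' r v} (h : Grow lo hi (State.set σ r v) σ') (h1 : lo ≤ r)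
    (h2 : r < hi) : Grow lo hi σ σ' :=
  ⟨h.next_le, h.cell_eq, h.out_eq, fun q hq => by
    rw [h.reg_eq q hq, State.set]; exact Function.update_of_ne (by omega) ..⟩

theorem Grow.of_set {lo hi σ r v} (h1 : lo ≤ r) (h2 : r < hi) : Grow lo hi σ (σ.set r v) :=
  (Grow.refl lo hi (σ.set r v)).set h1 h2

/-- The constant registers hold their constants. -/
structure Consts (d : ℕ) (σ : State) : Prop where
  zero : σ.reg (d + 4) = .num 0
  one : σ.reg (d + 5) = .num 1
  nil : σ.reg (d + 6) = .nil

theorem Consts.grow {d lo hi σ σ'} (h : Consts d σ) (hg : Grow lo hi σ σ') (hl : d + 7 ≤ lo) :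
    Consts d σ' :=
  ⟨(hg.reg_eq _ (by omega)).trans h.zero, (hg.reg_eq _ (by omega)).trans h.one,
    (hg.reg_eq _ (by omega)).trans h.nil⟩

theorem Consts.set {d σ r v} (h : Consts d σ) (hr : d + 7 ≤ r) : Consts d (σ.set r v) := by
  constructor <;> simp (disch := omega) only [State.set, Function.update_of_ne]
  exacts [h.zero, h.one, h.nil]

/-- The heaps `h` and `h'` agree on the cells below `N`, except for the fields from `8` on. -/
def Agree (N : ℕ) (h h' : ℕ → ℕ → Val) : Prop := ∀ a < N, ∀ f < 8, h' a f = h a f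

theorem Agree.refl (N h) : Agree N h h := fun _ _ _ _ => rfl

theorem Agree.update {N h h' a} (H : Agree N h h') (ha : N ≤ a) (r) :
    Agree N h (Function.update h' a r) := fun b hb f hf => by
  rw [Function.update_of_ne (by omega)]; exact H b hb f hf

theorem Grow.agree {lo hi σ σ'} (h : Grow lo hi σ σ') : Agree σ.next σ.cell σ'.cell :=
  fun a ha f _ => by rw [h.cell_eq a ha]

/-- A linked list of records of the points in `l`; the fields `0, 1, 3, 4` of the record of `j` are
given by `R j`, and field `2` leads to the next record. -/
def IsList (N : ℕ) (h : ℕ → ℕ → Val) (R : ℕ → ℕ → Val) : List ℕ → Val → Prop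
  | [], v => v = .nil
  | j :: l, v => ∃ a < N, v = .ptr a ∧ (h a 0 = R j 0 ∧ h a 1 = R j 1 ∧ h a 3 = R j 3 ∧
      h a 4 = R j 4 ∧ h a 5 = .nil) ∧ IsList N h R l (h a 2)

/-- Records use only the fields `0` to `5`, so it does no harm that `Agree` leaves the fields from
`8` on unconstrained. -/
theorem IsList.mono {N N' h h' R l v} (H : IsList N h R l v) (hN : N ≤ N') (hh : Agree N h h') :
    IsList N' h' R l v := by
  induction l generalizing v with
  | nil => exact H
  | cons j l ih =>
    obtain ⟨a, ha, hv, hr, hl⟩ := H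
    refine ⟨a, ha.trans_le hN, hv, ?_, ?_⟩
    · simpa only [hh a ha _ (show 0 < 8 by omega), hh a ha _ (show 1 < 8 by omega),
        hh a ha _ (show 3 < 8 by omega), hh a ha _ (show 4 < 8 by omega),
        hh a ha _ (show 5 < 8 by omega)] using hr
    · rw [hh a ha _ (by omega)]; exact ih hl

theorem IsList.grow {R l v lo hi σ σ'} (H : IsList σ.next σ.cell R l v) (hg : Grow lo hi σ σ') :
    IsList σ'.next σ'.cell R l v := H.mono hg.next_le hg.agree

/-! ### Merging -/

/-- Move the first record of the list in register `d + x` to the list in register `d + 12`. -/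
def take (d x : ℕ) : Prog :=
  blk ([.move (d + 13) (d + x), .load (d + x) (d + 13) 2, .load (d + 8) (d + 13) 0,
    .load (d + 9) (d + 13) 1, .load (d + 14) (d + 13) 3, .load (d + 15) (d + 13) 4] ++
    (mk (d + 16) [(0, d + 8), (1, d + 9), (2, d + 12), (3, d + 14), (4, d + 15)] ++
    [.move (d + 12) (d + 16)]))

/-- The record is copied to a fresh cell instead of being relinked. Hence the heap only grows, and
every list described before remains valid. -/
theorem take_spec {W d x σ R j l acc} (hx : x = 10 ∨ x = 11)
    (hl : IsList σ.next σ.cell R (j :: l) (σ.reg (d + x)))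
    (ha : IsList σ.next σ.cell R acc (σ.reg (d + 12))) :
    WP W (take d x) σ 15 fun σ' => Grow (d + 7) (d + 17) σ σ' ∧
      IsList σ'.next σ'.cell R l (σ'.reg (d + x)) ∧
      IsList σ'.next σ'.cell R (j :: acc) (σ'.reg (d + 12)) ∧
      (∀ y, y = 10 ∨ y = 11 → y ≠ x → σ'.reg (d + y) = σ.reg (d + y)) := by
  obtain ⟨reg, cell, next, out⟩ := σ
  obtain ⟨a, han, hv, ⟨h0, h1, h3, h4, h5⟩, hl⟩ := hl
  dsimp only at hv han h0 h1 h3 h4 h5 hl ha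
  refine (WP.blk ?_).le (by simp [length_mk])
  rw [execL_append]
  simp (disch := omega) only [execL, Instr.exec, State.set, Function.update_self,
    Function.update_of_ne, if_pos, Option.bind_some, hv]
  rw [execL_mk_append (by simp)]
  simp (disch := omega) only [execL, Instr.exec, State.set, Function.update_self,
    Function.update_of_ne, if_pos, Option.bind_some, hv, row, Option.some.injEq, exists_eq_left']
  have hag := (Agree.refl next cell).update le_rfl
  refine ⟨⟨by simp, ?_, rfl, ?_⟩, ?_, ?_, ?_⟩
  · intro b hb
    dsimp only at hb ⊢
    simp (disch := omega) only [Function.update_of_ne]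
  · intro r hr
    simp (disch := omega) only [Function.update_of_ne]
  · exact hl.mono (by omega) (hag _)
  · refine ⟨next, by omega, rfl, ?_, ?_⟩
    · simp [h0, h1, h3, h4]
    · simpa using ha.mono (by omega) (hag _)
  · intro y hy hyx
    simp (disch := omega) only [Function.update_of_ne]

/-- Move the list in register `d + 11` in reverse order to the list in register `d + 12`. -/
def revP (d : ℕ) : Prog := whileNe d (d + 11) (take d 11)

/-- Each iteration costs `15` for `take` and `3` for the loop. -/
theorem revP_spec {W d R} (hW : 1 ≤ W) (l : List ℕ) : ∀ {acc σ}, Consts d σ →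
    IsList σ.next σ.cell R l (σ.reg (d + 11)) → IsList σ.next σ.cell R acc (σ.reg (d + 12)) →
    WP W (revP d) σ (18 * l.length + 3) fun σ' => Grow (d + 7) (d + 17) σ σ' ∧
      IsList σ'.next σ'.cell R (l.reverse ++ acc) (σ'.reg (d + 12)) := by
  induction l with
  | nil =>
    intro acc σ hc hl ha
    exact WP.while_nil hl hc.one hc.nil ⟨.of_set le_rfl (by omega), by simpa [State.set] using ha⟩
  | cons j l ih =>
    intro acc σ hc hl ha
    obtain ⟨a, -, hv, -⟩ := id hl
    refine (WP.while_ptr hW hv hc.one hc.nil ((take_spec (R := R) (j := j) (l := l) (acc := acc)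
      (.inr rfl) ?_ ?_).conseq fun σ₁ ⟨hg, h1, h2, _⟩ =>
      (ih (hc.grow (hg.set le_rfl (by omega)) le_rfl) h1 h2).conseq fun σ₂ ⟨hg', h3⟩ =>
        ⟨(hg.set le_rfl (by omega)).trans hg', by simpa using h3⟩)).le ?_
    · simpa [State.set] using hl
    · simpa [State.set] using ha
    · simp only [List.length_cons]; omega

/-- Merge the sorted lists in the registers `d + 10` and `d + 11` in reverse order to the list in
register `d + 12`. -/
def mergeP (d : ℕ) : Prog :=
  .seq (whileNe d (d + 10) (.branch (.same (d + 11) (d + 6)) (take d 10)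
    (.seq (blk [.load (d + 8) (d + 10) 1, .load (d + 9) (d + 11) 1])
      (.branch (.le (d + 8) (d + 9)) (take d 10) (take d 11))))) (revP d)

theorem mergeP_spec {W d R} {le : ℕ → ℕ → Bool} (hW : 1 ≤ W)
    (hle : ∀ i j, leVal (R i 1) (R j 1) = some (le i j)) {l₁ l₂ acc σ} (hc : Consts d σ)
    (h1 : IsList σ.next σ.cell R l₁ (σ.reg (d + 10)))
    (h2 : IsList σ.next σ.cell R l₂ (σ.reg (d + 11)))
    (h3 : IsList σ.next σ.cell R acc (σ.reg (d + 12))) :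
    WP W (mergeP d) σ (46 * (l₁.length + l₂.length) + 6) fun σ' => Grow (d + 7) (d + 17) σ σ' ∧
      IsList σ'.next σ'.cell R ((List.merge l₁ l₂ le).reverse ++ acc) (σ'.reg (d + 12)) := by
  -- Induction on the total length of the two lists. The run of `revP` belongs to the postcondition
  -- because what remains of the second list is known only when the first one is exhausted; each of
  -- the two phases gets the budget `23 * m + 3`.
  suffices key : ∀ m, ∀ {l₁ l₂ acc σ}, l₁.length + l₂.length = m → Consts d σ →
    IsList σ.next σ.cell R l₁ (σ.reg (d + 10)) → IsList σ.next σ.cell R l₂ (σ.reg (d + 11)) →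
    IsList σ.next σ.cell R acc (σ.reg (d + 12)) →
    WP W (whileNe d (d + 10) (.branch (.same (d + 11) (d + 6)) (take d 10)
    (.seq (blk [.load (d + 8) (d + 10) 1, .load (d + 9) (d + 11) 1])
      (.branch (.le (d + 8) (d + 9)) (take d 10) (take d 11))))) σ (23 * m + 3) fun σ₁ =>
      WP W (revP d) σ₁ (23 * m + 3) fun σ' =>
      Grow (d + 7) (d + 17) σ σ' ∧
      IsList σ'.next σ'.cell R ((List.merge l₁ l₂ le).reverse ++ acc) (σ'.reg (d + 12)) from
    (WP.seq (key _ rfl hc h1 h2 h3)).le (by omega)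
  intro m
  clear hc h1 h2 h3 l₁ l₂ acc σ
  induction m with
  | zero =>
    intro l₁ l₂ acc σ hm hc h1 h2 h3
    obtain ⟨rfl, rfl⟩ : l₁ = [] ∧ l₂ = [] := by
      simpa [List.length_eq_zero_iff] using hm
    refine WP.while_nil h1 hc.one hc.nil (((revP_spec hW [] (acc := acc) (R := R)
      (hc.set le_rfl) ?_ ?_).le (by simp)).conseq fun σ' h =>
        ⟨(Grow.of_set le_rfl (by omega)).trans h.1, ?_⟩)
    · simpa [State.set] using h2
    · simpa [State.set] using h3
    · simpa using h.2
  | succ m ih =>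
    intro l₁ l₂ acc σ hm hc h1 h2 h3
    have hg0 : Grow (d + 7) (d + 17) σ (σ.set (d + 7) (.num 1)) := .of_set le_rfl (by omega)
    obtain _ | ⟨j, l₁⟩ := l₁
    · refine (WP.while_nil h1 hc.one hc.nil (((revP_spec hW l₂ (acc := acc) (R := R)
        (hc.set le_rfl) ?_ ?_).le ?_).conseq fun σ' h =>
          ⟨(Grow.of_set le_rfl (by omega)).trans h.1, ?_⟩)).le (by omega)
      · simpa [State.set] using h2
      · simpa [State.set] using h3
      · simp at hm; omega
      · simpa using h.2
    obtain ⟨a, han, hv, ⟨-, hk, -⟩, -⟩ := id h1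
    -- A record is taken from the left list on two occasions: when the right list is empty and when
    -- the comparison favours the left. In both the merged list starts with `j`, so they are treated
    -- together.
    have step10 : ∀ σ₁, Grow (d + 7) (d + 17) σ σ₁ →
        (∀ y, 10 ≤ y → σ₁.reg (d + y) = σ.reg (d + y)) →
        (∀ b l₂', l₂ = b :: l₂' → le j b = true) →
        WP W (take d 10) σ₁ 15 fun σ' => WP W (whileNe d (d + 10)
          (.branch (.same (d + 11) (d + 6)) (take d 10)
          (.seq (blk [.load (d + 8) (d + 10) 1, .load (d + 9) (d + 11) 1])
          (.branch (.le (d + 8) (d + 9)) (take d 10) (take d 11))))) σ' (23 * m + 3) fun σ₁ =>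
          WP W (revP d) σ₁ (23 * (m + 1) + 3) fun σ' => Grow (d + 7) (d + 17) σ σ' ∧
            IsList σ'.next σ'.cell R ((List.merge (j :: l₁) l₂ le).reverse ++ acc)
              (σ'.reg (d + 12)) := by
      intro σ₁ hg hr hlj
      refine (take_spec (R := R) (j := j) (l := l₁) (acc := acc) (.inl rfl) ?_ ?_).conseq
        fun σ₂ ⟨hg₂, e1, e2, e3⟩ => ((ih (l₁ := l₁) (l₂ := l₂) ?_
          (hc.grow (hg.trans hg₂) le_rfl) e1 ?_ e2).conseq fun σ₃ h => h.mono (by omega)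
            fun σ₄ ⟨h4, h5⟩ => ⟨(hg.trans hg₂).trans h4, ?_⟩)
      · rw [hr 10 (by omega)]; exact h1.grow hg
      · rw [hr 12 (by omega)]; exact h3.grow hg
      · simp at hm; omega
      · rw [e3 11 (.inr rfl) (by omega), hr 11 (by omega)]; exact h2.grow (hg.trans hg₂)
      · have : List.merge (j :: l₁) l₂ le = j :: List.merge l₁ l₂ le := by
          cases l₂ with
          | nil => simp
          | cons b l₂ => rw [List.cons_merge_cons_pos _ _ _ (hlj b l₂ rfl)]
        rw [this]; simpa using h5
    refine (WP.while_ptr (T' := 23 * m + 3) (T := 20) hW hv hc.one hc.nil ?_).le (by omega)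
    obtain _ | ⟨b, l₂⟩ := l₂
    · refine (WP.branch (T := 15) (b := true) ?_ (fun _ => step10 _ hg0 ?_ (by simp))
        (by simp)).le (by omega)
      · have h2' : σ.reg (d + 11) = .nil := h2
        simp [eval_same, State.set, h2', hc.nil, sameVal]
      · intro y hy
        exact Function.update_of_ne (by omega) ..
    · obtain ⟨a', han', hv', ⟨-, hk', -⟩, -⟩ := id h2
      refine (WP.branch (T := 19) (b := false) ?_ (by simp) fun _ => ?_).le (by omega)
      · simp [eval_same, State.set, hv', hc.nil, sameVal]
      refine WP.seq (T := 3) (T' := 16) ?_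
      refine WP.blk (is := [_, _]) ?_
      simp (disch := omega) only [execL, Instr.exec, State.set, Function.update_self,
        Function.update_of_ne, if_pos, Option.bind_some, hv, hv', hk, hk', Option.some.injEq,
        exists_eq_left']
      set σ₁ : State := ⟨_, σ.cell, σ.next, σ.out⟩ with hσ₁
      have hg1 : Grow (d + 7) (d + 17) σ σ₁ := by
        refine ⟨le_rfl, fun _ _ => rfl, rfl, fun r hr => ?_⟩
        simp (disch := omega) only [hσ₁, Function.update_of_ne]
      have hr1 : ∀ y, 10 ≤ y → σ₁.reg (d + y) = σ.reg (d + y) := by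
        intro y hy
        simp (disch := omega) only [hσ₁, Function.update_of_ne]
      refine WP.branch (T := 15) (b := le j b) ?_ (fun h => step10 σ₁ hg1 hr1 ?_) fun h' => ?_
      · rw [eval_le, ← hle]
        simp (disch := omega) only [hσ₁, Function.update_self, Function.update_of_ne]
      · rintro _ _ ⟨⟩; exact h
      · refine (take_spec (R := R) (j := b) (l := l₂) (acc := acc) (.inr rfl) ?_ ?_).conseq
          fun σ₂ ⟨hg₂, e1, e2, e3⟩ => ((ih (l₁ := j :: l₁) (l₂ := l₂) ?_
            (hc.grow (hg1.trans hg₂) le_rfl) ?_ e1 e2).conseq fun σ₃ h => h.mono (by omega)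
              fun σ₄ ⟨h4, h5⟩ => ⟨(hg1.trans hg₂).trans h4, ?_⟩)
        · rw [hr1 11 (by omega)]; exact h2.grow hg1
        · rw [hr1 12 (by omega)]; exact h3.grow hg1
        · simp at hm ⊢; omega
        · rw [e3 10 (.inl rfl) (by omega), hr1 10 (by omega)]; exact h1.grow (hg1.trans hg₂)
        · rw [List.cons_merge_cons_neg _ _ _ (by simp [h'])]; simpa using h5

/-! ### Sorting -/

/-- A linked list of linked lists of records. -/
def IsRuns (N : ℕ) (h : ℕ → ℕ → Val) (R : ℕ → ℕ → Val) : List (List ℕ) → Val → Prop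
  | [], v => v = .nil
  | l :: ls, v => ∃ a < N, v = .ptr a ∧ IsList N h R l (h a 0) ∧ IsRuns N h R ls (h a 2)

theorem IsRuns.mono {N N' h h' R ls v} (H : IsRuns N h R ls v) (hN : N ≤ N')
    (hh : Agree N h h') : IsRuns N' h' R ls v := by
  induction ls generalizing v with
  | nil => exact H
  | cons l ls ih =>
    obtain ⟨a, ha, hv, hl, hls⟩ := H
    refine ⟨a, ha.trans_le hN, hv, ?_, ?_⟩
    · rw [hh a ha _ (by omega)]; exact hl.mono hN hh
    · rw [hh a ha _ (by omega)]; exact ih hls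

theorem IsRuns.grow {R ls v lo hi σ σ'} (H : IsRuns σ.next σ.cell R ls v)
    (hg : Grow lo hi σ σ') : IsRuns σ'.next σ'.cell R ls v := H.mono hg.next_le hg.agree

/-- Merge the sorted lists in the registers `d + 10` and `d + 11` and put the result in front of
the list of runs in register `d + 18`. -/
def joinP (d : ℕ) : Prog :=
  .seq (blk [.clear (d + 12)]) (.seq (mergeP d) (.seq (blk [.move (d + 11) (d + 12),
    .clear (d + 12)]) (.seq (revP d) (blk (mk (d + 8) [(0, d + 12), (2, d + 18)] ++
      [.move (d + 18) (d + 8)])))))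

/-- Merging leaves its result reversed, so a further reversal follows; `64 = 46 + 18`. -/
theorem joinP_spec {W d R} {le : ℕ → ℕ → Bool} (hW : 1 ≤ W)
    (hle : ∀ i j, leVal (R i 1) (R j 1) = some (le i j)) {l₁ l₂ ls σ} (hc : Consts d σ)
    (h1 : IsList σ.next σ.cell R l₁ (σ.reg (d + 10)))
    (h2 : IsList σ.next σ.cell R l₂ (σ.reg (d + 11)))
    (h3 : IsRuns σ.next σ.cell R ls (σ.reg (d + 18))) :
    WP W (joinP d) σ (64 * (l₁.length + l₂.length) + 19) fun σ' =>
      Grow (d + 7) (d + 19) σ σ' ∧ σ'.reg (d + 17) = σ.reg (d + 17) ∧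
      IsRuns σ'.next σ'.cell R (List.merge l₁ l₂ le :: ls) (σ'.reg (d + 18)) := by
  have hg1 : Grow (d + 7) (d + 17) σ (σ.set (d + 12) .nil) := .of_set (by omega) (by omega)
  refine WP.le (T := 2 + ((46 * (l₁.length + l₂.length) + 6) + (3 +
    ((18 * ((l₁.merge l₂ le).reverse ++ []).length + 3) + 5)))) ?_ (by simp; omega)
  refine WP.seq (WP.blk (is := [_]) ⟨σ.set (d + 12) .nil, rfl, ?_⟩)
  refine WP.seq ((mergeP_spec hW hle (l₁ := l₁) (l₂ := l₂) (acc := []) (hc.grow hg1 le_rfl)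
    ?_ ?_ ?_).conseq ?_)
  · simpa (disch := omega) [State.set, Function.update_of_ne] using h1
  · simpa (disch := omega) [State.set, Function.update_of_ne] using h2
  · exact Function.update_self ..
  rintro σ₂ ⟨hg2, e2⟩
  refine WP.seq (WP.blk (is := [_, _])
        ⟨(σ₂.set (d + 11) (σ₂.reg (d + 12))).set (d + 12) .nil, rfl, ?_⟩)
  refine WP.seq ((revP_spec hW (R := R) ((l₁.merge l₂ le).reverse ++ []) (acc := [])
    ?_ ?_ ?_).conseq ?_)
  · exact ((hc.grow (hg1.trans hg2) le_rfl).set (by omega)).set (by omega)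
  · simpa (disch := omega) [State.set, Function.update_of_ne] using e2
  · exact Function.update_self ..
  rintro σ₄ ⟨hg4, e4⟩
  refine WP.blk (is := _ ++ _) ?_
  have hg : Grow (d + 7) (d + 17) σ σ₄ := (hg1.trans hg2).trans
    ((hg4.set (by omega) (by omega)).set (by omega) (by omega))
  have h3' := h3.grow hg
  rw [← hg.reg_eq (d + 18) (by omega)] at h3'
  have h17 := hg.reg_eq (d + 17) (by omega)
  obtain ⟨reg, cell, next, out⟩ := σ₄
  rw [execL_mk_append (by simp)]
  simp (disch := omega) only [execL, Instr.exec, State.set, Function.update_self,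
    Function.update_of_ne, if_pos, Option.bind_some, row, Option.some.injEq, exists_eq_left']
  have hag := (Agree.refl next cell).update le_rfl
  refine ⟨(hg.mono le_rfl (by omega)).trans ⟨by simp, fun b hb => ?_, rfl, fun r hr => ?_⟩, ?_,
    ?_⟩
  · dsimp only at hb ⊢
    simp (disch := omega) only [Function.update_of_ne]
  · simp (disch := omega) only [Function.update_of_ne]
  · exact h17
  · refine ⟨next, by omega, rfl, ?_, ?_⟩
    · simp only [Function.update_self]
      simpa using e4.mono (Nat.le_succ _) (hag _)
    · simpa using h3'.mono (Nat.le_succ _) (hag _)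

/-- Merge neighbouring runs in `d + 17`, with the result in `d + 18`. -/
def roundP (d : ℕ) : Prog :=
  whileNe d (d + 17) (.seq (blk [.load (d + 10) (d + 17) 0, .load (d + 17) (d + 17) 2,
    .clear (d + 11)]) (.seq (.branch (.same (d + 17) (d + 6)) .skip
      (blk [.load (d + 11) (d + 17) 0, .load (d + 17) (d + 17) 2])) (joinP d)))

/-- The runs after neighbours have been merged. -/
def mergeRuns (le : ℕ → ℕ → Bool) : List (List ℕ) → List (List ℕ) → List (List ℕ)
  | [], out => out
  | [l], out => l :: out
  | l₁ :: l₂ :: ls, out => mergeRuns le ls (List.merge l₁ l₂ le :: out)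

theorem length_mergeRuns (le ls out) :
    (mergeRuns le ls out).length = out.length + (ls.length + 1) / 2 := by
  fun_induction mergeRuns le ls out <;> grind

/-- The runs are not kept in order: the output is built by prepending, so only the multiset of
records is preserved. This suffices, as each run is sorted by itself. -/
theorem mergeRuns_perm (le ls out) :
    (mergeRuns le ls out).flatten.Perm (ls.flatten ++ out.flatten) := by
  fun_induction mergeRuns le ls out with
  | case1 => simp
  | case2 => simp
  | case3 l₁ l₂ ls out ih =>
    refine ih.trans ?_
    simp only [List.flatten_cons, ← List.append_assoc]
    refine List.Perm.append_right _ ?_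
    refine (List.Perm.append_left _ (List.merge_perm_append _)).trans ?_
    exact List.perm_append_comm

theorem mergeRuns_sorted {le : ℕ → ℕ → Bool} (trans : ∀ a b c, le a b → le b c → le a c)
    (total : ∀ a b, (le a b || le b a) = true) (ls out)
    (h1 : ∀ l ∈ ls, l.Pairwise (le · ·)) (h2 : ∀ l ∈ out, l.Pairwise (le · ·)) :
    ∀ l ∈ mergeRuns le ls out, l.Pairwise (le · ·) := by
  fun_induction mergeRuns le ls out with
  | case1 => exact h2
  | case2 => simp_all
  | case3 l₁ l₂ ls out ih =>
    refine ih (fun l hl => h1 l (by simp [hl])) fun l hl => ?_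
    obtain rfl | hl := List.mem_cons.1 hl
    · exact List.pairwise_merge trans total _ _ (h1 _ (by simp)) (h1 _ (by simp))
    · exact h2 l hl

theorem roundP_spec {W d R} {le : ℕ → ℕ → Bool} (hW : 1 ≤ W)
    (hle : ∀ i j, leVal (R i 1) (R j 1) = some (le i j)) (ls out) : ∀ {σ}, Consts d σ →
    IsRuns σ.next σ.cell R ls (σ.reg (d + 17)) → IsRuns σ.next σ.cell R out (σ.reg (d + 18)) →
    WP W (roundP d) σ (64 * ls.flatten.length + 40 * ls.length + 3) fun σ' =>
      Grow (d + 7) (d + 19) σ σ' ∧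
      IsRuns σ'.next σ'.cell R (mergeRuns le ls out) (σ'.reg (d + 18)) := by
  fun_induction mergeRuns le ls out with
  | case1 out =>
    intro σ hc h1 h2
    refine WP.le (WP.while_nil h1 hc.one hc.nil ⟨.of_set le_rfl (by omega), ?_⟩) (by simp)
    simpa [State.set] using h2
  | case2 l out =>
    intro σ hc h1 h2
    obtain ⟨a, ha, hv, h3, h4⟩ := h1
    have h4' : σ.cell a 2 = .nil := h4
    refine WP.le (T := (4 + (2 + (64 * (l.length + 0) + 19))) + 3 + 3) ?_
      (by simp; omega)
    refine WP.while_ptr hW hv hc.one hc.nil ?_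
    refine WP.seq (WP.blk (is := [_, _, _]) ?_)
    simp (disch := omega) only [execL, Instr.exec, State.set, Function.update_self,
      Function.update_of_ne, if_pos, Option.bind_some, Option.some.injEq, exists_eq_left', hv, h4',
          ha, if_true]
    refine WP.seq (WP.branch (b := true) ?_ (fun _ => WP.skip ?_) (by simp))
    · simp (disch := omega) only [eval_same, Function.update_self, Function.update_of_ne, hc.nil,
        sameVal]
    set σ₁ : State := ⟨_, σ.cell, σ.next, σ.out⟩ with hσ₁
    have hg1 : Grow (d + 7) (d + 19) σ σ₁ := by
      refine ⟨le_rfl, fun _ _ => rfl, rfl, fun r hr => ?_⟩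
      simp (disch := omega) only [hσ₁, Function.update_of_ne]
    refine (joinP_spec hW hle (l₁ := l) (l₂ := []) (ls := out) (hc.grow hg1 le_rfl) ?_ ?_
      ?_).conseq ?_
    · simpa (disch := omega) only [hσ₁, Function.update_self, Function.update_of_ne] using h3
    · simp (disch := omega) only [hσ₁, Function.update_self, Function.update_of_ne, IsList]
    · simpa (disch := omega) only [hσ₁, Function.update_self, Function.update_of_ne] using h2
    rintro σ₂ ⟨hg2, e1, e2⟩
    refine WP.while_nil ?_ (hc.grow (hg1.trans hg2) le_rfl).one
      (hc.grow (hg1.trans hg2) le_rfl).nil ⟨(hg1.trans hg2).trans (.of_set le_rfl (by omega)), ?_⟩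
    · rw [e1]; simp (disch := omega) only [hσ₁, Function.update_self, Function.update_of_ne]
    · simpa [State.set] using e2
  | case3 l₁ l₂ ls out ih =>
    intro σ hc h1 h2
    obtain ⟨a, ha, hv, h3, b, hb, hw, h4, h5⟩ := h1
    refine WP.le (T := (4 + (4 + (64 * (l₁.length + l₂.length) + 19))) +
      (64 * ls.flatten.length + 40 * ls.length + 3) + 3) ?_ (by simp; omega)
    refine WP.while_ptr hW hv hc.one hc.nil ?_
    refine WP.seq (WP.blk (is := [_, _, _]) ?_)
    simp (disch := omega) only [execL, Instr.exec, State.set, Function.update_self,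
      Function.update_of_ne, if_pos, Option.bind_some, Option.some.injEq, exists_eq_left', hv, hw,
          ha, hb, if_true]
    refine WP.seq (WP.branch (b := false) ?_ (by simp) fun _ => WP.blk (is := [_, _]) ?_)
    · simp (disch := omega) only [eval_same, Function.update_self, Function.update_of_ne, hc.nil,
        sameVal]
    simp (disch := omega) only [execL, Instr.exec, State.set, Function.update_self,
      Function.update_of_ne, if_pos, Option.bind_some, Option.some.injEq, exists_eq_left', hv, hw,
          ha, hb, if_true]
    set σ₁ : State := ⟨_, σ.cell, σ.next, σ.out⟩ with hσ₁
    have hg1 : Grow (d + 7) (d + 19) σ σ₁ := by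
      refine ⟨le_rfl, fun _ _ => rfl, rfl, fun r hr => ?_⟩
      simp (disch := omega) only [hσ₁, Function.update_of_ne]
    refine (joinP_spec hW hle (l₁ := l₁) (l₂ := l₂) (ls := out) (hc.grow hg1 le_rfl) ?_ ?_
      ?_).conseq ?_
    · simpa (disch := omega) only [hσ₁, Function.update_self, Function.update_of_ne] using h3
    · simpa (disch := omega) only [hσ₁, Function.update_self, Function.update_of_ne] using h4
    · simpa (disch := omega) only [hσ₁, Function.update_self, Function.update_of_ne] using h2
    rintro σ₂ ⟨hg2, e1, e2⟩
    refine (ih (hc.grow (hg1.trans hg2) le_rfl) ?_ e2).conseq fun σ₃ ⟨hg3, e3⟩ =>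
      ⟨(hg1.trans hg2).trans hg3, e3⟩
    have h6 : σ₁.reg (d + 17) = σ.cell b 2 := by
      simp (disch := omega) only [hσ₁, Function.update_self, Function.update_of_ne]
    rw [e1, h6]
    exact h5.grow (hg1.trans hg2)

/-- Sort the records: the runs in `d + 17` are merged until there is a single one, which is put into
register `d + 10`. -/
def sortP (d : ℕ) : Prog :=
  .seq (blk [.load (d + 19) (d + 17) 2]) (.seq (whileNe d (d + 19) (.seq (blk [.clear (d + 18)])
    (.seq (roundP d) (blk [.move (d + 17) (d + 18), .load (d + 19) (d + 17) 2]))))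
    (blk [.load (d + 10) (d + 17) 0]))

/-- Bottom-up merge sort. A round turns `r` runs into `⌈r / 2⌉` and costs a constant per record and
per run, so `k` rounds suffice for up to `2 ^ k` runs. -/
theorem sortP_spec {W d R} {le : ℕ → ℕ → Bool} (hW : 1 ≤ W)
    (trans : ∀ a b c, le a b → le b c → le a c) (total : ∀ a b, (le a b || le b a) = true)
    (hle : ∀ i j, leVal (R i 1) (R j 1) = some (le i j)) (k m r : ℕ) {ls σ} (hc : Consts d σ)
    (hls : ls ≠ []) (hk : ls.length ≤ 2 ^ k) (hr : ls.length ≤ r) (hm : ls.flatten.length = m)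
    (hs : ∀ l ∈ ls, l.Pairwise (le · ·)) (h1 : IsRuns σ.next σ.cell R ls (σ.reg (d + 17))) :
    WP W (sortP d) σ ((64 * m + 40 * r + 11) * k + 7) fun σ' =>
      Grow (d + 7) (d + 20) σ σ' ∧ ∃ l, l.Perm ls.flatten ∧ l.Pairwise (le · ·) ∧
      IsList σ'.next σ'.cell R l (σ'.reg (d + 10)) := by
  -- The loop is controlled by `d + 19`, the link from the first run to the second: it ends as soon
  -- as a single run is left.
  have key : ∀ k ls σ, Consts d σ → ls ≠ [] → ls.length ≤ 2 ^ k → ls.length ≤ r →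
      ls.flatten.length = m → (∀ l ∈ ls, l.Pairwise (le · ·)) →
      IsRuns σ.next σ.cell R ls (σ.reg (d + 17)) →
      (∃ a, σ.reg (d + 17) = .ptr a ∧ σ.reg (d + 19) = σ.cell a 2) →
      WP W (whileNe d (d + 19) (.seq (blk [.clear (d + 18)])
      (.seq (roundP d) (blk [.move (d + 17) (d + 18), .load (d + 19) (d + 17) 2])))) σ
      ((64 * m + 40 * r + 11) * k + 3) fun σ' =>
      Grow (d + 7) (d + 20) σ σ' ∧ ∃ l, l.Perm ls.flatten ∧ l.Pairwise (le · ·) ∧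
      IsRuns σ'.next σ'.cell R [l] (σ'.reg (d + 17)) := by
    intro k
    induction k with
    | zero =>
      intro ls σ hc hls hk hr hm hs h1 h2
      obtain ⟨l, rfl⟩ : ∃ l, ls = [l] := by
        obtain _ | ⟨l, _ | _⟩ := ls <;> simp_all
      obtain ⟨a, ha, hv, h3, h4⟩ := id h1
      obtain ⟨a', hv', h5⟩ := h2
      obtain rfl : a = a' := by simpa [hv] using hv'
      refine WP.le (WP.while_nil (h5.trans h4) hc.one hc.nil
        ⟨.of_set (by omega) (by omega), l, by simp, hs l (by simp), ?_⟩) (by simp)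
      simpa [State.set] using h1
    | succ k ih =>
      intro ls σ hc hls hk hr hm hs h1 h2
      obtain _ | ⟨l, _ | ⟨l', ls⟩⟩ := ls
      · exact absurd rfl hls
      · obtain ⟨a, ha, hv, h3, h4⟩ := id h1
        obtain ⟨a', hv', h5⟩ := h2
        obtain rfl : a = a' := by simpa [hv] using hv'
        refine WP.le (WP.while_nil (h5.trans h4) hc.one hc.nil
          ⟨.of_set (by omega) (by omega), l, by simp, hs l (by simp), ?_⟩) (by simp)
        simpa [State.set] using h1
      · obtain ⟨a, ha, hv, h3, b, hb, hw, h4⟩ := id h1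
        obtain ⟨a', hv', h5⟩ := h2
        obtain rfl : a = a' := by simpa [hv] using hv'
        generalize hls' : l :: l' :: ls = ls' at *
        refine WP.le (T := (2 + ((64 * ls'.flatten.length + 40 * ls'.length + 3) + 3)) +
          ((64 * m + 40 * r + 11) * k + 3) + 3) ?_ (by rw [hm]; nlinarith)
        refine WP.while_ptr hW (h5.trans hw) hc.one hc.nil ?_
        refine WP.seq (WP.blk (is := [_]) ⟨_, rfl, ?_⟩)
        set σ₁ : State := (σ.set (d + 7) (.num 1)).set (d + 18) .nil with hσ₁
        have hg1 : Grow (d + 7) (d + 19) σ σ₁ :=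
          (Grow.of_set (by omega) (by omega)).trans (.of_set (by omega) (by omega))
        refine WP.seq ((roundP_spec hW hle ls' [] (hc.grow hg1 le_rfl) ?_ ?_).conseq ?_)
        · simpa (disch := omega) [hσ₁, State.set, Function.update_of_ne] using h1
        · simp [hσ₁, State.set, IsRuns]
        rintro σ₂ ⟨hg2, e2⟩
        have hlen := length_mergeRuns le ls' []
        have hne : mergeRuns le ls' [] ≠ [] := by
          intro h
          rw [h, ← hls'] at hlen; simp at hlen; omega
        have hgt := (hg1.trans hg2).mono le_rfl (show d + 19 ≤ d + 20 by omega)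
        obtain ⟨a₂, hv₂, ha₂⟩ : ∃ a, σ₂.reg (d + 18) = .ptr a ∧ a < σ₂.next := by
          obtain ⟨l, ls, h⟩ := List.exists_cons_of_ne_nil hne
          rw [h] at e2; obtain ⟨a, ha, hv, -⟩ := e2; exact ⟨a, hv, ha⟩
        refine WP.blk (is := [_, _]) ?_
        simp (disch := omega) only [execL, Instr.exec, State.set, Function.update_self,
          Function.update_of_ne, if_pos, Option.bind_some, Option.some.injEq, exists_eq_left', hv₂]
        set σ₃ : State := ⟨_, σ₂.cell, σ₂.next, σ₂.out⟩ with hσ₃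
        have hg3 : Grow (d + 7) (d + 20) σ₂ σ₃ := by
          refine ⟨le_rfl, fun _ _ => rfl, rfl, fun r hr => ?_⟩
          simp (disch := omega) only [hσ₃, Function.update_of_ne]
        have hperm := mergeRuns_perm le ls' []
        rw [List.flatten_nil, List.append_nil] at hperm
        refine (ih _ σ₃ (hc.grow (hgt.trans hg3) le_rfl) hne ?_ ?_ ?_
          (mergeRuns_sorted trans total _ _ hs (by simp)) ?_ ⟨a₂, ?_, ?_⟩).conseq ?_
        · rw [hlen, List.length_nil]; rw [pow_succ] at hk; omega
        · rw [hlen, List.length_nil]; omega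
        · rw [hperm.length_eq, hm]
        · simpa (disch := omega) only [hσ₃, Function.update_self, Function.update_of_ne, hv₂]
            using e2
        · simp (disch := omega) only [hσ₃, Function.update_self, Function.update_of_ne, hv₂]
        · simp (disch := omega) only [hσ₃, Function.update_self, Function.update_of_ne, hv₂]
        rintro σ₄ ⟨hg4, l₄, hp4, hs4, e4⟩
        exact ⟨(hgt.trans hg3).trans hg4, l₄, hp4.trans hperm, hs4, e4⟩
  obtain ⟨a, hv, ha⟩ : ∃ a, σ.reg (d + 17) = .ptr a ∧ a < σ.next := by
    obtain ⟨l, ls, rfl⟩ := List.exists_cons_of_ne_nil hls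
    obtain ⟨a, ha, hv, -⟩ := h1; exact ⟨a, hv, ha⟩
  refine WP.le (T := 2 + (((64 * m + 40 * r + 11) * k + 3) + 2)) ?_ (by omega)
  refine WP.seq (WP.blk (is := [_]) ⟨σ.set (d + 19) (σ.cell a 2), ?_, ?_⟩)
  · simp [execL, Instr.exec, hv, ha]
  have hg0 : Grow (d + 7) (d + 20) σ (σ.set (d + 19) (σ.cell a 2)) :=
    .of_set (by omega) (by omega)
  refine WP.seq ((key k ls _ (hc.grow hg0 le_rfl) hls hk hr hm hs ?_ ⟨a, ?_, ?_⟩).conseq ?_)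
  · simpa (disch := omega) [State.set, Function.update_of_ne] using h1
  · simpa (disch := omega) [State.set, Function.update_of_ne] using hv
  · simp [State.set]
  rintro σ₁ ⟨hg1, l, hp, hs, b, hb, hw, e1, -⟩
  refine WP.blk (is := [_]) ⟨σ₁.set (d + 10) (σ₁.cell b 0), ?_, ?_, l, hp, hs, ?_⟩
  · simp [execL, Instr.exec, hw, hb]
  · exact (hg0.trans hg1).trans (.of_set (by omega) (by omega))
  · simpa [State.set] using e1

/-- The fields of the record of point `j`. -/
def recRow (kv cp rl : ℕ → Val) (j f : ℕ) : Val :=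
  if f = 0 then .ptr j else if f = 1 then kv j else if f = 3 then cp j else if f = 4 then rl j
  else .nil

theorem IsList.congr {N h R R' l v} (H : IsList N h R l v)
    (hR : ∀ j ∈ l, R j 0 = R' j 0 ∧ R j 1 = R' j 1 ∧ R j 3 = R' j 3 ∧ R j 4 = R' j 4) :
    IsList N h R' l v := by
  induction l generalizing v with
  | nil => exact H
  | cons j l ih =>
    obtain ⟨a, ha, hv, hr, hl⟩ := H
    obtain ⟨e0, e1, e3, e4⟩ := hR j (by simp)
    refine ⟨a, ha, hv, ?_, ih hl fun i hi => hR i (by simp [hi])⟩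
    rwa [← e0, ← e1, ← e3, ← e4]

/-! ### Reading the input -/

/-- Make records of the points in the input list, in register `d + 12`. -/
def initP (d : ℕ) : Prog :=
  .seq (blk (mk (d + 20) [(0, d + 4)] ++ [.clear (d + 12), .move (d + 11) (d + 1)]))
    (whileNe d (d + 11) (blk (mk (d + 16) [(0, d + 11), (2, d + 12), (4, d + 20)] ++
      [.move (d + 12) (d + 16), .load (d + 11) (d + 11) (d + 1)])))

/-- The `j`-th input cell has address `j`, so `.ptr j` both names the point and leads to its
coordinates. The extra cell `a` ends all rank lists: later programs load fields from the end of a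
rank list without a test, so this end must be an allocated cell. -/
theorem initP_spec {W d n σ} (hW : 1 ≤ W) (hc : Consts d σ) (hn : n ≤ σ.next)
    (h1 : σ.reg (d + 1) = if 0 < n then .ptr 0 else .nil)
    (hin : ∀ j < n, σ.cell j (d + 1) = if j + 1 < n then .ptr (j + 1) else .nil) :
    WP W (initP d) σ (10 * n + 8) fun σ' => Grow (d + 7) (d + 21) σ σ' ∧
      ∃ a < σ'.next, σ'.cell a 0 = .num 0 ∧
        IsList σ'.next σ'.cell (recRow (fun _ => .nil) (fun _ => .nil) fun _ => .ptr a)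
          (List.range n).reverse (σ'.reg (d + 12)) := by
  have key : ∀ k j σ a, j + k = n → Consts d σ → n ≤ σ.next →
      σ.reg (d + 11) = (if j < n then .ptr j else .nil) →
      (∀ j < n, σ.cell j (d + 1) = if j + 1 < n then .ptr (j + 1) else .nil) →
      σ.reg (d + 20) = .ptr a → a < σ.next → σ.cell a 0 = .num 0 →
      IsList σ.next σ.cell (recRow (fun _ => .nil) (fun _ => .nil) fun _ => .ptr a)
          (List.range j).reverse (σ.reg (d + 12)) →
      WP W (whileNe d (d + 11) (blk (mk (d + 16) [(0, d + 11), (2, d + 12), (4, d + 20)] ++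
      [.move (d + 12) (d + 16), .load (d + 11) (d + 11) (d + 1)]))) σ (10 * k + 3) fun σ' =>
      Grow (d + 7) (d + 21) σ σ' ∧ a < σ'.next ∧ σ'.cell a 0 = .num 0 ∧
        IsList σ'.next σ'.cell (recRow (fun _ => .nil) (fun _ => .nil) fun _ => .ptr a)
          (List.range n).reverse (σ'.reg (d + 12)) := by
    intro k
    induction k with
    | zero =>
      intro j σ a hj hc hn h11 hin h20 ha h0 hl
      obtain rfl : j = n := by omega
      refine WP.while_nil (by simpa using h11) hc.one hc.nil
        ⟨.of_set (by omega) (by omega), ha, h0, ?_⟩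
      simpa [State.set] using hl
    | succ k ih =>
      intro j σ a hj hc hn h11 hin h20 ha h0 hl
      rw [if_pos (by omega)] at h11
      refine WP.le (T := 7 + (10 * k + 3) + 3) ?_ (by omega)
      refine WP.while_ptr hW h11 hc.one hc.nil (WP.le (WP.blk (is := _ ++ _) ?_) (by
        simp [length_mk]))
      have hjn : j < σ.next := by omega
      have hin' := hin j (by omega)
      rw [State.set, execL_mk_append (by simp)]
      simp (disch := omega) only [execL, Instr.exec, State.set, Function.update_self,
      Function.update_of_ne, if_pos, Option.bind_some, Option.some.injEq, exists_eq_left', if_true,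
      row, h11, h20, hin']
      set σ₁ : State := ⟨_, _, _, σ.out⟩ with hσ₁
      have hg1 : Grow (d + 7) (d + 21) σ σ₁ := by
        refine ⟨Nat.le_succ _, fun b hb => ?_, rfl, fun r hr => ?_⟩
        · simp (disch := omega) only [hσ₁, Function.update_of_ne]
        · simp (disch := omega) only [hσ₁, Function.update_of_ne]
      have h11' : σ₁.reg (d + 11) = (if j + 1 < n then .ptr (j + 1) else .nil) := by
        simp (disch := omega) only [Function.update_self, Function.update_of_ne, hσ₁]
      refine (ih (j + 1) σ₁ a (by omega) (hc.grow hg1 le_rfl) (hn.trans hg1.next_le) h11' ?_ ?_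
        (ha.trans_le hg1.next_le) ?_ ?_).conseq ?_
      · intro i hi
        rw [hg1.cell_eq i (by omega), hin i hi]
      · simpa (disch := omega) only [hσ₁, Function.update_self, Function.update_of_ne] using h20
      · rw [hg1.cell_eq a ha, h0]
      · rw [List.range_succ, List.reverse_append]
        refine ⟨σ.next, by simp [hσ₁], ?_, ?_, ?_⟩
        · simp (disch := omega) only [Function.update_self, Function.update_of_ne, hσ₁]
        · simp [hσ₁, recRow]
        · have := hl.grow hg1
          simpa [hσ₁] using this
      · rintro σ₂ ⟨hg2, h⟩
        exact ⟨hg1.trans hg2, h⟩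
  refine WP.le (T := 5 + (10 * n + 3)) (WP.seq (WP.blk (is := _ ++ _) ?_)) (by omega)
  obtain ⟨reg, cell, next, out⟩ := σ
  rw [execL_mk_append (by simp)]
  simp (disch := omega) only [execL, Instr.exec, State.set, Function.update_self,
      Function.update_of_ne, if_pos, Option.bind_some, Option.some.injEq, exists_eq_left', if_true,
      row]
  set σ₁ : State := ⟨_, _, next + 1, out⟩ with hσ₁
  have hg1 : Grow (d + 7) (d + 21) ⟨reg, cell, next, out⟩ σ₁ := by
    refine ⟨Nat.le_succ _, fun b hb => ?_, rfl, fun r hr => ?_⟩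
    · dsimp only at hb
      simp (disch := omega) only [hσ₁, Function.update_of_ne]
    · simp (disch := omega) only [hσ₁, Function.update_of_ne]
  refine (key n 0 σ₁ next (by omega) (hc.grow hg1 le_rfl) (hn.trans hg1.next_le) ?_ ?_ ?_
    (Nat.lt_succ_self _) ?_ ?_).conseq ?_
  · simp (disch := omega) only [hσ₁, Function.update_self, Function.update_of_ne]; exact h1
  · intro j hj
    dsimp only at hn
    rw [hg1.cell_eq j (by dsimp only; omega)]; exact hin j hj
  · simp (disch := omega) only [Function.update_self, Function.update_of_ne, hσ₁]
  · simpa [hσ₁] using hc.zero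
  · simp [hσ₁, IsList]
  · rintro σ₂ ⟨hg2, h2, h3, h4⟩
    exact ⟨hg1.trans hg2, next, h2, h3, h4⟩

/-! ### Preparing to sort -/

/-- Take field `f` of the input cells as keys and make a run of each record in register
`d + 11`. -/
def rekeyP (d f : ℕ) : Prog :=
  .seq (blk [.clear (d + 17)]) (whileNe d (d + 11) (blk ([.load (d + 8) (d + 11) 0,
    .load (d + 9) (d + 8) f, .load (d + 14) (d + 11) 3, .load (d + 15) (d + 11) 4,
    .load (d + 11) (d + 11) 2] ++
    (mk (d + 16) [(0, d + 8), (1, d + 9), (3, d + 14), (4, d + 15)] ++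
    (mk (d + 13) [(0, d + 16), (2, d + 17)] ++ [.move (d + 17) (d + 13)])))))

/-- The new records form runs of length one, which are trivially sorted; this is the input that
`sortP` expects. Colour cells and rank lists are carried along. -/
theorem rekeyP_spec {W d f n kv cp rl l σ} {inp : ℕ → ℕ → Val} (hW : 1 ≤ W) (hc : Consts d σ)
    (hn : n ≤ σ.next) (hl : IsList σ.next σ.cell (recRow kv cp rl) l (σ.reg (d + 11)))
    (hin : ∀ j < n, σ.cell j = inp j) (hln : ∀ j ∈ l, j < n) :
    WP W (rekeyP d f) σ (18 * l.length + 5) fun σ' => Grow (d + 7) (d + 18) σ σ' ∧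
      IsRuns σ'.next σ'.cell (recRow (fun j => inp j f) cp rl) (l.reverse.map ([·]))
        (σ'.reg (d + 17)) := by
  have key : ∀ l (ls : List (List ℕ)) σ, Consts d σ → n ≤ σ.next →
      IsList σ.next σ.cell (recRow kv cp rl) l (σ.reg (d + 11)) →
      (∀ j < n, σ.cell j = inp j) → (∀ j ∈ l, j < n) →
      IsRuns σ.next σ.cell (recRow (fun j => inp j f) cp rl) ls (σ.reg (d + 17)) →
      WP W (whileNe d (d + 11) (blk ([.load (d + 8) (d + 11) 0,
        .load (d + 9) (d + 8) f, .load (d + 14) (d + 11) 3, .load (d + 15) (d + 11) 4,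
        .load (d + 11) (d + 11) 2] ++
        (mk (d + 16) [(0, d + 8), (1, d + 9), (3, d + 14), (4, d + 15)] ++
        (mk (d + 13) [(0, d + 16), (2, d + 17)] ++ [.move (d + 17) (d + 13)]))))) σ
        (18 * l.length + 3) fun σ' => Grow (d + 7) (d + 18) σ σ' ∧
      IsRuns σ'.next σ'.cell (recRow (fun j => inp j f) cp rl) (l.reverse.map ([·]) ++ ls)
        (σ'.reg (d + 17)) := by
    intro l
    induction l with
    | nil =>
      intro ls σ hc hn hl hin hln hr
      refine WP.while_nil hl hc.one hc.nil ⟨.of_set (by omega) (by omega), ?_⟩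
      simpa [State.set] using hr
    | cons j l ih =>
      intro ls σ hc hn hl hin hln hr
      obtain ⟨a, ha, hv, ⟨h0, h1, h3, h4, h5⟩, hl⟩ := hl
      refine WP.le (T := 15 + (18 * l.length + 3) + 3) ?_ (by simp; omega)
      refine WP.while_ptr hW hv hc.one hc.nil (WP.le (WP.blk (is := _ ++ _) ?_) (by
        simp [length_mk]))
      have hjn : j < σ.next := (hln j (by simp)).trans_le hn
      have hin' := hin j (hln j (by simp))
      have h0' : σ.cell a 0 = .ptr j := h0
      rw [State.set, execL_append]
      simp (disch := omega) only [execL, Instr.exec, State.set, Function.update_self,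
      Function.update_of_ne, if_pos, Option.bind_some, Option.some.injEq, exists_eq_left', if_true,
      row, hv, h0', ha, hjn, hin']
      rw [execL_mk_append (by simp)]
      simp (disch := omega) only [execL, Instr.exec, State.set, Function.update_self,
      Function.update_of_ne, if_pos, Option.bind_some, Option.some.injEq, exists_eq_left', if_true,
      row]
      rw [execL_mk_append (by simp)]
      simp (disch := omega) only [execL, Instr.exec, State.set, Function.update_self,
      Function.update_of_ne, if_pos, Option.bind_some, Option.some.injEq, exists_eq_left', if_true,
      row]
      set σ₁ : State := ⟨_, _, _, σ.out⟩ with hσ₁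
      have hg1 : Grow (d + 7) (d + 18) σ σ₁ := by
        refine ⟨(Nat.le_succ _).trans (Nat.le_succ _), fun b hb => ?_, rfl, fun r hr => ?_⟩
        · simp (disch := omega) only [hσ₁, Function.update_of_ne]
        · simp (disch := omega) only [hσ₁, Function.update_of_ne]
      refine (ih ([j] :: ls) σ₁ (hc.grow hg1 le_rfl) (hn.trans hg1.next_le) ?_ ?_
        (fun i hi => hln i (by simp [hi])) ?_).conseq ?_
      · have := hl.grow hg1
        simpa (disch := omega) only [Function.update_self, Function.update_of_ne, hσ₁] using this
      · intro i hi
        rw [hg1.cell_eq i (by omega), hin i hi]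
      · refine ⟨σ.next + 1, by simp [hσ₁], ?_, ?_, ?_⟩
        · simp (disch := omega) only [Function.update_self, Function.update_of_ne, hσ₁]
        · refine ⟨σ.next, by simp [hσ₁], ?_, ?_, ?_⟩
          · simp [hσ₁]
          · simp [hσ₁, recRow, h3, h4]
          · simp [hσ₁, IsList]
        · have := hr.grow hg1
          simpa [hσ₁] using this
      · rintro σ₂ ⟨hg2, h⟩
        refine ⟨hg1.trans hg2, by simpa using h⟩
  refine WP.le (T := 2 + (18 * l.length + 3)) (WP.seq (WP.blk (is := [_]) ⟨_, rfl, ?_⟩)) (by omega)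
  have hg0 : Grow (d + 7) (d + 18) σ (σ.set (d + 17) .nil) := .of_set (by omega) (by omega)
  refine (key l [] _ (hc.grow hg0 le_rfl) hn ?_ hin hln ?_).conseq ?_
  · simpa [State.set] using hl
  · simp [State.set, IsRuns]
  · rintro σ₂ ⟨hg2, h⟩
    exact ⟨hg0.trans hg2, by simpa using h⟩

/-! ### Colours -/

/-- There is one cell for each colour in `S`, with address given by `ca`; it holds the colour and
a counter. -/
structure ColorCells (N : ℕ) (h : ℕ → ℕ → Val) (ca : ℕ → ℕ) (S : Set ℕ) : Prop where
  lt : ∀ c ∈ S, ca c < N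
  color : ∀ c ∈ S, h (ca c) 0 = .num c
  count : ∀ c ∈ S, h (ca c) 8 = .num 0
  inj : Set.InjOn ca S

theorem ColorCells.grow {ca S lo hi σ σ'} (H : ColorCells σ.next σ.cell ca S)
    (hg : Grow lo hi σ σ') : ColorCells σ'.next σ'.cell ca S :=
  ⟨fun c hc => (H.lt c hc).trans_le hg.next_le,
    fun c hc => by rw [hg.cell_eq _ (H.lt c hc)]; exact H.color c hc,
    fun c hc => by rw [hg.cell_eq _ (H.lt c hc)]; exact H.count c hc, H.inj⟩

/-- Allocate a new colour cell unless the key in `d + 14` is the current colour. -/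
def newColorP (d : ℕ) : Prog :=
  .branch (.le (d + 14) (d + 8)) .skip (blk (mk (d + 9) [(0, d + 14), (8, d + 4)]))

/-- Give the records in `d + 11`, sorted by colour, colour cells. -/
def colorP (d : ℕ) : Prog :=
  .seq (blk [.clear (d + 12), .move (d + 8) (d + 4)]) (whileNe d (d + 11)
    (.seq (blk [.load (d + 14) (d + 11) 1]) (.seq (newColorP d)
    (blk ([.move (d + 8) (d + 14), .load (d + 15) (d + 11) 0, .load (d + 16) (d + 11) 4,
      .load (d + 11) (d + 11) 2] ++
      (mk (d + 13) [(0, d + 15), (1, d + 14), (2, d + 12), (3, d + 9), (4, d + 16)] ++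
      [.move (d + 12) (d + 13)]))))))

/-- As the colours come in nondecreasing order, the test `c ≤ prev` means that the colour is the
current one. At the start `prev = 0`, which no colour equals since `1 ≤ c`, so the first record
always gets a new cell. -/
theorem newColorP_spec {W d σ ca S prev c} (hc : Consts d σ)
    (h14 : σ.reg (d + 14) = .num c) (h8 : σ.reg (d + 8) = .num prev) (hpc : prev ≤ c)
    (hc1 : 1 ≤ c) (hprev : prev = 0 ∨ prev ∈ S ∧ σ.reg (d + 9) = .ptr (ca prev))
    (hS : ∀ e ∈ S, e ≤ prev) (hca : ColorCells σ.next σ.cell ca S) :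
    WP W (newColorP d) σ 5 fun σ' => Grow (d + 7) (d + 17) σ σ' ∧
      (∀ y, 10 ≤ y → σ'.reg (d + y) = σ.reg (d + y)) ∧
      ∃ ca', (∀ e ∈ S, ca' e = ca e) ∧ ColorCells σ'.next σ'.cell ca' (insert c S) ∧
        σ'.reg (d + 9) = .ptr (ca' c) := by
  refine WP.le (T := 4 + 1) (WP.branch (b := decide (c ≤ prev)) ?_ (fun h => ?_) fun h => ?_) le_rfl
  · simp [eval_le, h14, h8, leVal]
  · obtain rfl : c = prev := le_antisymm (by simpa using h) hpc
    obtain h | ⟨h1, h2⟩ := hprev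
    · omega
    refine WP.le (WP.skip ⟨Grow.refl .., fun _ _ => rfl, ca, fun _ _ => rfl, ?_, h2⟩) (by omega)
    rwa [Set.insert_eq_of_mem h1]
  · have hlt : prev < c := by simpa using h
    refine WP.le (WP.blk ?_) (by simp [length_mk])
    obtain ⟨reg, cell, next, out⟩ := σ
    rw [execL_mk (by simp)]
    simp only [Option.some.injEq, exists_eq_left']
    have hz := hc.zero
    dsimp only at h14 h8 hprev hca hz
    have hcS : c ∉ S := fun h => absurd (hS c h) (by omega)
    have hne : ∀ e ∈ S, e ≠ c := fun e he h => hcS (h ▸ he)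
    refine ⟨⟨Nat.le_succ _, fun b hb => ?_, rfl, fun r hr => ?_⟩, fun y hy => ?_,
      Function.update ca c next, fun e he => ?_, ⟨?_, ?_, ?_, ?_⟩, ?_⟩
    · dsimp only at hb ⊢
      simp (disch := omega) only [Function.update_self, Function.update_of_ne]
    · simp (disch := omega) only [Function.update_self, Function.update_of_ne]
    · simp (disch := omega) only [Function.update_self, Function.update_of_ne]
    · rw [Function.update_of_ne (hne e he)]
    · rintro e (rfl | he)
      · simp
      · rw [Function.update_of_ne (hne e he)]; exact (hca.lt e he).trans (Nat.lt_succ_self _)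
    · rintro e (rfl | he)
      · simp [row, h14]
      · have := hca.lt e he
        rw [Function.update_of_ne (hne e he)]; simp (disch := omega) only [Function.update_self,
            Function.update_of_ne]; exact hca.color e he
    · rintro e (rfl | he)
      · simp [row, hz]
      · have := hca.lt e he
        rw [Function.update_of_ne (hne e he)]; simp (disch := omega) only [Function.update_self,
            Function.update_of_ne]; exact hca.count e he
    · rw [Set.injOn_insert hcS]
      refine ⟨fun x hx y hy h => ?_, ?_⟩
      · rw [Function.update_of_ne (hne x hx), Function.update_of_ne (hne y hy)] at h
        exact hca.inj hx hy h
      · rintro ⟨e, he, h⟩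
        have := hca.lt e he
        rw [Function.update_of_ne (hne e he), Function.update_self] at h
        omega
    · simp

theorem colorP_spec {W d kv cp rl l σ} {col : ℕ → ℕ} (hW : 1 ≤ W) (hc : Consts d σ)
    (hkv : ∀ j, kv j = .num (col j))
    (hl : IsList σ.next σ.cell (recRow kv cp rl) l (σ.reg (d + 11)))
    (hs : l.Pairwise fun i j => col i ≤ col j) (hcol : ∀ j ∈ l, 1 ≤ col j) :
    WP W (colorP d) σ (25 * l.length + 6) fun σ' => Grow (d + 7) (d + 17) σ σ' ∧
      ∃ ca, ColorCells σ'.next σ'.cell ca {c | ∃ j ∈ l, col j = c} ∧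
      IsList σ'.next σ'.cell (recRow kv (fun j => .ptr (ca (col j))) rl) l.reverse
        (σ'.reg (d + 12)) := by
  have key : ∀ l acc σ ca prev, Consts d σ →
      IsList σ.next σ.cell (recRow kv cp rl) l (σ.reg (d + 11)) →
      l.Pairwise (fun i j => col i ≤ col j) → (∀ j ∈ l, 1 ≤ col j) →
      (∀ j ∈ l, prev ≤ col j) → (∀ j ∈ acc, col j ≤ prev) →
      ColorCells σ.next σ.cell ca {c | ∃ j ∈ acc, col j = c} →
      σ.reg (d + 8) = .num prev →
      (prev = 0 ∨ (∃ j ∈ acc, col j = prev) ∧ σ.reg (d + 9) = .ptr (ca prev)) →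
      IsList σ.next σ.cell (recRow kv (fun j => .ptr (ca (col j))) rl) acc (σ.reg (d + 12)) →
      WP W (whileNe d (d + 11)
        (.seq (blk [.load (d + 14) (d + 11) 1]) (.seq (newColorP d)
        (blk ([.move (d + 8) (d + 14), .load (d + 15) (d + 11) 0, .load (d + 16) (d + 11) 4,
          .load (d + 11) (d + 11) 2] ++
          (mk (d + 13) [(0, d + 15), (1, d + 14), (2, d + 12), (3, d + 9), (4, d + 16)] ++
          [.move (d + 12) (d + 13)])))))) σ (25 * l.length + 3) fun σ' =>
        Grow (d + 7) (d + 17) σ σ' ∧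
        ∃ ca, ColorCells σ'.next σ'.cell ca {c | ∃ j ∈ l.reverse ++ acc, col j = c} ∧
        IsList σ'.next σ'.cell (recRow kv (fun j => .ptr (ca (col j))) rl) (l.reverse ++ acc)
          (σ'.reg (d + 12)) := by
    intro l
    induction l with
    | nil =>
      intro acc σ ca prev hc hl _ _ _ _ hca _ _ hacc
      refine WP.while_nil hl hc.one hc.nil ⟨.of_set (by omega) (by omega), ca, ?_, ?_⟩
      · simpa [State.set] using hca
      · simpa [State.set] using hacc
    | cons j l ih =>
      intro acc σ ca prev hc hl hs hcol hpl hpa hca h8 hprev hacc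
      obtain ⟨a, ha, hv, hrow, hl'⟩ := id hl
      have h1 : σ.cell a 1 = .num (col j) := hrow.2.1.trans (hkv j)
      refine WP.le (T := (2 + (5 + 12)) + (25 * l.length + 3) + 3) ?_ (by simp; omega)
      refine WP.while_ptr hW hv hc.one hc.nil (WP.seq (WP.blk (is := [_]) ?_))
      simp (disch := omega) only [execL, Instr.exec, State.set, Function.update_self,
      Function.update_of_ne, if_pos, Option.bind_some, Option.some.injEq, exists_eq_left', if_true,
      row, hv, ha, h1]
      set σ₁ : State := ⟨_, _, _, σ.out⟩ with hσ₁
      have hg1 : Grow (d + 7) (d + 17) σ σ₁ := by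
        refine ⟨le_rfl, fun b hb => rfl, rfl, fun r hr => ?_⟩
        simp (disch := omega) only [hσ₁, Function.update_of_ne]
      refine WP.seq ((newColorP_spec (S := {c | ∃ j ∈ acc, col j = c}) (ca := ca) (prev := prev)
        (c := col j) (hc.grow hg1 le_rfl) ?_ ?_ (hpl j (by simp)) (hcol j (by simp)) ?_ ?_
        (hca.grow hg1)).conseq ?_)
      · simp (disch := omega) only [Function.update_self, Function.update_of_ne, hσ₁]
      · simp (disch := omega) only [Function.update_self, Function.update_of_ne, hσ₁, h8]
      · simpa (disch := omega) only [hσ₁, Function.update_self, Function.update_of_ne,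
          Set.mem_ofPred_eq] using hprev
      · rintro _ ⟨i, hi, rfl⟩; exact hpa i hi
      rintro σ₂ ⟨hg2, hr2, ca', hca', hcc, h9⟩
      have hg12 := hg1.trans hg2
      have e11 : σ₂.reg (d + 11) = .ptr a := by
        rw [hr2 11 (by omega)]; simp (disch := omega) only [Function.update_self, Function.update_of_ne, hσ₁, hv]
      have e14 : σ₂.reg (d + 14) = .num (col j) := by
        rw [hr2 14 (by omega)]; simp (disch := omega) only [Function.update_self, Function.update_of_ne, hσ₁]
      have e12 : σ₂.reg (d + 12) = σ.reg (d + 12) := by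
        rw [hr2 12 (by omega)]; simp (disch := omega) only [Function.update_self, Function.update_of_ne, hσ₁]
      have ha2 : a < σ₂.next := ha.trans_le hg12.next_le
      have e0 : σ₂.cell a = σ.cell a := hg12.cell_eq a ha
      refine WP.le (WP.blk (is := _ ++ _) ?_) (by simp [length_mk])
      rw [execL_append]
      simp (disch := omega) only [execL, Instr.exec, State.set, Function.update_self,
      Function.update_of_ne, if_pos, Option.bind_some, Option.some.injEq, exists_eq_left', if_true,
      row, e11, ha2, e0, e14]
      rw [execL_mk_append (by simp)]
      simp (disch := omega) only [execL, Instr.exec, State.set, Function.update_self,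
      Function.update_of_ne, if_pos, Option.bind_some, Option.some.injEq, exists_eq_left', if_true,
      row]
      set σ₃ : State := ⟨_, _, _, σ₂.out⟩ with hσ₃
      have hg3 : Grow (d + 7) (d + 17) σ₂ σ₃ := by
        refine ⟨Nat.le_succ _, fun b hb => ?_, rfl, fun r hr => ?_⟩
        · simp (disch := omega) only [hσ₃, Function.update_of_ne]
        · simp (disch := omega) only [hσ₃, Function.update_of_ne]
      have hset : {c | ∃ i ∈ j :: acc, col i = c} = insert (col j) {c | ∃ j ∈ acc, col j = c} := by
        ext c; simp [eq_comm]
      rw [List.pairwise_cons] at hs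
      refine (ih (j :: acc) σ₃ ca' (col j) (hc.grow (hg12.trans hg3) le_rfl) ?_ hs.2
        (fun i hi => hcol i (by simp [hi])) hs.1 ?_ ?_ ?_ (.inr ⟨⟨j, by simp, rfl⟩,
            ?_⟩) ?_).conseq ?_
      · have := hl'.grow (hg12.trans hg3)
        simpa (disch := omega) only [Function.update_self, Function.update_of_ne, hσ₃] using this
      · intro i hi
        obtain rfl | hi := List.mem_cons.1 hi
        · exact le_rfl
        · exact (hpa i hi).trans (hpl j (by simp))
      · rw [hset]; exact hcc.grow hg3
      · simp (disch := omega) only [Function.update_self, Function.update_of_ne, hσ₃]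
      · simpa (disch := omega) only [Function.update_self, Function.update_of_ne, hσ₃] using h9
      · refine ⟨σ₂.next, by simp [hσ₃], ?_, ?_, ?_⟩
        · simp (disch := omega) only [Function.update_self, Function.update_of_ne, hσ₃]
        · have e3 : σ.cell a 0 = _ := hrow.1
          have e4 : σ.cell a 4 = _ := hrow.2.2.2.1
          simp [hσ₃, recRow, hkv, e3, e4, h9, e14]
        -- The extended address function agrees with the old one on all colours met before, so the
        -- finished records remain correctly described.
        · have h := hacc.congr (R' := recRow kv (fun j => .ptr (ca' (col j))) rl) (fun i hi => by
            simp [recRow, hca' _ ⟨i, hi, rfl⟩])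
          have := h.grow (hg12.trans hg3)
          simpa [hσ₃, e12] using this
      · rintro σ₄ ⟨hg4, h⟩
        refine ⟨(hg12.trans hg3).trans hg4, by simpa using h⟩
  refine WP.le (T := 3 + (25 * l.length + 3)) (WP.seq (WP.blk (is := [_, _]) ⟨_, rfl, ?_⟩))
    (by omega)
  set σ₁ : State := (σ.set (d + 12) .nil).set (d + 8) _ with hσ₁
  have hg0 : Grow (d + 7) (d + 17) σ σ₁ :=
    (Grow.of_set (by omega) (by omega)).trans (.of_set (by omega) (by omega))
  -- The number `0` plays the role of a colour below all others; no cell belongs to it.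
  refine (key l [] σ₁ (fun _ => 0) 0 (hc.grow hg0 le_rfl) ?_ hs hcol (by simp) (by simp)
    ⟨by simp, by simp, by simp, by simp⟩ ?_ (.inl rfl) ?_).conseq ?_
  · simpa [State.set, hσ₁] using hl
  · have := hc.zero; simpa [State.set, hσ₁] using this
  · simp [State.set, hσ₁, IsList]
  · rintro σ₂ ⟨hg2, h⟩
    refine ⟨hg0.trans hg2, by simpa using h⟩

/-! ### Ranks -/

/-- Put ranks in front of the rank lists of the records in `d + 11`, which are sorted in decreasing
order; their number is in register `d + 20`. -/
def rankP (d : ℕ) : Prog :=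
  .seq (blk [.clear (d + 12)]) (whileNe d (d + 11)
    (blk ([.load (d + 8) (d + 11) 0, .load (d + 9) (d + 11) 1, .load (d + 14) (d + 11) 3,
      .load (d + 15) (d + 11) 4, .load (d + 11) (d + 11) 2] ++
      (mk (d + 13) [(0, d + 20), (1, d + 15)] ++
      (mk (d + 16) [(0, d + 8), (1, d + 9), (2, d + 12), (3, d + 14), (4, d + 13)] ++
      [.move (d + 12) (d + 16), .sub (d + 20) (d + 20) (d + 5)])))))

/-- The points of the list have the ranks `k, …, 2, 1`. -/
def RankDesc (rk : ℕ → ℕ) : List ℕ → Prop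
  | [] => True
  | j :: l => rk j = l.length + 1 ∧ RankDesc rk l

/-- The records arrive in decreasing order, the counter runs down from their number, and prepending
restores the increasing order. -/
theorem rankP_spec {W d kv cp rl rk l σ} (hW : 1 ≤ W) (hc : Consts d σ)
    (hl : IsList σ.next σ.cell (recRow kv cp rl) l (σ.reg (d + 11)))
    (hrk : RankDesc rk l) (h20 : σ.reg (d + 20) = .num l.length) (hnd : l.Nodup) :
    WP W (rankP d) σ (20 * l.length + 5) fun σ' => Grow (d + 7) (d + 21) σ σ' ∧
      ∃ rl', (∀ j ∈ l, ∃ a < σ'.next, rl' j = .ptr a ∧ σ'.cell a 0 = .num (rk j) ∧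
        σ'.cell a 1 = rl j) ∧
      IsList σ'.next σ'.cell (recRow kv cp rl') l.reverse (σ'.reg (d + 12)) := by
  have key : ∀ l acc σ rl', Consts d σ →
      IsList σ.next σ.cell (recRow kv cp rl) l (σ.reg (d + 11)) →
      RankDesc rk l → σ.reg (d + 20) = .num l.length → (l ++ acc).Nodup →
      (∀ j ∈ acc, ∃ a < σ.next, rl' j = .ptr a ∧ σ.cell a 0 = .num (rk j) ∧
        σ.cell a 1 = rl j) →
      IsList σ.next σ.cell (recRow kv cp rl') acc (σ.reg (d + 12)) →
      WP W (whileNe d (d + 11)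
        (blk ([.load (d + 8) (d + 11) 0, .load (d + 9) (d + 11) 1, .load (d + 14) (d + 11) 3,
          .load (d + 15) (d + 11) 4, .load (d + 11) (d + 11) 2] ++
          (mk (d + 13) [(0, d + 20), (1, d + 15)] ++
          (mk (d + 16) [(0, d + 8), (1, d + 9), (2, d + 12), (3, d + 14), (4, d + 13)] ++
          [.move (d + 12) (d + 16), .sub (d + 20) (d + 20) (d + 5)]))))) σ (20 * l.length + 3)
        fun σ' => Grow (d + 7) (d + 21) σ σ' ∧
        ∃ rl', (∀ j ∈ l.reverse ++ acc, ∃ a < σ'.next, rl' j = .ptr a ∧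
          σ'.cell a 0 = .num (rk j) ∧ σ'.cell a 1 = rl j) ∧
        IsList σ'.next σ'.cell (recRow kv cp rl') (l.reverse ++ acc) (σ'.reg (d + 12)) := by
    intro l
    induction l with
    | nil =>
      intro acc σ rl' hc hl _ _ _ h hacc
      refine WP.while_nil hl hc.one hc.nil ⟨.of_set (by omega) (by omega), rl', ?_, ?_⟩
      · simpa [State.set] using h
      · simpa [State.set] using hacc
    | cons j l ih =>
      intro acc σ rl' hc hl hrk h20 hnd h hacc
      obtain ⟨a, ha, hv, ⟨r0, r1, r3, r4, -⟩, hl'⟩ := hl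
      have h1 := hc.one
      refine WP.le (T := 17 + (20 * l.length + 3) + 3) ?_ (by simp; omega)
      refine WP.while_ptr hW hv hc.one hc.nil (WP.le (WP.blk (is := _ ++ _) ?_) (by
        simp [length_mk]))
      rw [State.set, execL_append]
      simp (disch := omega) only [execL, Instr.exec, State.set, Function.update_self,
      Function.update_of_ne, if_pos, Option.bind_some, Option.some.injEq, exists_eq_left', if_true,
      row, hv, ha]
      rw [execL_mk_append (by simp)]
      simp (disch := omega) only [execL, Instr.exec, State.set, Function.update_self,
      Function.update_of_ne, if_pos, Option.bind_some, Option.some.injEq, exists_eq_left', if_true,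
      row]
      rw [execL_mk_append (by simp)]
      simp (disch := omega) only [execL, Instr.exec, State.set, Function.update_self,
      Function.update_of_ne, if_pos, Option.bind_some, Option.some.injEq, exists_eq_left', if_true,
      row, h20, h1]
      set σ₁ : State := ⟨_, _, _, σ.out⟩ with hσ₁
      have hg1 : Grow (d + 7) (d + 21) σ σ₁ := by
        refine ⟨(Nat.le_succ _).trans (Nat.le_succ _), fun b hb => ?_, rfl, fun r hr => ?_⟩
        · simp (disch := omega) only [hσ₁, Function.update_of_ne]
        · simp (disch := omega) only [hσ₁, Function.update_of_ne]
      -- Distinctness of the points allows `rl'` to be updated at `j` without spoiling what it says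
      -- about the records already treated.
      have hja : ∀ i ∈ acc, i ≠ j := by
        rintro i hi rfl
        simp at hnd
        exact hnd.1.2 hi
      refine (ih (j :: acc) σ₁ (Function.update rl' j (.ptr σ.next)) (hc.grow hg1 le_rfl) ?_ hrk.2
        ?_ ?_ ?_ ?_).conseq ?_
      · have := hl'.grow hg1
        simpa (disch := omega) only [Function.update_self, Function.update_of_ne, hσ₁] using this
      · simp (disch := omega) only [Function.update_self, Function.update_of_ne, hσ₁]; simp
      · exact (List.perm_middle.nodup_iff).2 hnd
      · intro i hi
        obtain rfl | hi := List.mem_cons.1 hi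
        · refine ⟨σ.next, by simp [hσ₁], by simp, ?_, ?_⟩
          · simp (disch := omega) only [Function.update_self, Function.update_of_ne, hσ₁]
            simp [hrk.1]
          · simp (disch := omega) only [Function.update_self, Function.update_of_ne, hσ₁]
            simp [r4, recRow]
        · obtain ⟨b, hb, e1, e2, e3⟩ := h i hi
          refine ⟨b, hb.trans_le hg1.next_le, by rw [Function.update_of_ne (hja i hi), e1], ?_, ?_⟩
          · rw [hg1.cell_eq b hb, e2]
          · rw [hg1.cell_eq b hb, e3]
      · refine ⟨σ.next + 1, by simp [hσ₁], ?_, ?_, ?_⟩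
        · simp (disch := omega) only [Function.update_self, Function.update_of_ne, hσ₁]
        · simp [hσ₁, recRow, r0, r1, r3, r4]
        · have h := hacc.congr (R' := recRow kv cp (Function.update rl' j (.ptr σ.next)))
            (fun i hi => by simp [recRow, Function.update_of_ne (hja i hi)])
          have := h.grow hg1
          simpa [hσ₁] using this
      · rintro σ₂ ⟨hg2, h⟩
        refine ⟨hg1.trans hg2, by simpa using h⟩
  refine WP.le (T := 2 + (20 * l.length + 3)) (WP.seq (WP.blk (is := [_]) ⟨_, rfl, ?_⟩)) (by omega)
  have hg0 : Grow (d + 7) (d + 21) σ (σ.set (d + 12) .nil) := .of_set (by omega) (by omega)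
  refine (key l [] _ rl (hc.grow hg0 le_rfl) ?_ hrk ?_ (by simpa using hnd) (by simp) ?_).conseq ?_
  · simpa [State.set] using hl
  · simpa [State.set] using h20
  · simp [State.set, IsList]
  · rintro σ₂ ⟨hg2, rl', h1, h2⟩
    exact ⟨hg0.trans hg2, rl', by simpa using h1, by simpa using h2⟩

/-! ### Search structures -/

/-- The cells `a 0, …, a m` form a linked list; the keys of those after the first are given
by `kv`. -/
def Level (N : ℕ) (h : ℕ → ℕ → Val) (kv : ℕ → Val) (m : ℕ) (a : ℕ → ℕ) : Prop :=
  ∀ i ≤ m, a i < N ∧ h (a i) 2 = (if i < m then .ptr (a (i + 1)) else .nil) ∧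
    (0 < i → h (a i) 1 = kv i)

/-- A list of `n + 1` cells with `k` levels above it,
    each of which has every other cell of the level
below. -/
def Skip (N : ℕ) (h : ℕ → ℕ → Val) (kv pay : ℕ → Val) (n : ℕ) : ℕ → (ℕ → ℕ) → Prop
  | 0, a => Level N h kv n a ∧ ∀ i ≤ n, h (a i) 4 = pay i ∧ h (a i) 5 = .nil
  | k + 1, a => Level N h (fun i => kv (i * 2 ^ (k + 1))) (n / 2 ^ (k + 1)) a ∧
      ∃ a', Skip N h kv pay n k a' ∧ ∀ i ≤ n / 2 ^ (k + 1), h (a i) 5 = .ptr (a' (2 * i))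

theorem Level.mono {N N' h h' kv m a} (H : Level N h kv m a) (hN : N ≤ N') (hh : Agree N h h') :
    Level N' h' kv m a := fun i hi => by
  obtain ⟨h1, h2, h3⟩ := H i hi
  rw [hh _ h1 2 (by omega), hh _ h1 1 (by omega)]
  exact ⟨h1.trans_le hN, h2, h3⟩

theorem Skip.level {N h kv pay n k a} (H : Skip N h kv pay n k a) :
    Level N h (fun i => kv (i * 2 ^ k)) (n / 2 ^ k) a := by
  cases k with
  | zero => simpa using H.1
  | succ k => exact H.1

theorem Skip.mono {N N' h h' kv pay n k} (hN : N ≤ N') (hh : Agree N h h') : ∀ {a},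
    Skip N h kv pay n k a → Skip N' h' kv pay n k a := by
  induction k with
  | zero =>
    intro a H
    refine ⟨H.1.mono hN hh, fun i hi => ?_⟩
    have := (H.1 i hi).1
    rw [hh _ this 4 (by omega), hh _ this 5 (by omega)]
    exact H.2 i hi
  | succ k ih =>
    rintro a ⟨h1, a', h2, h3⟩
    refine ⟨h1.mono hN hh, a', ih h2, fun i hi => ?_⟩
    rw [hh _ (h1 i hi).1 5 (by omega), h3 i hi]

/-- Make a level from every other cell of the level in `d + 10`, whose second cell is in
`d + 11`. -/
def levelP (d : ℕ) : Prog :=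
  .seq (blk (mk (d + 12) [(5, d + 10)] ++ [.move (d + 13) (d + 12)])) (whileNe d (d + 11)
    (.seq (blk [.load (d + 11) (d + 11) 2]) (.branch (.same (d + 11) (d + 6)) .skip
      (blk ([.load (d + 15) (d + 11) 1] ++ (mk (d + 14) [(1, d + 15), (5, d + 11)] ++
        [.store (d + 13) 2 (d + 14), .move (d + 13) (d + 14), .load (d + 11) (d + 11) 2]))))))

/-- The new cells have the consecutive addresses `b, b + 1, …`. The only destructive store links the
last of them to its successor, hence hits an address at least `b`, and the level below stays intact.
The number `t` bounds the iterations still to come. -/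
theorem levelP_loop {W d b m a kv} (hW : 1 ≤ W) : ∀ t j σ, m ≤ 2 * j + 2 * t → 2 * j ≤ m →
    Consts d σ → σ.next = b + j + 1 → σ.reg (d + 13) = .ptr (b + j) →
    σ.reg (d + 11) = (if 2 * j < m then .ptr (a (2 * j + 1)) else .nil) →
    Level b σ.cell kv m a →
    (∀ i ≤ j, σ.cell (b + i) 2 = (if i < j then .ptr (b + (i + 1)) else .nil) ∧
      (0 < i → σ.cell (b + i) 1 = kv (2 * i)) ∧ σ.cell (b + i) 5 = .ptr (a (2 * i))) →
    WP W (whileNe d (d + 11)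
    (.seq (blk [.load (d + 11) (d + 11) 2]) (.branch (.same (d + 11) (d + 6)) .skip
      (blk ([.load (d + 15) (d + 11) 1] ++ (mk (d + 14) [(1, d + 15), (5, d + 11)] ++
        [.store (d + 13) 2 (d + 14), .move (d + 13) (d + 14), .load (d + 11) (d + 11) 2]))))))
      σ (15 * t + 3) fun σ' => σ'.next = b + m / 2 + 1 ∧ σ'.out = σ.out ∧
        (∀ x < b, σ'.cell x = σ.cell x) ∧
        (∀ r, r < d + 7 ∨ d + 16 ≤ r ∨ r = d + 12 → σ'.reg r = σ.reg r) ∧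
        ∀ i ≤ m / 2, σ'.cell (b + i) 2 = (if i < m / 2 then .ptr (b + (i + 1)) else .nil) ∧
          (0 < i → σ'.cell (b + i) 1 = kv (2 * i)) ∧ σ'.cell (b + i) 5 = .ptr (a (2 * i)) := by
  have atEnd : ∀ j σ, m / 2 = j → Consts d σ → σ.next = b + j + 1 → σ.reg (d + 11) = .nil →
    (∀ i ≤ j, σ.cell (b + i) 2 = (if i < j then .ptr (b + (i + 1)) else .nil) ∧
      (0 < i → σ.cell (b + i) 1 = kv (2 * i)) ∧ σ.cell (b + i) 5 = .ptr (a (2 * i))) →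
      WP W (whileNe d (d + 11)
      (.seq (blk [.load (d + 11) (d + 11) 2]) (.branch (.same (d + 11) (d + 6)) .skip
        (blk ([.load (d + 15) (d + 11) 1] ++ (mk (d + 14) [(1, d + 15), (5, d + 11)] ++
        [.store (d + 13) 2 (d + 14), .move (d + 13) (d + 14), .load (d + 11) (d + 11) 2]))))))
      σ 3 fun σ' => σ'.next = b + m / 2 + 1 ∧ σ'.out = σ.out ∧
        (∀ x < b, σ'.cell x = σ.cell x) ∧
        (∀ r, r < d + 7 ∨ d + 16 ≤ r ∨ r = d + 12 → σ'.reg r = σ.reg r) ∧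
        ∀ i ≤ m / 2, σ'.cell (b + i) 2 = (if i < m / 2 then .ptr (b + (i + 1)) else .nil) ∧
          (0 < i → σ'.cell (b + i) 1 = kv (2 * i)) ∧ σ'.cell (b + i) 5 = .ptr (a (2 * i)) := by
    rintro j σ rfl hc hn h11 h
    refine WP.while_nil h11 hc.one hc.nil ⟨hn, rfl, fun _ _ => rfl, fun r hr => ?_, h⟩
    simp (disch := omega) only [State.set, Function.update_of_ne]
  intro t
  induction t with
  | zero =>
    intro j σ ht hj hc hn h13 h11 hl h
    exact atEnd j σ (by omega) hc hn (by rw [h11, if_neg (by omega)]) h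
  | succ t ih =>
    intro j σ ht hj hc hn h13 h11 hl h
    by_cases hjm : 2 * j < m
    swap
    · exact (atEnd j σ (by omega) hc hn (by rw [h11, if_neg hjm]) h).le (by omega)
    rw [if_pos hjm] at h11
    obtain ⟨q1, q2, q3⟩ := hl (2 * j + 1) (by omega)
    have q1' : a (2 * j + 1) < σ.next := by omega
    refine WP.le (T := (2 + 10) + (15 * t + 3) + 3) ?_ (by omega)
    refine WP.while_ptr hW h11 hc.one hc.nil (WP.seq (WP.blk (is := [_]) ?_))
    simp (disch := omega) only [execL, Instr.exec, State.set, Function.update_self,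
      Function.update_of_ne, if_pos, Option.bind_some, Option.some.injEq, exists_eq_left', if_true,
      row, h11, q1', q2]
    by_cases hjm2 : 2 * j + 1 < m
    · simp only [if_pos hjm2]
      refine WP.le (WP.branch (T := 9) (b := false) ?_ (by simp) fun _ => WP.le (WP.blk
        (is := _ ++ _) ?_) (by simp [length_mk])) le_rfl
      · simp [eval_same, Function.update_of_ne, hc.nil, sameVal]
      obtain ⟨s1, s2, s3⟩ := hl (2 * j + 1 + 1) (by omega)
      have s1' : a (2 * j + 1 + 1) < σ.next := by omega
      have s1'' : a (2 * j + 1 + 1) < σ.next + 1 := by omega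
      have hbj : b + j < σ.next + 1 := by omega
      rw [execL_append]
      simp (disch := omega) only [execL, Instr.exec, State.set, Function.update_self,
      Function.update_of_ne, if_pos, Option.bind_some, Option.some.injEq, exists_eq_left', if_true,
      row, s1']
      rw [execL_mk_append (by simp)]
      simp (disch := omega) only [execL, Instr.exec, State.set, Function.update_self,
      Function.update_of_ne, if_pos, Option.bind_some, Option.some.injEq, exists_eq_left', if_true,
      row, h13, s1'', hbj, s2]
      set σ₁ : State := ⟨_, _, _, σ.out⟩ with hσ₁
      have hr1 : ∀ r, r < d + 7 ∨ d + 16 ≤ r ∨ r = d + 12 → σ₁.reg r = σ.reg r := by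
        intro r hr; simp (disch := omega) only [hσ₁, Function.update_of_ne]
      have hc1 : ∀ x < b, σ₁.cell x = σ.cell x := by
        intro r hr; simp (disch := omega) only [hσ₁, Function.update_of_ne]
      have hl1 : Level b σ₁.cell kv m a := hl.mono le_rfl fun x hx f _ => by rw [hc1 x hx]
      refine (ih (j + 1) σ₁ (by omega) (by omega) ⟨?_, ?_, ?_⟩ ?_ ?_ ?_ hl1 ?_).mono le_rfl ?_
      · rw [hr1 _ (by omega), hc.zero]
      · rw [hr1 _ (by omega), hc.one]
      · rw [hr1 _ (by omega), hc.nil]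
      · simp only [hσ₁]; omega
      · simp (disch := omega) only [Function.update_self, Function.update_of_ne, hσ₁, hn]; rfl
      · simp (disch := omega) only [Function.update_self, Function.update_of_ne, hσ₁,
            show 2 * (j + 1) = 2 * j + 1 + 1 by ring]
      · intro i hi
        -- The cell just made, its predecessor whose link was just set, and the cells before.
        obtain rfl | rfl | hi' : i = j + 1 ∨ i = j ∨ i < j := by omega
        · have e : b + (j + 1) = σ.next := by omega
          rw [if_neg (by omega), e]
          refine ⟨?_, fun _ => ?_, ?_⟩
          · simp (disch := omega) only [Function.update_self, Function.update_of_ne, hσ₁]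
          · simp (disch := omega) only [Function.update_self, Function.update_of_ne, hσ₁]; exact s3 (by omega)
          · simp (disch := omega) only [Function.update_self, Function.update_of_ne, hσ₁,
                show 2 * (j + 1) = 2 * j + 1 + 1 by ring]
        · obtain ⟨u1, u2, u3⟩ := h i le_rfl
          rw [if_pos (by omega)]
          refine ⟨?_, fun hi => ?_, ?_⟩
          · simp (disch := omega) only [Function.update_self, Function.update_of_ne, hσ₁, hn]; rfl
          · simp (disch := omega) only [Function.update_self, Function.update_of_ne,
                hσ₁]; exact u2 hi
          · simp (disch := omega) only [Function.update_self, Function.update_of_ne, hσ₁]; exact u3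
        · obtain ⟨u1, u2, u3⟩ := h i hi'.le
          rw [if_pos hi'] at u1
          rw [if_pos (by omega)]
          refine ⟨?_, fun hi => ?_, ?_⟩
          · simp (disch := omega) only [Function.update_self, Function.update_of_ne, hσ₁]; exact u1
          · simp (disch := omega) only [Function.update_self, Function.update_of_ne,
                hσ₁]; exact u2 hi
          · simp (disch := omega) only [Function.update_self, Function.update_of_ne, hσ₁]; exact u3
      · rintro σ₂ ⟨e1, e2, e3, e4, e5⟩
        exact ⟨e1, e2, fun x hx => (e3 x hx).trans (hc1 x hx),
          fun r hr => (e4 r hr).trans (hr1 r hr), e5⟩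
    -- Here `m = 2 * j + 1`: the last cell of the lower level has an odd index and is not
    -- represented above.
    · simp only [if_neg hjm2]
      refine WP.branch (T := 9) (b := true) ?_ (fun _ =>
        WP.le (T := 1) (WP.skip ?_) (by omega)) (by simp)
      · simp [eval_same, Function.update_of_ne, hc.nil, sameVal]
      refine WP.mono (atEnd j _ (by omega) ⟨?_, ?_, ?_⟩ hn ?_ h) ?_ ?_
      · simp (disch := omega) only [Function.update_self, Function.update_of_ne, hc.zero]
      · simp (disch := omega) only [Function.update_self, Function.update_of_ne, hc.one]
      · simp (disch := omega) only [Function.update_self, Function.update_of_ne, hc.nil]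
      · simp (disch := omega) only [Function.update_self, Function.update_of_ne]
      · omega
      · rintro σ₂ ⟨e1, e2, e3, e4, e5⟩
        refine ⟨e1, e2, e3, fun r hr => (e4 r hr).trans ?_, e5⟩
        simp (disch := omega) only [Function.update_of_ne]

theorem levelP_spec {W d m a kv σ} (hW : 1 ≤ W) (hc : Consts d σ)
    (h10 : σ.reg (d + 10) = .ptr (a 0))
    (h11 : σ.reg (d + 11) = (if 0 < m then .ptr (a 1) else .nil))
    (hl : Level σ.next σ.cell kv m a) :
    WP W (levelP d) σ (15 * ((m + 1) / 2) + 7) fun σ' => Grow (d + 7) (d + 16) σ σ' ∧ ∃ a',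
      Level σ'.next σ'.cell (fun i => kv (2 * i)) (m / 2) a' ∧ σ'.reg (d + 12) = .ptr (a' 0) ∧
      ∀ i ≤ m / 2, σ'.cell (a' i) 5 = .ptr (a (2 * i)) := by
  refine WP.le (T := 4 + (15 * ((m + 1) / 2) + 3)) (WP.seq (WP.blk (is := _ ++ _) ?_)) (by omega)
  obtain ⟨reg, cell, next, out⟩ := σ
  rw [execL_mk_append (by simp)]
  simp (disch := omega) only [execL, Instr.exec, State.set, Function.update_self,
      Function.update_of_ne, if_pos, Option.bind_some, Option.some.injEq, exists_eq_left', if_true,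
      row]
  set σ₁ : State := ⟨_, _, next + 1, out⟩ with hσ₁
  have hg1 : Grow (d + 7) (d + 16) ⟨reg, cell, next, out⟩ σ₁ := by
    refine ⟨Nat.le_succ _, fun b hb => ?_, rfl, fun r hr => ?_⟩
    · dsimp only at hb
      simp (disch := omega) only [hσ₁, Function.update_of_ne]
    · simp (disch := omega) only [hσ₁, Function.update_of_ne]
  dsimp only at h10 h11
  refine (levelP_loop hW (b := next) (m := m) (a := a) (kv := kv) ((m + 1) / 2) 0 σ₁ (by omega)
    (by omega) (hc.grow hg1 le_rfl) rfl ?_ ?_ (hl.mono le_rfl hg1.agree) ?_).conseq ?_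
  · simp (disch := omega) only [Function.update_self, Function.update_of_ne, hσ₁]; simp
  · simp (disch := omega) only [Function.update_self, Function.update_of_ne, hσ₁]; simpa using h11
  · intro i hi
    obtain rfl : i = 0 := by omega
    simp [hσ₁, row, h10]
  · rintro σ₂ ⟨e1, e2, e3, e4, e5⟩
    have e12 : σ₂.reg (d + 12) = .ptr next := by
      rw [e4 _ (by omega)]; simp (disch := omega) only [Function.update_self, Function.update_of_ne, hσ₁]
    refine ⟨⟨?_, fun x hx => ?_, e2, fun r hr => ?_⟩, fun i => next + i, fun i hi => ?_, e12,
      fun i hi => (e5 i hi).2.2⟩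
    · rw [e1]; dsimp only; omega
    · rw [e3 x hx, hg1.cell_eq x hx]
    · rw [e4 r (by omega), hg1.reg_eq r hr]
    · obtain ⟨h1, h2, -⟩ := e5 i hi
      exact ⟨by dsimp only; omega, h1, h2⟩

/-- Make levels above the level in `d + 10` until a level has one cell; the result is in
register `d + 10`. -/
def skipP (d : ℕ) : Prog :=
  .seq (blk [.load (d + 11) (d + 10) 2]) (whileNe d (d + 11) (.seq (levelP d)
    (blk [.move (d + 10) (d + 12), .load (d + 11) (d + 10) 2])))

/-- Making a level is linear in the level below and the lengths halve, so the total is a geometric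
sum. The bound `n < 2 ^ K` says that the top level is a single cell, where a search can start
without choice; `2 ^ K ≤ 2 * n + 1` keeps the number of levels logarithmic. -/
theorem skipP_spec {W d n a kv pay σ} (hW : 1 ≤ W) (hc : Consts d σ)
    (h10 : σ.reg (d + 10) = .ptr (a 0)) (hs : Skip σ.next σ.cell kv pay n 0 a) :
    WP W (skipP d) σ (80 * n + 5) fun σ' => Grow (d + 7) (d + 16) σ σ' ∧ ∃ K a',
      Skip σ'.next σ'.cell kv pay n K a' ∧ σ'.reg (d + 10) = .ptr (a' 0) ∧ n < 2 ^ K ∧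
      2 ^ K ≤ 2 * n + 1 := by
  have key : ∀ e k a σ, n / 2 ^ k < 2 ^ e → 2 ^ k ≤ 2 * n + 1 → Consts d σ →
      σ.reg (d + 10) = .ptr (a 0) →
      σ.reg (d + 11) = (if 0 < n / 2 ^ k then .ptr (a 1) else .nil) →
      Skip σ.next σ.cell kv pay n k a → WP W (whileNe d (d + 11) (.seq (levelP d)
      (blk [.move (d + 10) (d + 12), .load (d + 11) (d + 10) 2]))) σ (80 * (n / 2 ^ k) + 3)
      fun σ' => Grow (d + 7) (d + 16) σ σ' ∧ ∃ K a',
      Skip σ'.next σ'.cell kv pay n K a' ∧ σ'.reg (d + 10) = .ptr (a' 0) ∧ n < 2 ^ K ∧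
      2 ^ K ≤ 2 * n + 1 := by
    have atEnd : ∀ k a σ, n / 2 ^ k = 0 → 2 ^ k ≤ 2 * n + 1 → Consts d σ →
      σ.reg (d + 10) = .ptr (a 0) →
      σ.reg (d + 11) = .nil →
      Skip σ.next σ.cell kv pay n k a → WP W (whileNe d (d + 11) (.seq (levelP d)
      (blk [.move (d + 10) (d + 12), .load (d + 11) (d + 10) 2]))) σ 3
      fun σ' => Grow (d + 7) (d + 16) σ σ' ∧ ∃ K a',
      Skip σ'.next σ'.cell kv pay n K a' ∧ σ'.reg (d + 10) = .ptr (a' 0) ∧ n < 2 ^ K ∧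
      2 ^ K ≤ 2 * n + 1 := by
      intro k a σ h hk hc h10 h11 hs
      refine WP.while_nil h11 hc.one hc.nil ⟨.of_set (by omega) (by omega), k, a, hs, ?_, ?_, hk⟩
      · simpa [State.set] using h10
      · exact (Nat.div_eq_zero_iff_lt (by positivity)).1 h
    intro e
    induction e with
    | zero =>
      intro k a σ h hk hc h10 h11 hs
      have h0 : n / 2 ^ k = 0 := by simpa using h
      exact (atEnd k a σ h0 hk hc h10 (by simpa [h0] using h11) hs).le (by omega)
    | succ e ih =>
      intro k a σ h hk hc h10 h11 hs
      obtain h0 | h0 := Nat.eq_zero_or_pos (n / 2 ^ k)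
      · exact (atEnd k a σ h0 hk hc h10 (by simpa [h0] using h11) hs).le (by omega)
      have h11' := h11
      rw [if_pos h0] at h11'
      have hdiv : n / 2 ^ (k + 1) = n / 2 ^ k / 2 := by rw [pow_succ, Nat.div_div_eq_div_mul]
      have hg0 : Grow (d + 7) (d + 16) σ (σ.set (d + 7) (.num 1)) := .of_set le_rfl (by omega)
      refine WP.le (T := ((15 * ((n / 2 ^ k + 1) / 2) + 7) + 3) + (80 * (n / 2 ^ (k + 1)) + 3) + 3)
        ?_ (by omega)
      refine WP.while_ptr hW h11' hc.one hc.nil (WP.seq ((levelP_spec hW (m := n / 2 ^ k) (a := a)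
        (kv := fun i => kv (i * 2 ^ k)) (hc.grow hg0 le_rfl) ?_ ?_ ?_).conseq ?_))
      · simpa [State.set] using h10
      · simpa [State.set] using h11
      · exact hs.level
      rintro σ₁ ⟨hg1, a', hl', h12, h5⟩
      obtain ⟨l1, l2, -⟩ := hl' 0 (by omega)
      refine WP.blk (is := [_, _]) ?_
      simp (disch := omega) only [execL, Instr.exec, State.set, Function.update_self,
      Function.update_of_ne, if_pos, Option.bind_some, Option.some.injEq, exists_eq_left', if_true,
      row, h12, l1, l2]
      set σ₂ : State := ⟨_, _, _, _⟩ with hσ₂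
      have hg2 : Grow (d + 7) (d + 16) σ₁ σ₂ := by
        refine ⟨le_rfl, fun b hb => rfl, rfl, fun r hr => ?_⟩
        simp (disch := omega) only [hσ₂, Function.update_of_ne]
      have hg : Grow (d + 7) (d + 16) σ σ₂ := (hg0.trans hg1).trans hg2
      refine (ih (k + 1) a' σ₂ ?_ ?_ (hc.grow hg le_rfl) ?_ ?_ ⟨?_, a, ?_, ?_⟩).conseq ?_
      · rw [pow_succ 2 e] at h; omega
      -- A level above level `k` is made only if that level has a second cell, that is, if `2 ^ k ≤
      -- n`.
      · have := Nat.div_mul_le_self n (2 ^ k)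
        have := Nat.le_mul_of_pos_left (2 ^ k) h0
        rw [pow_succ]; omega
      · simp (disch := omega) only [Function.update_self, Function.update_of_ne, hσ₂]
      · simp (disch := omega) only [Function.update_self, Function.update_of_ne, hσ₂, hdiv]
      · have e : (fun i => kv (i * 2 ^ (k + 1))) = fun i => kv (2 * i * 2 ^ k) := by
          funext i; congr 1; ring
        rw [e, hdiv]
        exact hl'
      · exact hs.mono hg.next_le hg.agree
      · rw [hdiv]; exact h5
      · rintro σ₃ ⟨hg3, h⟩
        exact ⟨hg.trans hg3, h⟩
  obtain ⟨l1, l2, -⟩ := hs.1 0 (by omega)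
  refine WP.le (T := 2 + (80 * (n / 2 ^ 0) + 3)) (WP.seq (WP.blk (is := [_]) ?_)) (by simp; omega)
  simp (disch := omega) only [execL, Instr.exec, State.set, Function.update_self,
      Function.update_of_ne, if_pos, Option.bind_some, Option.some.injEq, exists_eq_left', if_true,
      row, h10, l1, l2]
  have hg0 : Grow (d + 7) (d + 16) σ (σ.set (d + 11) (if 0 < n then .ptr (a 1) else .nil)) :=
    .of_set (by omega) (by omega)
  refine (key n 0 a _ ?_ (by simp) (hc.grow hg0 le_rfl) ?_ ?_ hs).conseq ?_
  · simpa using Nat.lt_two_pow_self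
  · simpa [State.set] using h10
  · simp [State.set]
  · rintro σ₃ ⟨hg3, h⟩
    exact ⟨hg0.trans hg3, h⟩

theorem WP.loop_false {W c p σ} {Q : State → Prop} (hc : c.eval σ = some false) (h : Q σ) :
    WP W (.loop c p) σ 1 Q := ⟨1, σ, le_rfl, .loop_false hc, h⟩

theorem WP.loop_true {W c p σ T T'} {Q : State → Prop} (hc : c.eval σ = some true)
    (h : WP W p σ T fun σ' => WP W (.loop c p) σ' T' Q) : WP W (.loop c p) σ (T + T' + 1) Q := by
  obtain ⟨t, σ₁, ht, hr, t', σ₂, ht', hr', hq⟩ := h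
  exact ⟨_, σ₂, by omega, .loop_true hc hr hr', hq⟩

/-! ### The structure for frequency queries -/

/-- The heaps `h` and `h'` agree on the cells in `V`, except for the fields from `8` on. -/
def AgreeOn (V : Set ℕ) (h h' : ℕ → ℕ → Val) : Prop := ∀ a ∈ V, ∀ f < 8, h' a f = h a f

/-- A linked list of pairs of a colour and a weight, with cells in `V`. -/
def IsWL (V : Set ℕ) (h : ℕ → ℕ → Val) (ca : ℕ → ℕ) : List (ℕ × ℕ) → Val → Prop
  | [], v => v = .nil
  | p :: l, v => ∃ a ∈ V, v = .ptr a ∧ h a 0 = .ptr (ca p.1) ∧ h a 1 = .num p.2 ∧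
      IsWL V h ca l (h a 2)

/-- The total weight of a colour. -/
def weight (l : List (ℕ × ℕ)) (c : ℕ) : ℕ := (l.map fun p => if p.1 = c then p.2 else 0).sum

/-- A list of weights that gives the frequencies of the colours in `A`; it is at most twice as long
as there are colours, and the credit tells how many more pairs it may take. -/
def IsVL (κ : ℕ) (V : Set ℕ) (h : ℕ → ℕ → Val) (ca col : ℕ → ℕ) (v : Val)
    (A : Multiset ℕ) (Φ : ℕ) : Prop :=
  ∃ a ∈ V, v = .ptr a ∧ ∃ l cr k, IsWL V h ca l (h a 0) ∧ h a 1 = .num cr ∧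
    (∀ c, weight l c = (A.map col).count c) ∧ (∀ p ∈ l, 0 < p.2) ∧ l.length + cr = 2 * k ∧
    cr ≤ k ∧ k ≤ (A.map col).toFinset.card ∧ Φ = κ * (k - cr)

/-- A part of a trie on the values of `rk`, with the levels `ls`. It stores the points in `B`, whose
values are considered relative to `o`. At the bottom of each block of levels there are structures
for the points that precede in the block; `A` is the set of those that precede the whole part. -/
def IsTrie (V : Set ℕ) (h : ℕ → ℕ → Val) (D : Val → Multiset ℕ → ℕ → Prop) (rk : ℕ → ℕ) :
    List (Option ℕ) → ℕ → Val → Multiset ℕ → Multiset ℕ → ℕ → Prop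
  | [], _, _, A, _, Φ => A = 0 ∧ Φ = 0
  | none :: ls, o, v, A, B, Φ => ∃ a ∈ V, v = .ptr a ∧ ∃ Φ₁ Φ₂, Φ = Φ₁ + Φ₂ ∧ D (h a 0) A Φ₁ ∧
      IsTrie V h D rk ls o (h a 1) 0 B Φ₂
  | some w :: ls, o, v, A, B, Φ => ∃ a ∈ V, v = .ptr a ∧ ∃ Φ₁ Φ₂, Φ = Φ₁ + Φ₂ ∧
      IsTrie V h D rk ls o (h a 0) A (B.filter fun j => rk j < o + w) Φ₁ ∧
      IsTrie V h D rk ls (o + w) (h a 1) (A + B.filter fun j => rk j < o + w)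
        (B.filter fun j => ¬ rk j < o + w) Φ₂

/-- The structure for `m` tries, nested into each other. -/
def IsDom (κ : ℕ) (V : Set ℕ) (h : ℕ → ℕ → Val) (ca col : ℕ → ℕ) (rk : ℕ → ℕ → ℕ)
    (ls : List (Option ℕ)) : ℕ → Val → Multiset ℕ → ℕ → Prop
  | 0 => IsVL κ V h ca col
  | m + 1 => fun v A Φ => IsTrie V h (IsDom κ V h ca col rk ls m) (rk m) ls 0 v 0 A Φ

/-- A linked list that describes the levels of a trie. -/
def IsLevels (N : ℕ) (h : ℕ → ℕ → Val) (S : Val → Prop) : List (Option ℕ) → Val → Prop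
  | [], v => v = .nil
  | none :: ls, v => ∃ a < N, v = .ptr a ∧ h a 2 = .num 1 ∧ S (h a 3) ∧ IsLevels N h S ls (h a 1)
  | some w :: ls, v => ∃ a < N, v = .ptr a ∧ h a 0 = .num w ∧ h a 2 = .num 0 ∧
      IsLevels N h S ls (h a 1)

/-- A description of the levels of `m` nested tries. -/
def IsDesc (N : ℕ) (h : ℕ → ℕ → Val) (ls : List (Option ℕ)) : ℕ → Val → Prop
  | 0, v => ∃ a < N, v = .ptr a ∧ h a 2 = .num 2
  | m + 1, v => IsLevels N h (IsDesc N h ls m) ls v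

/-! ### Monotonicity of the heap predicates -/

section mono

variable {V V' : Set ℕ} {N N' : ℕ} {h h' : ℕ → ℕ → Val}

theorem IsWL.mono {ca l v} (hN : V ⊆ V') (hh : AgreeOn V h h') (H : IsWL V h ca l v) :
    IsWL V' h' ca l v := by
  induction l generalizing v with
  | nil => exact H
  | cons p l ih =>
    obtain ⟨a, ha, hv, h0, h1, hl⟩ := H
    refine ⟨a, hN ha, hv, ?_, ?_, ?_⟩
    · rwa [hh a ha _ (by omega)]
    · rwa [hh a ha _ (by omega)]
    · rw [hh a ha _ (by omega)]; exact ih hl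

theorem IsVL.mono {κ ca col v A Φ} (hN : V ⊆ V') (hh : AgreeOn V h h')
    (H : IsVL κ V h ca col v A Φ) : IsVL κ V' h' ca col v A Φ := by
  obtain ⟨a, ha, hv, l, cr, k, hl, hcr, H⟩ := H
  refine ⟨a, hN ha, hv, l, cr, k, ?_, ?_, H⟩
  · rw [hh a ha _ (by omega)]; exact hl.mono hN hh
  · rwa [hh a ha _ (by omega)]

theorem IsTrie.mono {D D' : Val → Multiset ℕ → ℕ → Prop} {rk ls o v A B Φ} (hN : V ⊆ V')
    (hh : AgreeOn V h h') (hD : ∀ v A Φ, D v A Φ → D' v A Φ) (H : IsTrie V h D rk ls o v A B Φ) :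
    IsTrie V' h' D' rk ls o v A B Φ := by
  induction ls generalizing o v A B Φ with
  | nil => exact H
  | cons x ls ih =>
    cases x with
    | none =>
      obtain ⟨a, ha, hv, Φ₁, Φ₂, hΦ, h1, h2⟩ := H
      refine ⟨a, hN ha, hv, Φ₁, Φ₂, hΦ, ?_, ?_⟩
      · rw [hh a ha _ (by omega)]; exact hD _ _ _ h1
      · rw [hh a ha _ (by omega)]; exact ih h2
    | some w =>
      obtain ⟨a, ha, hv, Φ₁, Φ₂, hΦ, h1, h2⟩ := H
      refine ⟨a, hN ha, hv, Φ₁, Φ₂, hΦ, ?_, ?_⟩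
      · rw [hh a ha _ (by omega)]; exact ih h1
      · rw [hh a ha _ (by omega)]; exact ih h2

theorem IsDom.mono {κ ca col rk ls m} (hN : V ⊆ V') (hh : AgreeOn V h h') : ∀ v A Φ,
    IsDom κ V h ca col rk ls m v A Φ → IsDom κ V' h' ca col rk ls m v A Φ := by
  induction m with
  | zero => exact fun v A Φ H => IsVL.mono hN hh H
  | succ m ih => exact fun v A Φ H => IsTrie.mono hN hh ih H

theorem IsLevels.mono {S S' : Val → Prop} {ls v} (hN : N ≤ N') (hh : Agree N h h')
    (hS : ∀ v, S v → S' v) (H : IsLevels N h S ls v) : IsLevels N' h' S' ls v := by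
  induction ls generalizing v with
  | nil => exact H
  | cons x ls ih =>
    cases x with
    | none =>
      obtain ⟨a, ha, hv, h2, h3, hl⟩ := H
      refine ⟨a, ha.trans_le hN, hv, ?_, ?_, ?_⟩
      · rwa [hh a ha _ (by omega)]
      · rw [hh a ha _ (by omega)]; exact hS _ h3
      · rw [hh a ha _ (by omega)]; exact ih hl
    | some w =>
      obtain ⟨a, ha, hv, h0, h2, hl⟩ := H
      refine ⟨a, ha.trans_le hN, hv, ?_, ?_, ?_⟩
      · rwa [hh a ha _ (by omega)]
      · rwa [hh a ha _ (by omega)]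
      · rw [hh a ha _ (by omega)]; exact ih hl

theorem IsDesc.mono {ls m} (hN : N ≤ N') (hh : Agree N h h') : ∀ v,
    IsDesc N h ls m v → IsDesc N' h' ls m v := by
  induction m with
  | zero =>
    rintro v ⟨a, ha, hv, h2⟩
    exact ⟨a, ha.trans_le hN, hv, by rwa [hh a ha _ (by omega)]⟩
  | succ m ih => exact fun v H => IsLevels.mono hN hh ih H

end mono

/-! ### The levels and the empty structure -/

/-- The levels of a trie with `e` bits, in blocks of `⌊log₂ s⌋` bits, together with the number of
leaves of the topmost block as far as it is complete. -/
def levels (s : ℕ) : ℕ → ℕ × List (Option ℕ)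
  | 0 => (1, [])
  | e + 1 => (if 4 * (levels s e).1 ≤ s then 2 * (levels s e).1 else 1, some (2 ^ e) ::
      if (levels s e).1 ≤ 1 then none :: (levels s e).2 else (levels s e).2)

/-- The invariant that allows one more bit at any time: doubling the leaves of the current block
never exceeds `s`. -/
theorem levels_fst {s : ℕ} (hs : 2 ≤ s) (e : ℕ) : 1 ≤ (levels s e).1 ∧ 2 * (levels s e).1 ≤ s := by
  induction e with
  | zero => simp [levels, hs]
  | succ e ih => rw [levels]; dsimp only; split_ifs <;> omega

/-- Put a block leaf below the trie in `d + 15`. -/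
def leafP (d : ℕ) : Prog :=
  .branch (.le (d + 13) (d + 5)) (blk (mk (d + 17) [(1, d + 14), (2, d + 5), (3, d + 10)] ++
    (mk (d + 18) [(0, d + 11), (1, d + 15)] ++ [.move (d + 14) (d + 17),
      .move (d + 15) (d + 18)]))) .skip

/-- Put a further bit on top of the levels in `d + 14` and of the empty trie in `d + 15`. -/
def bitP (d : ℕ) : Prog :=
  .seq (leafP d) (.seq (blk (mk (d + 17) [(0, d + 12), (1, d + 14), (2, d + 4)] ++
    (mk (d + 18) [(0, d + 15), (1, d + 15)] ++ [.move (d + 14) (d + 17), .move (d + 15) (d + 18),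
      .add (d + 12) (d + 12) (d + 12), .add (d + 13) (d + 13) (d + 13),
      .add (d + 20) (d + 13) (d + 13)])))
    (.branch (.le (d + 20) (d + 3)) .skip (blk [.move (d + 13) (d + 5)])))

/-- Make the levels and the empty structure for one more trie. -/
def addTrieP (d : ℕ) : Prog :=
  .seq (blk [.clear (d + 14), .clear (d + 15), .move (d + 12) (d + 5), .move (d + 13) (d + 5),
    .add (d + 16) (d + 2) (d + 5)]) (.seq (.loop (.le (d + 12) (d + 16)) (bitP d))
    (blk [.move (d + 10) (d + 14), .move (d + 11) (d + 15)]))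

/-- Make the levels and the empty structure for `m` tries. -/
def emptyP (d : ℕ) : ℕ → Prog
  | 0 => blk ([.const (d + 19) 2] ++ (mk (d + 10) [(2, d + 19)] ++ mk (d + 11) [(1, d + 4)]))
  | m + 1 => .seq (emptyP d m) (addTrieP d)

/-- The registers `d + 14` and `d + 15` hold levels and an empty trie over the structures in
`d + 10` and `d + 11`. -/
structure EmptyTrie (κ d : ℕ) (ca col : ℕ → ℕ) (rk : ℕ → ℕ → ℕ) (ls' ls : List (Option ℕ)) (m : ℕ)
    (σ : State) : Prop where
  desc : IsDesc σ.next σ.cell ls' m (σ.reg (d + 10))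
  dom : IsDom κ (Set.Iio σ.next) σ.cell ca col rk ls' m (σ.reg (d + 11)) 0 0
  levels : IsLevels σ.next σ.cell (IsDesc σ.next σ.cell ls' m) ls (σ.reg (d + 14))
  trie : ∀ o, IsTrie (Set.Iio σ.next) σ.cell (IsDom κ (Set.Iio σ.next) σ.cell ca col rk ls' m) (rk m) ls o
    (σ.reg (d + 15)) 0 0 0

theorem leafP_spec {κ d ca col rk ls' ls m v σ W} (hc : Consts d σ)
    (h : EmptyTrie κ d ca col rk ls' ls m σ) (hv : σ.reg (d + 13) = .num v) :
    WP W (leafP d) σ 12 fun σ' => Grow (d + 7) (d + 21) σ σ' ∧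
      EmptyTrie κ d ca col rk ls' (if v ≤ 1 then none :: ls else ls) m σ' ∧
      σ'.reg (d + 12) = σ.reg (d + 12) ∧ σ'.reg (d + 13) = σ.reg (d + 13) ∧
      σ'.reg (d + 16) = σ.reg (d + 16) := by
  refine WP.le (T := 11 + 1) (WP.branch (b := decide (v ≤ 1)) ?_ (fun h1 => ?_) fun h1 => ?_) le_rfl
  · simp [eval_le, hv, hc.one, leVal]
  · rw [if_pos (by simpa using h1)]
    obtain ⟨reg, cell, next, out⟩ := σ
    refine WP.le (WP.blk (is := _ ++ _) ?_) (by simp [length_mk])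
    have h5 := hc.one
    dsimp only at h5
    rw [execL_mk_append (by simp)]
    simp (disch := omega) only [execL, Instr.exec, State.set, Function.update_self,
      Function.update_of_ne, if_pos, Option.bind_some, Option.some.injEq, exists_eq_left', if_true,
      row]
    rw [execL_mk_append (by simp)]
    simp (disch := omega) only [execL, Instr.exec, State.set, Function.update_self,
      Function.update_of_ne, if_pos, Option.bind_some, Option.some.injEq, exists_eq_left', if_true,
      row, h5]
    set σ₁ : State := ⟨_, _, next + 1 + 1, out⟩ with hσ₁
    have hg1 : Grow (d + 7) (d + 21) ⟨reg, cell, next, out⟩ σ₁ := by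
      refine ⟨show next ≤ next + 1 + 1 by omega, fun b hb => ?_, rfl, fun r hr => ?_⟩
      · dsimp only at hb
        simp (disch := omega) only [hσ₁, Function.update_of_ne]
      · simp (disch := omega) only [hσ₁, Function.update_of_ne]
    have q1 := h.desc.mono hg1.next_le hg1.agree
    have q2 := h.dom.mono (Set.Iio_subset_Iio hg1.next_le) hg1.agree
    have q3 := h.levels.mono hg1.next_le hg1.agree (fun v hv => hv.mono hg1.next_le hg1.agree)
    have q4 := fun o => (h.trie o).mono (Set.Iio_subset_Iio hg1.next_le) hg1.agree
      (fun v A Φ hv => hv.mono (Set.Iio_subset_Iio hg1.next_le) hg1.agree)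
    refine ⟨hg1, ⟨?_, ?_, ?_, fun o => ?_⟩, ?_, ?_, ?_⟩
    · simpa (disch := omega) only [Function.update_self, Function.update_of_ne, hσ₁] using q1
    · simpa (disch := omega) only [Function.update_self, Function.update_of_ne, hσ₁] using q2
    · refine ⟨next, by simp [hσ₁], ?_, ?_, ?_, ?_⟩
      · simp (disch := omega) only [Function.update_self, Function.update_of_ne, hσ₁]
      · simp (disch := omega) only [Function.update_self, Function.update_of_ne, hσ₁]
      · simpa (disch := omega) only [hσ₁, Function.update_self, Function.update_of_ne] using q1
      · simpa (disch := omega) only [hσ₁, Function.update_self, Function.update_of_ne] using q3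
    · refine ⟨next + 1, by simp [hσ₁], ?_, 0, 0, rfl, ?_, ?_⟩
      · simp (disch := omega) only [Function.update_self, Function.update_of_ne, hσ₁]
      · simpa (disch := omega) only [hσ₁, Function.update_self, Function.update_of_ne] using q2
      · simpa (disch := omega) only [hσ₁, Function.update_self, Function.update_of_ne] using q4 o
    · simp (disch := omega) only [Function.update_self, Function.update_of_ne, hσ₁]
    · simp (disch := omega) only [Function.update_self, Function.update_of_ne, hσ₁]
    · simp (disch := omega) only [Function.update_self, Function.update_of_ne, hσ₁]
  · rw [if_neg (by simpa using h1)]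
    exact WP.le (WP.skip ⟨.refl .., h, rfl, rfl, rfl⟩) (by omega)

/-- Both children of an empty node are the same cell. This is why `EmptyTrie` quantifies over all
offsets `o`: an empty subtrie can stand at any position. The empty structure thus has only
logarithmic size, and path copying makes the sharing harmless. -/
theorem bitP_spec {κ d ca col rk ls' ls m e v s n σ W} (hc : Consts d σ)
    (h : EmptyTrie κ d ca col rk ls' ls m σ) (hv : σ.reg (d + 13) = .num v)
    (hw : σ.reg (d + 12) = .num (2 ^ e)) (hs : σ.reg (d + 3) = .num s) (hsn : s ≤ n)
    (hvs : 2 * v ≤ s) (hW : 2 * n + 2 ≤ W) (hwn : 2 ^ e ≤ n + 1) :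
    WP W (bitP d) σ 30 fun σ' => Grow (d + 7) (d + 21) σ σ' ∧
      EmptyTrie κ d ca col rk ls' (some (2 ^ e) :: if v ≤ 1 then none :: ls else ls) m σ' ∧
      σ'.reg (d + 12) = .num (2 ^ (e + 1)) ∧
      σ'.reg (d + 13) = .num (if 4 * v ≤ s then 2 * v else 1) ∧
      σ'.reg (d + 16) = σ.reg (d + 16) := by
  refine WP.le (T := 12 + (14 + 4)) (WP.seq ((leafP_spec hc h hv).conseq ?_)) (by omega)
  rintro σ₁ ⟨hg1, h1, e12, e13, e16⟩
  rw [hw] at e12; rw [hv] at e13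
  generalize (if v ≤ 1 then none :: ls else ls) = ls₁ at h1 ⊢
  refine WP.seq (WP.le (WP.blk (is := _ ++ _) ?_) (by simp [length_mk]))
  have hc1 := hc.grow hg1 le_rfl
  have h3 : σ₁.reg (d + 3) = .num s := by rw [hg1.reg_eq _ (by omega), hs]
  have h4 := hc1.zero
  have h5 := hc1.one
  obtain ⟨reg, cell, next, out⟩ := σ₁
  dsimp only at e12 e13 e16 h3 h4 h5
  have hb1 : 2 ^ e + 2 ^ e ≤ W := by omega
  have hb2 : v + v ≤ W := by omega
  have hb3 : v + v + (v + v) ≤ W := by omega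
  rw [execL_mk_append (by simp)]
  simp (disch := omega) only [execL, Instr.exec, State.set, Function.update_self,
      Function.update_of_ne, if_pos, Option.bind_some, Option.some.injEq, exists_eq_left', if_true,
      row]
  rw [execL_mk_append (by simp)]
  simp (disch := omega) only [execL, Instr.exec, State.set, Function.update_self,
      Function.update_of_ne, if_pos, Option.bind_some, Option.some.injEq, exists_eq_left', if_true,
      row, e12, e13, h4, hb1, hb2, hb3]
  set σ₂ : State := ⟨_, _, next + 1 + 1, out⟩ with hσ₂
  have hg2 : Grow (d + 7) (d + 21) ⟨reg, cell, next, out⟩ σ₂ := by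
    refine ⟨(Nat.le_succ _).trans (Nat.le_succ _), fun b hb => ?_, rfl, fun r hr => ?_⟩
    · dsimp only at hb
      simp (disch := omega) only [hσ₂, Function.update_of_ne]
    · simp (disch := omega) only [hσ₂, Function.update_of_ne]
  have q1 := h1.desc.mono hg2.next_le hg2.agree
  have q2 := h1.dom.mono (Set.Iio_subset_Iio hg2.next_le) hg2.agree
  have q3 := h1.levels.mono hg2.next_le hg2.agree (fun v hv => hv.mono hg2.next_le hg2.agree)
  have q4 := fun o => (h1.trie o).mono (Set.Iio_subset_Iio hg2.next_le) hg2.agree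
    (fun v A Φ hv => hv.mono (Set.Iio_subset_Iio hg2.next_le) hg2.agree)
  dsimp only at q1 q2 q3 q4
  have h2 : EmptyTrie κ d ca col rk ls' (some (2 ^ e) :: ls₁) m σ₂ := by
    refine ⟨?_, ?_, ?_, fun o => ?_⟩
    · simpa (disch := omega) only [Function.update_self, Function.update_of_ne, hσ₂] using q1
    · simpa (disch := omega) only [Function.update_self, Function.update_of_ne, hσ₂] using q2
    · refine ⟨next, by simp [hσ₂], ?_, ?_, ?_, ?_⟩
      · simp (disch := omega) only [Function.update_self, Function.update_of_ne, hσ₂]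
      · simp (disch := omega) only [Function.update_self, Function.update_of_ne, hσ₂]
      · simp (disch := omega) only [Function.update_self, Function.update_of_ne, hσ₂]
      · simpa (disch := omega) only [hσ₂, Function.update_self, Function.update_of_ne] using q3
    · refine ⟨next + 1, by simp [hσ₂], ?_, 0, 0, rfl, ?_, ?_⟩
      · simp (disch := omega) only [Function.update_self, Function.update_of_ne, hσ₂]
      · simpa (disch := omega) only [hσ₂, Function.update_self, Function.update_of_ne,
          Multiset.filter_zero, add_zero] using q4 o
      · simpa (disch := omega) only [hσ₂, Function.update_self, Function.update_of_ne,
          Multiset.filter_zero, add_zero] using q4 (o + 2 ^ e)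
  have hgt := hg1.trans hg2
  refine WP.le (T := 3 + 1) (WP.branch (b := decide (4 * v ≤ s)) ?_ (fun h => ?_) fun h => ?_) le_rfl
  · rw [eval_le]
    simp (disch := omega) only [Function.update_self, Function.update_of_ne, hσ₂, h3, leVal]
    congr 2
    exact propext ⟨fun h => by omega, fun h => by omega⟩
  · refine WP.le (WP.skip ⟨hgt, h2, ?_, ?_, ?_⟩) (by omega)
    · simp (disch := omega) only [Function.update_self, Function.update_of_ne, hσ₂]
      rw [pow_succ, mul_two]
    · simp (disch := omega) only [Function.update_self, Function.update_of_ne, hσ₂]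
      rw [if_pos (by simpa using h), two_mul]
    · simp (disch := omega) only [Function.update_self, Function.update_of_ne, hσ₂]; exact e16
  · refine WP.le (WP.blk (is := [_]) ⟨_, rfl, hgt.trans (.of_set (by omega) (by omega)),
      ⟨?_, ?_, ?_, fun o => ?_⟩, ?_, ?_, ?_⟩) (by simp)
    · simpa [State.set] using h2.desc
    · simpa [State.set] using h2.dom
    · simpa [State.set] using h2.levels
    · simpa [State.set] using h2.trie o
    · simp (disch := omega) only [hσ₂, State.set, Function.update_self, Function.update_of_ne]
      rw [pow_succ, mul_two]
    · simp (disch := omega) only [hσ₂, State.set, Function.update_self, Function.update_of_ne, h5]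
      rw [if_neg (by simpa using h)]
    · simp (disch := omega) only [hσ₂, State.set, Function.update_self, Function.update_of_ne]
      exact e16

/-- The levels of tries for `n` points. -/
def trieLevels (s n : ℕ) : List (Option ℕ) := (levels s (Nat.log 2 (n + 1) + 1)).2

/-- The loop adds bits while `2 ^ e ≤ n + 1`, that is, `Nat.log 2 (n + 1) + 1` times, and so arrives
exactly at `trieLevels`. The resulting trie has room for every query bound, which can be as large as
`n + 1`. -/
theorem addTrieP_spec {κ d ca col rk m s n σ W} (hc : Consts d σ)
    (h1 : IsDesc σ.next σ.cell (trieLevels s n) m (σ.reg (d + 10)))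
    (h2 : IsDom κ (Set.Iio σ.next) σ.cell ca col rk (trieLevels s n) m (σ.reg (d + 11)) 0 0)
    (hn : σ.reg (d + 2) = .num n) (hs : σ.reg (d + 3) = .num s) (hs2 : 2 ≤ s) (hsn : s ≤ n)
    (hW : 2 * n + 2 ≤ W) :
    WP W (addTrieP d) σ (31 * (Nat.log 2 (n + 1) + 1) + 10) fun σ' =>
      Grow (d + 7) (d + 21) σ σ' ∧
      IsDesc σ'.next σ'.cell (trieLevels s n) (m + 1) (σ'.reg (d + 10)) ∧
      IsDom κ (Set.Iio σ'.next) σ'.cell ca col rk (trieLevels s n) (m + 1) (σ'.reg (d + 11)) 0 0 := by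
  have key : ∀ k e σ, e + k = Nat.log 2 (n + 1) + 1 → Consts d σ →
      EmptyTrie κ d ca col rk (trieLevels s n) (levels s e).2 m σ →
      σ.reg (d + 12) = .num (2 ^ e) → σ.reg (d + 13) = .num (levels s e).1 →
      σ.reg (d + 16) = .num (n + 1) → σ.reg (d + 3) = .num s →
      WP W (.loop (.le (d + 12) (d + 16)) (bitP d)) σ (31 * k + 1) fun σ' =>
        Grow (d + 7) (d + 21) σ σ' ∧
        EmptyTrie κ d ca col rk (trieLevels s n) (trieLevels s n) m σ' := by
    intro k
    induction k with
    | zero =>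
      intro e σ he hc h h12 h13 h16 h3
      obtain rfl : e = Nat.log 2 (n + 1) + 1 := by omega
      refine WP.loop_false ?_ ⟨.refl .., h⟩
      have := Nat.lt_pow_succ_log_self (b := 2) (by omega) (n + 1)
      simp only [eval_le, h12, h16, leVal]
      simpa using this
    | succ k ih =>
      intro e σ he hc h h12 h13 h16 h3
      have : 2 ^ e ≤ n + 1 := (Nat.pow_le_pow_right (by omega) (by omega)).trans
        (Nat.pow_log_le_self 2 (by omega))
      refine WP.le (T := 30 + (31 * k + 1) + 1) (WP.loop_true ?_ ((bitP_spec hc h h13 h12 h3 hsn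
        (levels_fst hs2 e).2 hW this).conseq ?_)) (by omega)
      · simp only [eval_le, h12, h16, leVal]
        simpa using this
      · rintro σ₁ ⟨hg1, e1, e2, e3, e4⟩
        refine (ih (e + 1) σ₁ (by omega) (hc.grow hg1 le_rfl) e1 e2 e3 (by rw [e4, h16]) ?_).conseq
          fun σ₂ ⟨hg2, h⟩ => ⟨hg1.trans hg2, h⟩
        rw [hg1.reg_eq _ (by omega), h3]
  refine WP.le (T := 6 + ((31 * (Nat.log 2 (n + 1) + 1) + 1) + 3)) (WP.seq (WP.blk
    (is := [_, _, _, _, _]) ?_)) (by omega)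
  have h5 := hc.one
  have hb : n + 1 ≤ W := by omega
  simp (disch := omega) only [execL, Instr.exec, State.set, Function.update_self,
      Function.update_of_ne, if_pos, Option.bind_some, Option.some.injEq, exists_eq_left', if_true,
      row, h5, hn, hb]
  set σ₁ : State := ⟨_, _, _, _⟩ with hσ₁
  have hg1 : Grow (d + 7) (d + 21) σ σ₁ := by
    refine ⟨le_rfl, fun b hb => rfl, rfl, fun r hr => ?_⟩
    simp (disch := omega) only [hσ₁, Function.update_of_ne]
  refine WP.seq ((key _ 0 σ₁ (by omega) (hc.grow hg1 le_rfl) ⟨?_, ?_, ?_, fun o => ?_⟩ ?_ ?_ ?_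
    ?_).conseq ?_)
  · simpa (disch := omega) only [Function.update_self, Function.update_of_ne, hσ₁] using h1
  · simpa (disch := omega) only [Function.update_self, Function.update_of_ne, hσ₁] using h2
  · simp (disch := omega) only [hσ₁, Function.update_self, Function.update_of_ne, levels, IsLevels]
  · simp [levels, IsTrie]
  · simp (disch := omega) only [Function.update_self, Function.update_of_ne, hσ₁]; rfl
  · simp (disch := omega) only [Function.update_self, Function.update_of_ne, hσ₁]; rfl
  · simp (disch := omega) only [Function.update_self, Function.update_of_ne, hσ₁]
  · simp (disch := omega) only [Function.update_self, Function.update_of_ne, hσ₁]; exact hs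
  rintro σ₂ ⟨hg2, h⟩
  refine WP.blk (is := [_, _]) ⟨_, rfl, (hg1.trans hg2).trans
    ((Grow.of_set (by omega) (by omega)).trans (.of_set (by omega) (by omega))), ?_, ?_⟩
  · simpa [State.set, IsDesc] using h.levels
  · simpa [State.set, IsDom] using h.trie 0

theorem emptyP_spec {κ d ca col rk s n W} (hs2 : 2 ≤ s) (hsn : s ≤ n) (hW : 2 * n + 2 ≤ W) (m : ℕ) :
    ∀ {σ}, Consts d σ → σ.reg (d + 2) = .num n → σ.reg (d + 3) = .num s →
    WP W (emptyP d m) σ ((31 * (Nat.log 2 (n + 1) + 1) + 10) * m + 7) fun σ' =>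
      Grow (d + 7) (d + 21) σ σ' ∧
      IsDesc σ'.next σ'.cell (trieLevels s n) m (σ'.reg (d + 10)) ∧
      IsDom κ (Set.Iio σ'.next) σ'.cell ca col rk (trieLevels s n) m (σ'.reg (d + 11)) 0 0 := by
  induction m with
  | zero =>
    intro σ hc hn hs
    obtain ⟨reg, cell, next, out⟩ := σ
    refine WP.le (WP.blk (is := _ ++ _) ?_) (by simp [length_mk])
    have hb : 2 ≤ W := by omega
    have h4 := hc.zero
    dsimp only at h4
    rw [execL_append]
    simp (disch := omega) only [execL, Instr.exec, State.set, Function.update_self,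
      Function.update_of_ne, if_pos, Option.bind_some, Option.some.injEq, exists_eq_left', if_true,
      row, hb]
    rw [execL_mk_append (by simp)]
    simp (disch := omega) only [execL, Instr.exec, State.set, Function.update_self,
      Function.update_of_ne, if_pos, Option.bind_some, Option.some.injEq, exists_eq_left', if_true,
      row]
    rw [execL_mk (by simp)]
    simp (disch := omega) only [execL, Instr.exec, State.set, Function.update_self,
      Function.update_of_ne, if_pos, Option.bind_some, Option.some.injEq, exists_eq_left', if_true,
      row, h4]
    -- The empty list of weights has credit `0` and `k = 0`; its first insertion therefore compacts
    -- at once, at constant cost.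
    refine ⟨⟨(Nat.le_succ _).trans (Nat.le_succ _), fun b hb => ?_, rfl, fun r hr => ?_⟩,
      ⟨next, by simp, ?_, ?_⟩, next + 1, by simp, ?_, [], 0, 0, ?_, ?_, ?_⟩
    · dsimp only at hb
      simp (disch := omega) only [Function.update_of_ne]
    · simp (disch := omega) only [Function.update_of_ne]
    · simp (disch := omega) only [Function.update_self, Function.update_of_ne]
    · simp (disch := omega) only [Function.update_self, Function.update_of_ne]
    · simp (disch := omega) only [Function.update_self, Function.update_of_ne]
    · simp (disch := omega) only [Function.update_self, Function.update_of_ne, IsWL]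
    · simp (disch := omega) only [Function.update_self, Function.update_of_ne]
    · simp [weight]
  | succ m ih =>
    intro σ hc hn hs
    refine WP.le (T := ((31 * (Nat.log 2 (n + 1) + 1) + 10) * m + 7) +
      (31 * (Nat.log 2 (n + 1) + 1) + 10)) (WP.seq ((ih hc hn hs).conseq ?_)) (le_of_eq
        (by ring))
    rintro σ₁ ⟨hg1, h1, h2⟩
    refine (addTrieP_spec (hc.grow hg1 le_rfl) h1 h2 ?_ ?_ hs2 hsn hW).conseq
      fun σ₂ ⟨hg2, h⟩ => ⟨hg1.trans hg2, h⟩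
    · rw [hg1.reg_eq _ (by omega), hn]
    · rw [hg1.reg_eq _ (by omega), hs]

/-! ### Updates of cells that were allocated before -/

/-- `σ'` arises from `σ` by allocating and filling new cells, by changing cells in `X`, the
fields from `8` on, and registers with numbers between `lo` and `hi`. -/
structure Upd (lo hi : ℕ) (X : Set ℕ) (σ σ' : State) : Prop where
  next_le : σ.next ≤ σ'.next
  cell_eq : ∀ a < σ.next, a ∉ X → ∀ f < 8, σ'.cell a f = σ.cell a f
  out_eq : σ'.out = σ.out
  reg_eq : ∀ r, r < lo ∨ hi ≤ r → σ'.reg r = σ.reg r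

/-- Cells changed by the second update need to be accounted for only if they existed at the
beginning; changes to cells allocated in between are invisible. -/
theorem Upd.trans {lo hi X Y σ σ' σ''} (h : Upd lo hi X σ σ') (h' : Upd lo hi Y σ' σ'')
    (hY : ∀ a ∈ Y, a < σ.next → a ∈ X) : Upd lo hi X σ σ'' :=
  ⟨h.next_le.trans h'.next_le,
    fun a ha hX f hf => (h'.cell_eq a (ha.trans_le h.next_le) (fun h => hX (hY a h ha)) f hf).trans
      (h.cell_eq a ha hX f hf),
    h'.out_eq.trans h.out_eq, fun r hr => (h'.reg_eq r hr).trans (h.reg_eq r hr)⟩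

theorem Upd.of_set {lo hi X σ r v} (h1 : lo ≤ r) (h2 : r < hi) : Upd lo hi X σ (σ.set r v) :=
  ⟨le_rfl, fun _ _ _ _ _ => rfl, rfl, fun q hq => Function.update_of_ne (by omega) ..⟩

theorem Upd.mono {lo hi lo' hi' X Y σ σ'} (h : Upd lo hi X σ σ') (hl : lo' ≤ lo) (hh : hi ≤ hi')
    (hX : X ⊆ Y) : Upd lo' hi' Y σ σ' :=
  ⟨h.next_le, fun a ha haX => h.cell_eq a ha fun h => haX (hX h), h.out_eq,
    fun r hr => h.reg_eq r (by omega)⟩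

theorem Upd.agree {lo hi X σ σ' N} (h : Upd lo hi X σ σ') (hN : N ≤ σ.next)
    (hX : ∀ a ∈ X, N ≤ a) : Agree N σ.cell σ'.cell :=
  fun a ha f hf => h.cell_eq a (by omega) (fun h => absurd (hX a h) (by omega)) f hf

theorem Consts.upd {d lo hi X σ σ'} (h : Consts d σ) (hg : Upd lo hi X σ σ') (hl : d + 7 ≤ lo) :
    Consts d σ' :=
  ⟨(hg.reg_eq _ (by omega)).trans h.zero, (hg.reg_eq _ (by omega)).trans h.one,
    (hg.reg_eq _ (by omega)).trans h.nil⟩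

/-! ### Counting colours -/

/-- The cells of the colours in `S` have distinct addresses, given by `ca`. -/
structure ColorBase (N : ℕ) (h : ℕ → ℕ → Val) (ca : ℕ → ℕ) (S : Set ℕ) : Prop where
  lt : ∀ c ∈ S, ca c < N
  color : ∀ c ∈ S, h (ca c) 0 = .num c
  inj : Set.InjOn ca S

theorem ColorBase.mono {N N' h h' ca S} (H : ColorBase N h ca S) (hN : N ≤ N')
    (hh : Agree N h h') : ColorBase N' h' ca S :=
  ⟨fun c hc => (H.lt c hc).trans_le hN,
    fun c hc => by rw [hh _ (H.lt c hc) _ (by omega)]; exact H.color c hc, H.inj⟩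

/-- A linked list of the cells of colours. -/
def IsChain (h : ℕ → ℕ → Val) (ca : ℕ → ℕ) : List ℕ → Val → Prop
  | [], v => v = .nil
  | c :: l, v => v = .ptr (ca c) ∧ IsChain h ca l (h (ca c) 9)

/-- The counters of the colours in `S` are given by `F`; those that are not zero are in a linked
list. -/
structure Counters (h : ℕ → ℕ → Val) (ca : ℕ → ℕ) (S : Set ℕ) (F : ℕ → ℕ) (l : List ℕ) (v : Val) :
    Prop where
  count : ∀ c ∈ S, h (ca c) 8 = .num (F c)
  nodup : l.Nodup
  mem_iff : ∀ c, c ∈ l ↔ c ∈ S ∧ 0 < F c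
  chain : IsChain h ca l v

theorem IsChain.congr {h h' ca l v} (H : IsChain h ca l v)
    (hh : ∀ c ∈ l, h' (ca c) 9 = h (ca c) 9) : IsChain h' ca l v := by
  induction l generalizing v with
  | nil => exact H
  | cons c l ih =>
    refine ⟨H.1, ?_⟩
    rw [hh c (by simp)]
    exact ih H.2 fun e he => hh e (by simp [he])

/-- Add the weights of the list in register `d + 31` to the counters. -/
def accP (d : ℕ) : Prog :=
  whileNe d (d + 31) (.seq (blk [.load (d + 32) (d + 31) 0, .load (d + 33) (d + 31) 1,
    .load (d + 34) (d + 32) 8, .load (d + 31) (d + 31) 2]) (.seq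
    (.branch (.le (d + 34) (d + 4)) (blk [.store (d + 32) 9 (d + 30),
        .move (d + 30) (d + 32)]) .skip)
    (blk [.add (d + 34) (d + 34) (d + 33), .store (d + 32) 8 (d + 34)])))

/-- A colour enters the chain exactly when its counter leaves `0`, which keeps the chain free of
repetitions. The cost depends on the length of the list alone, not on the number of colours already
counted. -/
theorem accP_spec {W d ca S l} (hW : 1 ≤ W) : ∀ {V N F T σ}, (∀ a ∈ V,
    a < σ.next) → Consts d σ → N ≤ σ.next →
    ColorBase N σ.cell ca S → IsWL V σ.cell ca l (σ.reg (d + 31)) →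
    Counters σ.cell ca S F T (σ.reg (d + 30)) → (∀ p ∈ l, p.1 ∈ S ∧ 0 < p.2) →
    (∀ c, F c + weight l c ≤ W) →
    WP W (accP d) σ (15 * l.length + 3) fun σ' => Upd (d + 7) (d + 35) ∅ σ σ' ∧
      σ'.next = σ.next ∧
      ∃ T', Counters σ'.cell ca S (fun c => F c + weight l c) T' (σ'.reg (d + 30)) := by
  induction l with
  | nil =>
    intro V N F T σ hV hc hN hb hl hT _ _
    refine WP.while_nil hl hc.one hc.nil ⟨.of_set (by omega) (by omega), rfl, T, ?_⟩
    simpa [State.set, weight] using hT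
  | cons p l ih =>
    intro V N F T σ hV hc hN hb hl hT hp hF
    obtain ⟨a, ha, hv, h0, h1, hl⟩ := hl
    have hS := (hp p (by simp)).1
    have hcl := hb.lt _ hS
    have hcl' : ca p.1 < σ.next := by omega
    have ha' : a < σ.next := hV a ha
    have h8 := hT.count _ hS
    have h4 := hc.zero
    refine WP.le (T := (5 + (4 + 3)) + (15 * l.length + 3) + 3) (WP.while_ptr hW hv hc.one hc.nil
      (WP.seq (WP.blk (is := [_, _, _, _]) ?_))) (by simp; omega)
    simp (disch := omega) only [execL, Instr.exec, State.set, Function.update_self,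
      Function.update_of_ne, if_pos, Option.bind_some, Option.some.injEq, exists_eq_left', if_true,
      row, hv, ha', h0, h1, hcl', h8]
    have hFp : F p.1 + p.2 ≤ W := by
      have := hF p.1
      simp [weight] at this
      omega
    have hne : ∀ e ∈ S, e ≠ p.1 → ca e ≠ ca p.1 := fun e he h h' => h (hb.inj he hS h')
    have hF' : ∀ c, Function.update F p.1 (F p.1 + p.2) c + weight l c = F c + weight (p :: l) c := by
      intro c
      by_cases h : c = p.1
      · subst h; simp [weight]; omega
      · simp [weight, Function.update_of_ne h, Ne.symm h]
    -- the state after the test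
    suffices H : ∀ σ₂ : State, Upd (d + 7) (d + 35) ∅ σ σ₂ → σ₂.next = σ.next →
        σ₂.reg (d + 34) = .num (F p.1) → σ₂.reg (d + 33) = .num p.2 →
        σ₂.reg (d + 32) = .ptr (ca p.1) → σ₂.reg (d + 31) = σ.cell a 2 →
        (∃ T', T'.Nodup ∧ (∀ c, c ∈ T' ↔ c ∈ S ∧ (c = p.1 ∨ 0 < F c)) ∧
          IsChain σ₂.cell ca T' (σ₂.reg (d + 30))) → (∀ c ∈ S, σ₂.cell (ca c) 8 = .num (F c)) →
        WP W (blk [.add (d + 34) (d + 34) (d + 33), .store (d + 32) 8 (d + 34)]) σ₂ 3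
          fun σ' => WP W (accP d) σ' (15 * l.length + 3) fun σ' => Upd (d + 7) (d + 35) ∅ σ σ' ∧
            σ'.next = σ.next ∧ ∃ T', Counters σ'.cell ca S (fun c => F c + weight (p :: l) c) T'
              (σ'.reg (d + 30)) by
      refine WP.seq (WP.branch (T := 3) (b := decide (F p.1 = 0)) ?_ (fun h => ?_) fun h => ?_)
      · rw [eval_le]; simp (disch := omega) only [Function.update_self, Function.update_of_ne, h4,
            leVal, Nat.le_zero]
      · have hF0 : F p.1 = 0 := by simpa using h
        refine WP.blk (is := [_, _]) ?_
        simp (disch := omega) only [execL, Instr.exec, State.set, Function.update_self,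
      Function.update_of_ne, if_pos, Option.bind_some, Option.some.injEq, exists_eq_left', if_true,
      row, hcl']
        refine H _ ⟨le_rfl, fun b hb _ f hf => ?_, rfl, fun r hr => ?_⟩ rfl ?_ ?_ ?_ ?_
          ⟨p.1 :: T, ?_, fun c => ?_, ?_⟩ fun c hc => ?_
        · dsimp only
          by_cases h : b = ca p.1
          · subst h; simp (disch := omega) only [Function.update_self, Function.update_of_ne]
          · simp (disch := omega) only [Function.update_self, Function.update_of_ne]
        · simp (disch := omega) only [Function.update_self, Function.update_of_ne]
        · simp (disch := omega) only [Function.update_self, Function.update_of_ne]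
        · simp (disch := omega) only [Function.update_self, Function.update_of_ne]
        · simp (disch := omega) only [Function.update_self, Function.update_of_ne]
        · simp (disch := omega) only [Function.update_self, Function.update_of_ne]
        · refine List.nodup_cons.2 ⟨fun h => ?_, hT.nodup⟩
          have := ((hT.mem_iff _).1 h).2
          omega
        · rw [List.mem_cons, hT.mem_iff]
          constructor
          · rintro (rfl | h)
            · exact ⟨hS, .inl rfl⟩
            · exact ⟨h.1, .inr h.2⟩
          · rintro ⟨h1, h2⟩
            tauto
        · refine ⟨?_, ?_⟩
          · simp (disch := omega) only [Function.update_self, Function.update_of_ne]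
          · simp (disch := omega) only [Function.update_self, Function.update_of_ne]
            refine hT.chain.congr fun c hc => ?_
            have hc' := (hT.mem_iff c).1 hc
            have hcp : c ≠ p.1 := fun h => by rw [h] at hc'; omega
            rw [Function.update_of_ne (hne c hc'.1 hcp)]
        · by_cases h : c = p.1
          · subst h; simp (disch := omega) only [Function.update_self,
                Function.update_of_ne]; exact h8
          · have := hne c hc h
            simp (disch := omega) only [Function.update_self,
                Function.update_of_ne]; exact hT.count c hc
      · have hF0 : 0 < F p.1 := by simp at h; omega
        refine WP.le (WP.skip (H _ ⟨le_rfl, fun b hb _ f hf => rfl, rfl,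
            fun r hr => ?_⟩ rfl ?_ ?_ ?_
          ?_ ⟨T, hT.nodup, fun c => ?_, ?_⟩ hT.count)) (by omega)
        · simp (disch := omega) only [Function.update_self, Function.update_of_ne]
        · simp (disch := omega) only [Function.update_self, Function.update_of_ne]
        · simp (disch := omega) only [Function.update_self, Function.update_of_ne]
        · simp (disch := omega) only [Function.update_self, Function.update_of_ne]
        · simp (disch := omega) only [Function.update_self, Function.update_of_ne]
        · rw [hT.mem_iff]
          refine and_congr_right fun _ => ⟨.inr, ?_⟩
          rintro (rfl | h)
          · exact hF0
          · exact h
        · simp (disch := omega) only [Function.update_self, Function.update_of_ne]; exact hT.chain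
    rintro σ₂ hg2 hn2 e34 e33 e32 e31 ⟨T', hT1, hT2, hT3⟩ h8'
    refine WP.blk (is := [_, _]) ?_
    have hcl2 : ca p.1 < σ₂.next := by omega
    simp (disch := omega) only [execL, Instr.exec, State.set, Function.update_self,
      Function.update_of_ne, if_pos, Option.bind_some, Option.some.injEq, exists_eq_left', if_true,
      row, e34, e33, e32, hFp, hcl2]
    set σ₃ : State := ⟨_, _, _, _⟩ with hσ₃
    have hg3 : Upd (d + 7) (d + 35) ∅ σ₂ σ₃ := by
      refine ⟨le_rfl, fun b hb _ f hf => ?_, rfl, fun r hr => ?_⟩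
      · by_cases h : b = ca p.1
        · subst h; simp (disch := omega) only [Function.update_self, Function.update_of_ne, hσ₃]
        · simp (disch := omega) only [Function.update_self, Function.update_of_ne, hσ₃]
      · simp (disch := omega) only [Function.update_self, Function.update_of_ne, hσ₃]
    have hgt := hg2.trans hg3 (by simp)
    have hag : Agree N σ.cell σ₃.cell := hgt.agree hN (by simp)
    refine (ih (N := N) (F := Function.update F p.1 (F p.1 + p.2)) (T := T')
      (fun b hb => (hV b hb).trans_le hgt.next_le) (hc.upd hgt le_rfl)
      (hN.trans hgt.next_le) (hb.mono le_rfl hag) ?_ ⟨fun c hc => ?_, hT1, fun c => ?_, ?_⟩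
      (fun q hq => hp q (by simp [hq])) fun c => ?_).conseq ?_
    · have : σ₃.reg (d + 31) = σ.cell a 2 := by
        simp (disch := omega) only [Function.update_self, Function.update_of_ne, hσ₃, e31]
      rw [this]; exact hl.mono subset_rfl fun b hb f hf =>
        hgt.cell_eq b (hV b hb) (by simp) f hf
    · by_cases h : c = p.1
      · subst h; simp (disch := omega) only [Function.update_self, Function.update_of_ne, hσ₃]
      · have := hne c hc h
        rw [Function.update_of_ne h]
        simp (disch := omega) only [Function.update_self, Function.update_of_ne,
            hσ₃]; exact h8' c hc
    · rw [hT2]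
      refine and_congr_right fun _ => ?_
      by_cases h : c = p.1
      · subst h; have := (hp p (by simp)).2; simp [this]
      · simp [Function.update_of_ne h, h]
    · have : σ₃.reg (d + 30) = σ₂.reg (d + 30) := by
        simp (disch := omega) only [Function.update_self, Function.update_of_ne, hσ₃]
      rw [this]
      refine hT3.congr fun c hc => ?_
      by_cases h : c = p.1
      · subst h; simp (disch := omega) only [Function.update_self, Function.update_of_ne, hσ₃]
      · have := hne c ((hT2 c).1 hc).1 h
        simp (disch := omega) only [Function.update_self, Function.update_of_ne, hσ₃]
    · rw [hF']; exact hF c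
    · rintro σ₄ ⟨hg4, hn4, T₄, h4⟩
      refine ⟨hgt.trans hg4 (by simp), by rw [hn4]; exact hn2, T₄, ?_⟩
      have : (fun c => F c + weight (p :: l) c) =
        fun c => Function.update F p.1 (F p.1 + p.2) c + weight l c := funext fun c => (hF' c).symm
      rw [this]; exact h4

/-- Move the counters that are not zero to the list in `d + 35`; their number is added to
register `d + 36`. -/
def drainP (d : ℕ) : Prog :=
  whileNe d (d + 30) (blk ([.load (d + 34) (d + 30) 8] ++
    (mk (d + 37) [(0, d + 30), (1, d + 34), (2, d + 35)] ++ [.move (d + 35) (d + 37),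
      .store (d + 30) 8 (d + 4), .load (d + 30) (d + 30) 9, .add (d + 36) (d + 36) (d + 5)])))

/-- Only field `8` of one colour cell changes. The chain runs through field `9`, so its tail
survives, and injectivity of `ca` protects the other counters. -/
theorem Counters.pop {h ca S F c T v N} (hb : ColorBase N h ca S)
    (H : Counters h ca S F (c :: T) v) :
    Counters (Function.update h (ca c) (Function.update (h (ca c)) 8 (.num 0))) ca S
      (Function.update F c 0) T (h (ca c) 9) := by
  have hc := (H.mem_iff c).1 (by simp)
  have hnd := List.nodup_cons.1 H.nodup
  refine ⟨fun e he => ?_, hnd.2, fun e => ?_, H.chain.2.congr fun e he => ?_⟩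
  · by_cases h : e = c
    · subst h; simp
    · rw [Function.update_of_ne fun h' => h (hb.inj he hc.1 h'), Function.update_of_ne h]
      exact H.count e he
  · by_cases h : e = c
    · subst h; simp [hnd.1]
    · rw [Function.update_of_ne h, ← H.mem_iff]; simp [h]
  · by_cases h : ca e = ca c
    · rw [h]; simp
    · rw [Function.update_of_ne h]

theorem Counters.grow_row {h ca S F T v N x} (hb : ColorBase N h ca S)
    (H : Counters h ca S F T v) (hx : N ≤ x) (r) :
    Counters (Function.update h x r) ca S F T v := by
  refine ⟨fun e he => ?_, H.nodup, H.mem_iff, H.chain.congr fun e he => ?_⟩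
  · have := hb.lt e he
    rw [Function.update_of_ne (by omega)]; exact H.count e he
  · have := hb.lt e ((H.mem_iff e).1 he).1
    rw [Function.update_of_ne (by omega)]

/-- The colours are counted while they are moved, because their number becomes the credit of the
compacted list. Draining also restores the zero counters that the next insertion relies on. -/
theorem drainP_spec {W d ca S} (hW : 1 ≤ W) (T : List ℕ) : ∀ {V N F l k σ},
    (∀ a ∈ V, a < σ.next) → Consts d σ → N ≤ σ.next →
    ColorBase N σ.cell ca S → IsWL V σ.cell ca l (σ.reg (d + 35)) →
    Counters σ.cell ca S F T (σ.reg (d + 30)) → σ.reg (d + 36) = .num k → k + T.length ≤ W →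
    WP W (drainP d) σ (14 * T.length + 3) fun σ' => Upd (d + 7) (d + 38) ∅ σ σ' ∧
      Counters σ'.cell ca S (fun _ => 0) [] (σ'.reg (d + 30)) ∧
      σ'.reg (d + 36) = .num (k + T.length) ∧
      IsWL (V ∪ Set.Ico σ.next σ'.next) σ'.cell ca ((T.map fun c => (c,
          F c)).reverse ++ l) (σ'.reg (d + 35)) := by
  induction T with
  | nil =>
    intro V N F l k σ hV hc hN hb hl hT hk hkW
    refine WP.while_nil hT.chain hc.one hc.nil ⟨.of_set (by omega) (by omega), ⟨?_, ?_, ?_, ?_⟩, ?_,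
      ?_⟩
    · intro c hc
      have : F c = 0 := by
        have := hT.mem_iff c
        simp at this
        exact this hc
      have h := hT.count c hc
      rwa [this] at h
    · simp
    · simp
    · have := hT.chain; simpa [State.set] using this
    · simpa [State.set] using hk
    · refine IsWL.mono Set.subset_union_left (fun _ _ _ _ => rfl) ?_
      simpa [State.set] using hl
  | cons c T ih =>
    intro V N F l k σ hV hc hN hb hl hT hk hkW
    have hv := hT.chain.1
    have hcS := (hT.mem_iff c).1 (by simp)
    have h8 := hT.count c hcS.1
    have hlt := hb.lt c hcS.1
    have hlt' : ca c < σ.next := by omega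
    have hlt'' : ca c < σ.next + 1 := by omega
    have h4 := hc.zero
    have h5 := hc.one
    have hk1 : k + 1 ≤ W := by simp at hkW; omega
    refine WP.le (T := 10 + (14 * T.length + 3) + 3) (WP.while_ptr hW hv hc.one hc.nil
      (WP.le (WP.blk (is := _ ++ _) ?_) (by simp [length_mk]))) (by simp; omega)
    rw [execL_append]
    simp (disch := omega) only [execL, Instr.exec, State.set, Function.update_self,
      Function.update_of_ne, if_pos, Option.bind_some, Option.some.injEq, exists_eq_left', if_true,
      row, hv, hlt', h8]
    rw [execL_mk_append (by simp)]
    simp (disch := omega) only [execL, Instr.exec, State.set, Function.update_self,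
      Function.update_of_ne, if_pos, Option.bind_some, Option.some.injEq, exists_eq_left', if_true,
      row, hv, hlt'', h4, h5, hk, hk1]
    set σ₁ : State := ⟨_, _, σ.next + 1, _⟩ with hσ₁
    have hg1 : Upd (d + 7) (d + 38) ∅ σ σ₁ := by
      refine ⟨Nat.le_succ _, fun b hb _ f hf => ?_, rfl, fun r hr => ?_⟩
      · by_cases h : b = ca c
        · subst h; simp (disch := omega) only [Function.update_self, Function.update_of_ne, hσ₁]
        · simp (disch := omega) only [Function.update_self, Function.update_of_ne, hσ₁]
      · simp (disch := omega) only [Function.update_self, Function.update_of_ne, hσ₁]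
    have hag := hg1.agree hN (by simp)
    have hpop := (hT.pop hb).grow_row (N := N) (hb.mono le_rfl ?_) hN
      (Function.update (Function.update (Function.update (fun x => Val.nil) 2 (σ.reg (d + 35))) 1
        (Val.num (F c))) 0 (Val.ptr (ca c)))
    swap
    · intro b _ f hf
      by_cases h : b = ca c
      · subst h; simp (disch := omega) only [Function.update_self, Function.update_of_ne]
      · simp (disch := omega) only [Function.update_self, Function.update_of_ne]
    refine (ih (V := V ∪ {σ.next}) (N := N) (F := Function.update F c 0) (l := (c,
        F c) :: l) (k := k + 1)
      ?_ (hc.upd hg1 le_rfl) (hN.trans hg1.next_le) (hb.mono le_rfl hag) ?_ ?_ ?_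
      (by simp at hkW; omega)).conseq ?_
    · rintro b (hb | rfl)
      · exact (hV b hb).trans (Nat.lt_succ_self _)
      · exact Nat.lt_succ_self _
    · refine ⟨σ.next, by simp, ?_, ?_, ?_, ?_⟩
      · simp (disch := omega) only [Function.update_self, Function.update_of_ne, hσ₁]
      · simp (disch := omega) only [Function.update_self, Function.update_of_ne, hσ₁]
      · simp (disch := omega) only [Function.update_self, Function.update_of_ne, hσ₁]
      · have := hl.mono (V' := V ∪ {σ.next}) Set.subset_union_left fun b hb f hf =>
          hg1.cell_eq b (hV b hb) (by simp) f hf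
        simpa (disch := omega) only [hσ₁, Function.update_self, Function.update_of_ne] using this
    · have e : σ₁.reg (d + 30) = σ.cell (ca c) 9 := by
        simp (disch := omega) only [Function.update_self, Function.update_of_ne, hσ₁]
      have e' : σ₁.cell = Function.update (Function.update σ.cell (ca c)
          (Function.update (σ.cell (ca c)) 8 (Val.num 0))) σ.next
          (Function.update (Function.update (Function.update (fun x => Val.nil) 2
          (σ.reg (d + 35))) 1 (Val.num (F c))) 0 (Val.ptr (ca c))) := by
        rw [Function.update_comm (by omega)]
      rw [e, e']
      exact hpop
    · simp (disch := omega) only [Function.update_self, Function.update_of_ne, hσ₁]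
    · rintro σ₂ ⟨hg2, h1, h2, h3⟩
      refine ⟨hg1.trans hg2 (by simp), h1, by rw [h2]; simp; omega, ?_⟩
      have hmap : T.map (fun e => (e, Function.update F c 0 e)) = T.map fun e => (e, F e) := by
        refine List.map_congr_left fun e he => ?_
        have : e ≠ c := fun h => (List.nodup_cons.1 hT.nodup).1 (h ▸ he)
        rw [Function.update_of_ne this]
      rw [hmap] at h3
      refine IsWL.mono ?_ (fun _ _ _ _ => rfl) (by simpa using h3)
      have := hg2.next_le
      have hn1 : σ₁.next = σ.next + 1 := rfl
      intro b hb
      simp only [Set.mem_union, Set.mem_singleton_iff, Set.mem_Ico] at hb ⊢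
      obtain (hb | hb) | hb := hb
      · right; omega
      · exact .inl hb
      · right; omega

/-! ### Inserting a point into a list of weights -/

/-- Fill the cell in `d + 38` with the list of weights in `d + 20` and the colour in `d + 40`. -/
def weightP (d : ℕ) : Prog :=
  .seq (blk ([.load (d + 22) (d + 20) 0, .load (d + 23) (d + 20) 1] ++
    mk (d + 24) [(0, d + 40), (1, d + 5), (2, d + 22)]))
  (.branch (.le (d + 5) (d + 23))
    (blk [.sub (d + 23) (d + 23) (d + 5), .store (d + 38) 0 (d + 24), .store (d + 38) 1 (d + 23)])
    (.seq (blk [.move (d + 31) (d + 24), .clear (d + 30)]) (.seq (accP d)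
      (.seq (blk [.clear (d + 35), .move (d + 36) (d + 4)]) (.seq (drainP d)
        (blk [.store (d + 38) 0 (d + 35), .store (d + 38) 1 (d + 36)]))))))

theorem weight_reverse (l : List (ℕ × ℕ)) (c : ℕ) : weight l.reverse c = weight l c := by
  simp [weight]

theorem weight_map (T : List ℕ) (hT : T.Nodup) (F : ℕ → ℕ) (c : ℕ) :
    weight (T.map fun e => (e, F e)) c = if c ∈ T then F c else 0 := by
  induction T with
  | nil => simp [weight]
  | cons e T ih =>
    have hn := List.nodup_cons.1 hT
    have ih := ih hn.2
    simp only [weight, List.map_cons, List.sum_cons, List.mem_cons] at ih ⊢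
    rw [ih]
    by_cases h : e = c
    · subst h; simp [hn.1]
    · simp [h, Ne.symm h]

/-- Positive weights cannot cancel. Hence the colours in a list are exactly those with positive
frequency, which is what bounds list lengths by numbers of colours. -/
theorem weight_pos_iff (l : List (ℕ × ℕ)) (hl : ∀ p ∈ l, 0 < p.2) (c : ℕ) :
    0 < weight l c ↔ c ∈ l.map Prod.fst := by
  induction l with
  | nil => simp [weight]
  | cons p l ih =>
    have ih := ih fun q hq => hl q (by simp [hq])
    have hp := hl p (by simp)
    simp only [weight, List.map_cons, List.sum_cons, List.mem_cons] at ih ⊢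
    rw [← ih]
    by_cases h : p.1 = c
    · simp [h, hp]
    · simp [h, Ne.symm h]

/-- The addresses below `N`, the address `x`, and those from `a` to `b`. -/
def region (N x a b : ℕ) : Set ℕ := {i | i < N ∨ i = x ∨ a ≤ i ∧ i < b}

theorem mem_region {N x a b i : ℕ} : i ∈ region N x a b ↔ i < N ∨ i = x ∨ a ≤ i ∧ i < b := Iff.rfl

theorem Counters.eq_zero {h ca S l v} (H : Counters h ca S (fun _ => 0) l v) :
    ∀ c ∈ S, h (ca c) 8 = .num 0 := H.count

/-- Fill the cell in `d + 38` with a list and a number. -/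
theorem storeVL_spec {κ W d ca S N x σ₀ σ l cr k r r' A} {col : ℕ → ℕ}
    (hN : N ≤ x) (hx : x < σ₀.next) (hb : ColorBase N σ₀.cell ca S)
    (hg : Upd (d + 7) (d + 38) ∅ σ₀ σ) (h21 : σ.reg (d + 38) = .ptr x)
    (hl : IsWL (Set.Iio N ∪ Set.Ico σ₀.next σ.next) σ.cell ca l (σ.reg r))
    (hr : σ.reg r' = .num cr) (hwt : ∀ c, weight l c = (A.map col).count c)
    (hpos : ∀ p ∈ l, 0 < p.2) (hlen : l.length + cr = 2 * k) (hcr : cr ≤ k)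
    (hk : k ≤ (A.map col).toFinset.card) (hcnt : ∀ c ∈ S, σ.cell (ca c) 8 = .num 0) :
    ∃ σ', execL W [.store (d + 38) 0 r, .store (d + 38) 1 r'] σ = some σ' ∧
      Upd (d + 7) (d + 38) {x} σ₀ σ' ∧ (∀ c ∈ S, σ'.cell (ca c) 8 = .num 0) ∧
      IsVL κ (region N x σ₀.next σ'.next) σ'.cell ca col (.ptr x) A (κ * (k - cr)) := by
  have hx1 : x < σ.next := hx.trans_le hg.next_le
  simp (disch := omega) only [execL, Instr.exec, State.set, Function.update_self,
      Function.update_of_ne, if_pos, Option.bind_some, Option.some.injEq, exists_eq_left', if_true,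
      row, h21, hx1]
  set σ₁ : State := ⟨_, _, σ.next, _⟩ with hσ₁
  have hg1 : Upd (d + 7) (d + 38) {x} σ₀ σ₁ := by
    refine (hg.mono le_rfl le_rfl (Set.empty_subset _)).trans (Y := {x})
      ⟨le_rfl, fun b hb hbx f hf => ?_, rfl, fun r hr => rfl⟩ fun a h _ => h
    rw [Set.mem_singleton_iff] at hbx
    simp (disch := omega) only [Function.update_self, Function.update_of_ne, hσ₁]
  refine ⟨hg1, fun c hc => ?_, x, .inr (.inl rfl), rfl, l, cr, k, ?_, ?_, hwt, hpos, hlen, hcr, hk,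
    rfl⟩
  · have := hb.lt c hc
    simp (disch := omega) only [Function.update_self, Function.update_of_ne, hσ₁]; exact hcnt c hc
  · have h0 : σ₁.cell x 0 = σ.reg r := by
      simp (disch := omega) only [Function.update_self, Function.update_of_ne, hσ₁]
    change IsWL _ σ₁.cell ca l (σ₁.cell x 0)
    rw [h0]
    refine hl.mono (fun b hb => ?_) fun b hb f hf => ?_
    · exact hb.elim .inl fun h => .inr (.inr h)
    · have : b ≠ x := by
        rintro rfl
        obtain hb | hb := hb
        · exact absurd hb (not_lt.2 hN)
        · exact absurd hb.1 (not_le.2 hx)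
      simp (disch := omega) only [Function.update_self, Function.update_of_ne, hσ₁]
  · have h1 : σ₁.cell x 1 = σ.reg r' := by
      simp (disch := omega) only [Function.update_self, Function.update_of_ne, hσ₁]
    exact h1.trans hr

/-- The amortised analysis of one list. Here `k` is the number of colours at the last compaction and
`k - cr` the number of insertions since then, each of which has saved `κ`. After a compaction both
the length and the credit are `k`, so the length stays at most `2 * k`. The number of colours only
grows, so `k` stays a lower bound for it. -/
theorem weightP_spec {κ W d ca S N v x A Φ p σ} {col : ℕ → ℕ} (hκ : 60 ≤ κ) (hc : Consts d σ)
    (hN : N ≤ x) (hx : x < σ.next) (hb : ColorBase N σ.cell ca S)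
    (h20 : σ.reg (d + 20) = v) (h21 : σ.reg (d + 38) = .ptr x)
    (h29 : σ.reg (d + 40) = .ptr (ca (col p))) (hA : ∀ j ∈ p ::ₘ A, col j ∈ S)
    (hW : A.card + 1 ≤ W) (hv : IsVL κ (Set.Iio N) σ.cell ca col v A Φ)
    (hcnt : ∀ c ∈ S, σ.cell (ca c) 8 = .num 0) :
    ∃ T Φ', T + Φ' ≤ Φ + (κ + 100) ∧ WP W (weightP d) σ T fun σ' =>
      Upd (d + 7) (d + 38) {x} σ σ' ∧ (∀ c ∈ S, σ'.cell (ca c) 8 = .num 0) ∧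
      IsVL κ (region N x σ.next σ'.next) σ'.cell ca col (.ptr x) (p ::ₘ A) Φ' := by
  obtain ⟨a, ha, rfl, l, cr, k, hl, hcr, hwt, hpos, hlen, hcrk, hk, rfl⟩ := hv
  have ha' : a < σ.next := by rw [Set.mem_Iio] at ha; omega
  have h5 := hc.one
  have hx' : x < σ.next + 1 := by omega
  have hcol : (p ::ₘ A).map col = col p ::ₘ A.map col := by simp
  have hwt' : ∀ c, weight ((col p, 1) :: l) c = ((p ::ₘ A).map col).count c := by
    intro c
    rw [hcol, Multiset.count_cons, ← hwt]
    simp only [weight, List.map_cons, List.sum_cons]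
    by_cases h : col p = c
    · simp [h]; omega
    · simp [h, Ne.symm h]
  have hpos' : ∀ q ∈ (col p, 1) :: l, 0 < q.2 := by
    intro q hq
    obtain rfl | hq := List.mem_cons.1 hq
    · simp
    · exact hpos q hq
  -- Both cases begin by putting the pair of weight `1` in front, in a fresh cell; the old list
  -- remains as a shared tail for the older versions.
  have start : ∀ {T} {Q : State → Prop}, (∀ σ₁ : State, Upd (d + 7) (d + 38) ∅ σ σ₁ →
      σ₁.next = σ.next + 1 → (∀ c ∈ S, σ₁.cell (ca c) 8 = .num 0) →
      IsWL (region N σ.next σ.next σ₁.next) σ₁.cell ca ((col p, 1) :: l) (.ptr σ.next) →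
      σ₁.reg (d + 24) = .ptr σ.next → σ₁.reg (d + 23) = .num cr → σ₁.reg (d + 38) = .ptr x →
      WP W (.branch (.le (d + 5) (d + 23))
        (blk [.sub (d + 23) (d + 23) (d + 5), .store (d + 38) 0 (d + 24),
          .store (d + 38) 1 (d + 23)])
        (.seq (blk [.move (d + 31) (d + 24), .clear (d + 30)]) (.seq (accP d)
        (.seq (blk [.clear (d + 35), .move (d + 36) (d + 4)]) (.seq (drainP d)
        (blk [.store (d + 38) 0 (d + 35), .store (d + 38) 1 (d + 36)])))))) σ₁ T Q) →
      WP W (weightP d) σ (7 + T) Q := by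
    intro T Q H
    refine WP.seq (WP.le (WP.blk (is := _ ++ _) ?_) (by simp [length_mk]))
    rw [execL_append]
    simp (disch := omega) only [execL, Instr.exec, State.set, Function.update_self,
      Function.update_of_ne, if_pos, Option.bind_some, Option.some.injEq, exists_eq_left', if_true,
      row, h20, ha', hcr]
    rw [execL_mk (by simp)]
    simp (disch := omega) only [execL, Instr.exec, State.set, Function.update_self,
      Function.update_of_ne, if_pos, Option.bind_some, Option.some.injEq, exists_eq_left', if_true,
      row]
    set σ₁ : State := ⟨_, _, σ.next + 1, _⟩ with hσ₁
    have hg1 : Upd (d + 7) (d + 38) ∅ σ σ₁ := by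
      refine ⟨Nat.le_succ _, fun b hb _ f hf => ?_, rfl, fun r hr => ?_⟩
      · simp (disch := omega) only [Function.update_self, Function.update_of_ne, hσ₁]
      · simp (disch := omega) only [Function.update_self, Function.update_of_ne, hσ₁]
    refine H σ₁ hg1 rfl (fun c hc => ?_) ⟨σ.next, .inr (.inl rfl), rfl, ?_, ?_, ?_⟩ ?_ ?_ ?_
    · have := hb.lt c hc
      simp (disch := omega) only [Function.update_self, Function.update_of_ne, hσ₁]; exact hcnt c hc
    · simp (disch := omega) only [Function.update_self, Function.update_of_ne, hσ₁, h29]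
    · simp (disch := omega) only [Function.update_self, Function.update_of_ne, hσ₁, h5]
    · have := hl.mono (V' := region N σ.next σ.next σ₁.next) (fun b hb => .inl hb) fun b hb f hf =>
        hg1.cell_eq b (by have := Set.mem_Iio.1 hb; omega) (by simp) f hf
      simpa (disch := omega) only [Function.update_self, Function.update_of_ne, hσ₁] using this
    · simp (disch := omega) only [Function.update_self, Function.update_of_ne, hσ₁]
    · simp (disch := omega) only [Function.update_self, Function.update_of_ne, hσ₁]
    · simp (disch := omega) only [Function.update_self, Function.update_of_ne, hσ₁, h21]
  have hcard : k ≤ ((p ::ₘ A).map col).toFinset.card := by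
    refine hk.trans (Finset.card_le_card ?_)
    rw [hcol, Multiset.toFinset_cons]
    exact Finset.subset_insert _ _
  -- With credit left, one unit is spent and the potential rises by exactly `κ`.
  by_cases hcr1 : 1 ≤ cr
  · refine ⟨7 + 5, κ * (k - (cr - 1)), ?_, start ?_⟩
    · have : k - (cr - 1) = k - cr + 1 := by omega
      rw [this, mul_add]; omega
    intro σ₁ hg1 hn1 hcnt1 hl1 e24 e23 e21
    have h51 := (hc.upd hg1 le_rfl).one
    refine WP.branch (T := 4) (b := true) ?_ (fun _ => WP.blk (is := [_, _, _]) ?_) (by simp)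
    · simp [eval_le, e23, h51, leVal, hcr1]
    have := storeVL_spec (κ := κ) (W := W) (r := d + 24) (r' := d + 23) (cr := cr - 1) (k := k) (A := p ::ₘ A)
      (σ := σ₁.set (d + 23) (.num (cr - 1))) hN hx hb (hg1.trans (Y := ∅) (.of_set (by omega)
      (by omega)) (by simp)) ?_ ?_ ?_ hwt' hpos' (by simp; omega) (by omega) hcard hcnt1
    · simp only [execL, Instr.exec, e23, h51, Option.bind_some, State.set] at this ⊢
      exact this
    · simpa (disch := omega) only [State.set, Function.update_of_ne] using e21
    · simp (disch := omega) only [State.set, Function.update_of_ne, e24]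
      refine hl1.mono (fun b hb => ?_) fun _ _ _ _ => rfl
      rw [mem_region] at hb
      simp only [Set.mem_union, Set.mem_Iio, Set.mem_Ico]
      omega
    · simp [State.set]
  · have hcr0 : cr = 0 := by omega
    subst hcr0
    set F := fun c => weight ((col p, 1) :: l) c with hF
    have hlS : ∀ q ∈ (col p, 1) :: l, q.1 ∈ S := by
      intro q hq
      have h1 := (weight_pos_iff _ hpos' q.1).2 (List.mem_map_of_mem hq)
      rw [hwt', Multiset.count_pos, Multiset.mem_map] at h1
      obtain ⟨j, hj, h⟩ := h1
      exact h ▸ hA j hj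
    have hFW : ∀ c, 0 + weight ((col p, 1) :: l) c ≤ W := by
      intro c
      rw [hwt', zero_add]
      exact (Multiset.count_le_card _ _).trans (by simpa using hW)
    -- Without credit, `l.length = 2 * k` and the saved potential is `κ * k`. Counting and draining
    -- `2 * k + 1` pairs costs at most `29` per pair, so `58 * k` up to a constant, which `κ ≥ 60`
    -- covers. The new potential is `0`.
    refine ⟨7 + ((3 + ((15 * (l.length + 1) + 3) + (3 + ((14 * (l.length + 1) + 3) + 3)))) + 1), 0,
        ?_,
      start ?_⟩
    · have : 60 * k ≤ κ * k := Nat.mul_le_mul_right _ hκ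
      simp only [tsub_zero]
      omega
    intro σ₁ hg1 hn1 hcnt1 hl1 e24 e23 e21
    have hc1 := hc.upd hg1 le_rfl
    have h51 := hc1.one
    refine WP.branch (b := false) ?_ (by simp) (fun _ => ?_)
    · simp [eval_le, e23, h51, leVal]
    refine WP.seq (WP.blk (is := [_, _]) ?_)
    simp (disch := omega) only [execL, Instr.exec, State.set, Function.update_self,
      Function.update_of_ne, if_pos, Option.bind_some, Option.some.injEq, exists_eq_left', if_true,
      row]
    set σ₂ : State := ⟨_, _, _, _⟩ with hσ₂
    have hg2 : Upd (d + 7) (d + 38) ∅ σ σ₂ := hg1.trans (Y := ∅) ⟨le_rfl, fun _ _ _ _ _ => rfl, rfl,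
      fun r hr => by simp (disch := omega) only [Function.update_self, Function.update_of_ne,
          hσ₂]⟩ (by simp)
    have hn2 : σ₂.next = σ.next + 1 := hn1
    have hb2 : ColorBase N σ₂.cell ca S := hb.mono le_rfl (hg2.agree (by omega) (by simp))
    refine WP.seq (WP.conseq (accP_spec (l := (col p,
        1) :: l) (S := S) (ca := ca) (F := fun _ => 0) (N := N)
      (V := region N σ.next σ.next σ₁.next) (T := []) (by omega)
      (fun b hb => by rw [mem_region] at hb; simp only [hn2, hn1] at *; omega) (hc.upd hg2 le_rfl) (by omega) hb2
      ?_ ⟨hcnt1, by simp, by simp, ?_⟩ (fun q hq => ⟨hlS q hq, hpos' q hq⟩) hFW) ?_)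
    · simp (disch := omega) only [Function.update_self, Function.update_of_ne, hσ₂, e24]; exact hl1
    · simp (disch := omega) only [Function.update_self, Function.update_of_ne, hσ₂, IsChain]
    rintro σ₃ ⟨hg3, hn3, T, hT⟩
    have hg3' := hg2.trans (hg3.mono le_rfl (by omega) le_rfl) (by simp)
    refine WP.seq (WP.blk (is := [_, _]) ?_)
    have h43 := (hc.upd hg3' le_rfl).zero
    simp (disch := omega) only [execL, Instr.exec, State.set, Function.update_self,
      Function.update_of_ne, if_pos, Option.bind_some, Option.some.injEq, exists_eq_left', if_true,
      row, h43]
    set σ₄ : State := ⟨_, _, _, _⟩ with hσ₄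
    have hg4 : Upd (d + 7) (d + 38) ∅ σ σ₄ := hg3'.trans (Y := ∅) ⟨le_rfl, fun _ _ _ _ _ => rfl,
        rfl,
      fun r hr => by simp (disch := omega) only [Function.update_self, Function.update_of_ne,
          hσ₄]⟩ (by simp)
    simp only [zero_add] at hT
    have hTlen : T.length ≤ l.length + 1 := by
      have : T ⊆ ((col p, 1) :: l).map Prod.fst := fun c hc =>
        (weight_pos_iff _ hpos' c).1 ((hT.mem_iff c).1 hc).2
      simpa using (List.Nodup.subperm hT.nodup this).length_le
    have hTW : T.toFinset = ((p ::ₘ A).map col).toFinset := by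
      ext c
      rw [List.mem_toFinset, hT.mem_iff, hwt', Multiset.count_pos, Multiset.mem_toFinset]
      refine ⟨fun h => h.2, fun h => ⟨?_, h⟩⟩
      obtain ⟨j, hj, h⟩ := Multiset.mem_map.1 h
      exact h ▸ hA j hj
    -- The compacted list has one pair per colour, so the new value of `k` is the exact number of
    -- colours.
    have hTc : T.length = ((p ::ₘ A).map col).toFinset.card := by
      rw [← hTW, List.toFinset_card_of_nodup hT.nodup]
    have hTW' : T.length ≤ W := by
      rw [hTc]
      exact (Multiset.toFinset_card_le _).trans (by simpa using hW)
    have hn4 : σ₄.next = σ.next + 1 := by rw [← hn2, ← hn3]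
    refine WP.seq (WP.mono (drainP_spec (S := S) (ca := ca) (F := F) (N := N) (V := ∅) (l := []) (k := 0)
      (by omega) T (by simp) (hc.upd hg4 le_rfl) (by omega) (hb.mono le_rfl (hg4.agree (by omega)
      (by simp))) ?_ ?_ ?_ (by omega)) (by omega) ?_)
    · simp (disch := omega) only [Function.update_self, Function.update_of_ne, hσ₄, IsWL]
    · simpa (disch := omega) only [Function.update_self, Function.update_of_ne, hσ₄] using hT
    · simp (disch := omega) only [Function.update_self, Function.update_of_ne, hσ₄]
    rintro σ₅ ⟨hg5, h5, h36, hl5⟩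
    simp only [List.append_nil] at hl5
    have hg5' := hg4.trans hg5 (by simp)
    have := storeVL_spec (κ := κ) (W := W) (r := d + 35) (r' := d + 36) (k := T.length)
      (A := p ::ₘ A) hN hx hb hg5' ?_ (hl5.mono ?_ fun _ _ _ _ => rfl) (by simpa using h36) (l := (T.map fun c => (c, F c)).reverse) ?_ ?_ ?_ (by omega)
      hTc.le h5.eq_zero
    · simpa using WP.blk this
    · rw [hg5'.reg_eq _ (by omega), h21]
    · intro b hb
      rw [Set.empty_union] at hb
      exact .inr ⟨by have := hb.1; omega, hb.2⟩
    · intro c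
      rw [weight_reverse, weight_map _ hT.nodup]
      split_ifs with h
      · exact hwt' c
      · rw [← List.mem_toFinset, hTW, Multiset.mem_toFinset] at h
        exact (Multiset.count_eq_zero.2 h).symm
    · intro q hq
      obtain ⟨c, hc, rfl⟩ := List.mem_map.1 (List.mem_reverse.1 hq)
      exact ((hT.mem_iff c).1 hc).2
    · simp; omega

/-! ### Inserting a point -/

/-- Put a task on the stack in `d + 39`. -/
def pushTaskP (d a b r : ℕ) : Prog :=
  blk (mk (d + 22) [(0, a), (1, b), (2, d + 39), (3, r), (4, d + 12), (5, d + 21), (6, d + 14)] ++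
    [.move (d + 39) (d + 22)])

/-- Copy field `f` of the cell in `d + 10` to the cell in `d + 38`, whose field `g` becomes a new
cell, and put the task to fill that cell on the stack. -/
def push1P (d f g : ℕ) : Prog :=
  .seq (blk ([.load (d + 16) (d + 10) f, .load (d + 17) (d + 10) g] ++ (mk (d + 18) [] ++
    [.store (d + 38) f (d + 16), .store (d + 38) g (d + 18)])))
    (pushTaskP d (d + 17) (d + 18) (d + 5))

/-- Let the fields `0` and `1` of the cell in `d + 38` point to new cells, and put the tasks to fill
them on the stack. -/
def push2P (d : ℕ) : Prog :=
  .seq (blk ([.load (d + 16) (d + 10) 0, .load (d + 17) (d + 10) 1] ++ (mk (d + 18) [] ++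
    (mk (d + 19) [] ++ [.store (d + 38) 0 (d + 18), .store (d + 38) 1 (d + 19)]))))
    (.seq (pushTaskP d (d + 17) (d + 19) (d + 24)) (pushTaskP d (d + 16) (d + 18) (d + 23)))

/-- Insert the point into an inner node of a trie. -/
def bitInsP (d : ℕ) : Prog :=
  .seq (blk [.load (d + 21) (d + 13) 1, .load (d + 16) (d + 13) 0, .move (d + 24) (d + 4)])
  (.branch (.le (d + 11) (d + 4)) (.seq (blk [.move (d + 23) (d + 4)]) (push2P d))
    (.branch (.le (d + 16) (d + 12))
      (.seq (blk [.sub (d + 12) (d + 12) (d + 16)]) (push1P d 0 1))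
      (.seq (blk [.move (d + 23) (d + 5)]) (push2P d))))

/-- Insert the point into a leaf of a block. -/
def leafInsP (d : ℕ) : Prog :=
  .seq (blk [.load (d + 21) (d + 13) 1])
  (.branch (.le (d + 11) (d + 4))
    (.seq (blk [.load (d + 21) (d + 13) 3, .load (d + 12) (d + 14) 0, .load (d + 14) (d + 14) 1])
      (push1P d 1 0))
    (.branch (.same (d + 21) (d + 6)) (blk [.load (d + 16) (d + 10) 0, .store (d + 38) 0 (d + 16)])
      (push1P d 0 1)))

/-- Carry out the task on top of the stack. -/
def taskP (d : ℕ) : Prog :=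
  .seq (blk [.load (d + 10) (d + 39) 0, .load (d + 38) (d + 39) 1, .load (d + 11) (d + 39) 3,
    .load (d + 12) (d + 39) 4, .load (d + 13) (d + 39) 5, .load (d + 14) (d + 39) 6,
    .load (d + 39) (d + 39) 2, .load (d + 15) (d + 13) 2])
  (.branch (.le (d + 15) (d + 4)) (bitInsP d)
    (.branch (.le (d + 15) (d + 5)) (leafInsP d) (.seq (blk [.move (d + 20) (d + 10)]) (weightP d))))

/-- Carry out all tasks on the stack. -/
def insertP (d : ℕ) : Prog := whileNe d (d + 39) (taskP d)

/-! ### Correctness of insertion by a stack of tasks -/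

/-- The cell `a` describes the task to fill the cell `x`. -/
structure IsTask (h : ℕ → ℕ → Val) (a : ℕ) (old : Val) (x : ℕ) (rest role key pw rl : Val) :
    Prop where
  old : h a 0 = old
  dst : h a 1 = .ptr x
  rest : h a 2 = rest
  role : h a 3 = role
  key : h a 4 = key
  pw : h a 5 = pw
  rl : h a 6 = rl

theorem IsTask.congr {h h' a old x rest role key pw rl} (H : IsTask h a old x rest role key pw rl)
    (hh : ∀ f < 8, h' a f = h a f) : IsTask h' a old x rest role key pw rl := by
  constructor <;> rw [hh _ (by omega)]
  exacts [H.old, H.dst, H.rest, H.role, H.key, H.pw, H.rl]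

/-- The machine is ready to insert a point of the colour `c`; `h₀` is the memory before. -/
structure Ready (d N : ℕ) (h₀ : ℕ → ℕ → Val) (ca : ℕ → ℕ) (S : Set ℕ) (c : ℕ) (σ : State) :
    Prop where
  consts : Consts d σ
  le : N ≤ σ.next
  agree : Agree N h₀ σ.cell
  zero : ∀ c ∈ S, σ.cell (ca c) 8 = .num 0
  color : σ.reg (d + 40) = .ptr (ca c)

theorem Ready.upd {d N h₀ ca S c σ σ' x} (H : Ready d N h₀ ca S c σ)
    (hg : Upd (d + 7) (d + 40) {x} σ σ') (hx : N ≤ x)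
    (hz : ∀ c ∈ S, σ'.cell (ca c) 8 = .num 0) : Ready d N h₀ ca S c σ' := by
  refine ⟨H.consts.upd hg le_rfl, H.le.trans hg.next_le, fun a ha f hf => ?_, hz, ?_⟩
  · rw [hg.agree H.le (by simpa using hx) a ha f hf, H.agree a ha f hf]
  · rw [hg.reg_eq _ (by omega), H.color]

/-- The tasks on the stack of `σ`, down to `rest`, are carried out in about `cost` steps, after
which the cell `x` satisfies `R`. -/
def Goes (W d N : ℕ) (ca : ℕ → ℕ) (S : Set ℕ) (σ₀ σ : State) (x : ℕ) (rest : Val) (cost Φ : ℕ)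
    (R : Set ℕ → (ℕ → ℕ → Val) → Val → ℕ → Prop) : Prop :=
  ∃ T Φ' σ', T + Φ' ≤ Φ + cost ∧ Upd (d + 7) (d + 40) {x} σ₀ σ' ∧ σ'.reg (d + 39) = rest ∧
    (∀ c ∈ S, σ'.cell (ca c) 8 = .num 0) ∧ R (region N x σ₀.next σ'.next) σ'.cell (.ptr x) Φ' ∧
    ∀ T' Q, WP W (insertP d) σ' T' Q → WP W (insertP d) σ (T + T') Q

/-- `R` is preserved when cells are added. -/
def Stable (R : Set ℕ → (ℕ → ℕ → Val) → Val → ℕ → Prop) : Prop :=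
  ∀ V V' h h' v Φ, V ⊆ V' → AgreeOn V h h' → R V h v Φ → R V' h' v Φ

/-- A copied node shares one child with the old version and gets a new cell `y` as the other. The
potential `Φ₀` of the shared part is passed on unspent. -/
theorem Goes.one {W d N h₀ ca S c σ σ₁ x y g rest cost Φ Φ₀}
    {R R₁ : Set ℕ → (ℕ → ℕ → Val) → Val → ℕ → Prop} (hx : x < σ.next) (hN : N ≤ σ.next)
    (hg : Upd (d + 7) (d + 40) {x} σ σ₁) (hy : y < σ₁.next) (hy' : σ.next ≤ y)
    (hg8 : g < 8) (hxg : σ₁.cell x g = .ptr y) (hr : Ready d N h₀ ca S c σ₁)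
    (H : Goes W d N ca S σ₁ σ₁ y rest cost Φ R₁)
    (hR₁ : Stable R₁) (hR : ∀ V h Φ', x ∈ V → Set.Iio N ⊆ V → Agree N h₀ h →
      (∀ f < 8, h x f = σ₁.cell x f) → R₁ V h (h x g) Φ' → R V h (.ptr x) (Φ₀ + Φ')) :
    Goes W d N ca S σ σ₁ x rest cost (Φ₀ + Φ) R := by
  obtain ⟨T, Φ', σ₂, hT, hg2, h39, hz, hR2, hrun⟩ := H
  have hxx : ∀ f < 8, σ₂.cell x f = σ₁.cell x f := fun f hf =>
    hg2.cell_eq x (hx.trans_le hg.next_le) (by simp; omega) f hf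
  refine ⟨T, Φ₀ + Φ', σ₂, by omega, hg.trans hg2 (by rintro a rfl h; omega), h39, hz,
    hR _ _ _ (.inr (.inl rfl)) (fun b hb => .inl hb) ?_ hxx ?_, hrun⟩
  · exact (hr.upd hg2 (hN.trans hy') hz).agree
  · rw [hxx g hg8, hxg]
    refine hR₁ _ _ _ _ _ _ (fun b hb => ?_) (fun _ _ _ _ => rfl) hR2
    have := hg.next_le
    have := hg2.next_le
    rw [mem_region] at hb ⊢
    omega

/-- Both children are new cells, and the task for `z` waits on the stack while `y` is completed. The
footprint `region` is what separates them: the first result lives below `N`, at `y` and among the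
cells allocated meanwhile, none of which is `z`. Filling `z` afterwards therefore cannot damage it.
-/
theorem Goes.two {W d N h₀ ca S c σ σ₁ x y z i rest cost₁ cost₂ Φ₁ Φ₂ old role key pw rl}
    {R R₁ R₂ : Set ℕ → (ℕ → ℕ → Val) → Val → ℕ → Prop} (hx : x < σ.next) (hN : N ≤ σ.next)
    (hg : Upd (d + 7) (d + 40) {x} σ σ₁) (hr : Ready d N h₀ ca S c σ₁)
    (hy : σ.next ≤ y) (hy' : y < σ₁.next) (hz : σ.next ≤ z) (hz' : z < σ₁.next)
    (hi : i < σ₁.next) (hyz : y ≠ z) (hyi : y ≠ i)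
    (hx0 : σ₁.cell x 0 = .ptr y) (hx1 : σ₁.cell x 1 = .ptr z)
    (hti : IsTask σ₁.cell i old z rest role key pw rl)
    (H₁ : Goes W d N ca S σ₁ σ₁ y (.ptr i) cost₁ Φ₁ R₁)
    (H₂ : ∀ σ₂, Ready d N h₀ ca S c σ₂ → σ₂.reg (d + 39) = .ptr i → i < σ₂.next →
      IsTask σ₂.cell i old z rest role key pw rl → z < σ₂.next →
      Goes W d N ca S σ₂ σ₂ z rest cost₂ Φ₂ R₂)
    (hR₁ : Stable R₁) (hR₂ : Stable R₂)
    (hR : ∀ V h Φ₁' Φ₂', x ∈ V → R₁ V h (h x 0) Φ₁' → R₂ V h (h x 1) Φ₂' →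
      R V h (.ptr x) (Φ₁' + Φ₂')) :
    Goes W d N ca S σ σ₁ x rest (cost₁ + cost₂) (Φ₁ + Φ₂) R := by
  obtain ⟨T₁, Φ₁', σ₂, hT₁, hg₁, h39, hz₁, hR₁', hrun₁⟩ := H₁
  have hr2 := hr.upd hg₁ (hN.trans hy) hz₁
  have hn1 := hg.next_le
  have hn2 := hg₁.next_le
  obtain ⟨T₂, Φ₂', σ₃, hT₂, hg₂, h39', hz₂, hR₂', hrun₂⟩ := H₂ σ₂ hr2 h39 (by omega)
    (hti.congr fun f hf => hg₁.cell_eq i hi (by simp; omega) f hf) (by omega)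
  have hn3 := hg₂.next_le
  have hxx : ∀ f < 8, σ₃.cell x f = σ₁.cell x f := fun f hf =>
    (hg₂.cell_eq x (by omega) (by simp; omega) f hf).trans
      (hg₁.cell_eq x (by omega) (by simp; omega) f hf)
  refine ⟨T₁ + T₂, Φ₁' + Φ₂', σ₃, by omega, (hg.trans hg₁ (by rintro a rfl h; omega)).trans hg₂
    (by rintro a rfl h; omega), h39', hz₂, hR _ _ _ _ (.inr (.inl rfl)) ?_ ?_, fun T' Q h => ?_⟩
  · rw [hxx 0 (by omega), hx0]
    refine hR₁ _ _ _ _ _ _ (fun b hb => ?_) (fun b hb f hf => hg₂.cell_eq b ?_ ?_ f hf) hR₁'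
    · rw [mem_region] at hb ⊢; omega
    · rw [mem_region] at hb; omega
    · rw [mem_region] at hb; simp; omega
  · rw [hxx 1 (by omega), hx1]
    refine hR₂ _ _ _ _ _ _ (fun b hb => ?_) (fun _ _ _ _ => rfl) hR₂'
    rw [mem_region] at hb ⊢; omega
  · rw [add_assoc]; exact hrun₁ _ _ (hrun₂ _ _ h)

theorem pushTaskP_spec {W d a b r x σ old role rest key pw rl}
    (ha : σ.reg a = old) (hb : σ.reg b = .ptr x) (hr : σ.reg r = role)
    (ha' : a ≠ d + 22) (hb' : b ≠ d + 22) (hr' : r ≠ d + 22)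
    (h39 : σ.reg (d + 39) = rest) (h12 : σ.reg (d + 12) = key) (h21 : σ.reg (d + 21) = pw)
    (h14 : σ.reg (d + 14) = rl) :
    WP W (pushTaskP d a b r) σ 10 fun σ₁ => σ₁.next = σ.next + 1 ∧ σ₁.out = σ.out ∧
      σ₁.reg (d + 39) = .ptr σ.next ∧ (∀ q, q ≠ d + 22 → q ≠ d + 39 → σ₁.reg q = σ.reg q) ∧
      (∀ c, c ≠ σ.next → σ₁.cell c = σ.cell c) ∧
      IsTask σ₁.cell σ.next old x rest role key pw rl := by
  refine WP.le (WP.blk (is := _ ++ _) ?_) (by simp [length_mk])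
  rw [execL_mk_append (by simp [ha', hb', hr'])]
  simp (disch := omega) only [execL, Instr.exec, State.set, Function.update_self,
      Function.update_of_ne, if_pos, Option.bind_some, Option.some.injEq, exists_eq_left', if_true,
      row, h39, h12, h21, h14, ha, hb, hr]
  refine ⟨trivial, trivial, trivial, fun q h1 h2 => ?_, fun c hc => ?_, ⟨?_, ?_, ?_, ?_, ?_, ?_,
      ?_⟩⟩
  all_goals simp (disch := omega) only [Function.update_self, Function.update_of_ne]

theorem push1P_spec {W d N h₀ ca S c σ o x f g rest key pw rl} (hr : Ready d N h₀ ca S c σ)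
    (hb : ColorBase N h₀ ca S) (hfg : f = 0 ∧ g = 1 ∨ f = 1 ∧ g = 0) (ho : o < N) (hx : N ≤ x)
    (hxn : x < σ.next) (h10 : σ.reg (d + 10) = .ptr o) (h38 : σ.reg (d + 38) = .ptr x)
    (h39 : σ.reg (d + 39) = rest) (h12 : σ.reg (d + 12) = key) (h21 : σ.reg (d + 21) = pw)
    (h14 : σ.reg (d + 14) = rl) :
    WP W (push1P d f g) σ 16 fun σ₁ => Upd (d + 7) (d + 40) {x} σ σ₁ ∧
      Ready d N h₀ ca S c σ₁ ∧ σ₁.next = σ.next + 2 ∧ σ₁.cell x f = h₀ o f ∧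
      σ₁.cell x g = .ptr σ.next ∧ σ₁.reg (d + 39) = .ptr (σ.next + 1) ∧
      IsTask σ₁.cell (σ.next + 1) (h₀ o g) σ.next rest (.num 1) key pw rl := by
  have hle := hr.le
  have ho' : o < σ.next := by omega
  have hof := hr.agree o ho f (by omega)
  have hog := hr.agree o ho g (by omega)
  have h5 := hr.consts.one
  have hx1 : x < σ.next + 1 := by omega
  refine WP.le (T := 6 + 10) (WP.seq (WP.le (WP.blk (is := _ ++ _) ?_) (by simp [length_mk]))) le_rfl
  rw [execL_append]
  simp (disch := omega) only [execL, Instr.exec, State.set, Function.update_self,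
      Function.update_of_ne, if_pos, Option.bind_some, Option.some.injEq, exists_eq_left', if_true,
      row, h10, ho', hof, hog]
  rw [execL_mk_append (by simp)]
  simp (disch := omega) only [execL, Instr.exec, State.set, Function.update_self,
      Function.update_of_ne, if_pos, Option.bind_some, Option.some.injEq, exists_eq_left', if_true,
      row, h38, hx1]
  refine (pushTaskP_spec (old := h₀ o g) (x := σ.next) (role := .num 1) (rest := rest) (key := key)
    (pw := pw) (rl := rl) ?_ ?_ ?_ (by omega) (by omega) (by omega) ?_ ?_ ?_ ?_).conseq ?_
  · simp (disch := omega) only [Function.update_self, Function.update_of_ne]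
  · simp (disch := omega) only [Function.update_self, Function.update_of_ne]
  · simp (disch := omega) only [Function.update_self, Function.update_of_ne, h5]
  · simp (disch := omega) only [Function.update_self, Function.update_of_ne, h39]
  · simp (disch := omega) only [Function.update_self, Function.update_of_ne, h12]
  · simp (disch := omega) only [Function.update_self, Function.update_of_ne, h21]
  · simp (disch := omega) only [Function.update_self, Function.update_of_ne, h14]
  dsimp only
  rintro σ₁ ⟨hn, ho, e39, hreg, hcell, ht⟩
  have hg1 : Upd (d + 7) (d + 40) {x} σ σ₁ := by
    refine ⟨by omega, fun b hb hbx f hf => ?_, ho, fun r hr => ?_⟩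
    · rw [Set.mem_singleton_iff] at hbx
      rw [hcell b (by omega)]
      simp (disch := omega) only [Function.update_self, Function.update_of_ne]
    · rw [hreg r (by omega) (by omega)]
      simp (disch := omega) only [Function.update_self, Function.update_of_ne]
  refine ⟨hg1, hr.upd hg1 hx fun c hc => ?_, by omega, ?_, ?_, e39, ht⟩
  · have := hb.lt c hc
    rw [hcell _ (by omega)]
    simp (disch := omega) only [Function.update_self, Function.update_of_ne]; exact hr.zero c hc
  · rw [hcell _ (by omega)]
    simp (disch := omega) only [Function.update_self, Function.update_of_ne]
  · rw [hcell _ (by omega)]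
    simp (disch := omega) only [Function.update_self, Function.update_of_ne]

theorem push2P_spec {W d N h₀ ca S c σ o x rest key pw rl r₁ r₂} (hr : Ready d N h₀ ca S c σ)
    (hb : ColorBase N h₀ ca S) (ho : o < N) (hx : N ≤ x)
    (hxn : x < σ.next) (h10 : σ.reg (d + 10) = .ptr o) (h38 : σ.reg (d + 38) = .ptr x)
    (h39 : σ.reg (d + 39) = rest) (h12 : σ.reg (d + 12) = key) (h21 : σ.reg (d + 21) = pw)
    (h14 : σ.reg (d + 14) = rl) (h23 : σ.reg (d + 23) = r₁) (h24 : σ.reg (d + 24) = r₂) :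
    WP W (push2P d) σ 27 fun σ₁ => Upd (d + 7) (d + 40) {x} σ σ₁ ∧
      Ready d N h₀ ca S c σ₁ ∧ σ₁.next = σ.next + 4 ∧ σ₁.cell x 0 = .ptr σ.next ∧
      σ₁.cell x 1 = .ptr (σ.next + 1) ∧ σ₁.reg (d + 39) = .ptr (σ.next + 3) ∧
      IsTask σ₁.cell (σ.next + 3) (h₀ o 0) σ.next (.ptr (σ.next + 2)) r₁ key pw rl ∧
      IsTask σ₁.cell (σ.next + 2) (h₀ o 1) (σ.next + 1) rest r₂ key pw rl := by
  have hle := hr.le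
  have ho' : o < σ.next := by omega
  have ho0 := hr.agree o ho 0 (by omega)
  have ho1 := hr.agree o ho 1 (by omega)
  have hx1 : x < σ.next + 1 + 1 := by omega
  refine WP.le (T := 7 + (10 + 10)) (WP.seq (WP.le (WP.blk (is := _ ++ _) ?_)
    (by simp [length_mk]))) le_rfl
  rw [execL_append]
  simp (disch := omega) only [execL, Instr.exec, State.set, Function.update_self,
      Function.update_of_ne, if_pos, Option.bind_some, Option.some.injEq, exists_eq_left', if_true,
      row, h10, ho', ho0, ho1]
  rw [execL_mk_append (by simp), execL_mk_append (by simp)]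
  simp (disch := omega) only [execL, Instr.exec, State.set, Function.update_self,
      Function.update_of_ne, if_pos, Option.bind_some, Option.some.injEq, exists_eq_left', if_true,
      row, h38, hx1]
  refine WP.seq ((pushTaskP_spec (old := h₀ o 1) (x := σ.next + 1) (role := r₂) (rest := rest)
    (key := key) (pw := pw) (rl := rl) ?_ ?_ ?_ (by omega) (by omega) (by omega) ?_ ?_ ?_
    ?_).conseq ?_)
  · simp (disch := omega) only [Function.update_self, Function.update_of_ne]
  · simp (disch := omega) only [Function.update_self, Function.update_of_ne]
  · simp (disch := omega) only [Function.update_self, Function.update_of_ne, h24]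
  · simp (disch := omega) only [Function.update_self, Function.update_of_ne, h39]
  · simp (disch := omega) only [Function.update_self, Function.update_of_ne, h12]
  · simp (disch := omega) only [Function.update_self, Function.update_of_ne, h21]
  · simp (disch := omega) only [Function.update_self, Function.update_of_ne, h14]
  dsimp only
  rintro σ₁ ⟨hn, ho, e39, hreg, hcell, ht⟩
  refine (pushTaskP_spec (old := h₀ o 0) (x := σ.next) (role := r₁) (rest := .ptr (σ.next + 2))
    (key := key) (pw := pw) (rl := rl) ?_ ?_ ?_ (by omega) (by omega) (by omega) ?_ ?_ ?_
    ?_).conseq ?_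
  · rw [hreg _ (by omega) (by omega)]; simp (disch := omega) only [Function.update_self, Function.update_of_ne]
  · rw [hreg _ (by omega) (by omega)]; simp (disch := omega) only [Function.update_self, Function.update_of_ne]
  · rw [hreg _ (by omega) (by omega)]; simp (disch := omega) only [Function.update_self, Function.update_of_ne, h23]
  · exact e39
  · rw [hreg _ (by omega) (by omega)]; simp (disch := omega) only [Function.update_self, Function.update_of_ne, h12]
  · rw [hreg _ (by omega) (by omega)]; simp (disch := omega) only [Function.update_self, Function.update_of_ne, h21]
  · rw [hreg _ (by omega) (by omega)]; simp (disch := omega) only [Function.update_self, Function.update_of_ne, h14]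
  rw [hn]
  rintro σ₂ ⟨hn2, ho2, e39', hreg2, hcell2, ht2⟩
  have hg1 : Upd (d + 7) (d + 40) {x} σ σ₂ := by
    refine ⟨by omega, fun b hb hbx f hf => ?_, ho2.trans ho, fun r hr => ?_⟩
    · rw [Set.mem_singleton_iff] at hbx
      rw [hcell2 b (by omega), hcell b (by omega)]
      simp (disch := omega) only [Function.update_self, Function.update_of_ne]
    · rw [hreg2 r (by omega) (by omega), hreg r (by omega) (by omega)]
      simp (disch := omega) only [Function.update_self, Function.update_of_ne]
  refine ⟨hg1, hr.upd hg1 hx fun c hc => ?_, by omega, ?_, ?_, e39', ht2, ht.congr fun f _ => ?_⟩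
  · have := hb.lt c hc
    rw [hcell2 _ (by omega), hcell _ (by omega)]
    simp (disch := omega) only [Function.update_self, Function.update_of_ne]; exact hr.zero c hc
  · rw [hcell2 _ (by omega), hcell _ (by omega)]
    simp (disch := omega) only [Function.update_self, Function.update_of_ne]
  · rw [hcell2 _ (by omega), hcell _ (by omega)]
    simp (disch := omega) only [Function.update_self, Function.update_of_ne]
  · rw [hcell2 _ (by omega)]

/-- Carry out a task that has been loaded from the stack. -/
def loadedP (d : ℕ) : Prog :=
  .branch (.le (d + 15) (d + 4)) (bitInsP d)
    (.branch (.le (d + 15) (d + 5)) (leafInsP d) (.seq (blk [.move (d + 20) (d + 10)]) (weightP d)))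

/-- A task has been loaded from the stack. -/
structure Loaded (d : ℕ) (σ : State) (old : Val) (x : ℕ) (rest role key pw rl kind : Val) :
    Prop where
  old : σ.reg (d + 10) = old
  dst : σ.reg (d + 38) = .ptr x
  rest : σ.reg (d + 39) = rest
  role : σ.reg (d + 11) = role
  key : σ.reg (d + 12) = key
  pw : σ.reg (d + 13) = pw
  rl : σ.reg (d + 14) = rl
  kind : σ.reg (d + 15) = kind

/-- The `12` pays for loading a task (eight instructions and the closing `skip`) and for one
iteration of the loop. The hypothesis asks for the remainder of the task, dispatched by the kind of
level that its description shows. -/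
theorem Goes.pop {W d N h₀ ca S c σ a old x rest role key rl b cost Φ}
    {R : Set ℕ → (ℕ → ℕ → Val) → Val → ℕ → Prop} (hW : 1 ≤ W) (hr : Ready d N h₀ ca S c σ)
    (h39 : σ.reg (d + 39) = .ptr a) (ha : a < σ.next)
    (ht : IsTask σ.cell a old x rest role key (.ptr b) rl) (hb : b < N)
    (H : ∀ σ₁, Ready d N h₀ ca S c σ₁ → σ₁.next = σ.next →
      Loaded d σ₁ old x rest role key (.ptr b) rl (h₀ b 2) → ∃ T c' Φ₁,
          T + c' + Φ₁ + 12 ≤ cost + Φ ∧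
      WP W (loadedP d) σ₁ T fun σ₂ => Goes W d N ca S σ₁ σ₂ x rest c' Φ₁ R) :
    Goes W d N ca S σ σ x rest cost Φ R := by
  have hle := hr.le
  have hb' : b < σ.next := by omega
  have hb2 := hr.agree b hb 2 (by omega)
  obtain ⟨e0, e1, e2, e3, e4, e5, e6⟩ := ht
  have hload : ∃ σ₁, execL W [.load (d + 10) (d + 39) 0, .load (d + 38) (d + 39) 1,
      .load (d + 11) (d + 39) 3, .load (d + 12) (d + 39) 4, .load (d + 13) (d + 39) 5,
      .load (d + 14) (d + 39) 6, .load (d + 39) (d + 39) 2, .load (d + 15) (d + 13) 2]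
      (σ.set (d + 7) (.num 1)) = some σ₁ ∧ Upd (d + 7) (d + 40) ∅ σ σ₁ ∧ σ₁.next = σ.next ∧
      σ₁.cell = σ.cell ∧ Loaded d σ₁ old x rest role key (.ptr b) rl (h₀ b 2) := by
    simp (disch := omega) only [execL, Instr.exec, State.set, Function.update_self,
      Function.update_of_ne, if_pos, Option.bind_some, Option.some.injEq, exists_eq_left', if_true,
      row, h39, ha, e0, e1, e2, e3, e4, e5, e6, hb', hb2]
    refine ⟨⟨le_rfl, fun _ _ _ _ _ => rfl, rfl, fun r hr => ?_⟩, trivial, trivial, ⟨?_, ?_, ?_, ?_,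
        ?_, ?_,
      ?_, ?_⟩⟩
    all_goals simp (disch := omega) only [Function.update_self, Function.update_of_ne]
  obtain ⟨σ₁, hex, hg, hn, hcell, hl⟩ := hload
  have hr1 : Ready d N h₀ ca S c σ₁ := hr.upd (x := N) (hg.mono le_rfl le_rfl (Set.empty_subset _)) le_rfl
    (by rw [hcell]; exact hr.zero)
  obtain ⟨T, c', Φ₁, hT, t, σ₂, htT, hrun, T₂, Φ', σ₃, hT₂, hg3, h39', hz, hR,
      hgo⟩ := H σ₁ hr1 hn hl
  rw [hn] at hR
  refine ⟨9 + t + T₂ + 3, Φ', σ₃, by omega, (hg.mono le_rfl le_rfl (Set.empty_subset _)).trans hg3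
    (by simp), h39', hz, hR, fun T' Q h => ?_⟩
  refine WP.le (T := (9 + t) + (T₂ + T') + 3) ?_ (by omega)
  refine WP.while_ptr hW h39 hr.consts.one hr.consts.nil (WP.seq ?_)
  exact WP.blk (is := [_, _, _, _, _, _, _, _]) ⟨σ₁, hex, t, σ₂, le_rfl, hrun, hgo _ _ h⟩

/-! ### Inserting a point into nested tries -/

/-- The ranks of the point `p` in a linked list. -/
def RankList (N : ℕ) (h : ℕ → ℕ → Val) (rk : ℕ → ℕ → ℕ) (p : ℕ) : ℕ → Val → Prop
  | 0, v => ∃ a < N, v = .ptr a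
  | m + 1, v => ∃ a < N, v = .ptr a ∧ h a 0 = .num (rk m p) ∧ RankList N h rk p m (h a 1)

/-- The counters and the colours suffice for the points in `M`. -/
def Fits (W : ℕ) (S : Set ℕ) (col : ℕ → ℕ) (M : Multiset ℕ) : Prop := M.card ≤ W ∧ ∀ j ∈ M,
    col j ∈ S

theorem Fits.mono {W S col M M'} (H : Fits W S col M) (h : M' ≤ M) : Fits W S col M' :=
  ⟨(Multiset.card_le_card h).trans H.1, fun j hj => H.2 j (Multiset.mem_of_le h hj)⟩

/-- A non-empty list of levels that ends with a block leaf. -/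
def Closed : List (Option ℕ) → Prop
  | [] => False
  | none :: ls => ls = [] ∨ Closed ls
  | some _ :: ls => Closed ls

theorem trieR_stable {κ ca col rk ls' m ls o A B} : Stable fun V h v Φ =>
    IsTrie V h (IsDom κ V h ca col rk ls' m) (rk m) ls o v A B Φ :=
  fun _ _ _ _ _ _ hV hh H => H.mono hV hh fun _ _ _ => IsDom.mono hV hh _ _ _

theorem domR_stable {κ ca col rk ls m A} : Stable fun V h v Φ =>
    IsDom κ V h ca col rk ls m v A Φ := fun _ _ _ _ _ _ hV hh H => IsDom.mono hV hh _ _ _ H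

section

variable {κ W d N : ℕ} {h₀ : ℕ → ℕ → Val} {ca col : ℕ → ℕ} {S : Set ℕ} {rk : ℕ → ℕ → ℕ}
  {ls' : List (Option ℕ)} {p : ℕ}

/-- The point `p` can be inserted into a structure of `m` tries in about `cost` steps. -/
def DomIns (κ W d N : ℕ) (h₀ : ℕ → ℕ → Val) (ca col : ℕ → ℕ) (S : Set ℕ) (rk : ℕ → ℕ → ℕ)
    (ls' : List (Option ℕ)) (p m cost : ℕ) : Prop :=
  ∀ σ a old x rest r pw Φ A, Ready d N h₀ ca S (col p) σ → σ.reg (d + 39) = .ptr a → a < σ.next →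
    r < N → RankList N h₀ rk p m (.ptr r) →
    IsTask σ.cell a old x rest (.num 1) (h₀ r 0) pw (h₀ r 1) → IsDesc N h₀ ls' m pw →
    IsDom κ (Set.Iio N) h₀ ca col rk ls' m old A Φ → Fits W S col (p ::ₘ A) → N ≤ x → x < σ.next →
    Goes W d N ca S σ σ x rest cost Φ fun V h v Φ => IsDom κ V h ca col rk ls' m v (p ::ₘ A) Φ

/-- The innermost case: the amortised `κ + 100` of `weightP_spec` plus the overhead of popping and
dispatching the task. -/
theorem weight_domIns (hW : 1 ≤ W) (hκ : 60 ≤ κ) (hb : ColorBase N h₀ ca S) :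
    DomIns κ W d N h₀ ca col S rk ls' p 0 (κ + 120) := by
  intro σ a old x rest r pw Φ A hr h39 ha _ _ ht ⟨b, hbN, hpw, hk⟩ hdom hfit hx hxn
  subst hpw
  refine Goes.pop hW hr h39 ha ht hbN fun σ₁ hr1 hn hl => ?_
  have hag := hr1.agree
  obtain ⟨T, Φ', hT, hwp⟩ := weightP_spec (W := W) (σ := σ₁.set (d + 20) old) (p := p) (x := x) (N := N)
    hκ (hr1.consts.set (by omega)) hx
    (by rw [← hn] at hxn; exact hxn) (hb.mono le_rfl hag) (by simp [State.set])
    (by simpa [State.set] using hl.dst) (by simpa [State.set] using hr1.color) hfit.2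
    (by simpa using hfit.1) (hdom.mono subset_rfl fun b hb f hf => hag b hb f hf) hr1.zero
  refine ⟨1 + 1 + (2 + T), 0, Φ', by omega, ?_⟩
  refine WP.le (T := (2 + T) + 1 + 1) ?_ (by omega)
  have h4 := hr1.consts.zero
  have h5 := hr1.consts.one
  refine WP.branch (b := false) (by simp [eval_le, hl.kind, hk, h4, leVal]) (by simp) fun _ => ?_
  refine WP.branch (b := false) (by simp [eval_le, hl.kind, hk, h5, leVal]) (by simp) fun _ => ?_
  refine WP.seq (WP.blk (is := [_]) ⟨σ₁.set (d + 20) old, by simp [execL, Instr.exec, hl.old], ?_⟩)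
  refine hwp.conseq fun σ₂ ⟨hg, hz, hR⟩ => ?_
  have hg' := (Upd.of_set (X := {x}) (σ := σ₁) (v := old) (by omega : d + 7 ≤ d + 20)
    (by omega : d + 20 < d + 40)).trans (hg.mono le_rfl (by omega) le_rfl) (fun a h _ => h)
  refine ⟨0, Φ', σ₂, by omega, hg', ?_, hz, hR, fun T' Q h => by simpa using h⟩
  rw [hg.reg_eq _ (by omega)]
  simpa [State.set] using hl.rest

/-- The cost to add a point to the prefix of a trie, when it takes `c` steps to insert it into one
of the structures at the block leaves. -/
def prefixCost (c : ℕ) : List (Option ℕ) → ℕ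
  | [] => 0
  | none :: _ => c + 60
  | some _ :: ls => 2 * prefixCost c ls + 60

/-- The cost to insert a point into a trie, when it takes `c` steps to insert it into one
of the structures at the block leaves. -/
def trieCost (c : ℕ) : List (Option ℕ) → ℕ
  | [] => 0
  | none :: ls => trieCost c ls + 60
  | some _ :: ls => trieCost c ls + prefixCost c ls + 60

/-- Here the point precedes the whole part of the trie within the current block. It must therefore
be added at every leaf of the block below, and the recursion branches to both children. It stops at
the block leaves, since the next block starts with no preceding points; what lies below such a leaf
is shared with the old version. -/
theorem prefix_ins {m cD} (hW : 1 ≤ W) (hb : ColorBase N h₀ ca S)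
    (hD : DomIns κ W d N h₀ ca col S rk ls' p m cD) {ls} : ∀ {σ a old x rest key r pw Φ o A B},
    Closed ls → Ready d N h₀ ca S (col p) σ → σ.reg (d + 39) = .ptr a → a < σ.next →
    r < N → RankList N h₀ rk p m (.ptr r) →
    IsTask σ.cell a old x rest (.num 0) key pw (.ptr r) →
    IsLevels N h₀ (IsDesc N h₀ ls' m) ls pw →
    IsTrie (Set.Iio N) h₀ (IsDom κ (Set.Iio N) h₀ ca col rk ls' m) (rk m) ls o old A B Φ →
    Fits W S col (p ::ₘ (A + B)) → N ≤ x → x < σ.next →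
    Goes W d N ca S σ σ x rest (prefixCost cD ls) Φ fun V h v Φ =>
      IsTrie V h (IsDom κ V h ca col rk ls' m) (rk m) ls o v (p ::ₘ A) B Φ := by
  induction ls with
  | nil => exact fun h => h.elim
  | cons w ls ih =>
    intro σ a old x rest key r pw Φ o A B hls hr h39 ha hrN hrl ht hlev htr hfit hx hxn
    cases w with
    | none =>
      obtain ⟨b, hbN, rfl, hk, hdesc, hlev'⟩ := hlev
      obtain ⟨q, hq, rfl, Φ₁, Φ₂, rfl, h1, h2⟩ := htr
      have hq' := Set.mem_Iio.1 hq
      refine Goes.pop hW hr h39 ha ht hbN fun σ₁ hr1 hn hl => ⟨1 + 1 + (2 + 1 + (4 + 16)), cD,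
        Φ₂ + Φ₁, by rw [prefixCost]; omega, ?_⟩
      have h4 := hr1.consts.zero
      have h5 := hr1.consts.one
      have hle := hr1.le
      refine WP.le (T := (2 + (4 + 16 + 1)) + 1 + 1) ?_ (by omega)
      refine WP.branch (b := false) (by simp [eval_le, hl.kind, hk, h4,
          leVal]) (by simp) fun _ => ?_
      refine WP.branch (b := true) (by simp [eval_le, hl.kind, hk, h5,
          leVal]) (fun _ => ?_) (by simp)
      refine WP.seq (WP.blk (is := [_]) ?_)
      have hb' : b < σ₁.next := by omega
      have hr' : r < σ₁.next := by omega
      simp (disch := omega) only [execL, Instr.exec, State.set, Function.update_self,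
      Function.update_of_ne, if_pos, Option.bind_some, Option.some.injEq, exists_eq_left', if_true,
      row, hl.pw, hb']
      refine WP.branch (b := true) ?_ (fun _ => ?_) (by simp)
      · rw [eval_le]; simp (disch := omega) only [Function.update_self, Function.update_of_ne,
            hl.role, h4, leVal]; simp
      refine WP.le (WP.seq (T' := 16) (WP.blk (is := [_, _, _]) ?_)) (by simp)
      simp (disch := omega) only [execL, Instr.exec, State.set, Function.update_self,
      Function.update_of_ne, if_pos, Option.bind_some, Option.some.injEq, exists_eq_left', if_true,
      row, hl.pw, hl.rl, hb', hr', hr1.agree b hbN 3, hr1.agree r hrN 0, hr1.agree r hrN 1]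
      set σ₂ : State := ⟨_, _, σ₁.next, _⟩ with hσ₂
      have hg2 : Upd (d + 7) (d + 40) ∅ σ₁ σ₂ := ⟨le_rfl, fun _ _ _ _ _ => rfl, rfl, fun r hr => by
        simp (disch := omega) only [Function.update_self, Function.update_of_ne, hσ₂]⟩
      have hr2 : Ready d N h₀ ca S (col p) σ₂ := hr1.upd (x := N)
        (hg2.mono le_rfl le_rfl (Set.empty_subset _)) le_rfl hr1.zero
      refine (push1P_spec (rest := rest) (key := h₀ r 0) (pw := h₀ b 3) (rl := h₀ r 1)
        hr2 hb (.inr ⟨rfl, rfl⟩) hq' hx (hn ▸ hxn) ?_ ?_ ?_ ?_ ?_ ?_).conseq ?_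
      · simp (disch := omega) only [Function.update_self, Function.update_of_ne, hσ₂]; exact hl.old
      · simp (disch := omega) only [Function.update_self, Function.update_of_ne, hσ₂]; exact hl.dst
      · simp (disch := omega) only [Function.update_self, Function.update_of_ne, hσ₂]; exact hl.rest
      · simp (disch := omega) only [Function.update_self, Function.update_of_ne, hσ₂]
      · simp (disch := omega) only [Function.update_self, Function.update_of_ne, hσ₂]
      · simp (disch := omega) only [Function.update_self, Function.update_of_ne, hσ₂]
      rintro σ₃ ⟨hg3, hr3, hn3, e1, e0, e39, ht3⟩
      have hn2 : σ₂.next = σ₁.next := rfl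
      have hg3' := (hg2.mono le_rfl le_rfl (Set.empty_subset {x})).trans hg3 (fun a h _ => h)
      refine Goes.one (hn ▸ hxn) hle hg3' (y := σ₁.next) (by omega) le_rfl (g := 0) (by omega) e0 hr3
        (hD _ _ _ _ _ r _ _ _ hr3 e39 (by omega) hrN hrl ht3 hdesc h1 (hfit.mono ?_) hle
          (by omega)) domR_stable ?_
      · exact Multiset.cons_le_cons _ (Multiset.le_add_right _ _)
      · intro V h Φ' hxV hNV hag hxx hR
        refine ⟨x, hxV, rfl, Φ', Φ₂, add_comm _ _, hR, ?_⟩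
        rw [hxx 1 (by omega), e1]
        exact trieR_stable _ _ _ _ _ _ hNV (fun a ha f hf => hag a ha f hf) h2
    | some w =>
      obtain ⟨b, hbN, rfl, hw, hk, hlev'⟩ := hlev
      obtain ⟨q, hq, rfl, Φ₁, Φ₂, rfl, h1, h2⟩ := htr
      have hq' := Set.mem_Iio.1 hq
      refine Goes.pop hW hr h39 ha ht hbN fun σ₁ hr1 hn hl => ⟨1 + (4 + (2 + 27 + 1)),
        prefixCost cD ls + prefixCost cD ls, Φ₁ + Φ₂, by rw [prefixCost]; omega, ?_⟩
      have h4 := hr1.consts.zero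
      have hle := hr1.le
      refine WP.le (T := (4 + (2 + 27 + 1)) + 1) ?_ (by omega)
      refine WP.branch (b := true) (by simp [eval_le, hl.kind, hk, h4,
          leVal]) (fun _ => ?_) (by simp)
      refine WP.seq (WP.blk (is := [_, _, _]) ?_)
      have hb' : b < σ₁.next := by omega
      simp (disch := omega) only [execL, Instr.exec, State.set, Function.update_self,
      Function.update_of_ne, if_pos, Option.bind_some, Option.some.injEq, exists_eq_left', if_true,
      row, hl.pw, hb', hr1.agree b hbN 1, hr1.agree b hbN 0, h4]
      refine WP.branch (b := true) ?_ (fun _ => ?_) (by simp)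
      · rw [eval_le]; simp (disch := omega) only [Function.update_self, Function.update_of_ne,
            hl.role, h4, leVal]; simp
      refine WP.le (WP.seq (T' := 27) (WP.blk (is := [_]) ?_)) (by simp)
      simp (disch := omega) only [execL, Instr.exec, State.set, Function.update_self,
      Function.update_of_ne, if_pos, Option.bind_some, Option.some.injEq, exists_eq_left', if_true,
      row, h4]
      set σ₂ : State := ⟨_, _, σ₁.next, _⟩ with hσ₂
      have hg2 : Upd (d + 7) (d + 40) ∅ σ₁ σ₂ := ⟨le_rfl, fun _ _ _ _ _ => rfl, rfl, fun r hr => by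
        simp (disch := omega) only [Function.update_self, Function.update_of_ne, hσ₂]⟩
      have hr2 : Ready d N h₀ ca S (col p) σ₂ := hr1.upd (x := N)
        (hg2.mono le_rfl le_rfl (Set.empty_subset _)) le_rfl hr1.zero
      refine (push2P_spec (rest := rest) (key := key) (pw := h₀ b 1) (rl := .ptr r) (r₁ := .num 0)
        (r₂ := .num 0) hr2 hb hq' hx (hn ▸ hxn) ?_ ?_ ?_ ?_ ?_ ?_ ?_ ?_).conseq ?_
      · simp (disch := omega) only [Function.update_self, Function.update_of_ne, hσ₂]; exact hl.old
      · simp (disch := omega) only [Function.update_self, Function.update_of_ne, hσ₂]; exact hl.dst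
      · simp (disch := omega) only [Function.update_self, Function.update_of_ne, hσ₂]; exact hl.rest
      · simp (disch := omega) only [Function.update_self, Function.update_of_ne, hσ₂]; exact hl.key
      · simp (disch := omega) only [Function.update_self, Function.update_of_ne, hσ₂]
      · simp (disch := omega) only [Function.update_self, Function.update_of_ne, hσ₂]; exact hl.rl
      · simp (disch := omega) only [Function.update_self, Function.update_of_ne, hσ₂]
      · simp (disch := omega) only [Function.update_self, Function.update_of_ne, hσ₂]
      rintro σ₃ ⟨hg3, hr3, hn3, e0, e1, e39, ht3, ht4⟩
      have hn2 : σ₂.next = σ₁.next := rfl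
      have hg3' := (hg2.mono le_rfl le_rfl (Set.empty_subset {x})).trans hg3 (fun a h _ => h)
      refine Goes.two (hn ▸ hxn) hle hg3' hr3 (y := σ₁.next) (z := σ₁.next + 1) (i := σ₁.next + 2) le_rfl (by omega)
        (by omega) (by omega) (by omega) (by omega) (by omega) e0 e1 ht4
        (ih hls hr3 e39 (by omega) hrN hrl ht3 hlev' h1 (hfit.mono ?_) hle (by omega))
        (fun σ₄ hr4 h39 hi ht hz => ih hls hr4 h39 hi hrN hrl ht hlev' h2 (hfit.mono ?_) (by omega) hz)
        trieR_stable trieR_stable ?_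
      · refine Multiset.cons_le_cons _ (add_le_add_right (Multiset.filter_le _ _) _)
      · rw [add_assoc, Multiset.filter_add_not]
      · intro V h Φ₁' Φ₂' hxV hR1 hR2
        exact ⟨x, hxV, rfl, Φ₁', Φ₂', rfl, hR1, by simpa using hR2⟩

/-- The point is followed to its position. On a turn to the left it precedes everything in the right
sibling, which is handled by `prefix_ins`; on a turn to the right the left sibling is unaffected. A
block leaf on the path keeps its own structure, because a point does not precede itself. -/
theorem trie_ins {m cD} (hW : 1 ≤ W) (hb : ColorBase N h₀ ca S)
    (hD : DomIns κ W d N h₀ ca col S rk ls' p m cD) {ls} : ∀ {σ a old x rest r pw Φ o A B},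
    Closed ls → Ready d N h₀ ca S (col p) σ → σ.reg (d + 39) = .ptr a → a < σ.next →
    r < N → RankList N h₀ rk p m (.ptr r) → o ≤ rk m p →
    IsTask σ.cell a old x rest (.num 1) (.num (rk m p - o)) pw (.ptr r) →
    IsLevels N h₀ (IsDesc N h₀ ls' m) ls pw →
    IsTrie (Set.Iio N) h₀ (IsDom κ (Set.Iio N) h₀ ca col rk ls' m) (rk m) ls o old A B Φ →
    Fits W S col (p ::ₘ (A + B)) → N ≤ x → x < σ.next →
    Goes W d N ca S σ σ x rest (trieCost cD ls) Φ fun V h v Φ =>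
      IsTrie V h (IsDom κ V h ca col rk ls' m) (rk m) ls o v A (p ::ₘ B) Φ := by
  induction ls with
  | nil => exact fun h => h.elim
  | cons w ls ih =>
    intro σ a old x rest r pw Φ o A B hls hr h39 ha hrN hrl hop ht hlev htr hfit hx hxn
    cases w with
    | none =>
      obtain ⟨b, hbN, rfl, hk, hdesc, hlev'⟩ := hlev
      obtain ⟨q, hq, rfl, Φ₁, Φ₂, rfl, h1, h2⟩ := htr
      have hq' := Set.mem_Iio.1 hq
      refine Goes.pop hW hr h39 ha ht hbN fun σ₁ hr1 hn hl => ⟨1 + 1 + (2 + 1 + (1 + 16)),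
        trieCost cD ls, Φ₁ + Φ₂, by rw [trieCost]; omega, ?_⟩
      have h4 := hr1.consts.zero
      have h5 := hr1.consts.one
      have h6 := hr1.consts.nil
      have hle := hr1.le
      refine WP.le (T := (2 + (16 + 1 + 1)) + 1 + 1) ?_ (by omega)
      refine WP.branch (b := false) (by simp [eval_le, hl.kind, hk, h4,
          leVal]) (by simp) fun _ => ?_
      refine WP.branch (b := true) (by simp [eval_le, hl.kind, hk, h5,
          leVal]) (fun _ => ?_) (by simp)
      refine WP.seq (WP.blk (is := [_]) ?_)
      have hb' : b < σ₁.next := by omega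
      have hq1 : q < σ₁.next := by omega
      have hx1 : x < σ₁.next := by omega
      simp (disch := omega) only [execL, Instr.exec, State.set, Function.update_self,
      Function.update_of_ne, if_pos, Option.bind_some, Option.some.injEq, exists_eq_left', if_true,
      row, hl.pw, hb', hr1.agree b hbN 1]
      refine WP.branch (b := false) ?_ (by simp) (fun _ => ?_)
      · rw [eval_le]; simp (disch := omega) only [Function.update_self, Function.update_of_ne,
            hl.role, h4, leVal]; simp
      set σ₂ : State := ⟨_, _, σ₁.next, _⟩ with hσ₂
      have hg2 : Upd (d + 7) (d + 40) ∅ σ₁ σ₂ := ⟨le_rfl, fun _ _ _ _ _ => rfl, rfl, fun r hr => by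
        simp (disch := omega) only [Function.update_self, Function.update_of_ne, hσ₂]⟩
      have hr2 : Ready d N h₀ ca S (col p) σ₂ := hr1.upd (x := N)
        (hg2.mono le_rfl le_rfl (Set.empty_subset _)) le_rfl hr1.zero
      have e21 : σ₂.reg (d + 21) = h₀ b 1 := by
        simp (disch := omega) only [Function.update_self, Function.update_of_ne, hσ₂]
      have e6 : σ₂.reg (d + 6) = .nil := hr2.consts.nil
      have e10 : σ₂.reg (d + 10) = .ptr q := by
        simp (disch := omega) only [Function.update_self, Function.update_of_ne, hσ₂]; exact hl.old
      have e38 : σ₂.reg (d + 38) = .ptr x := by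
        simp (disch := omega) only [Function.update_self, Function.update_of_ne, hσ₂]; exact hl.dst
      have e39' : σ₂.reg (d + 39) = rest := by
        simp (disch := omega) only [Function.update_self, Function.update_of_ne, hσ₂]; exact hl.rest
      -- At the very bottom there is no trie to descend into. The copied cell keeps field `0` and
      -- its other field stays `nil`; this is correct because nothing is required of the address of
      -- a part without levels.
      by_cases hnil : ls = []
      · subst hnil
        refine WP.branch (b := true) (by rw [eval_same, e21, e6, hlev']; rfl) (fun _ => ?_) (by simp)
        refine WP.le (WP.blk (is := [_, _]) ?_) (by simp)
        have hq2 : q < σ₂.next := hq1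
        have hx2 : x < σ₂.next := hx1
        simp (disch := omega) only [execL, Instr.exec, State.set, Function.update_self,
      Function.update_of_ne, if_pos, Option.bind_some, Option.some.injEq, exists_eq_left', if_true,
      row, e10, e38, hq2, hx2, hr2.agree q hq' 0]
        set σ₃ : State := ⟨_, _, σ₂.next, _⟩ with hσ₃
        have hg3 : Upd (d + 7) (d + 40) {x} σ₂ σ₃ := by
          refine ⟨le_rfl, fun b hb hbx f hf => ?_, rfl,
              fun r hr => by simp (disch := omega) only [Function.update_self,
              Function.update_of_ne, hσ₃]⟩
          rw [Set.mem_singleton_iff] at hbx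
          simp (disch := omega) only [Function.update_self, Function.update_of_ne, hσ₃]
        have hg3' := (hg2.mono le_rfl le_rfl (Set.empty_subset {x})).trans hg3 (fun a h _ => h)
        have hz3 : ∀ c ∈ S, σ₃.cell (ca c) 8 = .num 0 := fun c hc => by
          have := hb.lt c hc
          simp (disch := omega) only [Function.update_self, Function.update_of_ne, hσ₃]
          exact hr2.zero c hc
        refine ⟨0, Φ₁ + Φ₂, σ₃, by omega, hg3', ?_, hz3, ⟨x, .inr (.inl rfl), rfl, Φ₁, Φ₂, rfl, ?_,
          ?_⟩, fun T' Q h => by simpa using h⟩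
        · simp (disch := omega) only [Function.update_self, Function.update_of_ne, hσ₃]; exact e39'
        · have : σ₃.cell x 0 = h₀ q 0 := by
            simp (disch := omega) only [Function.update_self, Function.update_of_ne, hσ₃]
          rw [this]
          exact domR_stable _ _ _ _ _ _ (fun a ha => .inl ha) (fun a ha f hf =>
            (hr2.upd hg3 hx hz3).agree a ha f hf) h1
        · exact ⟨rfl, h2.2⟩
      · have hcl : Closed ls := hls.resolve_left hnil
        obtain ⟨b', hb'⟩ : ∃ b', h₀ b 1 = .ptr b' := by
          cases ls with
          | nil => exact absurd rfl hnil
          | cons w ls =>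
            cases w with
            | none => obtain ⟨b', -, h, -⟩ := hlev'; exact ⟨b', h⟩
            | some w => obtain ⟨b', -, h, -⟩ := hlev'; exact ⟨b', h⟩
        refine WP.branch (b := false) (by rw [eval_same, e21, e6, hb']; rfl) (by simp) (fun _ => ?_)
        refine (push1P_spec (rest := rest) (key := .num (rk m p - o)) (pw := h₀ b 1) (rl := .ptr r)
          hr2 hb (.inl ⟨rfl, rfl⟩) hq' hx (hn ▸ hxn) e10 e38 e39' ?_ e21 ?_).conseq ?_
        · simp (disch := omega) only [Function.update_self, Function.update_of_ne,
              hσ₂]; exact hl.key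
        · simp (disch := omega) only [Function.update_self, Function.update_of_ne, hσ₂]; exact hl.rl
        rintro σ₃ ⟨hg3, hr3, hn3, e0, e1, e39, ht3⟩
        have hn2 : σ₂.next = σ₁.next := rfl
        have hg3' := (hg2.mono le_rfl le_rfl (Set.empty_subset {x})).trans hg3 (fun a h _ => h)
        refine Goes.one (hn ▸ hxn) hle hg3' (y := σ₁.next) (by omega) le_rfl (g := 1) (by omega) e1 hr3
          (ih hcl hr3 e39 (by omega) hrN hrl hop ht3 hlev' h2 (hfit.mono ?_) hle (by omega))
          trieR_stable ?_
        · refine Multiset.cons_le_cons _ ?_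
          rw [zero_add]
          exact Multiset.le_add_left _ _
        · intro V h Φ' hxV hNV hag hxx hR
          refine ⟨x, hxV, rfl, Φ₁, Φ', rfl, ?_, hR⟩
          rw [hxx 0 (by omega), e0]
          exact domR_stable _ _ _ _ _ _ hNV (fun a ha f hf => hag a ha f hf) h1
    | some w =>
      obtain ⟨b, hbN, rfl, hw, hk, hlev'⟩ := hlev
      obtain ⟨q, hq, rfl, Φ₁, Φ₂, rfl, h1, h2⟩ := htr
      have hq' := Set.mem_Iio.1 hq
      refine Goes.pop hW hr h39 ha ht hbN fun σ₁ hr1 hn hl => ⟨1 + (4 + (2 + 27 + 1 + 1)),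
        trieCost cD ls + prefixCost cD ls, Φ₁ + Φ₂, by rw [trieCost]; omega, ?_⟩
      have h4 := hr1.consts.zero
      have h5 := hr1.consts.one
      have hle := hr1.le
      refine WP.le (T := (4 + (2 + 27 + 1 + 1)) + 1) ?_ (by omega)
      refine WP.branch (b := true) (by simp [eval_le, hl.kind, hk, h4,
          leVal]) (fun _ => ?_) (by simp)
      refine WP.seq (WP.blk (is := [_, _, _]) ?_)
      have hb' : b < σ₁.next := by omega
      simp (disch := omega) only [execL, Instr.exec, State.set, Function.update_self,
      Function.update_of_ne, if_pos, Option.bind_some, Option.some.injEq, exists_eq_left', if_true,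
      row, hl.pw, hb', hr1.agree b hbN 1, hr1.agree b hbN 0, h4]
      refine WP.branch (b := false) ?_ (by simp) (fun _ => ?_)
      · rw [eval_le]; simp (disch := omega) only [Function.update_self, Function.update_of_ne,
            hl.role, h4, leVal]; simp
      refine WP.branch (b := decide (w ≤ rk m p - o)) ?_ (fun hwle => ?_) (fun hwle => ?_)
      · rw [eval_le]; simp (disch := omega) only [Function.update_self, Function.update_of_ne,
            hl.key, hw, leVal]
      -- Turn to the right: the left child is shared, and the key is made relative to the right
      -- child. The `prefixCost` in the bound is not used here.
      · have hwle : w ≤ rk m p - o := by simpa using hwle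
        refine WP.le (WP.seq (T' := 16) (WP.blk (is := [_]) ?_)) (by simp)
        simp (disch := omega) only [execL, Instr.exec, State.set, Function.update_self,
      Function.update_of_ne, if_pos, Option.bind_some, Option.some.injEq, exists_eq_left', if_true,
      row, hl.key, hw]
        set σ₂ : State := ⟨_, _, σ₁.next, _⟩ with hσ₂
        have hg2 : Upd (d + 7) (d + 40) ∅ σ₁ σ₂ := ⟨le_rfl, fun _ _ _ _ _ => rfl, rfl,
          fun r hr => by simp (disch := omega) only [Function.update_self, Function.update_of_ne,
              hσ₂]⟩
        have hr2 : Ready d N h₀ ca S (col p) σ₂ := hr1.upd (x := N)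
          (hg2.mono le_rfl le_rfl (Set.empty_subset _)) le_rfl hr1.zero
        refine (push1P_spec (rest := rest) (key := .num (rk m p - o - w)) (pw := h₀ b 1)
          (rl := .ptr r) hr2 hb (.inl ⟨rfl, rfl⟩) hq' hx (hn ▸ hxn) ?_ ?_ ?_ ?_ ?_ ?_).conseq ?_
        · simp (disch := omega) only [Function.update_self, Function.update_of_ne,
              hσ₂]; exact hl.old
        · simp (disch := omega) only [Function.update_self, Function.update_of_ne,
              hσ₂]; exact hl.dst
        · simp (disch := omega) only [Function.update_self, Function.update_of_ne,
              hσ₂]; exact hl.rest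
        · simp (disch := omega) only [Function.update_self, Function.update_of_ne, hσ₂]
        · simp (disch := omega) only [Function.update_self, Function.update_of_ne, hσ₂]
        · simp (disch := omega) only [Function.update_self, Function.update_of_ne, hσ₂]; exact hl.rl
        rintro σ₃ ⟨hg3, hr3, hn3, e0, e1, e39, ht3⟩
        have hn2 : σ₂.next = σ₁.next := rfl
        have hg3' := (hg2.mono le_rfl le_rfl (Set.empty_subset {x})).trans hg3 (fun a h _ => h)
        have hlt : ¬ rk m p < o + w := by omega
        have f₁ : (p ::ₘ B).filter (fun j => rk m j < o + w) = B.filter fun j => rk m j < o + w :=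
          Multiset.filter_cons_of_neg _ hlt
        have f₂ : (p ::ₘ B).filter (fun j => ¬ rk m j < o + w) =
          p ::ₘ B.filter fun j => ¬ rk m j < o + w := Multiset.filter_cons_of_pos _ hlt
        rw [Nat.sub_sub] at ht3
        have := Goes.one (R := fun V h v Φ => IsTrie V h (IsDom κ V h ca col rk ls' m) (rk m)
            (some w :: ls) o v A (p ::ₘ B) Φ) (hn ▸ hxn) hle hg3' (y := σ₁.next) (by omega) le_rfl
          (g := 1) (Φ₀ := Φ₁) (by omega) e1 hr3
          (ih hls hr3 e39 (by omega) hrN hrl (by omega) ht3 hlev' h2 (hfit.mono ?_) hle (by omega))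
          trieR_stable ?_
        · obtain ⟨T, Φ', σ', hT, H⟩ := this
          exact ⟨T, Φ', σ', by omega, H⟩
        · refine Multiset.cons_le_cons _ ?_
          rw [add_assoc, Multiset.filter_add_not]
        · intro V h Φ' hxV hNV hag hxx hR
          refine ⟨x, hxV, rfl, Φ₁, Φ', rfl, ?_, ?_⟩
          · rw [hxx 0 (by omega), e0, f₁]
            exact trieR_stable _ _ _ _ _ _ hNV (fun a ha f hf => hag a ha f hf) h1
          · rw [f₁, f₂]
            exact hR
      -- Turn to the left: the left task continues the path (role `1`), the right one adds the point
      -- to prefixes (role `0`).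
      · have hwle : ¬ w ≤ rk m p - o := by simpa using hwle
        refine WP.le (WP.seq (T' := 27) (WP.blk (is := [_]) ?_)) (by simp)
        simp (disch := omega) only [execL, Instr.exec, State.set, Function.update_self,
      Function.update_of_ne, if_pos, Option.bind_some, Option.some.injEq, exists_eq_left', if_true,
      row, h5]
        set σ₂ : State := ⟨_, _, σ₁.next, _⟩ with hσ₂
        have hg2 : Upd (d + 7) (d + 40) ∅ σ₁ σ₂ := ⟨le_rfl, fun _ _ _ _ _ => rfl, rfl,
          fun r hr => by simp (disch := omega) only [Function.update_self, Function.update_of_ne,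
              hσ₂]⟩
        have hr2 : Ready d N h₀ ca S (col p) σ₂ := hr1.upd (x := N)
          (hg2.mono le_rfl le_rfl (Set.empty_subset _)) le_rfl hr1.zero
        refine (push2P_spec (rest := rest) (key := .num (rk m p - o)) (pw := h₀ b 1) (rl := .ptr r)
          (r₁ := .num 1) (r₂ := .num 0) hr2 hb hq' hx (hn ▸ hxn) ?_ ?_ ?_ ?_ ?_ ?_ ?_ ?_).conseq ?_
        · simp (disch := omega) only [Function.update_self, Function.update_of_ne,
              hσ₂]; exact hl.old
        · simp (disch := omega) only [Function.update_self, Function.update_of_ne,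
              hσ₂]; exact hl.dst
        · simp (disch := omega) only [Function.update_self, Function.update_of_ne,
              hσ₂]; exact hl.rest
        · simp (disch := omega) only [Function.update_self, Function.update_of_ne,
              hσ₂]; exact hl.key
        · simp (disch := omega) only [Function.update_self, Function.update_of_ne, hσ₂]
        · simp (disch := omega) only [Function.update_self, Function.update_of_ne, hσ₂]; exact hl.rl
        · simp (disch := omega) only [Function.update_self, Function.update_of_ne, hσ₂]
        · simp (disch := omega) only [Function.update_self, Function.update_of_ne, hσ₂]
        rintro σ₃ ⟨hg3, hr3, hn3, e0, e1, e39, ht3, ht4⟩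
        have hn2 : σ₂.next = σ₁.next := rfl
        have hg3' := (hg2.mono le_rfl le_rfl (Set.empty_subset {x})).trans hg3 (fun a h _ => h)
        have hlt : rk m p < o + w := by omega
        have f₁ : (p ::ₘ B).filter (fun j => rk m j < o + w) =
          p ::ₘ B.filter fun j => rk m j < o + w := Multiset.filter_cons_of_pos _ hlt
        have f₂ : (p ::ₘ B).filter (fun j => ¬ rk m j < o + w) =
          B.filter fun j => ¬ rk m j < o + w := Multiset.filter_cons_of_neg _ (not_not.2 hlt)
        refine Goes.two (hn ▸ hxn) hle hg3' hr3 (y := σ₁.next) (z := σ₁.next + 1)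
          (i := σ₁.next + 2) le_rfl (by omega)
          (by omega) (by omega) (by omega) (by omega) (by omega) e0 e1 ht4
          (ih hls hr3 e39 (by omega) hrN hrl hop ht3 hlev' h1 (hfit.mono ?_) hle (by omega))
          (fun σ₄ hr4 h39 hi ht hz => prefix_ins hW hb hD hls hr4 h39 hi hrN hrl ht hlev' h2
            (hfit.mono ?_) (by omega) hz) trieR_stable trieR_stable ?_
        · refine Multiset.cons_le_cons _ (add_le_add_right (Multiset.filter_le _ _) _)
        · rw [add_assoc, Multiset.filter_add_not]
        · intro V h Φ₁' Φ₂' hxV hR1 hR2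
          refine ⟨x, hxV, rfl, Φ₁', Φ₂', rfl, ?_, ?_⟩
          · rw [f₁]; exact hR1
          · rw [f₁, f₂]
            simpa using hR2

/-- The cost to insert a point into a structure of `m` tries. -/
def domCost (κ : ℕ) (ls : List (Option ℕ)) : ℕ → ℕ
  | 0 => κ + 120
  | m + 1 => trieCost (domCost κ ls m) ls

/-- A structure of `m + 1` tries is a trie whose block leaves hold structures of `m` tries, so
`trie_ins` turns the cost for `m` into that for `m + 1`. -/
theorem dom_ins (hW : 1 ≤ W) (hκ : 60 ≤ κ) (hb : ColorBase N h₀ ca S) (hls : Closed ls') (m : ℕ) :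
    DomIns κ W d N h₀ ca col S rk ls' p m (domCost κ ls' m) := by
  induction m with
  | zero => exact weight_domIns hW hκ hb
  | succ m ih =>
    intro σ a old x rest r pw Φ A hr h39 ha hrN ⟨r', hr', e, e0, hrl⟩ ht hdesc hdom hfit hx hxn
    obtain rfl : r' = r := by injection e with e; exact e.symm
    -- The remaining rank list is an address even when no rank is left, thanks to the cell that ends
    -- it.
    obtain ⟨r₁, hr₁, e1⟩ : ∃ r₁ < N, h₀ r' 1 = .ptr r₁ := by
      cases m with
      | zero => obtain ⟨a, ha, h⟩ := hrl; exact ⟨a, ha, h⟩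
      | succ m => obtain ⟨a, ha, h, -⟩ := hrl; exact ⟨a, ha, h⟩
    rw [e0, e1] at ht
    rw [e1] at hrl
    exact trie_ins hW hb ih hls hr h39 ha hr₁ hrl (Nat.zero_le _) ht hdesc hdom (by simpa using hfit)
      hx hxn

end

theorem RankList.mono {N N' h h' rk p m} (hN : N ≤ N') (hh : Agree N h h') : ∀ {v},
    RankList N h rk p m v → RankList N' h' rk p m v := by
  induction m with
  | zero => rintro v ⟨a, ha, hv⟩; exact ⟨a, ha.trans_le hN, hv⟩
  | succ m ih =>
    rintro v ⟨a, ha, hv, h0, h1⟩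
    refine ⟨a, ha.trans_le hN, hv, ?_, ?_⟩
    · rwa [hh a ha _ (by omega)]
    · rw [hh a ha _ (by omega)]; exact ih h1

/-! ### The sweep over all points -/

/-- For each tail of `l`, `root` gives a structure for the points in it. -/
def Roots (κ : ℕ) (V : Set ℕ) (h : ℕ → ℕ → Val) (ca col : ℕ → ℕ) (rk : ℕ → ℕ → ℕ)
    (ls : List (Option ℕ)) (m : ℕ) (root : ℕ → Val) : List ℕ → Prop
  | [] => True
  | j :: l => (∃ Φ, IsDom κ V h ca col rk ls m (root j) (↑(j :: l) : Multiset ℕ) Φ) ∧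
      Roots κ V h ca col rk ls m root l

theorem Roots.mono {κ V V' h h' ca col rk ls m root root' l} (hV : V ⊆ V') (hh : AgreeOn V h h')
    (hr : ∀ j ∈ l, root' j = root j) (H : Roots κ V h ca col rk ls m root l) :
    Roots κ V' h' ca col rk ls m root' l := by
  induction l with
  | nil => trivial
  | cons j l ih =>
    obtain ⟨⟨Φ, h1⟩, h2⟩ := H
    refine ⟨⟨Φ, ?_⟩, ih (fun i hi => hr i (by simp [hi])) h2⟩
    rw [hr j (by simp)]
    exact IsDom.mono hV hh _ _ _ h1

/-- Insert the points of the list in `d + 41` one after the other into the structure in `d + 43`;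
the records with pointers to the structures are put in front of the list in `d + 42`. -/
def insertAllP (d : ℕ) : Prog :=
  whileNe d (d + 41) (.seq (blk [.load (d + 8) (d + 41) 0, .load (d + 9) (d + 41) 1,
    .load (d + 40) (d + 41) 3, .load (d + 14) (d + 41) 4, .load (d + 41) (d + 41) 2,
    .load (d + 12) (d + 14) 0, .load (d + 15) (d + 14) 1])
  (.seq (blk (mk (d + 10) [] ++ (mk (d + 39) [(0, d + 43), (1, d + 10), (2, d + 6), (3, d + 5),
    (4, d + 12), (5, d + 44), (6, d + 15)] ++ [.move (d + 43) (d + 10)])))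
  (.seq (blk (mk (d + 16) [(0, d + 8), (1, d + 9), (2, d + 42), (3, d + 40), (4, d + 43)] ++
    [.move (d + 42) (d + 16)])) (insertP d))))

/-- Amortised costs add up along the sweep: each insertion hands its potential to the next, and what
is left at the end is dropped. The old versions in `Roots` survive because an insertion changes no
cell that existed before, apart from the counters. -/
theorem insertAllP_spec {κ W d m kv rl rk ls S} {ca col : ℕ → ℕ} (hW : 1 ≤ W) (hκ : 60 ≤ κ)
    (hcl : Closed ls) (l : List ℕ) : ∀ {acc σ root Φ}, Consts d σ →
    ColorBase σ.next σ.cell ca S → (∀ c ∈ S, σ.cell (ca c) 8 = .num 0) →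
    IsList σ.next σ.cell (recRow kv (fun j => .ptr (ca (col j))) rl) l (σ.reg (d + 41)) →
    IsList σ.next σ.cell (recRow kv (fun j => .ptr (ca (col j))) root) acc (σ.reg (d + 42)) →
    Roots κ (Set.Iio σ.next) σ.cell ca col rk ls m root acc →
    IsDom κ (Set.Iio σ.next) σ.cell ca col rk ls m (σ.reg (d + 43)) (↑acc : Multiset ℕ) Φ →
    IsDesc σ.next σ.cell ls m (σ.reg (d + 44)) →
    (∀ j ∈ l, RankList σ.next σ.cell rk j m (rl j)) → (l ++ acc).Nodup →
    l.length + acc.length ≤ W → (∀ j ∈ l ++ acc, col j ∈ S) →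
    WP W (insertAllP d) σ (Φ + (domCost κ ls m + 40) * l.length + 3) fun σ' =>
      Upd (d + 7) (d + 44) ∅ σ σ' ∧ (∀ c ∈ S, σ'.cell (ca c) 8 = .num 0) ∧ ∃ root',
      IsList σ'.next σ'.cell (recRow kv (fun j => .ptr (ca (col j))) root') (l.reverse ++ acc)
        (σ'.reg (d + 42)) ∧
      Roots κ (Set.Iio σ'.next) σ'.cell ca col rk ls m root' (l.reverse ++ acc) := by
  induction l with
  | nil =>
    intro acc σ root Φ hc hb hz hl hacc hroots hdom hdesc _ _ _ _
    refine WP.le (WP.while_nil hl hc.one hc.nil ⟨.of_set (by omega) (by omega), hz, root, ?_, ?_⟩)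
      (by simp)
    · simpa [State.set] using hacc
    · simpa [State.set] using hroots
  | cons j l ih =>
    intro acc σ root Φ hc hb hz hl hacc hroots hdom hdesc hrl hnd hlW hS
    obtain ⟨a, ha, h41, ⟨e0, e1, e3, e4, -⟩, hl⟩ := hl
    simp only [recRow, if_true, if_false, OfNat.ofNat_ne_zero, one_ne_zero, OfNat.ofNat_ne_one,
      Nat.reduceEqDiff] at e0 e1 e3 e4
    have hrj := hrl j (by simp)
    obtain ⟨r, hr, hrv⟩ : ∃ r < σ.next, rl j = .ptr r := by
      cases m with
      | zero => obtain ⟨r, hr, h⟩ := hrj; exact ⟨r, hr, h⟩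
      | succ m => obtain ⟨r, hr, h, -⟩ := hrj; exact ⟨r, hr, h⟩
    rw [hrv] at hrj e4
    have prep : WP W (blk [.load (d + 8) (d + 41) 0, .load (d + 9) (d + 41) 1,
        .load (d + 40) (d + 41) 3, .load (d + 14) (d + 41) 4, .load (d + 41) (d + 41) 2,
        .load (d + 12) (d + 14) 0, .load (d + 15) (d + 14) 1]) (σ.set (d + 7) (.num 1)) 8
        fun σ₁ => Grow (d + 7) (d + 44) σ σ₁ ∧ σ₁.next = σ.next ∧
        σ₁.reg (d + 8) = .ptr j ∧ σ₁.reg (d + 9) = kv j ∧ σ₁.reg (d + 40) = .ptr (ca (col j)) ∧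
        σ₁.reg (d + 41) = σ.cell a 2 ∧ σ₁.reg (d + 12) = σ.cell r 0 ∧
        σ₁.reg (d + 15) = σ.cell r 1 ∧ σ₁.reg (d + 42) = σ.reg (d + 42) ∧
        σ₁.reg (d + 43) = σ.reg (d + 43) := by
      refine WP.blk (is := [_, _, _, _, _, _, _]) ?_
      simp (disch := omega) only [execL, Instr.exec, State.set, Function.update_self,
      Function.update_of_ne, if_pos, Option.bind_some, Option.some.injEq, exists_eq_left', if_true,
      row, h41, ha, e0, e1, e3, e4, hr]
      refine ⟨⟨le_rfl, fun _ _ => rfl, rfl, fun r hr => ?_⟩, trivial, trivial, trivial, trivial,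
        trivial, trivial, trivial, trivial, trivial⟩
      simp (disch := omega) only [Function.update_self, Function.update_of_ne]
    obtain ⟨t₁, σ₁, ht₁, hrun₁, hg1, hn1, e8, e9, e40, e41, e12, e15, e42, e43⟩ := prep
    have hc1 := hc.grow hg1 le_rfl
    have prep2 : WP W (blk (mk (d + 10) [] ++ (mk (d + 39) [(0, d + 43), (1, d + 10),
        (2, d + 6), (3, d + 5), (4, d + 12), (5, d + 44), (6, d + 15)] ++
        [.move (d + 43) (d + 10)]))) σ₁ 11 fun σ₂ => Grow (d + 7) (d + 44) σ₁ σ₂ ∧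
        σ₂.next = σ.next + 2 ∧ σ₂.reg (d + 43) = .ptr σ.next ∧ σ₂.reg (d + 39) = .ptr (σ.next + 1) ∧
        (∀ q, q ≠ d + 43 → q ≠ d + 39 → q ≠ d + 10 → σ₂.reg q = σ₁.reg q) ∧
        IsTask σ₂.cell (σ.next + 1) (σ.reg (d + 43)) σ.next .nil (.num 1) (σ.cell r 0)
          (σ.reg (d + 44)) (σ.cell r 1) := by
      have h5 := hc1.one
      have h6 := hc1.nil
      have e44 := hg1.reg_eq (d + 44) (by omega)
      rw [← hn1]
      refine WP.le (WP.blk (is := _ ++ _) ?_) (by simp [length_mk])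
      rw [execL_mk_append (by simp), execL_mk_append (by simp)]
      simp (disch := omega) only [execL, Instr.exec, State.set, Function.update_self,
      Function.update_of_ne, if_pos, Option.bind_some, Option.some.injEq, exists_eq_left', if_true,
      row, e43, h6, h5, e12, e44, e15]
      refine ⟨⟨?_, fun b hb => ?_, rfl, fun r hr => ?_⟩, trivial, trivial, trivial,
        fun q h1 h2 h3 => ?_, ⟨?_, ?_, ?_, ?_, ?_, ?_, ?_⟩⟩
      · exact (Nat.le_succ _).trans (Nat.le_succ _)
      all_goals simp (disch := omega) only [Function.update_self, Function.update_of_ne]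
    obtain ⟨t₂, σ₂, ht₂, hrun₂, hg2, hn2, e43', e39', hreg2, ht2⟩ := prep2
    have prep3 : WP W (blk (mk (d + 16) [(0, d + 8), (1, d + 9), (2, d + 42),
        (3, d + 40), (4, d + 43)] ++ [.move (d + 42) (d + 16)])) σ₂ 8 fun σ₃ =>
        Grow (d + 7) (d + 44) σ₂ σ₃ ∧ σ₃.next = σ.next + 3 ∧ σ₃.reg (d + 42) = .ptr (σ.next + 2) ∧
        (∀ q, q ≠ d + 42 → q ≠ d + 16 → σ₃.reg q = σ₂.reg q) ∧
        σ₃.cell (σ.next + 2) 0 = .ptr j ∧ σ₃.cell (σ.next + 2) 1 = kv j ∧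
        σ₃.cell (σ.next + 2) 2 = σ.reg (d + 42) ∧ σ₃.cell (σ.next + 2) 3 = .ptr (ca (col j)) ∧
        σ₃.cell (σ.next + 2) 4 = .ptr σ.next ∧ σ₃.cell (σ.next + 2) 5 = .nil := by
      rw [← hn2]
      refine WP.le (WP.blk (is := _ ++ _) ?_) (by simp [length_mk])
      rw [execL_mk_append (by simp)]
      simp (disch := omega) only [execL, Instr.exec, State.set, Function.update_self,
      Function.update_of_ne, if_pos, Option.bind_some, Option.some.injEq, exists_eq_left', if_true,
      row, hreg2, e8, e9, e40, e42, e43']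
      refine ⟨⟨?_, fun b hb => ?_, rfl, fun r hr => ?_⟩, by omega, trivial, fun q h1 h2 => ?_,
        trivial, trivial, trivial, trivial, trivial, trivial⟩
      · exact Nat.le_succ _
      all_goals simp (disch := omega) only [Function.update_self, Function.update_of_ne]
    obtain ⟨t₃, σ₃, ht₃, hrun₃, hg3, hn3, e42', hreg3, r0, r1, r2, r3, r4, r5⟩ := prep3
    have hg13 := (hg1.trans hg2).trans hg3
    have hag : Agree σ.next σ.cell σ₃.cell := hg13.agree
    have hready : Ready d σ.next σ.cell ca S (col j) σ₃ := by
      refine ⟨hc.grow hg13 le_rfl, hg13.next_le, hag, fun c hc => ?_, ?_⟩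
      · rw [hg13.cell_eq _ (hb.lt c hc)]; exact hz c hc
      · rw [hreg3 _ (by omega) (by omega), hreg2 _ (by omega) (by omega) (by omega), e40]
    have hfit : Fits W S col (j ::ₘ (↑acc : Multiset ℕ)) := by
      refine ⟨?_, fun i hi => ?_⟩
      · simp at hlW ⊢; omega
      · simp only [Multiset.mem_cons, Multiset.mem_coe] at hi
        refine hS i ?_
        simp only [List.cons_append, List.mem_append, List.mem_cons]
        obtain h | h := hi
        exacts [.inl h, .inr (.inr h)]
    obtain ⟨T, Φ', σ₄, hT, hg4, h39, hz4, hR, hgo⟩ := dom_ins (rk := rk) hW hκ hb hcl m σ₃ (σ.next + 1)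
      _ σ.next .nil r _ Φ (↑acc : Multiset ℕ) hready
      (by rw [hreg3 _ (by omega) (by omega), e39']) (by omega) hr hrj
      (ht2.congr fun f hf => by rw [hg3.cell_eq _ (by omega)]) hdesc hdom hfit le_rfl (by omega)
    -- The destination of the insertion is itself a fresh cell, so relative to `σ` nothing below
    -- field `8` is overwritten.
    have hg4' : Upd (d + 7) (d + 44) ∅ σ σ₄ := by
      refine Upd.trans (Y := {σ.next}) ⟨hg13.next_le, fun a ha _ f hf => hag a ha f hf, hg13.out_eq,
        hg13.reg_eq⟩ (hg4.mono le_rfl (by omega) subset_rfl) (by simp)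
    have hag4 : Agree σ.next σ.cell σ₄.cell := hg4'.agree le_rfl (by simp)
    have hn4 := hg4.next_le
    have hg4s : Upd (d + 7) (d + 44) ∅ σ (σ₄.set (d + 7) (.num 0)) :=
      hg4'.trans (Y := ∅) (.of_set (by omega) (by omega)) (by simp)
    have hnd' := List.nodup_cons.1 hnd
    have hsub : Set.Iio σ.next ⊆ Set.Iio σ₄.next := Set.Iio_subset_Iio (by omega)
    have hago : AgreeOn (Set.Iio σ.next) σ.cell σ₄.cell := fun a ha f hf => hag4 a ha f hf
    have hreg4 : ∀ q, q < d + 7 ∨ d + 40 ≤ q → (σ₄.set (d + 7) (.num 0)).reg q = σ₃.reg q := by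
      intro q hq
      rw [State.set]
      dsimp only
      rw [Function.update_of_ne (by omega), hg4.reg_eq q hq]
    have hrow : ∀ f < 8, σ₄.cell (σ.next + 2) f = σ₃.cell (σ.next + 2) f := fun f hf =>
      hg4.cell_eq _ (by omega) (by simp) f hf
    have hnext := ih (acc := j :: acc) (σ := σ₄.set (d + 7) (.num 0))
      (root := Function.update root j (.ptr σ.next)) (Φ := Φ') (hc.upd hg4s le_rfl)
      (hb.mono hg4'.next_le hag4) hz4 ?_ ?_ ?_ ?_ ?_ ?_ ?_ ?_ ?_
    · refine WP.le (T := (8 + (11 + (8 + (T + 3)))) +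
        (Φ' + (domCost κ ls m + 40) * l.length + 3) + 3) ?_ ?_
      · refine WP.while_ptr hW h41 hc.one hc.nil ?_
        refine WP.seq ⟨t₁, σ₁, ht₁, hrun₁, WP.seq ⟨t₂, σ₂, ht₂, hrun₂, WP.seq ⟨t₃, σ₃, ht₃, hrun₃,
          hgo _ _ (WP.while_nil h39 ((hc.upd hg4' le_rfl).one) ((hc.upd hg4' le_rfl).nil) ?_)⟩⟩⟩
        refine hnext.conseq fun σ₅ ⟨hg5, hz5, root', h1, h2⟩ =>
          ⟨hg4s.trans hg5 (by simp), hz5, root', by simpa using h1, by simpa using h2⟩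
      · rw [List.length_cons, mul_add, mul_one]; omega
    · rw [hreg4 _ (by omega), hreg3 _ (by omega) (by omega),
          hreg2 _ (by omega) (by omega) (by omega), e41]
      exact hl.mono hg4'.next_le hag4
    · rw [hreg4 _ (by omega), e42']
      refine ⟨σ.next + 2, show _ < σ₄.next by omega, rfl, ?_, ?_⟩
      · simp only [State.set, hrow 0 (by omega), hrow 1 (by omega), hrow 3 (by omega),
          hrow 4 (by omega), hrow 5 (by omega), r0, r1, r3, r4, r5]
        simp [recRow]
      · have := hrow 2 (by omega)
        simp only [State.set]
        rw [this, r2]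
        refine (hacc.mono hg4'.next_le hag4).congr fun i hi => ?_
        have : i ≠ j := fun h => hnd'.1 (by simp [← h, hi])
        simp [recRow, Function.update_of_ne this]
    · refine ⟨⟨Φ', ?_⟩, hroots.mono hsub hago fun i hi => ?_⟩
      · rw [Function.update_self]
        refine IsDom.mono (fun a ha => ?_) (fun _ _ _ _ => rfl) _ _ _ hR
        rw [mem_region] at ha
        rw [Set.mem_Iio]
        simp only [State.set]
        omega
      · have : i ≠ j := fun h => hnd'.1 (by simp [← h, hi])
        rw [Function.update_of_ne this]
    · rw [hreg4 _ (by omega), hreg3 _ (by omega) (by omega), e43']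
      refine IsDom.mono (fun a ha => ?_) (fun _ _ _ _ => rfl) _ _ _ hR
      rw [mem_region] at ha
      rw [Set.mem_Iio]
      simp only [State.set]
      omega
    · rw [hg4s.reg_eq _ (by omega)]
      exact hdesc.mono hg4'.next_le hag4
    · exact fun i hi => (hrl i (by simp [hi])).mono hg4'.next_le hag4
    · rw [List.nodup_middle]; exact hnd
    · simp at hlW ⊢; omega
    · intro i hi
      simp only [List.mem_append, List.mem_cons] at hi
      refine hS i ?_
      simp only [List.cons_append, List.mem_append, List.mem_cons]
      obtain h | h | h := hi
      exacts [.inr (.inl h), .inl h, .inr (.inr h)]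

/-! ### Sorting by a coordinate -/

/-- A search structure for the points `0, …, n - 1`, sorted by `key`; for each prefix of the sorted
list it holds a value that satisfies `P`. -/
def Search (N : ℕ) (h : ℕ → ℕ → Val) (n : ℕ) (key : ℕ → ℝ) (P : List ℕ → Val → Prop) (v : Val) :
    Prop :=
  ∃ (K : ℕ) (a : ℕ → ℕ) (l : List ℕ) (kv pay : ℕ → Val), v = .ptr (a 0) ∧
    Skip N h kv pay n K a ∧ n < 2 ^ K ∧ 2 ^ K ≤ 2 * n + 1 ∧
    l.Perm (List.range n) ∧ l.Pairwise (key · ≤ key ·) ∧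
    (∀ t (ht : t < l.length), kv (t + 1) = .real (key l[t])) ∧ ∀ t ≤ n, P (l.take t) (pay t)

theorem Search.mono {N N' h h' n key P P' v} (H : Search N h n key P v) (hN : N ≤ N')
    (hh : Agree N h h') (hP : ∀ l v, P l v → P' l v) : Search N' h' n key P' v := by
  obtain ⟨K, a, l, kv, pay, hv, hs, h1, h2, h3, h4, h5, h6⟩ := H
  exact ⟨K, a, l, kv, pay, hv, hs.mono hN hh, h1, h2, h3, h4, h5, fun t ht => hP _ _ (h6 t ht)⟩

/-- The recursive description of a list is turned into an indexed one, as the levels of a search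
structure need it. The `nil` in field `5` marks the bottom level, where a search stops. -/
theorem IsList.exists_cells {N h R l v} (H : IsList N h R l v) : ∃ b : ℕ → ℕ,
    v = (if 0 < l.length then .ptr (b 0) else .nil) ∧ ∀ t (ht : t < l.length), b t < N ∧
      h (b t) 1 = R l[t] 1 ∧ h (b t) 4 = R l[t] 4 ∧ h (b t) 5 = .nil ∧
      h (b t) 2 = (if t + 1 < l.length then .ptr (b (t + 1)) else .nil) := by
  induction l generalizing v with
  | nil => exact ⟨fun _ => 0, H, by simp⟩
  | cons j l ih =>
    obtain ⟨a, ha, rfl, ⟨-, h1, -, h4, h5⟩, hl⟩ := H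
    obtain ⟨b, hb, hbt⟩ := ih hl
    refine ⟨fun t => if t = 0 then a else b (t - 1), by simp, fun t ht => ?_⟩
    cases t with
    | zero => simp [ha, h1, h4, h5, hb]
    | succ t => simpa using hbt t (by simpa using ht)

/-- Make a search structure from the list in `d + 12` and the register `s`, in register `r`. -/
def indexP (d r s : ℕ) : Prog :=
  .seq (blk (mk (d + 10) [(2, d + 12), (4, s)])) (.seq (skipP d) (blk [.move r (d + 10)]))

theorem indexP_spec {W d r s n key cp rl l σ} (hW : 1 ≤ W) (hc : Consts d σ) (hs : s ≠ d + 10)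
    (hl : IsList σ.next σ.cell (recRow (fun j => .real (key j)) cp rl) l (σ.reg (d + 12)))
    (hn : l.length = n) (hperm : l.Perm (List.range n)) (hsort : l.Pairwise (key · ≤ key ·)) :
    WP W (indexP d r s) σ (80 * n + 11) fun σ' => ∃ σ₁ v, Grow (d + 7) (d + 16) σ σ₁ ∧
      σ' = σ₁.set r v ∧ ∀ P : List ℕ → Val → Prop, P [] (σ.reg s) →
      (∀ t (ht : t < l.length), P (l.take (t + 1)) (rl l[t])) → Search σ₁.next σ₁.cell n key P v := by
  refine WP.le (T := 4 + ((80 * n + 5) + 2)) (WP.seq (WP.blk (is := mk _ _) ?_)) (by omega)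
  obtain ⟨reg, cell, next, out⟩ := σ
  rw [execL_mk (by simp; exact fun h => hs h)]
  simp (disch := omega) only [execL, Instr.exec, State.set, Function.update_self,
      Function.update_of_ne, if_pos, Option.bind_some, Option.some.injEq, exists_eq_left', if_true,
      row]
  set σ₁ : State := ⟨_, _, next + 1, _⟩ with hσ₁
  have hg1 : Grow (d + 7) (d + 16) ⟨reg, cell, next, out⟩ σ₁ := by
    refine ⟨Nat.le_succ _, fun b hb => ?_, rfl, fun r hr => ?_⟩
    · dsimp only at hb; simp (disch := omega) only [Function.update_self, Function.update_of_ne,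
          hσ₁]
    · simp (disch := omega) only [Function.update_self, Function.update_of_ne, hσ₁]
  obtain ⟨b, hb, hbt⟩ := (hl.mono hg1.next_le hg1.agree).exists_cells
  -- An additional cell without a key precedes the sorted list, with index `0`. It carries the value
  -- for the empty prefix, so a search always has a cell to start from; the record at position `t`
  -- gets index `t + 1`.
  have hskip : Skip σ₁.next σ₁.cell (fun t => if h : t - 1 < l.length then .real (key l[t - 1]) else .nil)
      (fun t => if t = 0 then reg s else if h : t - 1 < l.length then rl l[t - 1] else .nil)
      n 0 (fun t => if t = 0 then next else b (t - 1)) := by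
    refine ⟨fun t ht => ?_, fun t ht => ?_⟩
    · cases t with
      | zero =>
        refine ⟨by simp [hσ₁], ?_, by simp⟩
        simp only [if_true, Nat.zero_add, Nat.add_eq_zero_iff, one_ne_zero, and_false, if_false]
        simp (disch := omega) only [Function.update_self, Function.update_of_ne, hσ₁]
        dsimp only at hb
        rw [hb, hn]
      | succ t =>
        obtain ⟨h1, h2, h3, h4, h5⟩ := hbt t (by omega)
        refine ⟨by simpa using h1, ?_, fun _ => ?_⟩
        · simpa [hn] using h5
        · have : t < l.length := by omega
          simpa [this, recRow] using h2
    · cases t with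
      | zero =>
        simp only [if_true]
        refine ⟨?_, ?_⟩
        · simp (disch := omega) only [Function.update_self, Function.update_of_ne, hσ₁]
        · simp (disch := omega) only [Function.update_self, Function.update_of_ne, hσ₁]
      | succ t =>
        obtain ⟨h1, h2, h3, h4, h5⟩ := hbt t (by omega)
        have : t < l.length := by omega
        exact ⟨by simpa [this, recRow] using h3, by simpa using h4⟩
  refine WP.seq ((skipP_spec (n := n) hW (hc.grow hg1 le_rfl) (by simp (disch := omega) only [Function.update_self, Function.update_of_ne, hσ₁]; simp) hskip).conseq ?_)
  rintro σ₂ ⟨hg2, K, a', hs2, e10, hK, hK'⟩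
  refine WP.blk (is := [_]) ⟨_, rfl, σ₂, σ₂.reg (d + 10), hg1.trans hg2, rfl, fun P h0 hP => ?_⟩
  refine ⟨K, a', l, _, _, e10, hs2, hK, hK', hperm, hsort, fun t ht => ?_, fun t ht => ?_⟩
  · simp [ht]
  · cases t with
    | zero => simpa using h0
    | succ t =>
      have : t < l.length := by omega
      simpa [this] using hP t this

/-- The position of an element in a list, counted from `1`. -/
def rankIn (l : List ℕ) (j : ℕ) : ℕ := l.idxOf j + 1

/-- Appending an element at the end does not alter the positions of the earlier ones. -/
theorem rankDesc_reverse (l : List ℕ) (hl : l.Nodup) : RankDesc (rankIn l) l.reverse := by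
  induction l using List.reverseRecOn with
  | nil => trivial
  | append_singleton l j ih =>
    rw [List.reverse_append, List.reverse_singleton, List.singleton_append]
    have hnd := List.nodup_append.1 hl
    have hj : j ∉ l := fun h => hnd.2.2 j h j (by simp) rfl
    refine ⟨by simp [rankIn, List.idxOf_append, hj], ?_⟩
    have key : ∀ l' : List ℕ, (∀ i ∈ l', i ∈ l) → RankDesc (rankIn l) l' →
        RankDesc (rankIn (l ++ [j])) l' := by
      intro l'
      induction l' with
      | nil => exact fun _ _ => trivial
      | cons i l' ih' =>
        rintro h ⟨h1, h2⟩
        refine ⟨?_, ih' (fun i hi => h i (by simp [hi])) h2⟩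
        rw [← h1, rankIn, rankIn, List.idxOf_append_of_mem (h i (by simp))]
    exact key _ (by simp) (ih hnd.1)

/-- What a search structure says about the ranks `rk`. -/
def RankAt (N : ℕ) (h : ℕ → ℕ → Val) (n : ℕ) (rk : ℕ → ℕ) (l : List ℕ) (v : Val) : Prop :=
  ∃ r < N, v = .ptr r ∧ h r 0 = .num l.length ∧ l.length ≤ n ∧ ∀ j < n, (j ∈ l ↔ rk j ≤ l.length)

theorem RankAt.mono {N N' h h' n rk l v} (H : RankAt N h n rk l v) (hN : N ≤ N')
    (hh : Agree N h h') : RankAt N' h' n rk l v := by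
  obtain ⟨r, hr, hv, h0, H⟩ := H
  exact ⟨r, hr.trans_le hN, hv, by rwa [hh r hr 0 (by omega)], H⟩

/-- Sort the list in `d + 12` by coordinate `i`. -/
def sortByP (d i : ℕ) : Prog :=
  .seq (blk [.move (d + 11) (d + 12)]) (.seq (rekeyP d i) (sortP d))

theorem sortByP_spec {W d i n k kv cp rl l σ} {R : ℕ → Val} {le : ℕ → ℕ → Bool} {inp : ℕ → ℕ → Val}
    (hW : 1 ≤ W) (hc : Consts d σ)
    (trans : ∀ a b c, le a b → le b c → le a c) (total : ∀ a b, (le a b || le b a) = true)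
    (hle : ∀ i j, leVal (R i) (R j) = some (le i j)) (hR : ∀ j < n, inp j i = R j)
    (hn : n ≤ σ.next) (hn0 : 0 < n) (hk : n ≤ 2 ^ k)
    (hl : IsList σ.next σ.cell (recRow kv cp rl) l (σ.reg (d + 12))) (hin : ∀ j < n,
        σ.cell j = inp j)
    (hperm : l.Perm (List.range n)) :
    WP W (sortByP d i) σ ((104 * n + 11) * k + 18 * n + 14) fun σ' =>
      Grow (d + 7) (d + 20) σ σ' ∧ ∃ l', l'.Perm (List.range n) ∧ l'.Pairwise (le · ·) ∧
      IsList σ'.next σ'.cell (recRow R cp rl) l' (σ'.reg (d + 10)) := by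
  have hlen : l.length = n := by simpa using hperm.length_eq
  have hmem : ∀ j ∈ l, j < n := fun j hj => by simpa using hperm.mem_iff.1 hj
  refine WP.le (T := 2 + ((18 * l.length + 5) + ((64 * n + 40 * n + 11) * k + 7))) (WP.seq
    (WP.blk (is := [_]) ⟨_, rfl, ?_⟩)) (by rw [hlen]; ring_nf; omega)
  have hg1 : Grow (d + 7) (d + 20) σ (σ.set (d + 11) (σ.reg (d + 12))) :=
    .of_set (by omega) (by omega)
  -- The keys of actual points are replaced by the total function `R`, with which they agree:
  -- sorting requires keys that are comparable for all indices, not only for those below `n`.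
  refine WP.seq ((rekeyP_spec (f := i) (inp := fun j f => if f = i then R j else inp j f) hW
    (hc.grow hg1 le_rfl) hn (by simpa [State.set] using hl)
    (fun j hj => ?_) hmem).conseq ?_)
  · ext f
    simp only [State.set, hin j hj]
    split_ifs with h
    · rw [h, hR j hj]
    · rfl
  rintro σ₁ ⟨hg2, hruns⟩
  have hg12 := hg1.trans (hg2.mono le_rfl (by omega))
  simp only [if_true] at hruns
  have hflat : (l.reverse.map ([·])).flatten = l.reverse := by
    induction l.reverse with
    | nil => rfl
    | cons a l ih => simp [ih]
  refine (sortP_spec (le := le) hW trans total (fun i j => by simpa [recRow] using hle i j) k n n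
    (hc.grow hg12 le_rfl) ?_ (by simp [hlen, hk]) (by simp [hlen]) (by rw [hflat]; simp [hlen])
    ?_ hruns).conseq ?_
  · intro h
    have := congrArg List.length h
    simp [hlen] at this
    omega
  · simp
  · rintro σ₂ ⟨hg3, l', hp, hs, hl'⟩
    rw [hflat] at hp
    exact ⟨hg12.trans hg3, l', hp.trans ((List.reverse_perm l).trans hperm), hs, hl'⟩

/-- Rank the points by coordinate `i`, and make a search structure in register `r`. -/
def coordP (d i r : ℕ) : Prog :=
  .seq (sortByP d i) (.seq (blk [.move (d + 11) (d + 10), .clear (d + 12)]) (.seq (revP d)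
    (.seq (blk [.move (d + 11) (d + 12), .move (d + 20) (d + 2)]) (.seq (rankP d)
    (.seq (blk (mk (d + 8) [(0, d + 4)] ++ [.move (d + 22) (d + 12)]))
    (.seq (indexP d r (d + 8)) (blk [.move (d + 12) (d + 22)])))))))

theorem coordP_spec {W d i r n k kv cp rl l σ} {key : ℕ → ℝ} {inp : ℕ → ℕ → Val} (hW : 1 ≤ W)
    (hc : Consts d σ) (hr : d + 41 ≤ r) (h2 : σ.reg (d + 2) = .num n)
    (hR : ∀ j < n, inp j i = .real (key j)) (hn : n ≤ σ.next) (hn0 : 0 < n) (hk : n ≤ 2 ^ k)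
    (hl : IsList σ.next σ.cell (recRow kv cp rl) l (σ.reg (d + 12))) (hin : ∀ j < n,
        σ.cell j = inp j)
    (hperm : l.Perm (List.range n)) :
    WP W (coordP d i r) σ ((104 * n + 11) * k + 136 * n + 50) fun σ' =>
      Grow (d + 7) (r + 1) σ σ' ∧ ∃ l' kv' rl' rk, l'.Perm (List.range n) ∧
      IsList σ'.next σ'.cell (recRow kv' cp rl') l' (σ'.reg (d + 12)) ∧
      (∀ j < n, ∃ a < σ'.next, rl' j = .ptr a ∧ σ'.cell a 0 = .num (rk j) ∧ σ'.cell a 1 = rl j) ∧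
      Search σ'.next σ'.cell n key (RankAt σ'.next σ'.cell n rk) (σ'.reg r) := by
  refine WP.le (T := ((104 * n + 11) * k + 18 * n + 14) + (3 + ((18 * n + 3) + (3 + ((20 * n + 5) +
    (4 + ((80 * n + 11) + 2))))))) ?_ (by omega)
  refine WP.seq ((sortByP_spec (le := fun i j => decide (key i ≤ key j)) (R := fun j => .real (key j))
    hW hc (fun a b c => by simpa using le_trans) (fun a b => by simpa using le_total _ _)
    (fun _ _ => rfl) hR hn hn0 hk hl hin hperm).conseq ?_)
  rintro σ₁ ⟨hg1, l', hp, hsort, hl1⟩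
  have hlen : l'.length = n := by simpa using hp.length_eq
  have hnd : l'.Nodup := hp.nodup_iff.2 List.nodup_range
  have hmem : ∀ j, j ∈ l' ↔ j < n := fun j => by simpa using hp.mem_iff (a := j)
  have hsort' : l'.Pairwise (key · ≤ key ·) := hsort.imp (by simp)
  refine WP.seq (WP.blk (is := [_, _]) ?_)
  simp (disch := omega) only [execL, Instr.exec, State.set, Function.update_self,
      Function.update_of_ne, if_pos, Option.bind_some, Option.some.injEq, exists_eq_left', if_true,
      row]
  set σ₂ : State := ⟨_, _, _, _⟩ with hσ₂
  have hg2 : Grow (d + 7) (d + 21) σ σ₂ := (hg1.mono le_rfl (by omega)).trans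
    ⟨le_rfl, fun _ _ => rfl, rfl, fun r hr => by simp (disch := omega) only [Function.update_self,
        Function.update_of_ne, hσ₂]⟩
  have hc2 := hc.grow hg2 le_rfl
  refine WP.seq (WP.mono (revP_spec (R := recRow (fun j => .real (key j)) cp rl) hW l' (acc := []) hc2
    (by simp (disch := omega) only [Function.update_self, Function.update_of_ne, hσ₂]; exact hl1) (by simp (disch := omega) only [Function.update_self, Function.update_of_ne, hσ₂]; rfl)) (by omega) ?_)
  rintro σ₃ ⟨hg3, hl3⟩
  rw [List.append_nil] at hl3
  have hg3' := hg2.trans (hg3.mono le_rfl (by omega))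
  refine WP.seq (WP.blk (is := [_, _]) ?_)
  simp (disch := omega) only [execL, Instr.exec, State.set, Function.update_self,
      Function.update_of_ne, if_pos, Option.bind_some, Option.some.injEq, exists_eq_left', if_true,
      row]
  have e2 : σ₃.reg (d + 2) = .num n := by rw [hg3'.reg_eq _ (by omega), h2]
  set σ₄ : State := ⟨_, _, _, _⟩ with hσ₄
  have hg4 : Grow (d + 7) (d + 21) σ σ₄ := hg3'.trans
    ⟨le_rfl, fun _ _ => rfl, rfl, fun r hr => by simp (disch := omega) only [Function.update_self,
        Function.update_of_ne, hσ₄]⟩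
  refine WP.seq (WP.mono (rankP_spec (W := W) (l := l'.reverse) (rk := rankIn l') (rl := rl) hW
    (hc.grow hg4 le_rfl) (by simp (disch := omega) only [Function.update_self, Function.update_of_ne, hσ₄]; exact hl3) (rankDesc_reverse _ hnd) (by simp (disch := omega) only [Function.update_self, Function.update_of_ne, hσ₄]; simp [e2, hlen])
    (List.nodup_reverse.2 hnd)) (by simp [hlen]) ?_)
  rintro σ₅ ⟨hg5, rl', hrl', hl5⟩
  rw [List.reverse_reverse] at hl5
  have hg5' := hg4.trans hg5
  have h4 := (hc.grow hg5' le_rfl).zero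
  -- The new cell holds the rank `0` for the empty prefix. The list of records is saved in `d + 22`,
  -- as making the index overwrites `d + 12`.
  refine WP.seq (WP.le (WP.blk (is := _ ++ _) ?_) (by simp [length_mk]))
  rw [show σ₅ = ⟨σ₅.reg, σ₅.cell, σ₅.next, σ₅.out⟩ from rfl, execL_mk_append (by simp)]
  simp (disch := omega) only [execL, Instr.exec, State.set, Function.update_self,
      Function.update_of_ne, if_pos, Option.bind_some, Option.some.injEq, exists_eq_left', if_true,
      row, h4]
  set σ₆ : State := ⟨_, _, σ₅.next + 1, _⟩ with hσ₆
  have hg6 : Grow (d + 7) (d + 23) σ₅ σ₆ := by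
    refine ⟨Nat.le_succ _, fun b hb => by simp (disch := omega) only [Function.update_self,
        Function.update_of_ne, hσ₆], rfl, fun r hr => by simp (disch := omega) only [Function.update_self, Function.update_of_ne, hσ₆]⟩
  have hg6' := (hg5'.mono le_rfl (by omega)).trans hg6
  have hl6 := hl5.grow hg6
  have e6 : σ₆.reg (d + 12) = σ₅.reg (d + 12) := by
    simp (disch := omega) only [Function.update_self, Function.update_of_ne, hσ₆]
  have e622 : σ₆.reg (d + 22) = σ₅.reg (d + 12) := by
    simp (disch := omega) only [Function.update_self, Function.update_of_ne, hσ₆]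
  refine WP.seq ((indexP_spec (r := r) (s := d + 8) (key := key) (cp := cp) (rl := rl') (l := l') hW
    (hc.grow hg6' le_rfl) (by omega) (by rw [e6]; exact hl6) hlen hp hsort').conseq ?_)
  rintro σ₇ ⟨σ₈, v, hg8, rfl, hsearch⟩
  have hg8' := hg6'.trans (hg8.mono le_rfl (by omega))
  have hg68 := hg6.trans (hg8.mono le_rfl (by omega))
  refine WP.blk (is := [_]) ?_
  have e822 : σ₈.reg (d + 22) = σ₅.reg (d + 12) := by rw [hg8.reg_eq _ (by omega), e622]
  simp (disch := omega) only [execL, Instr.exec, State.set, Function.update_self,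
      Function.update_of_ne, if_pos, Option.bind_some, Option.some.injEq, exists_eq_left', if_true,
      row, e822]
  refine ⟨(hg8'.mono le_rfl (by omega)).trans ⟨le_rfl, fun _ _ => rfl, rfl, fun q hq => ?_⟩, l', _,
    rl', rankIn l', hp, hl5.grow hg68, fun j hj => ?_, hsearch _ ?_ fun t ht => ?_⟩
  · simp (disch := omega) only [Function.update_self, Function.update_of_ne]
  · obtain ⟨a, ha, h1, h2, h3⟩ := hrl' j (by simpa using (hmem j).2 hj)
    refine ⟨a, ha.trans_le hg68.next_le, h1, ?_, ?_⟩
    · rw [hg68.cell_eq a ha, h2]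
    · rw [hg68.cell_eq a ha, h3]
  · have e : σ₆.reg (d + 8) = .ptr σ₅.next := by
      simp (disch := omega) only [Function.update_self, Function.update_of_ne, hσ₆]
    have e0 : σ₈.cell σ₅.next 0 = .num 0 := by
      rw [hg8.cell_eq _ (by simp [hσ₆])]; simp (disch := omega) only [Function.update_self, Function.update_of_ne, hσ₆]
    refine ⟨σ₅.next, ?_, e, e0, Nat.zero_le _, fun j hj => by simp [rankIn]⟩
    have := hg8.next_le
    simp only [hσ₆] at this
    omega
  · have hj := (hmem _).1 (List.getElem_mem ht)
    obtain ⟨a, ha, h1, h2, h3⟩ := hrl' l'[t] (by simp)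
    refine ⟨a, ha.trans_le hg68.next_le, h1, ?_, ?_, fun j hj => ?_⟩
    · rw [hg68.cell_eq a ha, h2, rankIn, hnd.idxOf_getElem, List.length_take]
      congr 1; omega
    · rw [List.length_take]; omega
    · rw [List.mem_take_iff_idxOf_lt ((hmem j).2 hj), List.length_take, rankIn]
      omega

/-! ### Preprocessing -/

/-- The first bit ever added opens a block, so a block leaf lies at the very bottom. -/
theorem closed_levels (s e : ℕ) : Closed (levels s (e + 1)).2 := by
  induction e with
  | zero => simp [levels, Closed]
  | succ e ih =>
    rw [levels, Closed]
    split_ifs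
    exacts [.inr ih, ih]

/-- Rank the points by the coordinates `1, …, m`, with search structures. -/
def stagesP (d : ℕ) : ℕ → Prog
  | 0 => .skip
  | m + 1 => .seq (stagesP d m) (coordP d (m + 1) (2 * d + 45 - m))

/-- The results go into registers with decreasing numbers. A stage that writes to register `r` may
change everything from `d + 7` up to `r`, and the earlier results lie above. Coordinates are treated
in increasing order, so the rank of the outermost trie comes first in each rank list. -/
theorem stagesP_spec {W d n k kv cp rl l σ} {key : ℕ → ℕ → ℝ} {inp : ℕ → ℕ → Val} (hW : 1 ≤ W)
    (hc : Consts d σ) (h2 : σ.reg (d + 2) = .num n)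
    (hR : ∀ i < d, ∀ j < n, inp j i = .real (key i j)) (hn : n ≤ σ.next) (hn0 : 0 < n)
    (hk : n ≤ 2 ^ k) (hl : IsList σ.next σ.cell (recRow kv cp rl) l (σ.reg (d + 12)))
    (hin : ∀ j < n, σ.cell j = inp j) (hperm : l.Perm (List.range n))
    (hrl : ∀ j < n, RankList σ.next σ.cell (fun _ _ => 0) j 0 (rl j)) (m : ℕ) (hm : m < d) :
    WP W (stagesP d m) σ (((104 * n + 11) * k + 136 * n + 50) * m + 1) fun σ' =>
      Grow (d + 7) (2 * d + 46) σ σ' ∧ ∃ l' kv' rl' rk, l'.Perm (List.range n) ∧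
      IsList σ'.next σ'.cell (recRow kv' cp rl') l' (σ'.reg (d + 12)) ∧
      (∀ j < n, RankList σ'.next σ'.cell rk j m (rl' j)) ∧
      ∀ i < m, Search σ'.next σ'.cell n (key (i + 1)) (RankAt σ'.next σ'.cell n (rk i))
        (σ'.reg (2 * d + 45 - i)) := by
  induction m with
  | zero =>
    exact WP.le (WP.skip ⟨.refl .., l, kv, rl, fun _ _ => 0, hperm, hl, hrl, by simp⟩) (by omega)
  | succ m ih =>
    refine WP.le (WP.seq ((ih (by omega)).conseq ?_)) (le_of_eq (by ring :
      ((104 * n + 11) * k + 136 * n + 50) * m + 1 + ((104 * n + 11) * k + 136 * n + 50) = _))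
    rintro σ₁ ⟨hg1, l₁, kv₁, rl₁, rk, hp1, hl1, hrl1, hs1⟩
    refine (coordP_spec (key := key (m + 1)) hW (hc.grow hg1 le_rfl) (by omega)
      (by rw [hg1.reg_eq _ (by omega), h2]) (hR _ hm) (hn.trans hg1.next_le) hn0 hk hl1
      (fun j hj => by rw [hg1.cell_eq j (by omega), hin j hj]) hp1).conseq ?_
    rintro σ₂ ⟨hg2, l₂, kv₂, rl₂, rk₂, hp2, hl2, hrl2, hs2⟩
    refine ⟨hg1.trans (hg2.mono le_rfl (by omega)), l₂, kv₂, rl₂, Function.update rk m rk₂, hp2,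
        hl2,
      fun j hj => ?_, fun i hi => ?_⟩
    · obtain ⟨a, ha, h1, h2, h3⟩ := hrl2 j hj
      refine ⟨a, ha, h1, by rw [Function.update_self, h2], ?_⟩
      rw [h3]
      have := (hrl1 j hj).mono hg2.next_le hg2.agree
      -- A rank list with `m'` entries mentions only the ranks `0, …, m' - 1`, which the update at
      -- `m` does not touch.
      have hcongr : ∀ m' v, m' ≤ m → RankList σ₂.next σ₂.cell rk j m' v →
          RankList σ₂.next σ₂.cell (Function.update rk m rk₂) j m' v := by
        intro m'
        induction m' with
        | zero => exact fun v _ h => h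
        | succ m' ih =>
          rintro v hm' ⟨a, ha, hv, h0, h1⟩
          exact ⟨a, ha, hv, by rwa [Function.update_of_ne (by omega)], ih _ (by omega) h1⟩
      exact hcongr m _ le_rfl this
    · obtain rfl | hi' : i = m ∨ i < m := by omega
      · rw [Function.update_self]; exact hs2
      · rw [Function.update_of_ne (by omega), hg2.reg_eq _ (by omega)]
        exact (hs1 i hi').mono hg2.next_le hg2.agree fun l v h => h.mono hg2.next_le hg2.agree

/-! ### The finished index -/

/-- What the preprocessing provides: search structures for all coordinates. That of coordinate
`0` leads to structures for the other coordinates. -/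
structure Index (κ d n : ℕ) (ls : List (Option ℕ)) (key : ℕ → ℕ → ℝ) (col ca : ℕ → ℕ)
    (rk : ℕ → ℕ → ℕ) (σ : State) : Prop where
  consts : Consts d σ
  colors : ColorBase σ.next σ.cell ca {c | ∃ j < n, col j = c}
  count : ∀ j < n, σ.cell (ca (col j)) 8 = .num 0
  desc : IsDesc σ.next σ.cell ls (d - 1) (σ.reg (d + 44))
  root : Search σ.next σ.cell n (key 0) (fun l v => ∃ Φ,
      IsDom κ (Set.Iio σ.next) σ.cell ca col rk ls
    (d - 1) v (↑l : Multiset ℕ) Φ) (σ.reg (2 * d + 46))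
  rank : ∀ i < d - 1, Search σ.next σ.cell n (key (i + 1)) (RankAt σ.next σ.cell n (rk i))
    (σ.reg (2 * d + 45 - i))

/-- Sort the points by colour and make colour cells. -/
def colorsP (d : ℕ) : Prog :=
  .seq (sortByP d d) (.seq (blk [.move (d + 11) (d + 10)]) (colorP d))

/-- Insert all points, which are in a list in `d + 12`, in the order of coordinate `0`. -/
def sweepP (d : ℕ) : Prog :=
  .seq (sortByP d 0) (.seq (blk [.move (d + 41) (d + 10)]) (.seq (emptyP d (d - 1))
    (.seq (blk [.move (d + 44) (d + 10), .move (d + 43) (d + 11), .move (d + 45) (d + 11),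
      .clear (d + 42)]) (.seq (insertAllP d) (.seq (blk [.move (d + 11) (d + 42), .clear (d + 12)])
    (.seq (revP d) (indexP d (2 * d + 46) (d + 45))))))))

/-- The preprocessing program. -/
def buildP (d : ℕ) : Prog :=
  .seq (blk [.move (d + 3) 2, .move (d + 2) 1, .move (d + 1) 0, .const (d + 4) 0,
    .const (d + 5) 1, .clear (d + 6)]) (.seq (initP d) (.seq (colorsP d)
    (.seq (stagesP d (d - 1)) (sweepP d))))

theorem colorsP_spec {W d n k kv cp rl l σ} {col : ℕ → ℕ} {inp : ℕ → ℕ → Val} (hW : 1 ≤ W)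
    (hc : Consts d σ) (hR : ∀ j < n, inp j d = .num (col j)) (hn : n ≤ σ.next) (hn0 : 0 < n)
    (hk : n ≤ 2 ^ k) (hl : IsList σ.next σ.cell (recRow kv cp rl) l (σ.reg (d + 12)))
    (hin : ∀ j < n, σ.cell j = inp j) (hperm : l.Perm (List.range n)) (hcol : ∀ j < n, 1 ≤ col j) :
    WP W (colorsP d) σ ((104 * n + 11) * k + 43 * n + 22) fun σ' =>
      Grow (d + 7) (d + 20) σ σ' ∧ ∃ l' kv' ca, l'.Perm (List.range n) ∧
      ColorCells σ'.next σ'.cell ca {c | ∃ j < n, col j = c} ∧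
      IsList σ'.next σ'.cell (recRow kv' (fun j => .ptr (ca (col j))) rl) l' (σ'.reg (d + 12)) := by
  refine WP.le (T := ((104 * n + 11) * k + 18 * n + 14) + (2 + (25 * n + 6))) ?_ (by omega)
  refine WP.seq ((sortByP_spec (le := fun i j => decide (col i ≤ col j)) (R := fun j => .num (col j))
    hW hc (fun a b c => by simpa using le_trans) (fun a b => by simpa using le_total _ _)
    (fun _ _ => rfl) hR hn hn0 hk hl hin hperm).conseq ?_)
  rintro σ₁ ⟨hg1, l', hp, hsort, hl1⟩
  have hlen : l'.length = n := by simpa using hp.length_eq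
  have hmem : ∀ j, j ∈ l' ↔ j < n := fun j => by simpa using hp.mem_iff (a := j)
  refine WP.seq (WP.blk (is := [_]) ⟨_, rfl, ?_⟩)
  have hg2 : Grow (d + 7) (d + 20) σ (σ₁.set (d + 11) (σ₁.reg (d + 10))) :=
    hg1.trans (.of_set (by omega) (by omega))
  refine (WP.mono (colorP_spec (col := col) (l := l') hW (hc.grow hg2 le_rfl) (fun _ => rfl)
    (by simpa [State.set] using hl1) (hsort.imp (by simp)) fun j hj => hcol j ((hmem j).1 hj))
    (by rw [hlen]) ?_)
  rintro σ₂ ⟨hg3, ca, hca, hl2⟩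
  refine ⟨hg2.trans (hg3.mono le_rfl (by omega)), l'.reverse, _, ca,
      (List.reverse_perm _).trans hp, ?_,
    hl2⟩
  simpa only [hmem] using hca

theorem Roots.take {κ V h ca col rk ls m root} : ∀ {l : List ℕ}, Roots κ V h ca col rk ls m root l →
    ∀ t (ht : t < l.length), ∃ Φ, IsDom κ V h ca col rk ls m (root l[t]) (↑(l.drop t) : Multiset ℕ) Φ
  | j :: l, H, 0, _ => by simpa using H.1
  | j :: l, H, t + 1, ht => by simpa using H.2.take t (by simpa using ht)

/-- The records that come out of the sweep point to the versions, so the index over coordinate `0`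
has the structure for a prefix as the value of that prefix. The empty structure is the value of the
empty prefix. -/
theorem sweepP_spec {W d n k s kv rl l σ ca rk} {col : ℕ → ℕ} {key : ℕ → ℕ → ℝ} {inp : ℕ → ℕ → Val}
    (hd : 1 ≤ d) (hW : 2 * n + 2 ≤ W) (hs2 : 2 ≤ s) (hsn : s ≤ n) (hc : Consts d σ)
    (h2 : σ.reg (d + 2) = .num n) (h3 : σ.reg (d + 3) = .num s)
    (hR : ∀ j < n, inp j 0 = .real (key 0 j)) (hn : n ≤ σ.next) (hk : n ≤ 2 ^ k)
    (hl : IsList σ.next σ.cell (recRow kv (fun j => .ptr (ca (col j))) rl) l (σ.reg (d + 12)))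
    (hin : ∀ j < n, σ.cell j = inp j) (hperm : l.Perm (List.range n))
    (hca : ColorCells σ.next σ.cell ca {c | ∃ j < n, col j = c})
    (hrl : ∀ j < n, RankList σ.next σ.cell rk j (d - 1) (rl j))
    (hrank : ∀ i < d - 1, Search σ.next σ.cell n (key (i + 1)) (RankAt σ.next σ.cell n (rk i))
        (σ.reg (2 * d + 45 - i))) :
    WP W (sweepP d) σ (((104 * n + 11) * k + 18 * n + 14) + (2 +
      (((31 * (Nat.log 2 (n + 1) + 1) + 10) * (d - 1) + 7) + (5 +
      (((domCost 60 (trieLevels s n) (d - 1) + 40) * n + 3) + (3 + ((18 * n + 3) + (80 * n + 11))))))))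
      (Index 60 d n (trieLevels s n) key col ca rk) := by
  have hn0 : 0 < n := by omega
  have hW1 : 1 ≤ W := by omega
  refine WP.seq ((sortByP_spec (le := fun i j => decide (key 0 i ≤ key 0 j))
    (R := fun j => .real (key 0 j))
    hW1 hc (fun a b c => by simpa using le_trans) (fun a b => by simpa using le_total _ _)
    (fun _ _ => rfl) hR hn hn0 hk hl hin hperm).conseq ?_)
  rintro σ₁ ⟨hg1, l', hp, hsort, hl1⟩
  have hlen : l'.length = n := by simpa using hp.length_eq
  have hnd : l'.Nodup := hp.nodup_iff.2 List.nodup_range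
  have hmem : ∀ j, j ∈ l' ↔ j < n := fun j => by simpa using hp.mem_iff (a := j)
  have hsort' : l'.Pairwise (key 0 · ≤ key 0 ·) := hsort.imp (by simp)
  refine WP.seq (WP.blk (is := [_]) ⟨_, rfl, ?_⟩)
  have hg2 : Grow (d + 7) (d + 42) σ (σ₁.set (d + 41) (σ₁.reg (d + 10))) :=
    (hg1.mono le_rfl (by omega)).trans (.of_set (by omega) (by omega))
  refine WP.seq ((emptyP_spec (κ := 60) (ca := ca) (col := col) (rk := rk) hs2 hsn hW (d - 1)
    (hc.grow hg2 le_rfl) (by rw [hg2.reg_eq _ (by omega), h2])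
    (by rw [hg2.reg_eq _ (by omega), h3])).conseq ?_)
  rintro σ₂ ⟨hg3, hdesc, hdom⟩
  have hg3' := hg2.trans (hg3.mono le_rfl (by omega))
  have e41 : σ₂.reg (d + 41) = σ₁.reg (d + 10) := by
    rw [hg3.reg_eq _ (by omega)]; simp [State.set]
  have hl2 : IsList σ₂.next σ₂.cell _ l' (σ₁.reg (d + 10)) :=
    IsList.grow (σ := σ₁.set (d + 41) (σ₁.reg (d + 10))) hl1 hg3
  refine WP.seq (WP.blk (is := [_, _, _, _]) ?_)
  simp (disch := omega) only [execL, Instr.exec, State.set, Function.update_self,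
      Function.update_of_ne, if_pos, Option.bind_some, Option.some.injEq, exists_eq_left', if_true,
      row]
  set σ₃ : State := ⟨_, _, _, _⟩ with hσ₃
  have hg23 : Grow (d + 7) (d + 46) σ₂ σ₃ := ⟨le_rfl, fun _ _ => rfl, rfl,
      fun r hr => by simp (disch := omega) only [Function.update_self, Function.update_of_ne, hσ₃]⟩
  have hg4 : Grow (d + 7) (d + 46) σ σ₃ := (hg3'.mono le_rfl (by omega)).trans hg23
  have hc3 := hc.grow hg4 le_rfl
  have hca3 := hca.grow hg4
  have hb3 : ColorBase σ₃.next σ₃.cell ca {c | ∃ j < n, col j = c} :=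
    ⟨hca3.lt, hca3.color, hca3.inj⟩
  have e45 : σ₃.reg (d + 45) = σ₂.reg (d + 11) := by
    simp (disch := omega) only [Function.update_self, Function.update_of_ne, hσ₃]
  refine WP.seq (WP.mono (insertAllP_spec (κ := 60) (m := d - 1) (rk := rk) (ls := trieLevels s n)
    (acc := []) (root := rl) (Φ := 0) (S := {c | ∃ j < n,
        col j = c}) (kv := fun j => .real (key 0 j))
    (rl := rl) (ca := ca) (col := col) hW1 le_rfl (closed_levels _ _) l' hc3 hb3 hca3.count ?_ ?_ trivial ?_ ?_
    (fun j hj => (hrl j ((hmem j).1 hj)).mono hg4.next_le hg4.agree) (by simpa using hnd)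
    (by simp; omega) fun j hj => ⟨j, (hmem j).1 (by simpa using hj), rfl⟩) (by rw [hlen]; omega) ?_)
  · simp (disch := omega) only [Function.update_self, Function.update_of_ne, hσ₃, e41]; exact hl2
  · simp (disch := omega) only [Function.update_self, Function.update_of_ne, hσ₃]; rfl
  · simp (disch := omega) only [Function.update_self, Function.update_of_ne, hσ₃]; exact hdom
  · simp (disch := omega) only [Function.update_self, Function.update_of_ne, hσ₃]; exact hdesc
  rintro σ₄ ⟨hg5, hz4, root, hl4, hroots⟩
  rw [List.append_nil] at hl4 hroots
  have hg5' : Upd (d + 7) (d + 46) ∅ σ σ₄ := Upd.trans (Y := ∅)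
    ⟨hg4.next_le, fun a ha _ f hf => hg4.agree a ha f hf, hg4.out_eq, hg4.reg_eq⟩
    (hg5.mono le_rfl (by omega) subset_rfl) (by simp)
  have hc4 := hc.upd hg5' le_rfl
  refine WP.seq (WP.blk (is := [_, _]) ?_)
  simp (disch := omega) only [execL, Instr.exec, State.set, Function.update_self,
      Function.update_of_ne, if_pos, Option.bind_some, Option.some.injEq, exists_eq_left', if_true,
      row]
  set σ₅ : State := ⟨_, _, _, _⟩ with hσ₅
  have hg6 : Grow (d + 7) (d + 44) σ₄ σ₅ := ⟨le_rfl, fun _ _ => rfl, rfl,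
      fun r hr => by simp (disch := omega) only [Function.update_self, Function.update_of_ne, hσ₅]⟩
  refine WP.seq (WP.mono (revP_spec (R := recRow (fun j => .real (key 0 j))
    (fun j => .ptr (ca (col j))) root) hW1 l'.reverse (acc := []) (hc4.grow hg6 le_rfl)
    (by simp (disch := omega) only [Function.update_self, Function.update_of_ne, hσ₅]; exact hl4) (by simp (disch := omega) only [Function.update_self, Function.update_of_ne, hσ₅]; rfl)) (by simp [hlen]) ?_)
  rintro σ₆ ⟨hg7, hl6⟩
  rw [List.append_nil, List.reverse_reverse] at hl6
  have hg46 := hg6.trans (hg7.mono le_rfl (by omega))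
  refine (indexP_spec (r := 2 * d + 46) (s := d + 45) (key := key 0) hW1
    (hc4.grow hg46 le_rfl) (by omega) hl6 hlen hp hsort').conseq ?_
  rintro σ₈ ⟨σ₇, v, hg8, rfl, hsearch⟩
  have hg47 := hg46.trans (hg8.mono le_rfl (by omega))
  have hgt : Upd (d + 7) (d + 46) ∅ σ σ₇ := hg5'.trans (Y := ∅)
    ⟨hg47.next_le, fun a ha _ f hf => hg47.agree a ha f hf, hg47.out_eq,
      fun r hr => hg47.reg_eq r (by omega)⟩ (by simp)
  have hag := hgt.agree le_rfl (by simp)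
  have hz7 : ∀ j < n, σ₇.cell (ca (col j)) 8 = .num 0 := fun j hj => by
    rw [hg47.cell_eq _ ((hca3.lt _ ⟨j, hj, rfl⟩).trans_le hg5.next_le)]
    exact hz4 _ ⟨j, hj, rfl⟩
  have hag37 : Agree σ₃.next σ₃.cell σ₇.cell := fun a ha f hf => by
    rw [hg47.cell_eq _ (ha.trans_le hg5.next_le), hg5.cell_eq a ha (by simp) f hf]
  refine ⟨(hc.upd hgt le_rfl).set (by omega), ?_, hz7, ?_, ?_, fun i hi => ?_⟩
  · exact ColorBase.mono ⟨hca.lt, hca.color, hca.inj⟩ hgt.next_le hag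
  · have e : (σ₇.set (2 * d + 46) v).reg (d + 44) = σ₂.reg (d + 10) := by
      have e3 : σ₃.reg (d + 44) = σ₂.reg (d + 10) := by
        simp (disch := omega) only [Function.update_self, Function.update_of_ne, hσ₃]
      rw [← e3, ← hg5.reg_eq _ (by omega), ← hg47.reg_eq _ (by omega)]
      simp only [State.set]
      rw [Function.update_of_ne (by omega)]
    rw [e]
    exact hdesc.mono (hg5.next_le.trans hg47.next_le) hag37
  · have hv : (σ₇.set (2 * d + 46) v).reg (2 * d + 46) = v := by simp [State.set]
    rw [hv]
    refine hsearch _ ⟨0, ?_⟩ fun t ht => ?_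
    · rw [hg46.reg_eq _ (by omega), hg5.reg_eq _ (by omega), e45]
      exact IsDom.mono (Set.Iio_subset_Iio (hg5.next_le.trans hg47.next_le))
        (fun a ha f hf => hag37 a ha f hf) _ _ _ hdom
    -- The versions belong to the tails of the reversed order; the tail that starts at position
    -- `l'.length - 1 - t` is, as a multiset, the prefix of length `t + 1` of the sorted order.
    · obtain ⟨Φ, h⟩ := hroots.take (l'.length - 1 - t) (by simp; omega)
      refine ⟨Φ, ?_⟩
      have e1 : l'.reverse[l'.length - 1 - t]'(by simp; omega) = l'[t] := by
        rw [List.getElem_reverse]; congr 1; omega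
      have e2 : (↑(l'.reverse.drop (l'.length - 1 - t)) : Multiset ℕ) = ↑(l'.take (t + 1)) := by
        rw [List.drop_reverse, Multiset.coe_reverse]
        congr 2; omega
      rw [e1, e2] at h
      exact IsDom.mono (Set.Iio_subset_Iio hg47.next_le) (fun a ha f hf => hg47.agree a ha f hf) _ _ _ h
  · have e : (σ₇.set (2 * d + 46) v).reg (2 * d + 45 - i) = σ.reg (2 * d + 45 - i) := by
      rw [← hgt.reg_eq _ (by omega)]
      simp only [State.set]
      rw [Function.update_of_ne (by omega)]
    rw [e]
    exact (hrank i hi).mono hgt.next_le hag fun l v h => h.mono hgt.next_le hag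

theorem buildP_spec {W d n s σ} {col : ℕ → ℕ} {key : ℕ → ℕ → ℝ}
    (hd : 2 ≤ d) (hW : 2 * n + 2 ≤ W) (hs2 : 2 ≤ s) (hsn : s ≤ n)
    (h0 : σ.reg 0 = .ptr 0) (h1 : σ.reg 1 = .num n) (h2 : σ.reg 2 = .num s) (hn : n ≤ σ.next)
    (hin : ∀ j < n, (∀ i < d, σ.cell j i = .real (key i j)) ∧ σ.cell j d = .num (col j) ∧
      σ.cell j (d + 1) = if j + 1 < n then .ptr (j + 1) else .nil) (hcol : ∀ j < n, 1 ≤ col j) :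
    WP W (buildP d) σ (400 * d * (n * (Nat.log 2 (n + 1) + 1)) +
      domCost 60 (trieLevels s n) (d - 1) * n) fun σ' =>
        ∃ ca rk, Index 60 d n (trieLevels s n) key col ca rk σ' := by
  set k := Nat.log 2 (n + 1) + 1 with hk
  have hnk : n ≤ 2 ^ k := by 
    have : n + 1 < 2 ^ k := Nat.lt_pow_succ_log_self (by omega) (n + 1)
    omega
  refine WP.le (T := 7 + ((10 * n + 8) + (((104 * n + 11) * k + 43 * n + 22) +
    ((((104 * n + 11) * k + 136 * n + 50) * (d - 1) + 1) + (((104 * n + 11) * k + 18 * n + 14) + (2 +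
      (((31 * k + 10) * (d - 1) + 7) + (5 +
      (((domCost 60 (trieLevels s n) (d - 1) + 40) * n + 3) + (3 + ((18 * n + 3) +
      (80 * n + 11)))))))))))) ?_ ?_
  · refine WP.seq (WP.blk (is := [_, _, _, _, _, _]) ?_)
    have hW1 : 1 ≤ W := by omega
    simp (disch := omega) only [execL, Instr.exec, State.set, Function.update_self,
      Function.update_of_ne, if_pos, Option.bind_some, Option.some.injEq, exists_eq_left', if_true,
      row, h0, h1, h2, Nat.zero_le, hW1]
    set σ₁ : State := ⟨_, _, _, _⟩ with hσ₁
    have hc1 : Consts d σ₁ := ⟨by simp (disch := omega) only [Function.update_self,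
        Function.update_of_ne, hσ₁], by simp (disch := omega) only [Function.update_self,
        Function.update_of_ne, hσ₁], by simp (disch := omega) only [Function.update_self,
        Function.update_of_ne, hσ₁]⟩
    refine WP.seq ((initP_spec (n := n) hW1 hc1 hn (by simp (disch := omega) only [Function.update_self, Function.update_of_ne, hσ₁]; rw [if_pos (by omega)]) fun j hj =>
      (hin j hj).2.2).conseq ?_)
    rintro σ₂ ⟨hg2, a, ha, ha0, hl2⟩
    have hcell2 : ∀ j < n, σ₂.cell j = σ.cell j := fun j hj => hg2.cell_eq j (hj.trans_le hn)
    refine WP.seq ((colorsP_spec (inp := σ.cell) (col := col) hW1 (hc1.grow hg2 le_rfl)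
      (fun j hj => (hin j hj).2.1) (hn.trans hg2.next_le) (by omega) hnk hl2 hcell2
      (List.reverse_perm _) hcol).conseq ?_)
    rintro σ₃ ⟨hg3, l₃, kv₃, ca, hp3, hca, hl3⟩
    have hg3' := hg2.trans (hg3.mono le_rfl (by omega))
    have hcell3 : ∀ j < n, σ₃.cell j = σ.cell j := fun j hj => hg3'.cell_eq j (hj.trans_le hn)
    refine WP.seq ((stagesP_spec (inp := σ.cell) (key := key) hW1 (hc1.grow hg3' le_rfl)
      (by rw [hg3'.reg_eq _ (by omega)]; simp (disch := omega) only [Function.update_self, Function.update_of_ne, hσ₁]) (fun i hi j hj => (hin j hj).1 i hi)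
      (hn.trans hg3'.next_le) (by omega) hnk hl3 hcell3 hp3
      (fun j hj => ⟨a, ha.trans_le hg3.next_le, rfl⟩) (d - 1) (by omega)).conseq ?_)
    rintro σ₄ ⟨hg4, l₄, kv₄, rl₄, rk, hp4, hl4, hrl4, hs4⟩
    have hg4' := (hg3'.mono le_rfl (by omega)).trans hg4
    refine (sweepP_spec (inp := σ.cell) (rk := rk) (by omega) hW hs2 hsn (hc1.grow hg4' le_rfl)
      (by rw [hg4'.reg_eq _ (by omega)]; simp (disch := omega) only [Function.update_self, Function.update_of_ne, hσ₁]) (by rw [hg4'.reg_eq _ (by omega)]; simp (disch := omega) only [Function.update_self, Function.update_of_ne, hσ₁])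
      (fun j hj => (hin j hj).1 0 (by omega)) (hn.trans hg4'.next_le) hnk hl4
      (fun j hj => hg4'.cell_eq j (hj.trans_le hn)) hp4 (hca.grow hg4) hrl4 hs4).conseq ?_
    exact fun σ₅ h => ⟨ca, rk, h⟩
  · obtain ⟨e, rfl⟩ : ∃ e, d = e + 1 := ⟨d - 1, by omega⟩
    have hk1 : 2 ≤ k := by
      have : 1 ≤ Nat.log 2 (n + 1) := Nat.log_pos (by omega) (by omega)
      omega
    -- With `2 ≤ n` and `2 ≤ k`, all lower-order terms are absorbed into multiples of `n * k`.
    have x1 : 2 * k ≤ n * k := Nat.mul_le_mul_right _ (by omega)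
    have x2 : n * 2 ≤ n * k := Nat.mul_le_mul_left _ hk1
    have x3 : 4 ≤ n * k := by omega
    rw [Nat.add_sub_cancel]
    generalize domCost 60 (trieLevels s n) e = D
    generalize hX : n * k = X at *
    have y1 : (104 * n + 11) * k + 136 * n + 50 ≤ 200 * X := by
      rw [add_mul, mul_assoc, hX]; omega
    have y2 := Nat.mul_le_mul_right e y1
    have y3 : (31 * k + 10) * e ≤ (20 * X) * e := Nat.mul_le_mul_right e (by omega)
    have y4 : (104 * n + 11) * k = 104 * X + 11 * k := by rw [add_mul, mul_assoc, hX]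
    have y5 : 400 * (e + 1) * X = 400 * (X * e) + 400 * X := by ring
    have y6 : 200 * X * e = 200 * (X * e) := by ring
    have y7 : 20 * X * e = 20 * (X * e) := by ring
    rw [y5, y4, add_mul D]
    rw [y4] at y2
    omega

/-! ### Searching -/

/-- `σ'` arises from `σ` by changing fields from `8` on, working registers, and registers with
numbers between `lo` and `hi`. -/
structure Keep (d lo hi : ℕ) (σ σ' : State) : Prop where
  next_eq : σ'.next = σ.next
  cell_eq : Agree σ.next σ.cell σ'.cell
  reg_eq : ∀ r, r < d + 7 ∨ d + 40 ≤ r ∧ r < lo ∨ d + 40 ≤ r ∧ hi ≤ r → σ'.reg r = σ.reg r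

theorem Keep.refl (d lo hi σ) : Keep d lo hi σ σ := ⟨rfl, Agree.refl _ _, fun _ _ => rfl⟩

theorem Keep.trans {d lo hi σ σ' σ''} (h : Keep d lo hi σ σ') (h' : Keep d lo hi σ' σ'') :
    Keep d lo hi σ σ'' :=
  ⟨h'.next_eq.trans h.next_eq, fun a ha f hf =>
    (h'.cell_eq a (by rw [h.next_eq]; exact ha) f hf).trans (h.cell_eq a ha f hf),
    fun r hr => (h'.reg_eq r hr).trans (h.reg_eq r hr)⟩

theorem Keep.mono {d lo hi lo' hi' σ σ'} (h : Keep d lo hi σ σ') (hl : lo' ≤ lo) (hh : hi ≤ hi') :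
    Keep d lo' hi' σ σ' := ⟨h.next_eq, h.cell_eq, fun r hr => h.reg_eq r (by omega)⟩

theorem Keep.of_set {d lo hi σ r v} (h1 : d + 7 ≤ r) (h2 : r < d + 40 ∨ lo ≤ r ∧ r < hi) :
    Keep d lo hi σ (σ.set r v) :=
  ⟨rfl, Agree.refl _ _, fun q hq => Function.update_of_ne (by omega) ..⟩

theorem Consts.keep {d lo hi σ σ'} (h : Consts d σ) (hg : Keep d lo hi σ σ') : Consts d σ' :=
  ⟨(hg.reg_eq _ (by omega)).trans h.zero, (hg.reg_eq _ (by omega)).trans h.one,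
    (hg.reg_eq _ (by omega)).trans h.nil⟩

/-- In a sorted list the positions with key at most `x` form an initial segment, whatever the order
among equal keys. -/
theorem exists_count_le {key : ℕ → ℝ} (x : ℝ) : ∀ l : List ℕ, l.Pairwise (key · ≤ key ·) →
    ∃ r ≤ l.length, ∀ t (ht : t < l.length), key l[t] ≤ x ↔ t < r
  | [], _ => ⟨0, le_rfl, by simp⟩
  | j :: l, H => by
    rw [List.pairwise_cons] at H
    obtain ⟨r, hr, hrt⟩ := exists_count_le x l H.2
    by_cases hj : key j ≤ x
    · refine ⟨r + 1, by simpa using hr, fun t ht => ?_⟩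
      cases t with
      | zero => simp [hj]
      | succ t => simpa using hrt t (by simpa using ht)
    · refine ⟨0, Nat.zero_le _, fun t ht => ?_⟩
      cases t with
      | zero => simpa using hj
      | succ t =>
        have := H.1 _ (List.getElem_mem (by simpa using ht : t < l.length))
        simp only [List.getElem_cons_succ, Nat.not_lt_zero, iff_false]
        exact fun h => hj (this.trans h)

/-- Go one step to the right from the cell in `d + 8` if the key there is at most register `i`. -/
def rightP (d i : ℕ) : Prog :=
  .branch (.same (d + 10) (d + 6)) .skip (.seq (blk [.load (d + 11) (d + 10) 1])
    (.branch (.le (d + 11) i) (blk [.move (d + 8) (d + 10)]) .skip))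

/-- Look up the value of register `i` in the search structure in register `s`; the result is in
register `r`. -/
def searchP (d i s r : ℕ) : Prog :=
  .seq (blk [.move (d + 8) s, .load (d + 9) (d + 8) 5]) (.seq (whileNe d (d + 9)
    (.seq (blk [.move (d + 8) (d + 9), .load (d + 10) (d + 8) 2]) (.seq (rightP d i)
    (blk [.load (d + 9) (d + 8) 5])))) (blk [.load r (d + 8) 4]))

/-- The predicate `good` abstracts from the level: it says whether the position with this index is
still among the keys at most `x`. Past the end of the level it must fail. -/
theorem rightP_spec {W d i σ m a kv x j} {good : ℕ → Prop} (hc : Consts d σ) (hi : i < d + 7)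
    (hx : σ.reg i = .real x) (hl : Level σ.next σ.cell kv m a) (hj : j ≤ m)
    (h8 : σ.reg (d + 8) = .ptr (a j)) (h10 : σ.reg (d + 10) = σ.cell (a j) 2)
    (hkv : j < m → ∃ y, kv (j + 1) = .real y ∧ (y ≤ x ↔ good (j + 1))) (hm : ¬ good (m + 1)) :
    WP W (rightP d i) σ 6 fun σ' => (∃ v w, σ' = (σ.set (d + 11) v).set (d + 8) w) ∧
      ∃ j', σ'.reg (d + 8) = .ptr (a j') ∧ j' ≤ m ∧
      (j' = j ∧ ¬ good (j + 1) ∨ j' = j + 1 ∧ good (j + 1)) := by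
  obtain ⟨h1, h2, -⟩ := hl j hj
  rw [h2] at h10
  have e0 : σ = (σ.set (d + 11) (σ.reg (d + 11))).set (d + 8) (σ.reg (d + 8)) := by
    simp [State.set]
  refine WP.le (T := 5 + 1) (WP.branch (b := decide (¬ j < m)) ?_ (fun h => ?_) fun h => ?_) le_rfl
  · rw [eval_same, h10, hc.nil]
    split_ifs with h <;> simp [sameVal, h]
  · have h : ¬ j < m := by simpa using h
    obtain rfl : j = m := by omega
    exact WP.le (WP.skip ⟨⟨_, _, e0⟩, j, h8, hj, .inl ⟨rfl, hm⟩⟩) (by omega)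
  · have h : j < m := by simpa using h
    rw [if_pos h] at h10
    obtain ⟨y, hy, hyx⟩ := hkv h
    obtain ⟨h1', -, h3'⟩ := hl (j + 1) h
    have h3 := h3' (Nat.succ_pos _)
    rw [hy] at h3
    refine WP.le (T := 2 + (2 + 1)) (WP.seq (WP.blk (is := [_]) ?_)) le_rfl
    simp (disch := omega) only [execL, Instr.exec, State.set, Function.update_self,
      Function.update_of_ne, if_pos, Option.bind_some, Option.some.injEq, exists_eq_left', if_true,
      row, h10, h1', h3]
    refine WP.branch (b := decide (y ≤ x)) ?_ (fun h => ?_) fun h => ?_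
    · rw [eval_le]; simp (disch := omega) only [Function.update_self, Function.update_of_ne, hx,
          leVal]
    · have h : y ≤ x := by simpa using h
      refine WP.blk (is := [_]) ⟨_, rfl, ⟨_, _, rfl⟩, j + 1, ?_, by omega, .inr ⟨rfl, hyx.1 h⟩⟩
      simp (disch := omega) only [Function.update_self, Function.update_of_ne, State.set]; exact h10
    · have h : ¬ y ≤ x := by simpa using h
      refine WP.le (WP.skip ⟨⟨.real y, σ.reg (d + 8), ?_⟩, j, ?_, hj, .inl ⟨rfl,
          fun h' => h (hyx.2 h')⟩⟩)
        (by omega)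
      · congr 1
        rw [eq_comm, Function.update_eq_self_iff, Function.update_of_ne (by omega)]
      · simp (disch := omega) only [Function.update_self, Function.update_of_ne]; exact h8

/-- The number `c` of keys at most `x` is approached from above: at level `K` the current index is
`⌊c / 2 ^ K⌋`. Going down doubles the index, and at most one step to the right corrects it, so the
time is proportional to the number of levels. -/
theorem searchP_spec {W d i s r n x σ} {key : ℕ → ℝ} {P : List ℕ → Val → Prop} (hW : 1 ≤ W)
    (hc : Consts d σ) (hi : i < d + 7) (hr : d + 40 ≤ r) (hx : σ.reg i = .real x)
    (hs : Search σ.next σ.cell n key P (σ.reg s)) :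
    WP W (searchP d i s r) σ (14 * (Nat.log 2 (n + 1) + 1) + 8) fun σ' => Keep d r (r + 1) σ σ' ∧
      σ'.out = σ.out ∧ σ'.cell = σ.cell ∧
      ∃ l : List ℕ, P l (σ'.reg r) ∧ l.Nodup ∧ ∀ j, j ∈ l ↔ j < n ∧ key j ≤ x := by
  obtain ⟨K, a, l, kv, pay, hv, hsk, hK1, hK2, hp, hsort, hkv, hP⟩ := hs
  have hlen : l.length = n := by simpa using hp.length_eq
  have hnd : l.Nodup := hp.nodup_iff.2 List.nodup_range
  have hmem : ∀ j, j ∈ l ↔ j < n := fun j => by simpa using hp.mem_iff (a := j)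
  obtain ⟨c, hcl, hct⟩ := exists_count_le x l hsort
  rw [hlen] at hcl
  -- From `2 ^ K ≤ 2 * n + 1` and `n + 1 < 2 ^ (Nat.log 2 (n + 1) + 1)`.
  have hKL : K ≤ Nat.log 2 (n + 1) + 1 := by
    have h1 : 2 ^ K < 2 ^ (Nat.log 2 (n + 1) + 1 + 1) := by
      have : n + 1 < 2 ^ (Nat.log 2 (n + 1) + 1) := Nat.lt_pow_succ_log_self (by omega) (n + 1)
      rw [pow_succ]; omega
    have := (Nat.pow_lt_pow_iff_right (a := 2) (by omega)).1 h1
    omega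
  have loop : ∀ K a j τ, Skip σ.next σ.cell kv pay n K a → Keep d r (r + 1) σ τ → τ.out = σ.out →
      τ.cell = σ.cell →
      j ≤ n / 2 ^ K → j * 2 ^ K ≤ c → c < (j + 1) * 2 ^ K → τ.reg (d + 8) = .ptr (a j) →
      τ.reg (d + 9) = σ.cell (a j) 5 →
      WP W (whileNe d (d + 9) (.seq (blk [.move (d + 8) (d + 9), .load (d + 10) (d + 8) 2])
        (.seq (rightP d i) (blk [.load (d + 9) (d + 8) 5])))) τ (14 * K + 3) fun τ' =>
        Keep d r (r + 1) σ τ' ∧ τ'.out = σ.out ∧ τ'.cell = σ.cell ∧ ∃ b < σ.next,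
          τ'.reg (d + 8) = .ptr b ∧ σ.cell b 4 = pay c := by
    intro K
    induction K with
    | zero =>
      intro a j τ hsk hg hout hcell hj h1 h2 h8 h9
      obtain rfl : c = j := by omega
      rw [(hsk.2 c hcl).2] at h9
      refine WP.while_nil h9 (hc.keep hg).one (hc.keep hg).nil ⟨hg.trans (.of_set le_rfl (by omega)),
        hout, hcell, a c, (hsk.1 c hcl).1, ?_, (hsk.2 c hcl).1⟩
      simp (disch := omega) only [Function.update_self, Function.update_of_ne, State.set]; exact h8
    | succ K ih =>
      intro a j τ hsk hg hout hcell hj h1 h2 h8 h9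
      obtain ⟨hlev, a', hsk', hdown⟩ := hsk
      rw [hdown j hj] at h9
      have hlev' := hsk'.level
      have hc1 := hc.keep hg
      have hpos : 0 < 2 ^ K := by positivity
      have hj2 : 2 * j ≤ n / 2 ^ K := by
        rw [Nat.le_div_iff_mul_le hpos]
        rw [pow_succ] at h1
        calc 2 * j * 2 ^ K = j * (2 ^ K * 2) := by ring
          _ ≤ n := h1.trans hcl
      have ha' : a' (2 * j) < τ.next := by rw [hg.next_eq]; exact (hlev' _ hj2).1
      refine WP.le (T := (3 + (6 + 2)) + (14 * K + 3) + 3) (WP.while_ptr hW h9 hc1.one hc1.nil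
        (WP.seq (WP.blk (is := [_, _]) ?_))) (by omega)
      simp (disch := omega) only [execL, Instr.exec, State.set, Function.update_self,
      Function.update_of_ne, if_pos, Option.bind_some, Option.some.injEq, exists_eq_left', if_true,
      row, h9, ha']
      set τ₁ : State := ⟨_, _, _, _⟩ with hτ₁
      have hg1 : Keep d r (r + 1) σ τ₁ := hg.trans ⟨rfl, Agree.refl _ _,
          fun r hr => by simp (disch := omega) only [Function.update_self, Function.update_of_ne,
          hτ₁]⟩
      refine WP.seq ((rightP_spec (good := fun j => j * 2 ^ K ≤ c) (x := x) (j := 2 * j) (a := a')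
        (kv := fun i => kv (i * 2 ^ K)) (m := n / 2 ^ K) (hc.keep hg1) hi
        (by rw [hg1.reg_eq _ (by omega), hx]) ?_ hj2 ?_ ?_ (fun hlt => ?_) ?_).conseq ?_)
      · rw [hg1.next_eq]; simpa only [hτ₁, hcell] using hlev'
      · simp (disch := omega) only [Function.update_self, Function.update_of_ne, hτ₁]
      · simp (disch := omega) only [Function.update_self, Function.update_of_ne, hτ₁]
      -- Cell indices are shifted by one against list positions because of the cell for the empty
      -- prefix.
      · have hle : (2 * j + 1) * 2 ^ K ≤ n := (Nat.le_div_iff_mul_le hpos).1 hlt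
        have h0 : 0 < (2 * j + 1) * 2 ^ K := by positivity
        have := hkv ((2 * j + 1) * 2 ^ K - 1) (by omega)
        rw [Nat.sub_add_cancel h0] at this
        refine ⟨_, this, ?_⟩
        rw [hct]
        omega
      -- Beyond the last cell of the level the index times `2 ^ K` exceeds `n`, hence also `c`.
      · rw [not_le]
        exact hcl.trans_lt ((Nat.div_lt_iff_lt_mul hpos).1 (Nat.lt_succ_self _))
      · rintro τ₂ ⟨⟨v, w, rfl⟩, j', h8', hj', hor⟩
        set τ₂ := (τ₁.set (d + 11) v).set (d + 8) w with hτ₂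
        have hg2 : Keep d r (r + 1) σ τ₂ := (hg1.trans (.of_set (by omega) (by omega))).trans
          (.of_set (by omega) (by omega))
        have ha2 : a' j' < τ₂.next := by rw [hg2.next_eq]; exact (hlev' _ hj').1
        refine WP.blk (is := [_]) ?_
        simp (disch := omega) only [execL, Instr.exec, State.set, Function.update_self,
      Function.update_of_ne, if_pos, Option.bind_some, Option.some.injEq, exists_eq_left', if_true,
      row, h8', ha2]
        refine ih a' j' _ hsk' (hg2.trans ⟨rfl, Agree.refl _ _,
            fun r hr => by simp (disch := omega) only [Function.update_self,
            Function.update_of_ne]⟩) hout hcell hj' ?_ ?_ ?_ ?_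
        · rw [pow_succ] at h1
          obtain ⟨rfl, h⟩ | ⟨rfl, h⟩ := hor
          · calc 2 * j * 2 ^ K = j * (2 ^ K * 2) := by ring
              _ ≤ c := h1
          · exact h
        · rw [pow_succ] at h2
          obtain ⟨rfl, h⟩ | ⟨rfl, h⟩ := hor
          · exact not_le.1 h
          · calc c < (j + 1) * (2 ^ K * 2) := h2
              _ = (2 * j + 1 + 1) * 2 ^ K := by ring
        · simp (disch := omega) only [Function.update_self, Function.update_of_ne]; exact h8'
        · simp (disch := omega) only [Function.update_self, Function.update_of_ne]
          exact congrFun (congrFun hcell _) _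
  have ha0 : a 0 < σ.next := (hsk.level 0 (Nat.zero_le _)).1
  refine WP.le (T := 3 + ((14 * K + 3) + 2)) (WP.seq (WP.blk (is := [_, _]) ?_)) (by omega)
  simp (disch := omega) only [execL, Instr.exec, State.set, Function.update_self,
      Function.update_of_ne, if_pos, Option.bind_some, Option.some.injEq, exists_eq_left', if_true,
      row, hv, ha0]
  set τ₀ : State := ⟨_, _, _, _⟩ with hτ₀
  refine WP.seq ((loop K a 0 τ₀ hsk ⟨rfl, Agree.refl _ _,
      fun r hr => by simp (disch := omega) only [Function.update_self, Function.update_of_ne,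
      hτ₀]⟩ rfl rfl
    (Nat.zero_le _) (by simp) (by rw [zero_add, one_mul]; omega) (by simp (disch := omega) only [Function.update_self, Function.update_of_ne, hτ₀]) (by simp (disch := omega) only [Function.update_self, Function.update_of_ne, hτ₀])).conseq ?_)
  rintro τ ⟨hg, hout, hcell, b, hb, h8, h4⟩
  have hb' : b < τ.next := by rw [hg.next_eq]; exact hb
  refine WP.blk (is := [_]) ?_
  simp (disch := omega) only [execL, Instr.exec, State.set, Function.update_self,
      Function.update_of_ne, if_pos, Option.bind_some, Option.some.injEq, exists_eq_left', if_true,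
      row, h8, hb']
  refine ⟨hg.trans ⟨rfl, Agree.refl _ _, fun q hq => by simp (disch := omega) only [Function.update_self, Function.update_of_ne]⟩, hout, hcell, l.take c, ?_, hnd.sublist
    (List.take_sublist _ _), fun j => ?_⟩
  · rw [hcell, h4]; exact hP c hcl
  · rw [← hmem j]
    constructor
    · intro h
      obtain ⟨t, ht, rfl⟩ := List.getElem_of_mem h
      rw [List.length_take] at ht
      rw [List.getElem_take]
      exact ⟨List.getElem_mem _, (hct t (by omega)).2 (by omega)⟩
    · rintro ⟨h, hx⟩
      obtain ⟨t, ht, rfl⟩ := List.getElem_of_mem h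
      rw [List.mem_take_iff_getElem]
      have := (hct t ht).1 hx
      exact ⟨t, by omega, rfl⟩

/-- Put the numbers of points that precede the query in the coordinates `1, …, m`, increased by
`1`, into the registers from `2 * d + 47` on. -/
def ranksP (d : ℕ) : ℕ → Prog
  | 0 => .skip
  | m + 1 => .seq (ranksP d m) (.seq (searchP d (m + 1) (2 * d + 45 - m) (2 * d + 47 + m))
    (blk [.load (2 * d + 47 + m) (2 * d + 47 + m) 0,
      .add (2 * d + 47 + m) (2 * d + 47 + m) (d + 5)]))

theorem ranksP_spec {W d n σ} {rk : ℕ → ℕ → ℕ} {key : ℕ → ℕ → ℝ} {x : ℕ → ℝ} (hW : n + 1 ≤ W)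
    (hc : Consts d σ) (hx : ∀ i < d, σ.reg i = .real (x i)) (m : ℕ) (hm : m < d)
    (hs : ∀ i < m, Search σ.next σ.cell n (key (i + 1)) (RankAt σ.next σ.cell n (rk i))
        (σ.reg (2 * d + 45 - i))) :
    WP W (ranksP d m) σ ((14 * (Nat.log 2 (n + 1) + 1) + 11) * m + 1) fun σ' =>
      Keep d (2 * d + 47) (2 * d + 47 + m) σ σ' ∧ σ'.out = σ.out ∧ σ'.cell = σ.cell ∧
      ∀ i < m, ∃ y ≤ n + 1, σ'.reg (2 * d + 47 + i) = .num y ∧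
        ∀ j < n, rk i j < y ↔ key (i + 1) j ≤ x (i + 1) := by
  induction m with
  | zero => exact WP.le (WP.skip ⟨.refl .., rfl, rfl, by simp⟩) (by omega)
  | succ m ih =>
    refine WP.le (WP.seq ((ih (by omega) fun i hi => hs i (by omega)).conseq ?_))
      (le_of_eq (by ring : ((14 * (Nat.log 2 (n + 1) + 1) + 11) * m + 1) +
        ((14 * (Nat.log 2 (n + 1) + 1) + 8) + 3) = _))
    rintro σ₁ ⟨hg1, hout1, hcell1, h1⟩
    refine WP.seq ((searchP_spec (n := n) (x := x (m + 1)) (key := key (m + 1))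
      (P := RankAt σ₁.next σ₁.cell n (rk m)) (by omega) (hc.keep hg1) (by omega) (by omega)
      (by rw [hg1.reg_eq _ (by omega), hx _ hm]) ?_).conseq ?_)
    · rw [hg1.reg_eq _ (by omega), hg1.next_eq, hcell1]
      exact hs m (by omega)
    rintro σ₂ ⟨hg2, hout2, hcell2, l, ⟨r, hr, hv, h0, hln, hrk⟩, hnd, hmem⟩
    have hr' : r < σ₂.next := by rw [hg2.next_eq]; exact hr
    have h0' : σ₂.cell r 0 = .num l.length := by rw [hcell2]; exact h0
    have h5 := ((hc.keep hg1).keep hg2).one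
    have hlW : l.length + 1 ≤ W := by omega
    refine WP.blk (is := [_, _]) ?_
    simp (disch := omega) only [execL, Instr.exec, State.set, Function.update_self,
      Function.update_of_ne, if_pos, Option.bind_some, Option.some.injEq, exists_eq_left', if_true,
      row, hv, hr', h0', h5, hlW]
    refine ⟨(hg1.mono le_rfl (by omega)).trans ((hg2.mono (by omega) le_rfl).trans
      ⟨rfl, Agree.refl _ _, fun q hq => by simp (disch := omega) only [Function.update_self,
          Function.update_of_ne]⟩), by rw [hout2, hout1], by rw [hcell2, hcell1],
      fun i hi => ?_⟩
    obtain rfl | hi' : i = m ∨ i < m := by omega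
    -- Ranks start at `1` and those in the prefix are at most its length; adding `1` gives the
    -- strict bound with which the tries work.
    · refine ⟨l.length + 1, by omega, by simp (disch := omega) only [Function.update_self,
          Function.update_of_ne], fun j hj => ?_⟩
      rw [Nat.lt_succ_iff, ← hrk j hj, hmem]
      simp [hj]
    · obtain ⟨y, hy, hyr, H⟩ := h1 i hi'
      refine ⟨y, hy, ?_, H⟩
      simp (disch := omega) only [Function.update_self, Function.update_of_ne]
      rw [hg2.reg_eq _ (by omega), hyr]

/-! ### Queries -/

/-- The number of values below a trie with given levels. -/
def capacity : List (Option ℕ) → ℕ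
  | [] => 1
  | none :: ls => capacity ls
  | some w :: _ => 2 * w

/-- Each bit has the weight that is appropriate for the levels below it. -/
def Halving : List (Option ℕ) → Prop
  | [] => True
  | none :: ls => Halving ls
  | some w :: ls => capacity ls = w ∧ Halving ls

/-- The number of points of colour `c`. -/
def freq (col : ℕ → ℕ) (A : Multiset ℕ) (c : ℕ) : ℕ := (A.map col).count c

theorem freq_add (col : ℕ → ℕ) (A B : Multiset ℕ) (c : ℕ) :
    freq col (A + B) c = freq col A c + freq col B c := by simp [freq]

/-- The points of `A` that are below the query in `m` coordinates. -/
def below (rk : ℕ → ℕ → ℕ) (x : ℕ → ℕ) (m : ℕ) (A : Multiset ℕ) : Multiset ℕ :=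
  A.filter fun j => ∀ i < m, rk i j < x i

theorem mem_below {rk x m A j} : j ∈ below rk x m A ↔ j ∈ A ∧ ∀ i < m, rk i j < x i :=
  Multiset.mem_filter

theorem below_zero (rk x A) : below rk x 0 A = A := Multiset.filter_eq_self.2 (by simp)

theorem below_add (rk x m A B) : below rk x m (A + B) = below rk x m A + below rk x m B :=
  Multiset.filter_add ..

/-- The rank condition of the outermost trie is applied first; the inner structures see only the
points that satisfy it. -/
theorem below_succ (rk x m A) :
    below rk x (m + 1) A = below rk x m (A.filter fun j => rk m j < x m) := by
  rw [below, below, Multiset.filter_filter]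
  exact Multiset.filter_congr fun j _ => by rw [Nat.forall_lt_succ_right]

/-- The state `σ` arises from a heap `h₀` with addresses below `N` by changing counters. -/
structure Frame (d N : ℕ) (h₀ : ℕ → ℕ → Val) (σ : State) : Prop where
  consts : Consts d σ
  next_eq : σ.next = N
  agree : Agree N h₀ σ.cell

theorem Frame.keep {d N h₀ lo hi σ σ'} (H : Frame d N h₀ σ) (h : Keep d lo hi σ σ') :
    Frame d N h₀ σ' :=
  ⟨H.consts.keep h, h.next_eq.trans H.next_eq, fun a ha f hf =>
    (h.cell_eq a (by rw [H.next_eq]; exact ha) f hf).trans (H.agree a ha f hf)⟩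

/-- Walk down the trie in register `3 * d + 3 * m + 53` with the levels in the next register and the
bound in the one after it, where `p` treats the structures at the block leaves. -/
def walkP (d m : ℕ) (p : Prog) : Prog :=
  whileNe d (3 * d + 3 * m + 54) (.seq (blk [.load (d + 8) (3 * d + 3 * m + 54) 2])
    (.branch (.le (d + 8) (d + 4))
      (.seq (blk [.load (d + 9) (3 * d + 3 * m + 54) 0,
        .load (3 * d + 3 * m + 54) (3 * d + 3 * m + 54) 1])
        (.branch (.le (d + 9) (3 * d + 3 * m + 55))
          (blk [.sub (3 * d + 3 * m + 55) (3 * d + 3 * m + 55) (d + 9),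
            .load (3 * d + 3 * m + 53) (3 * d + 3 * m + 53) 1])
          (blk [.load (3 * d + 3 * m + 53) (3 * d + 3 * m + 53) 0])))
      (.seq (blk [.load (3 * d + 3 * m + 50) (3 * d + 3 * m + 53) 0,
        .load (3 * d + 3 * m + 51) (3 * d + 3 * m + 54) 3,
        .load (3 * d + 3 * m + 53) (3 * d + 3 * m + 53) 1,
        .load (3 * d + 3 * m + 54) (3 * d + 3 * m + 54) 1]) p)))

/-- Add the frequencies of the colours of the points below the query, in the structure in register
`3 * d + 3 * m + 50` with a description in the next register. -/
def countP (d : ℕ) : ℕ → Prog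
  | 0 => .seq (blk [.load (d + 31) (3 * d + 3 * 0 + 50) 0]) (accP d)
  | m + 1 => .seq (blk [.move (3 * d + 3 * m + 55) (2 * d + 47 + m)]) (walkP d m (countP d m))

/-- The time of `countP` if there are `k` colours. -/
def countCost (k : ℕ) (ls : List (Option ℕ)) : ℕ → ℕ
  | 0 => 30 * k + 5
  | m + 1 => ls.count none * countCost k ls m + 15 * ls.length + 5

section count

variable {W d N κ : ℕ} {h₀ : ℕ → ℕ → Val} {ca col x : ℕ → ℕ} {S : Set ℕ} {rk : ℕ → ℕ → ℕ}
  {ls : List (Option ℕ)} {K : Finset ℕ}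

/-- The program `p` counts the points of structures for `m` tries that are below the query. -/
def Counts (W d N κ : ℕ) (h₀ : ℕ → ℕ → Val) (ca col x : ℕ → ℕ) (S : Set ℕ) (rk : ℕ → ℕ → ℕ)
    (ls : List (Option ℕ)) (K : Finset ℕ) (m : ℕ) (p : Prog) (cost : ℕ) : Prop :=
  ∀ σ A Φ F T, Frame d N h₀ σ → Counters σ.cell ca S F T (σ.reg (d + 30)) →
    IsDom κ (Set.Iio N) h₀ ca col rk ls m (σ.reg (3 * d + 3 * m + 50)) A Φ →
    IsDesc N h₀ ls m (σ.reg (3 * d + 3 * m + 51)) → (∀ i < m, σ.reg (2 * d + 47 + i) = .num (x i)) →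
    (∀ j ∈ below rk x m A, col j ∈ K) →
    (∀ c, F c + freq col (below rk x m A) c ≤ W) →
    WP W p σ cost fun σ' => Keep d (3 * d + 50) (3 * d + 3 * m + 53) σ σ' ∧ σ'.out = σ.out ∧
      ∃ T', Counters σ'.cell ca S
        (fun c => F c + freq col (below rk x m A) c) T' (σ'.reg (d + 30))

/-- All points of the list are below the query, so its colours are among those in `K`; as the list
is at most twice as long as it has colours, `15` steps per pair make `30` per colour of `K`. -/
theorem counts_zero (hW : 1 ≤ W) (hb : ColorBase N h₀ ca S) (hK : ∀ c ∈ K, c ∈ S) :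
    Counts W d N κ h₀ ca col x S rk ls K 0 (countP d 0) (30 * K.card + 5) := by
  rintro σ A Φ F T hf hT ⟨a, ha, hv, l, cr, k, hl, hcr, hw, hpos, hlen, hcrk, hkc, -⟩ - - hAK hFW
  rw [below_zero] at hAK hFW ⊢
  have hsub : (A.map col).toFinset ⊆ K := fun c hc => by
    obtain ⟨j, hj, rfl⟩ := Multiset.mem_map.1 (Multiset.mem_toFinset.1 hc)
    exact hAK j hj
  have hcard := Finset.card_le_card hsub
  refine WP.le (T := 2 + (15 * l.length + 3)) (WP.seq (WP.blk (is := [_]) ?_)) (by omega)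
  have ha' : a < σ.next := by rw [hf.next_eq]; exact ha
  have h0 : σ.cell a 0 = h₀ a 0 := hf.agree a ha 0 (by omega)
  simp (disch := omega) only [execL, Instr.exec, State.set, Function.update_self,
      Function.update_of_ne, if_pos, Option.bind_some, Option.some.injEq, exists_eq_left', if_true,
      row, hv, ha', h0]
  set σ₁ : State := ⟨_, _, _, _⟩ with hσ₁
  have hk1 : Keep d (3 * d + 50) (3 * d + 3 * 0 + 53) σ σ₁ :=
    ⟨rfl, Agree.refl _ _, fun r hr => by simp (disch := omega) only [Function.update_self,
        Function.update_of_ne, hσ₁]⟩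
  have hf1 := hf.keep hk1
  have hS : ∀ p ∈ l, p.1 ∈ S ∧ 0 < p.2 := fun p hp => by
    refine ⟨?_, hpos p hp⟩
    have h1 := (weight_pos_iff l hpos p.1).2 (List.mem_map_of_mem hp)
    rw [hw, Multiset.count_pos] at h1
    exact hK _ (hsub (Multiset.mem_toFinset.2 h1))
  refine (accP_spec hW (V := Set.Iio N) (N := N) (F := F) (T := T) (S := S) (ca := ca) (l := l)
    (fun a ha => by rw [hf1.next_eq]; exact ha) hf1.consts hf1.next_eq.ge
    (hb.mono le_rfl hf1.agree) ?_ ?_ hS (fun c => by rw [hw]; exact hFW c)).conseq ?_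
  · have e31 : σ₁.reg (d + 31) = h₀ a 0 := by
      simp (disch := omega) only [Function.update_self, Function.update_of_ne, hσ₁]
    rw [e31]
    exact hl.mono subset_rfl fun a ha f hf => hf1.agree a ha f hf
  · have e30 : σ₁.reg (d + 30) = σ.reg (d + 30) := by
      simp (disch := omega) only [Function.update_self, Function.update_of_ne, hσ₁]
    rw [e30]; exact hT
  · rintro σ₂ ⟨hu, hn, T', hT'⟩
    refine ⟨hk1.trans ⟨hn, hu.agree le_rfl (by simp), fun r hr => hu.reg_eq r (by omega)⟩,
        hu.out_eq,
      T', ?_⟩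
    simpa only [hw, freq] using hT'

/-- For a turn to the right: the points of the left child, together with those of the right child
below the bound, are all points below the bound. -/
theorem filter_split (B : Multiset ℕ) (p q : ℕ → Prop) [DecidablePred p] [DecidablePred q]
    (h : ∀ j, p j → q j) : B.filter p + (B.filter fun j => ¬ p j).filter q = B.filter q := by
  rw [← Multiset.filter_add_not p (B.filter q), Multiset.filter_filter, Multiset.filter_filter,
    Multiset.filter_filter]
  congr 1
  · exact Multiset.filter_congr fun j _ => ⟨fun hp => ⟨hp, h j hp⟩, fun hp => hp.1⟩
  · exact Multiset.filter_congr fun j _ => and_comm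

/-- The invariant: what is still to be counted are the points of `A`, which precede the current part
within its block, and the points of `B` with rank below `o + y`. Turns only regroup this set. At a
block leaf the structure for `A` is counted and the walk continues with nothing in `A`. Thus there
is one inner count per block, and a constant number of other steps per level. -/
theorem walk_spec {m cost : ℕ} {p : Prog} (hW : 1 ≤ W) (hm : m < d)
    (hp : Counts W d N κ h₀ ca col x S rk ls K m p cost) : ∀ (ls₁ : List (Option ℕ)) (o y : ℕ)
    (σ : State) (A B : Multiset ℕ) (Φ : ℕ) (F : ℕ → ℕ) (T : List ℕ),
        Halving ls₁ → y < capacity ls₁ →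
    Frame d N h₀ σ →
    Counters σ.cell ca S F T (σ.reg (d + 30)) →
    IsTrie (Set.Iio N) h₀ (IsDom κ (Set.Iio N) h₀ ca col rk ls m) (rk m) ls₁ o
      (σ.reg (3 * d + 3 * m + 53)) A B Φ →
    IsLevels N h₀ (IsDesc N h₀ ls m) ls₁ (σ.reg (3 * d + 3 * m + 54)) →
    σ.reg (3 * d + 3 * m + 55) = .num y → (∀ j ∈ B, o ≤ rk m j) →
    (∀ i < m, σ.reg (2 * d + 47 + i) = .num (x i)) →
    (∀ j ∈ below rk x m (A + B.filter fun j => rk m j < o + y), col j ∈ K) →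
    (∀ c, F c + freq col (below rk x m (A + B.filter fun j => rk m j < o + y)) c ≤ W) →
    WP W (walkP d m p) σ (ls₁.count none * cost + 15 * ls₁.length + 3) fun σ' =>
      Keep d (3 * d + 50) (3 * d + 3 * m + 56) σ σ' ∧ σ'.out = σ.out ∧
      ∃ T', Counters σ'.cell ca S (fun c => F c +
        freq col (below rk x m (A + B.filter fun j => rk m j < o + y)) c)
        T' (σ'.reg (d + 30)) := by
  intro ls₁
  induction ls₁ with
  | nil =>
    rintro o y σ A B Φ F T - hy hf hT ⟨rfl, -⟩ hlev hX ho hx hK hFW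
    -- At the bottom a single value is left and the bound is exclusive, so no point below this
    -- position remains to be counted.
    obtain rfl : y = 0 := by simpa [capacity] using hy
    have e : (B.filter fun j => rk m j < o + 0) = 0 :=
      Multiset.filter_eq_nil.2 fun j hj => by have := ho j hj; omega
    refine WP.le (T := 3) (WP.while_nil hlev hf.consts.one hf.consts.nil ?_) (by simp)
    refine ⟨.of_set le_rfl (by omega), rfl, T, ?_⟩
    rw [e]
    have e30 : (σ.set (d + 7) (.num 0)).reg (d + 30) = σ.reg (d + 30) := by
      simp (disch := omega) only [Function.update_self, Function.update_of_ne, State.set]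
    rw [e30]
    simpa [freq, below, State.set] using hT
  | cons b ls₁ ih =>
    cases b with
    | none =>
      rintro o y σ A B Φ F T hls hy hf hT ⟨a, ha, hv, Φ₁, Φ₂, -, h0, h1⟩ ⟨b, hb, hbv, b2, b3, hlev⟩
        hX ho hx hAK hFW
      refine WP.le (T := (2 + (1 + 5 + cost)) + (ls₁.count none * cost + 15 * ls₁.length + 3) + 3)
        (WP.while_ptr hW hbv hf.consts.one hf.consts.nil (WP.seq (WP.blk (is := [_]) ?_))) ?_
      swap
      · rw [List.count_cons_self, List.length_cons, add_mul, one_mul]; omega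
      have ha' : a < σ.next := by rw [hf.next_eq]; exact ha
      have hb' : b < σ.next := by rw [hf.next_eq]; exact hb
      have c0 := hf.agree a ha 0 (by omega)
      have c1 := hf.agree a ha 1 (by omega)
      have e1 := hf.agree b hb 1 (by omega)
      have e2 := hf.agree b hb 2 (by omega)
      have e3 := hf.agree b hb 3 (by omega)
      rw [b2] at e2
      have h4 := hf.consts.zero
      simp (disch := omega) only [execL, Instr.exec, State.set, Function.update_self,
      Function.update_of_ne, if_pos, Option.bind_some, Option.some.injEq, exists_eq_left', if_true,
      row, hbv, hb', e2]
      refine WP.le (T := (5 + cost) + 1) (WP.branch (b := false) ?_ (by simp) fun _ =>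
        WP.seq (WP.blk (is := [_, _, _, _]) ?_)) (by omega)
      · rw [eval_le]; simp (disch := omega) only [Function.update_self, Function.update_of_ne, h4,
            leVal]; simp
      simp (disch := omega) only [execL, Instr.exec, State.set, Function.update_self,
      Function.update_of_ne, if_pos, Option.bind_some, Option.some.injEq, exists_eq_left', if_true,
      row, hv, ha', hbv, hb', c0, c1, e1, e3]
      set σ₁ : State := ⟨_, _, _, _⟩ with hσ₁
      have hk1 : Keep d (3 * d + 50) (3 * d + 3 * m + 56) σ σ₁ :=
        ⟨rfl, Agree.refl _ _, fun r hr => by simp (disch := omega) only [Function.update_self,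
            Function.update_of_ne, hσ₁]⟩
      have e30 : σ₁.reg (d + 30) = σ.reg (d + 30) := by
        simp (disch := omega) only [Function.update_self, Function.update_of_ne, hσ₁]
      -- The set splits into `A`, counted now by the inner program, and the rest, left to the
      -- remainder of the walk.
      rw [below_add] at hAK hFW ⊢
      simp only [Multiset.mem_add] at hAK
      simp only [freq_add] at hFW ⊢
      refine (hp σ₁ A Φ₁ F T (hf.keep hk1) (by rw [e30]; exact hT) (by simp (disch := omega) only [Function.update_self, Function.update_of_ne, hσ₁]; exact h0)
        (by simp (disch := omega) only [Function.update_self, Function.update_of_ne, hσ₁]; exact b3) (fun i hi => by rw [hk1.reg_eq _ (by omega), hx i hi])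
        (fun j hj => hAK j (.inl hj)) fun c => by have := hFW c; omega).conseq ?_
      rintro σ₂ ⟨hk2, hout, T', hT'⟩
      have hk2' := hk1.trans (hk2.mono le_rfl (by omega))
      refine (ih o y σ₂ 0 B Φ₂ _ T' hls hy (hf.keep hk2') hT' ?_ ?_ ?_ ho
        (fun i hi => by rw [hk2'.reg_eq _ (by omega), hx i hi]) ?_ fun c => ?_).conseq ?_
      · rw [hk2.reg_eq _ (by omega)]; simp (disch := omega) only [Function.update_self, Function.update_of_ne, hσ₁]; exact h1
      · rw [hk2.reg_eq _ (by omega)]; simp (disch := omega) only [Function.update_self, Function.update_of_ne, hσ₁]; exact hlev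
      · rw [hk2.reg_eq _ (by omega)]; simp (disch := omega) only [Function.update_self, Function.update_of_ne, hσ₁]; exact hX
      · rw [zero_add]; exact fun j hj => hAK j (.inr hj)
      · rw [zero_add]; have := hFW c; omega
      · rintro σ₃ ⟨hk3, hout3, T₃, hT₃⟩
        refine ⟨hk2'.trans hk3, by rw [hout3, hout], T₃, ?_⟩
        simpa only [zero_add, add_assoc] using hT₃
    | some w =>
      rintro o y σ A B Φ F T ⟨hcap, hls⟩ hy hf hT ⟨a, ha, hv, Φ₁, Φ₂, -, h0, h1⟩
        ⟨b, hb, hbv, b0, b2, hlev⟩ hX ho hx hAK hFW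
      refine WP.le (T := (2 + (1 + 3 + 4)) + (ls₁.count none * cost + 15 * ls₁.length + 3) + 3)
        (WP.while_ptr hW hbv hf.consts.one hf.consts.nil (WP.seq (WP.blk (is := [_]) ?_))) ?_
      swap
      · rw [List.count_cons_of_ne (by simp), List.length_cons]; omega
      have ha' : a < σ.next := by rw [hf.next_eq]; exact ha
      have hb' : b < σ.next := by rw [hf.next_eq]; exact hb
      have c0 := hf.agree a ha 0 (by omega)
      have c1 := hf.agree a ha 1 (by omega)
      have e0 := hf.agree b hb 0 (by omega)
      have e1 := hf.agree b hb 1 (by omega)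
      have e2 := hf.agree b hb 2 (by omega)
      rw [b2] at e2
      rw [b0] at e0
      have h4 := hf.consts.zero
      simp (disch := omega) only [execL, Instr.exec, State.set, Function.update_self,
      Function.update_of_ne, if_pos, Option.bind_some, Option.some.injEq, exists_eq_left', if_true,
      row, hbv, hb', e2]
      refine WP.le (T := (3 + 4) + 1) (WP.branch (b := true) ?_ (fun _ =>
        WP.seq (WP.blk (is := [_, _]) ?_)) (by simp)) (by omega)
      · rw [eval_le]; simp (disch := omega) only [Function.update_self, Function.update_of_ne, h4,
            leVal]; simp
      simp (disch := omega) only [execL, Instr.exec, State.set, Function.update_self,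
      Function.update_of_ne, if_pos, Option.bind_some, Option.some.injEq, exists_eq_left', if_true,
      row, hbv, hb', e0, e1]
      refine WP.le (T := 3 + 1) (WP.branch (b := decide (w ≤ y)) ?_ (fun h => ?_) fun h => ?_) le_rfl
      · rw [eval_le]; simp (disch := omega) only [Function.update_self, Function.update_of_ne, hX,
            leVal]
      -- Turn to the right: the whole left child is below the bound and joins `A`, which is how the
      -- right child was stored.
      · have hwy : w ≤ y := by simpa using h
        refine WP.blk (is := [_, _]) ?_
        simp (disch := omega) only [execL, Instr.exec, State.set, Function.update_self,
      Function.update_of_ne, if_pos, Option.bind_some, Option.some.injEq, exists_eq_left', if_true,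
      row, hX, hv, ha', c1]
        set σ₁ : State := ⟨_, _, _, _⟩ with hσ₁
        have hk1 : Keep d (3 * d + 50) (3 * d + 3 * m + 56) σ σ₁ :=
          ⟨rfl, Agree.refl _ _, fun r hr => by simp (disch := omega) only [Function.update_self,
              Function.update_of_ne, hσ₁]⟩
        have e30 : σ₁.reg (d + 30) = σ.reg (d + 30) := by
          simp (disch := omega) only [Function.update_self, Function.update_of_ne, hσ₁]
        have hset : (A + B.filter fun j => rk m j < o + w) +
            ((B.filter fun j => ¬ rk m j < o + w).filter fun j => rk m j < o + w + (y - w)) =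
            A + B.filter fun j => rk m j < o + y := by
          rw [add_assoc, ← filter_split B (fun j => rk m j < o + w) (fun j => rk m j < o + y)
            (fun j hj => by omega), show o + w + (y - w) = o + y by omega]
        rw [← hset] at hAK hFW ⊢
        refine (ih (o + w) (y - w) σ₁ _ _ Φ₂ F T hls ?_ (hf.keep hk1) (by rw [e30]; exact hT) ?_ ?_ ?_
          ?_ (fun i hi => by rw [hk1.reg_eq _ (by omega), hx i hi]) hAK hFW).conseq ?_
        · simp only [capacity] at hy; omega
        · simp (disch := omega) only [Function.update_self, Function.update_of_ne, hσ₁]; exact h1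
        · simp (disch := omega) only [Function.update_self, Function.update_of_ne, hσ₁]; exact hlev
        · simp (disch := omega) only [Function.update_self, Function.update_of_ne, hσ₁]
        · intro j hj
          rw [Multiset.mem_filter] at hj
          omega
        · rintro σ₂ ⟨hk2, h⟩
          exact ⟨hk1.trans hk2, h⟩
      -- Turn to the left: the points of the right child have ranks at least `o + w > o + y`, so
      -- none is lost.
      · have hwy : ¬ w ≤ y := by simpa using h
        refine WP.le (T := 2) (WP.blk (is := [_]) ?_) (by omega)
        simp (disch := omega) only [execL, Instr.exec, State.set, Function.update_self,
      Function.update_of_ne, if_pos, Option.bind_some, Option.some.injEq, exists_eq_left', if_true,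
      row, hX, hv, ha', c0]
        set σ₁ : State := ⟨_, _, _, _⟩ with hσ₁
        have hk1 : Keep d (3 * d + 50) (3 * d + 3 * m + 56) σ σ₁ :=
          ⟨rfl, Agree.refl _ _, fun r hr => by simp (disch := omega) only [Function.update_self,
              Function.update_of_ne, hσ₁]⟩
        have e30 : σ₁.reg (d + 30) = σ.reg (d + 30) := by
          simp (disch := omega) only [Function.update_self, Function.update_of_ne, hσ₁]
        have hset : A + ((B.filter fun j => rk m j < o + w).filter fun j => rk m j < o + y) =
            A + B.filter fun j => rk m j < o + y := by
          rw [Multiset.filter_filter]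
          congr 1
          exact Multiset.filter_congr fun j _ => ⟨fun h => h.1, fun h => ⟨h, by omega⟩⟩
        rw [← hset] at hAK hFW ⊢
        refine (ih o y σ₁ _ _ Φ₁ F T hls (by omega) (hf.keep hk1) (by rw [e30]; exact hT) ?_ ?_ ?_
          (fun j hj => ho j (Multiset.mem_filter.1 hj).1)
          (fun i hi => by rw [hk1.reg_eq _ (by omega), hx i hi]) hAK hFW).conseq ?_
        · simp (disch := omega) only [Function.update_self, Function.update_of_ne, hσ₁]; exact h0
        · simp (disch := omega) only [Function.update_self, Function.update_of_ne, hσ₁]; exact hlev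
        · simp (disch := omega) only [Function.update_self, Function.update_of_ne, hσ₁]; exact hX
        · rintro σ₂ ⟨hk2, h⟩
          exact ⟨hk1.trans hk2, h⟩

/-- For fixed `d` the recursion over the coordinates unfolds into nested loops, so no stack is
needed. Each nesting depth has its own registers: `3 * d + 3 * m + 53` is at once the trie of the
walk at depth `m` and the structure handed over at depth `m + 1`, and inner walks change only
registers below it. The bound is copied before each walk, since the walk consumes it and inner
structures are visited many times. -/
theorem countP_spec (hW : 1 ≤ W) (hb : ColorBase N h₀ ca S) (hK : ∀ c ∈ K, c ∈ S)
    (hls : Halving ls) (m : ℕ) (hm : m ≤ d) (hx : ∀ i < m, x i < capacity ls) :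
    Counts W d N κ h₀ ca col x S rk ls K m (countP d m) (countCost K.card ls m) := by
  induction m with
  | zero => exact counts_zero hW hb hK
  | succ m ih =>
    intro σ A Φ F T hf hT hdom hdesc hreg hAK hFW
    have e : below rk x (m + 1) A = below rk x m (0 + A.filter fun j => rk m j < 0 + x m) := by
      rw [zero_add, zero_add, below_succ]
    rw [e] at hAK hFW ⊢
    refine WP.le (T := 2 + (ls.count none * countCost K.card ls m + 15 * ls.length + 3))
      (WP.seq (WP.blk (is := [_]) ⟨_, rfl, ?_⟩)) (by simp only [countCost]; omega)
    rw [hreg m (by omega)]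
    have hk1 : Keep d (3 * d + 50) (3 * d + 3 * m + 56) σ (σ.set (3 * d + 3 * m + 55) (.num (x m))) :=
      .of_set (by omega) (by omega)
    set σ₁ := σ.set (3 * d + 3 * m + 55) (.num (x m)) with hσ₁
    have er : ∀ r, r ≠ 3 * d + 3 * m + 55 → σ₁.reg r = σ.reg r := fun r hr => by
      simp (disch := omega) only [Function.update_self, Function.update_of_ne, hσ₁, State.set]
    refine (walk_spec hW (by omega) (ih (by omega) fun i hi => hx i (by omega)) ls 0 (x m) σ₁ 0 A Φ F T
      hls (hx m (by omega)) (hf.keep hk1) ?_ ?_ ?_ ?_ (fun _ _ => Nat.zero_le _) ?_ hAK hFW).conseq ?_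
    · rw [er _ (by omega)]; exact hT
    · rw [er _ (by omega)]; exact hdom
    · rw [er _ (by omega)]; exact hdesc
    · simp (disch := omega) only [Function.update_self, Function.update_of_ne, hσ₁, State.set]
    · intro i hi
      rw [er _ (by omega), hreg i (by omega)]
    · rintro σ₂ ⟨hk2, h⟩
      exact ⟨hk1.trans hk2, h⟩

end count

/-- Print the colours in the list in `d + 30` with their counters, and reset these. -/
def outP (d : ℕ) : Prog :=
  whileNe d (d + 30) (blk [.load (d + 31) (d + 30) 0, .load (d + 32) (d + 30) 8,
    .emit (d + 31) (d + 32), .store (d + 30) 8 (d + 4), .load (d + 30) (d + 30) 9])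

/-- Printing resets each counter, so the next query again starts from zero counters. No cell is
allocated. -/
theorem outP_spec {W d N ca S lo hi} {h₀ : ℕ → ℕ → Val} (hW : 1 ≤ W) (hb : ColorBase N h₀ ca S)
    (T : List ℕ) : ∀ {F σ}, Frame d N h₀ σ → Counters σ.cell ca S F T (σ.reg (d + 30)) →
    WP W (outP d) σ (9 * T.length + 3) fun σ' => Keep d lo hi σ σ' ∧
      σ'.out = σ.out ++ T.map (fun c => (c, F c)) ∧ ∀ c ∈ S, σ'.cell (ca c) 8 = .num 0 := by
  induction T with
  | nil =>
    intro F σ hf hT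
    refine WP.while_nil hT.chain hf.consts.one hf.consts.nil ⟨.of_set le_rfl (by omega),
        by simp [State.set],
      fun c hc => ?_⟩
    have := hT.count c hc
    rwa [show F c = 0 by by_contra h; simpa [hc, Nat.pos_of_ne_zero h] using hT.mem_iff c] at this
  | cons c T ih =>
    intro F σ hf hT
    have hcS := (hT.mem_iff c).1 (by simp)
    have hv := hT.chain.1
    have h8 := hT.count c hcS.1
    have hlt := hb.lt c hcS.1
    have hlt' : ca c < σ.next := by rw [hf.next_eq]; exact hlt
    have h0 : σ.cell (ca c) 0 = .num c := by rw [hf.agree _ hlt _ (by omega), hb.color c hcS.1]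
    have h4 := hf.consts.zero
    have hpop := hT.pop (hb.mono le_rfl hf.agree)
    refine WP.le (T := 6 + (9 * T.length + 3) + 3) (WP.while_ptr hW hv hf.consts.one hf.consts.nil
      (WP.blk (is := [_, _, _, _, _]) ?_)) (by simp; omega)
    simp (disch := omega) only [execL, Instr.exec, State.set, Function.update_self,
      Function.update_of_ne, if_pos, Option.bind_some, Option.some.injEq, exists_eq_left', if_true,
      row, hv, hlt', h0, h8, h4]
    set σ₁ : State := ⟨_, _, _, _⟩ with hσ₁
    have hk1 : Keep d lo hi σ σ₁ := by
      refine ⟨rfl, fun a ha f hf => ?_, fun r hr => by simp (disch := omega) only [Function.update_self, Function.update_of_ne, hσ₁]⟩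
      simp only [hσ₁]
      by_cases h : a = ca c
      · subst h; simp (disch := omega) only [Function.update_self, Function.update_of_ne]
      · rw [Function.update_of_ne h]
    have e30 : σ₁.reg (d + 30) = σ.cell (ca c) 9 := by
      simp (disch := omega) only [Function.update_self, Function.update_of_ne, hσ₁]
    refine (ih (F := Function.update F c 0) (hf.keep hk1) (by rw [e30]; exact hpop)).conseq ?_
    rintro σ₂ ⟨hk2, hout, hz⟩
    refine ⟨hk1.trans hk2, ?_, hz⟩
    rw [hout]
    simp only [hσ₁, List.append_assoc, List.map_cons, List.cons_append, List.nil_append,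
      List.singleton_append]
    congr 2
    refine List.map_congr_left fun e he => ?_
    rw [Function.update_of_ne (by rintro rfl; exact (List.nodup_cons.1 hT.nodup).1 he)]

/-- The query program. -/
def queryP (d : ℕ) : Prog :=
  .seq (ranksP d (d - 1)) (.seq (searchP d 0 (2 * d + 46) (3 * d + 3 * (d - 1) + 50))
    (.seq (blk [.move (3 * d + 3 * (d - 1) + 51) (d + 44), .clear (d + 30)])
    (.seq (countP d (d - 1)) (outP d))))

/-- Everything the index refers to lies in registers below `2 * d + 47` that are not working
registers, and in fields below `8`, except for the counters, whose reset is assumed. -/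
theorem Index.keep {κ d n ls key col ca rk lo hi σ σ'} (H : Index κ d n ls key col ca rk σ)
    (h : Keep d lo hi σ σ') (hlo : 2 * d + 47 ≤ lo) (hd : 1 ≤ d)
    (hz : ∀ j < n, σ'.cell (ca (col j)) 8 = .num 0) : Index κ d n ls key col ca rk σ' := by
  have hag : Agree σ.next σ.cell σ'.cell := h.cell_eq
  refine ⟨H.consts.keep h, ?_, hz, ?_, ?_, fun i hi => ?_⟩ <;> rw [h.next_eq]
  · exact H.colors.mono le_rfl hag
  · rw [h.reg_eq _ (by omega)]; exact H.desc.mono le_rfl hag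
  · rw [h.reg_eq _ (by omega)]
    exact H.root.mono le_rfl hag fun l v ⟨Φ, h⟩ => ⟨Φ,
        h.mono subset_rfl fun a ha f hf => hag a ha f hf⟩
  · rw [h.reg_eq _ (by omega)]
    exact (H.rank i hi).mono le_rfl hag fun l v h => h.mono le_rfl hag

theorem queryP_spec {W κ d n σ} {ls : List (Option ℕ)} {key : ℕ → ℕ → ℝ} {col ca : ℕ → ℕ}
    {rk : ℕ → ℕ → ℕ} {x : ℕ → ℝ} (hd : 1 ≤ d) (hW : n + 1 ≤ W)
    (hidx : Index κ d n ls key col ca rk σ) (hls : Halving ls) (hcap : n + 1 < capacity ls)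
    (hx : ∀ i < d, σ.reg i = .real (x i)) (hout : σ.out = []) (A : Multiset ℕ) (hAnd : A.Nodup)
    (hA : ∀ j, j ∈ A ↔ j < n ∧ ∀ i < d, key i j ≤ x i) :
    WP W (queryP d) σ ((14 * (Nat.log 2 (n + 1) + 1) + 11) * d +
      (countCost (A.map col).toFinset.card ls (d - 1) + 9 * (A.map col).toFinset.card + 4)) fun σ' =>
      Index κ d n ls key col ca rk σ' ∧ σ'.next = σ.next ∧ ∃ T : List ℕ, T.Nodup ∧
        (∀ c, c ∈ T ↔ 0 < freq col A c) ∧ σ'.out = T.map fun c => (c, freq col A c) := by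
  have hW1 : 1 ≤ W := by omega
  set K := (A.map col).toFinset with hK
  have hKS : ∀ c ∈ K, c ∈ {c | ∃ j < n, col j = c} := fun c hc => by
    obtain ⟨j, hj, rfl⟩ := Multiset.mem_map.1 (Multiset.mem_toFinset.1 hc)
    exact ⟨j, ((hA j).1 hj).1, rfl⟩
  have hAn : A.card ≤ n := by
    have : A ≤ Multiset.range n := (Multiset.le_iff_subset hAnd).2 fun j hj => by
      simpa using ((hA j).1 hj).1
    simpa using Multiset.card_le_card this
  obtain ⟨m, rfl⟩ : ∃ m, d = m + 1 := ⟨d - 1, by omega⟩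
  rw [queryP, Nat.add_sub_cancel]
  refine WP.le (T := ((14 * (Nat.log 2 (n + 1) + 1) + 11) * m + 1) +
    ((14 * (Nat.log 2 (n + 1) + 1) + 8) + (3 + (countCost K.card ls m + (9 * K.card + 3))))) ?_
    (by rw [mul_add _ m]; omega)
  refine WP.seq ((ranksP_spec (key := key) hW hidx.consts hx m (by omega) hidx.rank).conseq ?_)
  rintro σ₁ ⟨hk1, hout1, hcell1, hy⟩
  -- The bounds in rank space, as a function on all indices; only the values below `m` matter.
  choose! y hyn hyr hy using hy
  have hk1' : Keep (m + 1) (2 * (m + 1) + 47) (6 * m + 100) σ σ₁ := hk1.mono le_rfl (by omega)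
  have hroot := hidx.root
  rw [← hk1.next_eq, ← hcell1, ← hk1.reg_eq (2 * (m + 1) + 46) (by omega)] at hroot
  refine WP.seq ((searchP_spec (r := 3 * (m + 1) + 3 * m + 50) (x := x 0) hW1 (hidx.consts.keep hk1)
    (by omega) (by omega) (by rw [hk1.reg_eq _ (by omega), hx _ (by omega)]) hroot).conseq ?_)
  rintro σ₂ ⟨hk2, hout2, hcell2, l, ⟨Φ, hdom⟩, hlnd, hl⟩
  have hk2' := hk1'.trans (hk2.mono (by omega) (by omega))
  refine WP.seq (WP.blk (is := [_, _]) ?_)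
  simp (disch := omega) only [execL, Instr.exec, State.set, Function.update_self,
      Function.update_of_ne, if_pos, Option.bind_some, Option.some.injEq, exists_eq_left', if_true,
      row]
  set σ₃ : State := ⟨_, _, _, _⟩ with hσ₃
  have hk23 : Keep (m + 1) (2 * (m + 1) + 47) (6 * m + 100) σ₂ σ₃ :=
    ⟨rfl, Agree.refl _ _, fun r hr => by simp (disch := omega) only [Function.update_self,
        Function.update_of_ne, hσ₃]⟩
  have hk3 := hk2'.trans hk23
  have hcell3 : σ₃.cell = σ.cell := by rw [← hcell1, ← hcell2]
  -- The version contains the points that satisfy the condition on coordinate `0`, and the rank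
  -- bounds express the others. Together they are the points of the dominance range.
  have hAl : below rk y m (↑l : Multiset ℕ) = A := by
    refine (Multiset.Nodup.ext (Multiset.Nodup.filter _ (Multiset.coe_nodup.2 hlnd)) hAnd).2 fun j => ?_
    rw [← below, mem_below, hA, Multiset.mem_coe, hl]
    constructor
    · rintro ⟨⟨h1, h2⟩, h3⟩
      refine ⟨h1, fun i hi => ?_⟩
      cases i with
      | zero => exact h2
      | succ i => exact (hy i (by omega) j h1).1 (h3 i (by omega))
    · rintro ⟨h1, h2⟩
      exact ⟨⟨h1, h2 0 (by omega)⟩, fun i hi => (hy i hi j h1).2 (h2 (i + 1) (by omega))⟩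
  have hf3 : Frame (m + 1) σ.next σ.cell σ₃ :=
    Frame.keep ⟨hidx.consts, rfl, Agree.refl _ _⟩ hk3
  have hcount := countP_spec (d := m + 1) (κ := κ) (ca := ca) (col := col) (rk := rk) (x := y) hW1
    hidx.colors hKS hls m (by omega) (fun i hi => (hyn i hi).trans_lt hcap) σ₃ ↑l Φ (fun _ => 0) [] hf3
    ?_ ?_ ?_ ?_ ?_ ?_
  · rw [hAl] at hcount
    simp only [zero_add] at hcount
    refine WP.seq (hcount.conseq ?_)
    rintro σ₄ ⟨hk4, hout4, T, hT⟩
    have hk4' := hk3.trans (hk4.mono (by omega) (by omega))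
    have hTK : T.length ≤ K.card := by
      rw [← List.toFinset_card_of_nodup hT.nodup]
      refine Finset.card_le_card fun c hc => ?_
      have := ((hT.mem_iff c).1 (List.mem_toFinset.1 hc)).2
      rw [freq, Multiset.count_pos] at this
      exact Multiset.mem_toFinset.2 this
    refine WP.mono (outP_spec (lo := 2 * (m + 1) + 47) (hi := 6 * m + 100) hW1 hidx.colors T
      (hf3.keep hk4) hT) (by omega) ?_
    rintro σ₅ ⟨hk5, hout5, hz⟩
    have hk5' := hk4'.trans hk5
    refine ⟨hidx.keep hk5' le_rfl (by omega) fun j hj => hz _ ⟨j, hj, rfl⟩, hk5'.next_eq, T,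
        hT.nodup,
      fun c => ?_, ?_⟩
    · rw [hT.mem_iff]
      refine ⟨fun h => h.2, fun h => ⟨hKS c ?_, h⟩⟩
      rw [freq, Multiset.count_pos] at h
      exact Multiset.mem_toFinset.2 h
    · have e3 : σ₃.out = [] := by rw [← hout, ← hout1, ← hout2]
      rw [hout5, hout4, e3, List.nil_append]
  · refine ⟨?_, List.nodup_nil, by simp, ?_⟩
    · rintro c ⟨j, hj, rfl⟩
      rw [hcell3, hidx.count j hj]
    · simp (disch := omega) only [Function.update_self, Function.update_of_ne, hσ₃]; rfl
  · simp (disch := omega) only [Function.update_self, Function.update_of_ne, hσ₃]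
    rwa [hk1.next_eq, hcell1] at hdom
  · simp (disch := omega) only [Function.update_self, Function.update_of_ne, hσ₃]
    rw [hk2'.reg_eq _ (by omega)]
    exact hidx.desc
  · intro i hi
    simp (disch := omega) only [Function.update_self, Function.update_of_ne, hσ₃]
    rw [hk2.reg_eq _ (by omega), hyr i hi]
  · rw [hAl]
    exact fun j hj => Multiset.mem_toFinset.2 (Multiset.mem_map_of_mem col hj)
  · rw [hAl]
    intro c
    have := Multiset.count_le_card c (A.map col)
    rw [Multiset.card_map] at this
    simp only [freq]
    omega

/-! ### Bounds -/

/-- The bit added to `e` bits has weight `2 ^ e`, the capacity of what lies below; block leaves do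
not affect it. -/
theorem levels_halving (s e : ℕ) : capacity (levels s e).2 = 2 ^ e ∧ Halving (levels s e).2 := by
  induction e with
  | zero => simp [levels, capacity, Halving]
  | succ e ih =>
    rw [levels]
    refine ⟨by simp only [capacity, pow_succ, mul_comm], ?_⟩
    dsimp only
    split_ifs
    exacts [ih, ih]

theorem length_levels (s e : ℕ) : (levels s e).2.length ≤ 2 * e := by
  induction e with
  | zero => simp [levels]
  | succ e ih =>
    rw [levels]
    dsimp only
    split_ifs <;> simp only [List.length_cons] <;> omega

/-- The first component of `levels` is `2 ^ i`, where `i` is the number of bits in the unfinished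
block, and `i = 0` if all blocks are full. Each full block has `Nat.log 2 s` bits, and the
unfinished one already counts as a block. Hence the number of blocks is `⌈e / Nat.log 2 s⌉`. -/
theorem count_levels {s : ℕ} (hs : 2 ≤ s) (e : ℕ) : ∃ i < Nat.log 2 s, (levels s e).1 = 2 ^ i ∧
    (i = 0 → Nat.log 2 s * (levels s e).2.count none = e) ∧
    (0 < i → Nat.log 2 s * (levels s e).2.count none + i = e + Nat.log 2 s) := by
  have hβ : 0 < Nat.log 2 s := Nat.log_pos (by omega) hs
  have h4 : ∀ i, 4 * 2 ^ i ≤ s ↔ i + 2 ≤ Nat.log 2 s := fun i => by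
    rw [Nat.le_log_iff_pow_le (by omega) (by omega), pow_add]
    omega
  generalize hβs : Nat.log 2 s = β at *
  induction e with
  | zero => exact ⟨0, hβ, by simp [levels], by simp [levels], by simp⟩
  | succ e ih =>
    obtain ⟨i, hi, hv, h0, h1⟩ := ih
    have hcount : β * (levels s (e + 1)).2.count none + i = e + β := by
      rw [levels, hv, List.count_cons_of_ne (by simp)]
      obtain rfl | hi0 := Nat.eq_zero_or_pos i
      · have := h0 rfl
        rw [pow_zero, if_pos le_rfl, List.count_cons_self, mul_add]
        omega
      · have : 1 < 2 ^ i := Nat.one_lt_two_pow (by omega)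
        rw [if_neg (by omega)]
        exact h1 hi0
    have hv' : (levels s (e + 1)).1 = if i + 2 ≤ β then 2 ^ (i + 1) else 1 := by
      rw [levels, hv]
      simp only [h4]
      split_ifs
      · rw [pow_succ, mul_comm]
      · rfl
    split_ifs at hv' with h
    · exact ⟨i + 1, by omega, hv', by simp, fun _ => by omega⟩
    · exact ⟨0, hβ, by simpa using hv', fun _ => by omega, by simp⟩

/-- The part of a block that is built so far has as many leaves as the first component of `levels`
says, and a prefix insertion visits all of them. The summand `60` on the left absorbs the cost of
the inner nodes: it doubles along with the number of leaves. -/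
theorem prefixCost_levels {s : ℕ} (hs : 2 ≤ s) (c e : ℕ) (he : 1 < (levels s e).1) :
    prefixCost c (levels s e).2 + 60 ≤ (levels s e).1 * (c + 120) := by
  induction e with
  | zero => simp [levels] at he
  | succ e ih =>
    have h1 := (levels_fst hs e).1
    rw [levels] at he ⊢
    dsimp only at he ⊢
    by_cases h : (levels s e).1 ≤ 1
    · have : (levels s e).1 = 1 := by omega
      rw [this] at he ⊢
      simp only [le_refl, if_true, prefixCost]
      split_ifs at he ⊢ <;> omega
    · have := ih (by omega)
      rw [if_neg h]
      split_ifs at he ⊢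
      · simp only [prefixCost]
        rw [mul_assoc]
        omega
      · omega

/-- Within a block the right siblings of the path have `1, 2, 4, …` leaves, so an unfinished block
with `v` leaves has contributed `v - 1` of them. The second statement keeps account of this by
replacing the last summand `s` by `v - 1`. When the block becomes full, its contribution, at most `s
- 1` leaves and the path, is rounded up to `s`. -/
theorem trieCost_levels {s : ℕ} (hs : 2 ≤ s) (c e : ℕ) :
    ((levels s e).1 ≤ 1 → trieCost c (levels s e).2 ≤
      (c + 180) * ((levels s e).2.count none * s)) ∧
    (1 < (levels s e).1 → trieCost c (levels s e).2 + (c + 180) * (s + 1) ≤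
      (c + 180) * ((levels s e).2.count none * s + (levels s e).1)) := by
  induction e with
  | zero => simp [levels, trieCost]
  | succ e ih =>
    obtain ⟨h1, h2⟩ := levels_fst hs e
    have hp := prefixCost_levels hs c e
    have hs' : (c + 180) * 2 ≤ (c + 180) * s := Nat.mul_le_mul_left _ hs
    rw [levels]
    dsimp only
    rw [List.count_cons_of_ne (by simp), trieCost]
    generalize (levels s e).1 = v at *
    generalize (levels s e).2 = ls at *
    by_cases hv : v ≤ 1
    · obtain rfl : v = 1 := by omega
      have ih := ih.1 le_rfl
      rw [if_pos le_rfl, List.count_cons_self, trieCost, prefixCost]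
      generalize (ls.count none) = M at *
      rw [add_mul M, one_mul, mul_add _ _ s] 
      constructor
      · intro _; omega
      · intro hv'
        split_ifs at hv' ⊢ with h
        · simp only [mul_add] at *; omega
        · omega
    · have ih := ih.2 (by omega)
      have hp := hp (by omega)
      have hp' : prefixCost c ls + 60 ≤ (c + 180) * v := by
        rw [mul_comm]; exact hp.trans (Nat.mul_le_mul_left _ (by omega))
      have hv2 : (c + 180) * (2 * v) ≤ (c + 180) * s := Nat.mul_le_mul_left _ h2
      rw [if_neg hv]
      generalize (ls.count none) = M at *
      simp only [mul_add, mul_one] at *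
      have e2 : (c + 180) * (2 * v) = 2 * ((c + 180) * v) := by ring
      constructor
      · intro _; omega
      · intro hv'
        split_ifs at hv' ⊢ with h
        · omega
        · omega

theorem trieCost_le {s : ℕ} (hs : 2 ≤ s) (c e : ℕ) :
    trieCost c (levels s e).2 ≤ (c + 180) * ((levels s e).2.count none * s) := by
  obtain ⟨h1, h2⟩ := trieCost_levels hs c e
  by_cases hv : (levels s e).1 ≤ 1
  · exact h1 hv
  · have h2 := h2 (by omega)
    have := Nat.mul_le_mul_left (c + 180) (show (levels s e).1 ≤ s + 1 by
      have := (levels_fst hs e).2; omega)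
    rw [mul_add _ (_ * s)] at h2
    omega

/-- The additive `180` from `trieCost_le` is carried on the left-hand side; restoring it after each
trie costs a factor of at most `2`. -/
theorem domCost_le {κ s : ℕ} (hs : 2 ≤ s) (e m : ℕ)
    (hM : 1 ≤ (levels s e).2.count none) : domCost κ (levels s e).2 m + 180 ≤
      (κ + 300) * (2 * ((levels s e).2.count none * s)) ^ m := by
  induction m with
  | zero => simp [domCost]
  | succ m ih =>
    have h1 := trieCost_le hs (domCost κ (levels s e).2 m) e
    have h2 := Nat.mul_le_mul_right (2 * ((levels s e).2.count none * s)) ih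
    rw [domCost, pow_succ, ← mul_assoc]
    refine le_trans ?_ h2
    have hX : 1 ≤ (levels s e).2.count none * s := Nat.mul_pos hM (by omega)
    generalize (levels s e).2.count none * s = X at *
    have : 180 * 1 ≤ (domCost κ (levels s e).2 m + 180) * X := Nat.mul_le_mul (by omega) hX
    have e2 : (domCost κ (levels s e).2 m + 180) * (2 * X) =
      2 * ((domCost κ (levels s e).2 m + 180) * X) := by ring
    omega

/-- Unfolding the recursion yields `k` multiplied by the number of innermost lists, and for each
trie depth the number of walks times `L`. As `1 ≤ M`, each depth is dominated by `L * M ^ m`, where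
`M` is the number of blocks. -/
theorem countCost_le {ls : List (Option ℕ)} {L : ℕ} (k m : ℕ) (hL : 1 ≤ L)
    (hlen : ls.length ≤ 2 * L) (hM : 1 ≤ ls.count none) :
    countCost k ls (m + 1) ≤ 30 * k * ls.count none ^ (m + 1) +
      50 * (m + 1) * (L * ls.count none ^ m) := by
  have hML : ls.count none ≤ 2 * L := List.count_le_length.trans hlen
  induction m with
  | zero =>
    simp only [countCost, zero_add, pow_one, pow_zero, mul_one]
    have : ls.count none * (30 * k + 5) = 30 * k * ls.count none + 5 * ls.count none := by ring
    omega
  | succ m ih =>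
    rw [countCost]
    have h1 := Nat.mul_le_mul_left (ls.count none) ih
    have h2 : L * 1 ≤ L * ls.count none ^ (m + 1) := Nat.mul_le_mul_left _ (Nat.one_le_pow _ _ hM)
    have e : ls.count none * (30 * k * ls.count none ^ (m + 1) +
      50 * (m + 1) * (L * ls.count none ^ m)) + 50 * (L * ls.count none ^ (m + 1)) =
      30 * k * ls.count none ^ (m + 1 + 1) + 50 * (m + 1 + 1) * (L * ls.count none ^ (m + 1)) := by
      ring
    omega

/-- The number of blocks of levels, and the number of levels, in terms of logarithms. -/
theorem trieLevels_bounds {s n : ℕ} (hs : 2 ≤ s) (hsn : s ≤ n) :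
    1 ≤ (trieLevels s n).count none ∧ ((trieLevels s n).count none : ℝ) ≤ 7 * Real.logb s n ∧
    ((Nat.log 2 (n + 1) + 1 : ℕ) : ℝ) ≤ 5 * Real.log n ∧ 1 ≤ Real.logb s n ∧
    Real.log n ≤ s * Real.logb s n := by
  obtain ⟨i, hi, -, h0, h1⟩ := count_levels hs (Nat.log 2 (n + 1) + 1)
  rw [← trieLevels] at h0 h1
  have hβ : 0 < Nat.log 2 s := Nat.log_pos (by omega) hs
  -- Since `n + 1 ≤ 2 * n`, the logarithm grows by at most one, and `1 ≤ Nat.log 2 n` as `2 ≤ n`.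
  have hLn : Nat.log 2 (n + 1) + 1 ≤ 3 * Nat.log 2 n := by
    have h1 : Nat.log 2 (n + 1) ≤ Nat.log 2 (n * 2) := Nat.log_mono_right (by omega)
    rw [Nat.log_mul_base (by omega) (by omega)] at h1
    have : 0 < Nat.log 2 n := Nat.log_pos (by omega) (by omega)
    omega
  have l2 := Real.log_two_gt_d9
  have ls0 : 0 < Real.log s := Real.log_pos (by exact_mod_cast hs)
  have hlsn : Real.log s ≤ Real.log n :=
    Real.log_le_log (by exact_mod_cast (by omega : 0 < s)) (by exact_mod_cast hsn)
  have hn2 : Nat.log 2 n * Real.log 2 ≤ Real.log n := by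
    rw [← Real.log_pow]
    refine Real.log_le_log (by positivity) ?_
    exact_mod_cast Nat.pow_log_le_self 2 (by omega)
  -- Rounding the logarithm of `s` down loses at most a factor `2`, because it is at least `1`.
  have hs2 : Real.log s ≤ 2 * (Nat.log 2 s * Real.log 2) := by
    have : Real.log s ≤ (Nat.log 2 s + 1 : ℕ) * Real.log 2 := by
      rw [← Real.log_pow]
      refine Real.log_le_log (by exact_mod_cast (by omega : 0 < s)) ?_
      exact_mod_cast (Nat.lt_pow_succ_log_self (b := 2) (by omega) s).le
    have hb : (1 : ℝ) ≤ Nat.log 2 s := by exact_mod_cast hβ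
    push_cast at this
    nlinarith
  have hlg : Real.logb s n = Real.log n / Real.log s := rfl
  have hLr : ((Nat.log 2 (n + 1) + 1 : ℕ) : ℝ) ≤ 3 * Nat.log 2 n := by exact_mod_cast hLn
  refine ⟨?_, ?_, ?_, ?_, ?_⟩
  · by_contra h
    have h : (trieLevels s n).count none = 0 := by omega
    rw [h] at h0 h1
    omega
  -- All blocks but one are full, so `Nat.log 2 s * (M - 1)` is at most the number of levels.
  -- Converting to natural logarithms gives `(M - 1) * log s ≤ 6 * log n`; the last block adds `log
  -- s ≤ log n`, whence the constant `7`.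
  · have hM : Nat.log 2 s * (trieLevels s n).count none ≤ Nat.log 2 (n + 1) + 1 + Nat.log 2 s := by
      omega
    have hM' : (Nat.log 2 s : ℝ) * (trieLevels s n).count none ≤
        (Nat.log 2 (n + 1) + 1 : ℕ) + Nat.log 2 s := by exact_mod_cast hM
    rw [hlg, mul_div_assoc', le_div_iff₀ ls0]
    generalize ((trieLevels s n).count none : ℝ) = M at *
    have hM1 : (Nat.log 2 s : ℝ) * (M - 1) ≤ 3 * Nat.log 2 n := by linarith
    obtain hM0 | hM0 := le_total M 1
    · nlinarith
    · have a1 : Real.log s * (M - 1) ≤ 2 * (Nat.log 2 s * Real.log 2) * (M - 1) :=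
        mul_le_mul_of_nonneg_right hs2 (by linarith)
      have a2 : (Nat.log 2 s : ℝ) * (M - 1) * Real.log 2 ≤ 3 * Nat.log 2 n * Real.log 2 :=
        mul_le_mul_of_nonneg_right hM1 (by linarith)
      nlinarith
  · nlinarith
  · rw [hlg, le_div_iff₀ ls0]; linarith
  · have : Real.log s ≤ s := (Real.log_le_sub_one_of_pos
      (by exact_mod_cast (by omega : 0 < s))).trans (by linarith)
    rw [hlg, mul_div_assoc', le_div_iff₀ ls0, mul_comm]
    exact mul_le_mul_of_nonneg_right this (by linarith)

/-! ### From numbered points back to the given points and colours -/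

open ColorFrequency

/-- Posing a query overwrites only the registers below `d`, where the index keeps nothing. -/
theorem Index.ask {κ d n ls key col ca rk σ} (H : Index κ d n ls key col ca rk σ) (q : Fin d → ℝ) :
    Index κ d n ls key col ca rk (ask σ q) := by
  have hr : ∀ r, d ≤ r → (ColorFrequency.ask σ q).reg r = σ.reg r := fun r hr => dif_neg (by omega)
  refine ⟨⟨?_, ?_, ?_⟩, H.colors, H.count, ?_, ?_, fun i hi => ?_⟩
  · rw [hr _ (by omega)]; exact H.consts.zero
  · rw [hr _ (by omega)]; exact H.consts.one
  · rw [hr _ (by omega)]; exact H.consts.nil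
  · rw [hr _ (by omega)]; exact H.desc
  · rw [hr _ (by omega)]; exact H.root
  · rw [hr _ (by omega)]; exact H.rank i hi

section points

variable {n d : ℕ} (p : Fin n → Fin d → ℝ) (col : Fin n → ℕ) (q : Fin d → ℝ)

/-- The coordinates, with the points and the coordinates numbered by natural numbers. -/
noncomputable def coord (i j : ℕ) : ℝ := if h : j < n ∧ i < d then p ⟨j, h.1⟩ ⟨i, h.2⟩ else 0

/-- The colours, with the points numbered by natural numbers. -/
def colorOf (j : ℕ) : ℕ := if h : j < n then col ⟨j, h⟩ else 1

open Classical in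
/-- The points in the dominance range. -/
noncomputable def dominated : Multiset ℕ :=
  (Finset.univ.filter fun j => ∀ i, p j i ≤ q i).val.map Fin.val

theorem dominated_nodup : (dominated p q).Nodup :=
  (Finset.nodup _).map Fin.val_injective

theorem mem_dominated (j : ℕ) : j ∈ dominated p q ↔
    j < n ∧ ∀ i < d, coord p i j ≤ if h : i < d then q ⟨i, h⟩ else 0 := by
  simp only [dominated, Multiset.mem_map, Finset.mem_val, Finset.mem_filter, Finset.mem_univ,
    true_and]
  constructor
  · rintro ⟨j, hj, rfl⟩
    refine ⟨j.2, fun i hi => ?_⟩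
    rw [dif_pos hi, coord, dif_pos ⟨j.2, hi⟩]
    exact hj ⟨i, hi⟩
  · rintro ⟨hj, h⟩
    refine ⟨⟨j, hj⟩, fun i => ?_, rfl⟩
    have := h i i.2
    rwa [dif_pos i.2, coord, dif_pos ⟨hj, i.2⟩] at this

open Classical in
theorem map_dominated : (dominated p q).map (colorOf col) =
    (Finset.univ.filter fun j => ∀ i, p j i ≤ q i).val.map col := by
  rw [dominated, Multiset.map_map]
  exact Multiset.map_congr rfl fun j _ => dif_pos j.2

theorem freq_dominated (c : ℕ) : freq (colorOf col) (dominated p q) c = frequency p col q c := by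
  classical
  rw [freq, map_dominated, Multiset.count_map, frequency, ← Finset.filter_val, Finset.card_val,
    Finset.filter_filter]
  congr 1
  ext j
  simp only [Finset.mem_filter, Finset.mem_univ, true_and]
  rw [and_comm, eq_comm]

theorem card_dominated : ((dominated p q).map (colorOf col)).toFinset.card = numColors p col q := by
  classical
  rw [map_dominated, numColors, Finset.image]

end points

/-! ### The two programs on the given input -/

theorem buildP_inputState {n d s : ℕ} (hd : 2 ≤ d) {W : ℕ} (hW : 2 * n + 2 ≤ W) (hs2 : 2 ≤ s)
    (hsn : s ≤ n) (p : Fin n → Fin d → ℝ) (col : Fin n → ℕ) (hcol : ∀ j, 1 ≤ col j) :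
    WP W (buildP d) (inputState p col s) (400 * d * (n * (Nat.log 2 (n + 1) + 1)) +
      domCost 60 (trieLevels s n) (d - 1) * n) fun σ =>
        ∃ ca rk, Index 60 d n (trieLevels s n) (coord p) (colorOf col) ca rk σ := by
  refine buildP_spec hd hW hs2 hsn ?_ ?_ ?_ le_rfl (fun j hj => ⟨fun i hi => ?_, ?_, ?_⟩)
    fun j hj => ?_
  · simp [inputState]; omega
  · simp [inputState]
  · simp [inputState]
  · simp [inputState, inputCell, hj, hi, coord]
  · simp [inputState, inputCell, hj, colorOf]
  · simp [inputState, inputCell, hj]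
  · rw [colorOf, dif_pos hj]; exact hcol _

theorem queryP_ask {n d s W : ℕ} (hd : 1 ≤ d) (hW : n + 1 ≤ W) (p : Fin n → Fin d → ℝ)
    (col : Fin n → ℕ) (q : Fin d → ℝ) {ca rk σ}
    (H : Index 60 d n (trieLevels s n) (coord p) (colorOf col) ca rk σ) :
    WP W (queryP d) (ask σ q) ((14 * (Nat.log 2 (n + 1) + 1) + 11) * d +
      (countCost (numColors p col q) (trieLevels s n) (d - 1) + 9 * numColors p col q + 4)) fun σ' =>
      Index 60 d n (trieLevels s n) (coord p) (colorOf col) ca rk σ' ∧ σ'.next = σ.next ∧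
        IsAnswer p col q σ'.out := by
  have hlev := levels_halving s (Nat.log 2 (n + 1) + 1)
  rw [← trieLevels] at hlev
  have := queryP_spec (x := fun i => if h : i < d then q ⟨i, h⟩ else 0) hd hW (H.ask q) hlev.2
    (by rw [hlev.1]; exact Nat.lt_pow_succ_log_self (by omega) (n + 1))
    (fun i hi => by simp [ColorFrequency.ask, hi]) rfl (dominated p q) (dominated_nodup p q)
    (mem_dominated p q)
  rw [card_dominated] at this
  refine this.conseq ?_
  rintro σ' ⟨h1, h2, T, hnd, hT, hout⟩
  simp only [freq_dominated] at hT hout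
  refine ⟨h1, h2, ?_, fun c f => ?_⟩
  · rw [hout]
    exact hnd.map fun a b h => (Prod.mk.inj h).1
  · rw [hout]
    simp only [List.mem_map, Prod.mk.injEq]
    constructor
    · rintro ⟨e, he, rfl, rfl⟩
      exact ⟨rfl, (hT e).1 he⟩
    · rintro ⟨rfl, hf⟩
      exact ⟨c, (hT c).2 hf, rfl, rfl⟩

/-- The base `14 = 2 * 7` combines the factor `2` per trie of `domCost_le` with the constant of `M ≤
7 * log_s n`. The second bound includes the `n` cells of the input. -/
theorem buildCost_le {d n s : ℕ} (hd : 2 ≤ d) (hs : 2 ≤ s) (hsn : s ≤ n) :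
    ((400 * d * (n * (Nat.log 2 (n + 1) + 1)) + domCost 60 (trieLevels s n) (d - 1) * n : ℕ) : ℝ) ≤
      (3000 * d * 14 ^ d : ℕ) * (n * Real.log n * (s * Real.logb s n) ^ (d - 1)) ∧
    (n : ℝ) + (400 * d * (n * (Nat.log 2 (n + 1) + 1)) + domCost 60 (trieLevels s n) (d - 1) * n : ℕ) ≤
      (3000 * d * 14 ^ d : ℕ) * (n * (s * Real.logb s n) ^ (d - 1)) := by
  obtain ⟨hM1, hM, hL, hlg, hln⟩ := trieLevels_bounds hs hsn
  have hD := domCost_le (κ := 60) hs (Nat.log 2 (n + 1) + 1) (d - 1) (by rwa [← trieLevels])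
  rw [← trieLevels] at hD
  obtain ⟨m, rfl⟩ : ∃ m, d = m + 2 := ⟨d - 2, by omega⟩
  rw [show m + 2 - 1 = m + 1 from rfl] at *
  have hs' : (2 : ℝ) ≤ s := by exact_mod_cast hs
  have hn' : (2 : ℝ) ≤ n := by exact_mod_cast hs.trans hsn
  have hlog : 1 / 2 ≤ Real.log n := by
    have h1 := Real.log_two_gt_d9
    have h2 : Real.log 2 ≤ Real.log n := Real.log_le_log (by norm_num) hn'
    linarith
  have hD' : (domCost 60 (trieLevels s n) (m + 1) : ℝ) ≤
      360 * (14 ^ (m + 1) * (s * Real.logb s n) ^ (m + 1)) := by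
    rw [← mul_pow]
    have h1 : (domCost 60 (trieLevels s n) (m + 1) + 180 : ℝ) ≤
        (60 + 300) * (2 * ((trieLevels s n).count none * s)) ^ (m + 1) := by exact_mod_cast hD
    have h2 : (2 * ((trieLevels s n).count none * s) : ℝ) ^ (m + 1) ≤
        (14 * (s * Real.logb s n)) ^ (m + 1) := by
      refine pow_le_pow_left₀ (by positivity) ?_ _
      nlinarith
    linarith
  generalize domCost 60 (trieLevels s n) (m + 1) = D at *
  generalize Nat.log 2 (n + 1) + 1 = L at *
  have hY1 : (1 : ℝ) ≤ s * Real.logb s n := by nlinarith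
  have hY : s * Real.logb s n ≤ (s * Real.logb s n) ^ (m + 1) := le_self_pow₀ hY1 (by omega)
  generalize (s : ℝ) * Real.logb s n = Y at *
  have hY' : 1 ≤ Y ^ (m + 1) := hY1.trans hY
  generalize Y ^ (m + 1) = Z at *
  have hP : (1 : ℝ) ≤ 14 ^ (m + 1) := one_le_pow₀ (by norm_num)
  have hP2 : (14 : ℝ) ^ (m + 2) = 14 * 14 ^ (m + 1) := by ring
  push_cast
  rw [hP2]
  generalize (14 : ℝ) ^ (m + 1) = P at *
  have hE : (2 : ℝ) ≤ (m : ℝ) + 2 := by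
    have : (0 : ℝ) ≤ m := m.cast_nonneg
    linarith
  generalize (m : ℝ) + 2 = E at *
  generalize Real.log n = G at *
  have hZU' : Z ≤ P * Z := le_mul_of_one_le_left (by linarith) hP
  have hU : 1 ≤ P * Z := one_le_mul_of_one_le_of_one_le hP hY'
  rw [show 3000 * E * (14 * P) * (n * G * Z) = n * (42000 * (E * G) * (P * Z)) by ring,
    show 3000 * E * (14 * P) * (n * Z) = n * (42000 * E * (P * Z)) by ring,
    show 400 * E * (n * L) + D * n = n * (400 * (E * L) + D) by ring]
  generalize P * Z = U at *
  have hEL : E * L ≤ 5 * (E * G) := by nlinarith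
  constructor
  · refine mul_le_mul_of_nonneg_left ?_ (by linarith)
    have hV : 1 ≤ E * G := by nlinarith
    generalize E * G = V at *
    have h1 : V ≤ V * U := le_mul_of_one_le_right (by linarith) hU
    have h2 : U ≤ V * U := le_mul_of_one_le_left (by linarith) hV
    linarith
  -- For the size, the sorting term has to do without its logarithm: `log n ≤ s * log_s n`, and this
  -- is at most the power, whose exponent is at least `1`.
  · have hGU : E * G ≤ E * Z := mul_le_mul_of_nonneg_left (hln.trans hY) (by linarith)
    have hZU : E * Z ≤ E * U := mul_le_mul_of_nonneg_left hZU' (by linarith)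
    have hEU : U ≤ E * U := le_mul_of_one_le_left (by linarith) (by linarith)
    rw [show (n : ℝ) + n * (400 * (E * L) + D) = n * (1 + (400 * (E * L) + D)) by ring]
    refine mul_le_mul_of_nonneg_left ?_ (by linarith)
    linarith

/-- The binary searches and the terms linear in `L` or in `k` alone are absorbed by the two main
terms, since the number of blocks is at least `1`. -/
theorem queryCost_le {d n s : ℕ} (hd : 2 ≤ d) (hs : 2 ≤ s) (hsn : s ≤ n) (k : ℕ) :
    (((14 * (Nat.log 2 (n + 1) + 1) + 11) * d +
      (countCost k (trieLevels s n) (d - 1) + 9 * k + 4) : ℕ) : ℝ) ≤ (3000 * d * 14 ^ d : ℕ) *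
      (Real.log n * Real.logb s n ^ (d - 2) + k * Real.logb s n ^ (d - 1)) := by
  obtain ⟨hM1, hM, hL, hlg, -⟩ := trieLevels_bounds hs hsn
  obtain ⟨m, rfl⟩ : ∃ m, d = m + 2 := ⟨d - 2, by omega⟩
  rw [show m + 2 - 1 = m + 1 from rfl, Nat.add_sub_cancel]
  have hQ := countCost_le (ls := trieLevels s n) (L := Nat.log 2 (n + 1) + 1) k m (by omega) (length_levels s _) hM1
  have hL1 : 1 ≤ Nat.log 2 (n + 1) + 1 := by omega
  generalize Nat.log 2 (n + 1) + 1 = L at *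
  generalize (trieLevels s n).count none = M at *
  generalize countCost k (trieLevels s n) (m + 1) = Q at *
  have hnat : (14 * L + 11) * (m + 2) + (Q + 9 * k + 4) ≤
      80 * ((m + 2) * (L * M ^ m)) + 39 * (k * M ^ (m + 1)) := by
    have h1 : L * 1 ≤ L * M ^ m := Nat.mul_le_mul_left _ (Nat.one_le_pow _ _ hM1)
    have h2 : k * 1 ≤ k * M ^ (m + 1) := Nat.mul_le_mul_left _ (Nat.one_le_pow _ _ hM1)
    have h3 : (14 * L + 11) * (m + 2) ≤ (25 * (L * M ^ m)) * (m + 2) :=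
      Nat.mul_le_mul_right _ (by omega)
    have h4 : (L * M ^ m) * 2 ≤ (L * M ^ m) * (m + 2) := Nat.mul_le_mul_left _ (by omega)
    rw [mul_assoc 30 k] at hQ
    have e1 : 50 * (m + 1) * (L * M ^ m) + 50 * (L * M ^ m) = 50 * ((L * M ^ m) * (m + 2)) := by
      ring
    rw [mul_comm (m + 2) (L * M ^ m)]
    rw [mul_assoc 25] at h3
    omega
  have hR : (M : ℝ) ^ m ≤ 14 ^ m * Real.logb s n ^ m := by
    rw [← mul_pow]
    exact pow_le_pow_left₀ M.cast_nonneg (by linarith) _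
  have hR' : (M : ℝ) ^ (m + 1) ≤ 14 * 14 ^ m * Real.logb s n ^ (m + 1) := by
    rw [show (14 : ℝ) * 14 ^ m = 14 ^ (m + 1) by ring, ← mul_pow]
    exact pow_le_pow_left₀ M.cast_nonneg (by linarith) _
  have hnat' : (((14 * L + 11) * (m + 2) + (Q + 9 * k + 4) : ℕ) : ℝ) ≤
      80 * (((m : ℝ) + 2) * (L * (M : ℝ) ^ m)) + 39 * (k * (M : ℝ) ^ (m + 1)) := by
        exact_mod_cast hnat
  refine hnat'.trans ?_
  have hE : (2 : ℝ) ≤ (m : ℝ) + 2 := by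
    have : (0 : ℝ) ≤ m := m.cast_nonneg
    linarith
  have hS : (1 : ℝ) ≤ 14 ^ m := one_le_pow₀ (by norm_num)
  have hk : (0 : ℝ) ≤ k := k.cast_nonneg
  have hT1 : 1 ≤ Real.logb s n ^ m := one_le_pow₀ hlg
  have hT2 : 1 ≤ Real.logb s n ^ (m + 1) := one_le_pow₀ hlg
  have hL0 : (1 : ℝ) ≤ L := by exact_mod_cast hL1
  push_cast
  rw [show (14 : ℝ) ^ (m + 2) = 196 * 14 ^ m by ring]
  generalize (m : ℝ) + 2 = E at *
  generalize (14 : ℝ) ^ m = S at *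
  generalize Real.logb s n ^ m = T at *
  generalize Real.logb s n ^ (m + 1) = T' at *
  generalize Real.log n = G at *
  have h1 : L * (M : ℝ) ^ m ≤ 5 * G * (S * T) := mul_le_mul hL hR (by positivity) (by linarith)
  have h2 : E * (L * (M : ℝ) ^ m) ≤ E * (5 * G * (S * T)) := mul_le_mul_of_nonneg_left h1 (by linarith)
  have h3 : k * (M : ℝ) ^ (m + 1) ≤ k * (14 * S * T') := mul_le_mul_of_nonneg_left hR' hk
  have h4 : k * S * T' ≤ E * (k * S * T') := le_mul_of_one_le_left (by positivity) (by linarith)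
  have h5 : 0 ≤ E * (G * S * T) := by
    have : 0 ≤ G := by linarith
    positivity
  have h6 : 0 ≤ k * S * T' := by positivity
  rw [show 3000 * E * (196 * S) * (G * T + k * T') =
    588000 * (E * (G * S * T)) + 588000 * (E * (k * S * T')) by ring]
  rw [show E * (5 * G * (S * T)) = 5 * (E * (G * S * T)) by ring] at h2
  rw [show k * (14 * S * T') = 14 * (k * S * T') by ring] at h3
  linarith

end PointerMachine

theorem mainTheorem3 (d : ℕ) (hd : 2 ≤ d) :
    ∃ (build query : PointerMachine.Prog) (C : ℕ),
      ∀ (n s φ : ℕ), 2 ≤ s → s ≤ n →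
      ∀ (p : Fin n → Fin d → ℝ), Function.Injective p →
      ∀ (col : Fin n → ℕ), (∀ j, 1 ≤ col j ∧ col j ≤ φ) →
      ∃ (t : ℕ) (σ : PointerMachine.State),
        PointerMachine.Run (C * (n + φ)) build (ColorFrequency.inputState p col s) t σ ∧
        (t : ℝ) ≤ C * (n * Real.log n * (s * Real.logb s n) ^ (d - 1)) ∧
        ∀ σ' : PointerMachine.State,
          ColorFrequency.Queried (C * (n + φ)) d query σ σ' →
          (σ'.size : ℝ) ≤ C * (n * (s * Real.logb s n) ^ (d - 1)) ∧
          ∀ q : Fin d → ℝ, ∃ (t' : ℕ) (σ'' : PointerMachine.State),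
            PointerMachine.Run (C * (n + φ)) query (ColorFrequency.ask σ' q) t' σ'' ∧
            ColorFrequency.IsAnswer p col q σ''.out ∧
            (t' : ℝ) ≤ C * (Real.log n * Real.logb s n ^ (d - 2)
              + ColorFrequency.numColors p col q * Real.logb s n ^ (d - 1)) := by
  open PointerMachine ColorFrequency in
  refine ⟨buildP d, queryP d, 3000 * d * 14 ^ d, fun n s φ hs hsn p _ col hcol => ?_⟩
  -- The programs compute only numbers up to `2 * n + 2`, which is at most `3 * n` as `2 ≤ n`.
  -- Colours are copied and compared but never added.
  have hC : 3 * n ≤ 3000 * d * 14 ^ d * (n + φ) := by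
    have h1 : 3 * 1 ≤ 3000 * d * 14 ^ d := Nat.mul_le_mul (by omega) (Nat.one_le_pow _ _ (by omega))
    exact Nat.mul_le_mul h1 (by omega)
  generalize hW : 3000 * d * 14 ^ d * (n + φ) = W at *
  obtain ⟨t, σ, ht, hrun, ca, rk, hidx⟩ := buildP_inputState (W := W) hd (by omega) hs hsn p col
    fun j => (hcol j).1
  have hcost := buildCost_le hd hs hsn
  refine ⟨t, σ, hrun, (Nat.cast_le.2 ht).trans hcost.1, fun σ' hσ' => ?_⟩
  -- Each query returns the machine with a valid index and without new cells, so both facts persist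
  -- through any sequence of queries. The value `60` is the smallest potential per insertion that
  -- `weightP_spec` admits.
  obtain ⟨hidx', hnext⟩ : Index 60 d n (trieLevels s n) (coord p) (colorOf col) ca rk σ' ∧
      σ'.next = σ.next := by
    induction hσ' with
    | start => exact ⟨hidx, rfl⟩
    | next q _ hr ih =>
      obtain ⟨t₁, σ₁, -, hr₁, h₁, h₂, -⟩ := queryP_ask (W := W) (by omega) (by omega) p col q ih.1
      obtain rfl := hr.det hr₁
      exact ⟨h₁, h₂.trans ih.2⟩
  constructor
  -- Reachable cells are allocated cells. There are at most `n` plus the preprocessing time of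
  -- these, and queries add none.
  · refine le_trans ?_ hcost.2
    have h1 := σ'.size_le_next
    have h2 : σ.next ≤ n + t := hrun.next_le
    have h3 := h1.trans (hnext.le.trans (h2.trans (Nat.add_le_add_left ht n)))
    exact_mod_cast h3
  · intro q
    obtain ⟨t', σ'', ht', hrun', -, -, hans⟩ :=
      queryP_ask (W := W) (by omega) (by omega) p col q hidx'
    exact ⟨t', σ'', hrun', hans, (Nat.cast_le.2 ht').trans (queryCost_le hd hs hsn _)⟩
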